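/- **Setting.** Write $\langle x\rangle=\sqrt{1+x^2}$, $\kappa=|k|$, and $\|f\|_{H^s}^2=\int_{\mathbb R}|\hat f(\xi)|^2(4+\xi^2)^s\,d\xi$ with $\hat f(\xi)=(2\pi)^{-1/2}\int e^{-ix\xi}f(x)\,dx$. Let $q$ be real white noise on $\mathbb R$, that is, a random real tempered distribution with $\mathbb E\,e^{i\langle f,q\rangle}=e^{-\frac12\|f\|_{L^2}^2}$ for every real Schwartz function $f$. For $L_0\in\{2,4,8,\dots\}$ let $q_{L_0}(x)=\sum_{n\in\mathbb Z}[1_{[-L_0,L_0]}q](x-2nL_0)$ be the $2L_0$-periodic extension of the restriction of $q$ to $[-L_0,L_0]$, and let $q_\infty=q$. Let $R_{L_0}(k)=(-\partial_x^2+q_{L_0}+k^2)^{-1}$ be the resolvent of the Schrödinger operator on $L^2(\mathbb R)$ with potential $q_{L_0}$; thus $R_{L_0}(k)\delta_y$ is the weak solution $u\in H^1(\mathbb R)$ of $-u''+q_{L_0}u+k^2u=\delta_y$. Let $g_{L_0}(x;k)=\langle\delta_x,R_{L_0}(k)\delta_x\rangle$ be the diagonal Green's function. Given $C\ge 1$,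 call a nonzero $k\in\mathbb C$ *strictly admissible* if $0\le\arg k<\frac\pi4$, $|\frac\pi8-\arg k|<\frac\pi{16}$ and $\operatorname{Im}(k^2)\ge C$. **Proposition 4.5.** There is an absolute constant $C\ge1$ such that, for every strictly admissible $k$ and every $L_0\in\{2,4,8,\dots\}\cup\{\infty\}$, almost surely $g_{L_0}(x;k)$ is well defined and nonzero for all $x\in\mathbb R$, and the following bounds hold for every $1\le p<\infty$. (i) For every $\beta>\frac1p$ there is a constant $K=K(p,\beta)$ with $$\mathbb E\Bigl\{\Bigl\|\frac{\langle x\rangle^{-\beta}}{g_{L_0}(x;k)}\Bigr\|_{L^p(\mathbb R)}^p\Bigr\}\le K\,\kappa^p .$$ (ii) For every $\beta>5$ and $0\le s<\frac32$ there is a constant $K=K(p,\beta,s)$ with $$\mathbb E\Bigl\{\Bigl\|\frac{\langle x\rangle^{-\beta}}{g_{L_0}(x;k)}\Bigr\|_{H^s(\mathbb R)}^p\Bigr\}\le K\,\kappa^p .$$ The constants $K$ do not depend on $k$ or on $L_0$; in particular the bounds are uniform in the volume. -/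

import Mathlib

open MeasureTheory
open scoped ENNReal SchwartzMap FourierTransform

universe u

noncomputable section

namespace WhiteNoiseGreen

/-- The Japanese bracket `⟨x⟩ = √(1 + x²)`. -/
def japaneseBracket (x : ℝ) : ℝ := Real.sqrt (1 + x ^ 2)

/-- Real-valued tempered distributions on the line. -/
abbrev RealTempered : Type := 𝓢(ℝ, ℝ) →L[ℝ] ℝ

/-- `L₀ ∈ 2^ℕ ∪ {∞}`, where `ℕ = {1, 2, 3, …}`. -/
def IsDyadicVolume (L₀ : ℕ∞) : Prop :=
  L₀ = ⊤ ∨ ∃ n : ℕ, 1 ≤ n ∧ L₀ = ((2 ^ n : ℕ) : ℕ∞)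

/-- `q` is real white noise on the line: a random tempered distribution with characteristic
functional `E exp (i ⟨f, q⟩) = exp (- ‖f‖² / 2)` for all real Schwartz functions `f`. -/
structure IsWhiteNoise {Ω : Type*} [MeasurableSpace Ω] (P : Measure Ω)
    (q : Ω → RealTempered) : Prop where
  measurable_apply : ∀ f : 𝓢(ℝ, ℝ), Measurable fun ω => q ω f
  charFun : ∀ f : 𝓢(ℝ, ℝ),
    ∫ ω, Complex.exp (Complex.I * ((q ω f : ℝ) : ℂ)) ∂P
      = Complex.exp (-(1 / 2) * ((∫ x, f x ^ 2 : ℝ) : ℂ))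

/-- `W` is a continuous primitive of the distribution `T`, that is, `T = W'` as distributions.
(Almost every sample of white noise has one, namely a two-sided Brownian path, and it is unique
up to an additive constant.) -/
def IsPrimitive (T : RealTempered) (W : ℝ → ℝ) : Prop :=
  Continuous W ∧
    ∀ φ : 𝓢(ℝ, ℝ), HasCompactSupport φ → T φ = -∫ x, W x * deriv φ x

open scoped Classical in
/-- A continuous primitive of `T` (the zero function if there is none). -/
def primitive (T : RealTempered) : ℝ → ℝ :=
  if h : ∃ W, IsPrimitive T W then h.choose else 0

/-- If `q = W'`, then `periodizedPrimitive L W` is a primitive of the `2L`-periodic distribution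
`∑ₙ [1_{[-L,L]} q](x - 2nL)`: it agrees with `W` on `[-L, L]`, and from each period cell
`[(2m-1)L, (2m+1)L)` to the next one it increases by the constant `W L - W (-L)`. -/
def periodizedPrimitive (L : ℝ) (W : ℝ → ℝ) (x : ℝ) : ℝ :=
  let m : ℤ := ⌊(x + L) / (2 * L)⌋
  W (x - 2 * m * L) + m * (W L - W (-L))

/-- A primitive of the potential `q_{L₀}`.  For finite `L₀` this potential is the restriction of
`q` to `[-L₀, L₀]`, repeated with period `2 L₀`; for `L₀ = ∞` it is `q` itself. -/
def potentialPrimitive (T : RealTempered) : ℕ∞ → ℝ → ℝ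
  | ⊤ => primitive T
  | (L : ℕ) => periodizedPrimitive (L : ℝ) (primitive T)

/-- `u` belongs to `H¹(ℝ; ℂ)` (as its continuous representative) and has weak derivative `v`. -/
def HasH1Deriv (u v : ℝ → ℂ) : Prop :=
  MemLp u 2 volume ∧ MemLp v 2 volume ∧ ∀ a b : ℝ, u b - u a = ∫ x in a..b, v x

/-- `u = R(k) δ_y`, where `R(k) = (H + k²)⁻¹` is the resolvent of the Schrödinger operator
`H = -∂² + q` with potential `q = W'`.  That is, `u ∈ H¹(ℝ; ℂ)` and `(H + k²) u = δ_y` in the form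
sense: `∫ u' φ' + ⟨q, u φ⟩ + k² ∫ u φ = φ(y)` for all test functions `φ`, the pairing of
`q = W'` with the compactly supported function `u φ ∈ W^{1,1}` being `- ∫ W (u φ)'`. -/
def IsResolventDelta (W : ℝ → ℝ) (k : ℂ) (y : ℝ) (u : ℝ → ℂ) : Prop :=
  ∃ v : ℝ → ℂ, HasH1Deriv u v ∧
    ∀ φ : ℝ → ℝ, ContDiff ℝ (⊤ : ℕ∞) φ → HasCompactSupport φ →
      (∫ x, v x * ((deriv φ x : ℝ) : ℂ))
        + (-∫ x, (W x : ℂ) * (v x * ((φ x : ℝ) : ℂ) + u x * ((deriv φ x : ℝ) : ℂ)))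
        + k ^ 2 * ∫ x, u x * ((φ x : ℝ) : ℂ) = (φ y : ℂ)

open scoped Classical in
/-- The diagonal Green's function `g(x; q, k) = ⟨δ_x, R(k) δ_x⟩ = (R(k) δ_x)(x)` for the
potential `q = W'` (and `0` at points where `R(k) δ_x` does not exist). -/
def diagGreen (W : ℝ → ℝ) (k : ℂ) (x : ℝ) : ℂ :=
  if h : ∃ u, IsResolventDelta W k x u then h.choose x else 0

/-- The function `⟨x⟩^{-β} / g(x)`. -/
def weightedReciprocal (β : ℝ) (g : ℝ → ℂ) (x : ℝ) : ℂ :=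
  ((japaneseBracket x ^ (-β) : ℝ) : ℂ) / g x

open scoped Classical in
/-- The norm of `H^s(ℝ)`, `s ≥ 0`, given by `‖f‖² = ∫ |f̂(ξ)|² (4 + ξ²)^s dξ` with
`f̂(ξ) = (2π)^{-1/2} ∫ e^{-ixξ} f(x) dx` (and `∞` if `f ∉ L²`).  Here `𝓕` is Mathlib's Plancherel
transform, `𝓕 f (η) = ∫ e^{-2πixη} f(x) dx`, so that `f̂(2πη) = (2π)^{-1/2} 𝓕 f (η)` and the
substitution `ξ = 2πη` gives the formula below. -/
def sobolevNorm (s : ℝ) (f : ℝ → ℂ) : ℝ≥0∞ :=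
  if h : MemLp f 2 (volume : Measure ℝ) then
    (∫⁻ η : ℝ, ENNReal.ofReal ((4 + (2 * Real.pi * η) ^ 2) ^ s)
      * ‖(𝓕 (h.toLp f) : Lp (α := ℝ) ℂ 2 volume) η‖ₑ ^ 2) ^ (1 / 2 : ℝ)
  else ⊤

/-- Strict admissibility of the spectral parameter `k`, with threshold `C` for `Im k²`. -/
def StrictlyAdmissible (C : ℝ) (k : ℂ) : Prop :=
  k ≠ 0 ∧ 0 ≤ k.arg ∧ k.arg < Real.pi / 4 ∧ C ≤ (k ^ 2).im ∧
    |Real.pi / 8 - k.arg| < Real.pi / 16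

/-- The potential with primitive `W` has a well-defined, nowhere vanishing diagonal Green's
function at spectral parameter `k`. -/
def HasDiagGreen (W : ℝ → ℝ) (k : ℂ) : Prop :=
  ∀ x : ℝ, (∃! u, IsResolventDelta W k x u) ∧ diagGreen W k x ≠ 0

end WhiteNoiseGreen

end

open WhiteNoiseGreen

noncomputable section

namespace WhiteNoiseGreen

open Set Filter Topology

section
/-! ### One-dimensional weak derivatives -/

/-! Almost surely q = W' with W continuous, so -u'' + qu + k²u = 0 is a first-order system with
continuous coefficients for u and the quasi-derivative z = u' - Wu (`IsSolution`). The basic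
identity is (Im z ū)' = Im(k²)|u|². It gives uniqueness for the resolvent equation
(`eq_zero_of_weak_solution`), an energy inequality characterizing Weyl solutions ψ± on the two
half-lines, and positivity of Im m± for m± = ∓ψ±'/ψ±. Gluing ψ₊ to ψ₋ gives g = 1/(m₊ + m₋)
(`hasDiagGreen_and_eq`). Since m₋ is the Weyl function of the reflected noise, it suffices to study
one half-line.

The heart of the matter is a deterministic and local estimate: √κ |m(x) - k| is at most 1 + 3456
times `noiseSize`, a functional of W on [x, x+1] only (`norm_add_le_of_isSolution_zero`). The
equation is tested against a cut-off copy of e^{-kt}. The Weyl inequality bounds the mass of the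
solution on [x, x+1] by |m(x)| itself, and the resulting occurrence of |m(x) - k| on the right is
absorbed. The noise enters through |W(x+t) - W(x)|/√t, averaged against a weight of mass bounded
uniformly in κ. Hence all moments of the error are bounded uniformly in x, k and the volume. This
gives the L^p bound: |m₊ + m₋| is at most 2κ times a variable with bounded moments, and Fubini
leaves the integral of ⟨x⟩^{-βp}.

For the Sobolev bound, use the Riccati equation (m₊ + W)' = m₊² - k². In the sum of the two
half-lines W cancels, so (m₊ + m₋)' = m₊² - m₋². Moreover m± is Hölder of order 1/2 with constants
having all moments (`enorm_weylM_sub_weylM_le`): over distances above 1/κ by the pointwise bound,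
over shorter ones by integrating the Riccati equation. Thus the derivative F' of F = ⟨x⟩^{-β}/g has
increments of order κ√t over distance t. For 1 ≤ s < 3/2 the square of the H^s norm is controlled by
the L² norm of F and by the integral of t^{1-2s}‖F'(·+t) - F'(·-t)‖² over (0,1)
(`sobolevNorm_sq_le`), which converges like that of t^{2-2s}. Each estimate is linear in κ, whence
κ^p.

Probability enters only through `RegularProcess`: exponential moments of normalized increments over
distances at most 2. White noise has such a primitive, the limit of pairings with smoothed
indicators of dyadic intervals. Periodization breaks an increment into at most two increments of W,
so the bounds do not see the volume. The primitive chosen in the statement differs from this process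
by a constant, which does not affect the Green's function. -/

theorem exists_pos_forall_lt_abs_eq_zero {φ : ℝ → ℝ} (h : HasCompactSupport φ) :
    ∃ R : ℝ, 0 < R ∧ ∀ x, R ≤ |x| → φ x = 0 := by
  obtain ⟨R, hR⟩ := h.isBounded.subset_closedBall 0
  refine ⟨|R| + 1, by positivity, fun x hx => ?_⟩
  by_contra hne
  have h1 := hR (subset_tsupport φ hne)
  rw [Metric.mem_closedBall, dist_zero_right, Real.norm_eq_abs] at h1
  linarith [le_abs_self R]

theorem deriv_eq_zero_of_eq_zero_off {φ : ℝ → ℝ} {R : ℝ} (h : ∀ x, R ≤ |x| → φ x = 0) :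
    ∀ x, R < |x| → deriv φ x = 0 := by
  intro x hx
  have : φ =ᶠ[𝓝 x] fun _ => 0 := by
    filter_upwards [(isOpen_lt continuous_const continuous_abs).mem_nhds hx] with y hy
    exact h y (le_of_lt hy)
  rw [this.deriv_eq]; simp

theorem integral_eq_intervalIntegral_of_eq_zero_off {E : Type*} [NormedAddCommGroup E]
    [NormedSpace ℝ E] {f : ℝ → E} {R : ℝ} (hR : 0 ≤ R)
    (h : ∀ x, R < |x| → f x = 0) : ∫ x, f x = ∫ x in (-R)..R, f x := by
  rw [intervalIntegral.integral_of_le (by linarith), ← integral_Icc_eq_integral_Ioc]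
  refine (setIntegral_eq_integral_of_forall_compl_eq_zero fun x hx => h x ?_).symm
  by_contra hc
  exact hx (abs_le.1 (not_lt.1 hc))

/-- Integration by parts against a compactly supported `C¹` function, for a primitive `u` of a
locally integrable function `v`. -/
theorem integral_mul_eq_neg_integral_mul_deriv {u v : ℝ → ℂ} (hv : LocallyIntegrable v)
    (huv : ∀ a b : ℝ, u b - u a = ∫ x in a..b, v x) {φ : ℝ → ℝ} (hφ : ContDiff ℝ 1 φ)
    (hc : HasCompactSupport φ) :
    ∫ x, v x * ((φ x : ℝ) : ℂ) = -∫ x, u x * ((deriv φ x : ℝ) : ℂ) := by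
  obtain ⟨R, hR, h0⟩ := exists_pos_forall_lt_abs_eq_zero hc
  have hd0 := deriv_eq_zero_of_eq_zero_off h0
  have hdc : Continuous (deriv φ) := hφ.continuous_deriv le_rfl
  have hder : ∀ x, HasDerivAt φ (deriv φ x) x := fun x =>
    (hφ.differentiable one_ne_zero x).hasDerivAt
  rw [integral_eq_intervalIntegral_of_eq_zero_off hR.le (f := fun x => v x * ((φ x : ℝ) : ℂ))
      (fun x hx => by simp [h0 x hx.le]),
    integral_eq_intervalIntegral_of_eq_zero_off hR.le
      (f := fun x => u x * ((deriv φ x : ℝ) : ℂ)) (fun x hx => by simp [hd0 x hx])]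
  have hvi : ∀ a b, IntervalIntegrable v volume a b := fun a b =>
    (hv.integrableOn_isCompact isCompact_uIcc).intervalIntegrable
  have hle : -R ≤ R := by linarith
  -- the double integral
  set μ := volume.restrict (Ioc (-R) R) with hμ
  have hvμ : Integrable v μ := (hvi (-R) R).1
  have hdμ : Integrable (fun x => ((deriv φ x : ℝ) : ℂ)) μ :=
    ((Complex.continuous_ofReal.comp hdc).intervalIntegrable (-R) R).1
  have hprod : Integrable (fun p : ℝ × ℝ => v p.1 * ((deriv φ p.2 : ℝ) : ℂ)) (μ.prod μ) :=
    hvμ.mul_prod hdμ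
  have hS : MeasurableSet {p : ℝ × ℝ | p.1 ≤ p.2} := measurableSet_le measurable_fst measurable_snd
  -- Fubini for v(t) φ'(x) on the triangle t ≤ x: integrating in x first gives -v(t) φ(t),
  -- integrating in t first gives (u(x) - u(-R)) φ'(x). No differentiability of u is needed.
  have hF : Integrable (fun p : ℝ × ℝ =>
      Set.indicator {p : ℝ × ℝ | p.1 ≤ p.2} (fun p => v p.1 * ((deriv φ p.2 : ℝ) : ℂ)) p)
      (μ.prod μ) := hprod.indicator hS
  have hswap := integral_integral_swap (f := fun t x =>
    Set.indicator {p : ℝ × ℝ | p.1 ≤ p.2} (fun p => v p.1 * ((deriv φ p.2 : ℝ) : ℂ)) (t, x)) hF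
  have hR0 : φ R = 0 := h0 R (le_abs_self R)
  have hmR0 : φ (-R) = 0 := h0 (-R) (by rw [abs_neg]; exact le_abs_self R)
  have hint : ∀ a b, ∫ x in a..b, ((deriv φ x : ℝ) : ℂ) = ((φ b - φ a : ℝ) : ℂ) := by
    intro a b
    rw [intervalIntegral.integral_ofReal, intervalIntegral.integral_eq_sub_of_hasDerivAt
      (fun x _ => hder x) (hdc.intervalIntegrable a b)]
  have h1 : ∀ t ∈ Ioc (-R) R, ∫ x, Set.indicator {p : ℝ × ℝ | p.1 ≤ p.2}
      (fun p => v p.1 * ((deriv φ p.2 : ℝ) : ℂ)) (t, x) ∂μ = -(v t * ((φ t : ℝ) : ℂ)) := by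
    intro t ht
    have : (fun x => Set.indicator {p : ℝ × ℝ | p.1 ≤ p.2}
        (fun p => v p.1 * ((deriv φ p.2 : ℝ) : ℂ)) (t, x)) =
        Set.indicator (Ici t) (fun x => v t * ((deriv φ x : ℝ) : ℂ)) := by
      ext x; simp [Set.indicator, mem_Ici]
    rw [this, integral_indicator measurableSet_Ici, hμ, Measure.restrict_restrict measurableSet_Ici,
      show Ici t ∩ Ioc (-R) R = Icc t R by
        ext x; simp only [mem_inter_iff, mem_Ici, mem_Ioc, mem_Icc]
        constructor
        · rintro ⟨a, b, c⟩; exact ⟨a, c⟩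
        · rintro ⟨a, c⟩; exact ⟨a, lt_of_lt_of_le ht.1 a, c⟩,
      integral_Icc_eq_integral_Ioc, ← intervalIntegral.integral_of_le ht.2,
      intervalIntegral.integral_const_mul, hint, hR0]
    push_cast; ring
  have h2 : ∀ x ∈ Ioc (-R) R, ∫ t, Set.indicator {p : ℝ × ℝ | p.1 ≤ p.2}
      (fun p => v p.1 * ((deriv φ p.2 : ℝ) : ℂ)) (t, x) ∂μ
        = (u x - u (-R)) * ((deriv φ x : ℝ) : ℂ) := by
    intro x hx
    have : (fun t => Set.indicator {p : ℝ × ℝ | p.1 ≤ p.2}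
        (fun p => v p.1 * ((deriv φ p.2 : ℝ) : ℂ)) (t, x)) =
        Set.indicator (Iic x) (fun t => v t * ((deriv φ x : ℝ) : ℂ)) := by
      ext t; simp [Set.indicator, mem_Iic]
    rw [this, integral_indicator measurableSet_Iic, hμ, Measure.restrict_restrict measurableSet_Iic,
      show Iic x ∩ Ioc (-R) R = Ioc (-R) x by
        ext t; simp only [mem_inter_iff, mem_Iic, mem_Ioc]
        constructor
        · rintro ⟨a, b, c⟩; exact ⟨b, a⟩
        · rintro ⟨b, a⟩; exact ⟨a, b, a.trans hx.2⟩,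
      ← intervalIntegral.integral_of_le hx.1.le, intervalIntegral.integral_mul_const, huv]
  rw [setIntegral_congr_fun measurableSet_Ioc h1, setIntegral_congr_fun measurableSet_Ioc h2,
    ← intervalIntegral.integral_of_le hle, ← intervalIntegral.integral_of_le hle,
    intervalIntegral.integral_neg] at hswap
  have hu : Continuous u := by
    have : u = fun x => u 0 + ∫ t in (0 : ℝ)..x, v t := by
      ext x; rw [← huv]; ring
    rw [this]
    exact continuous_const.add (intervalIntegral.continuous_primitive hvi 0)
  have h3 : ∫ x in (-R)..R, (u x - u (-R)) * ((deriv φ x : ℝ) : ℂ)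
      = ∫ x in (-R)..R, u x * ((deriv φ x : ℝ) : ℂ) := by
    have hdc' : Continuous fun x => ((deriv φ x : ℝ) : ℂ) := Complex.continuous_ofReal.comp hdc
    simp_rw [sub_mul]
    have e1 : Continuous fun x => u x * ((deriv φ x : ℝ) : ℂ) := hu.mul hdc'
    have e2 : Continuous fun x => u (-R) * ((deriv φ x : ℝ) : ℂ) := continuous_const.mul hdc'
    rw [intervalIntegral.integral_sub (e1.intervalIntegrable _ _)
      (e2.intervalIntegrable _ _), intervalIntegral.integral_const_mul,
      hint, hR0, hmR0]
    simp
  rw [h3] at hswap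
  rw [← hswap, neg_neg]

theorem contDiff_primitive {f : ℝ → ℝ} (hf : ContDiff ℝ (⊤ : ℕ∞) f) (a : ℝ) :
    ContDiff ℝ (⊤ : ℕ∞) fun x => ∫ t in a..x, f t := by
  have hd : ∀ x, HasDerivAt (fun x => ∫ t in a..x, f t) (f x) x := fun x =>
    intervalIntegral.integral_hasDerivAt_right (hf.continuous.intervalIntegrable _ _)
      (hf.continuous.stronglyMeasurableAtFilter _ _) hf.continuous.continuousAt
  rw [contDiff_infty_iff_deriv]
  refine ⟨fun x => (hd x).differentiableAt, ?_⟩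
  rwa [show deriv (fun x => ∫ t in a..x, f t) = f from funext fun x => (hd x).deriv]

/-- Du Bois-Reymond: a locally integrable function with vanishing weak derivative is constant. -/
theorem exists_ae_eq_const_of_integral_mul_deriv_eq_zero {g : ℝ → ℂ} (hg : LocallyIntegrable g)
    (h : ∀ φ : ℝ → ℝ, ContDiff ℝ (⊤ : ℕ∞) φ → HasCompactSupport φ →
      ∫ x, g x * ((deriv φ x : ℝ) : ℂ) = 0) : ∃ c : ℂ, g =ᵐ[volume] fun _ => c := by
  let ρ : ContDiffBump (0 : ℝ) := default
  set r : ℝ → ℝ := ρ.normed volume with hr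
  have hr1 : ContDiff ℝ (⊤ : ℕ∞) r := ρ.contDiff_normed
  have hr2 : HasCompactSupport r := ρ.hasCompactSupport_normed
  have hr3 : ∫ x, r x = 1 := ρ.integral_normed
  -- Subtracting a multiple of the bump r makes η of mean zero, hence the derivative of a compactly
  -- supported function, against which g integrates to zero.
  have key : ∀ η : ℝ → ℝ, ContDiff ℝ (⊤ : ℕ∞) η → HasCompactSupport η →
      ∫ x, g x * ((η x : ℝ) : ℂ) = (∫ x, η x : ℝ) * ∫ x, g x * ((r x : ℝ) : ℂ) := by
    intro η hη hηc
    set J := ∫ x, η x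
    set f : ℝ → ℝ := fun x => η x - J * r x with hf
    have hfc : ContDiff ℝ (⊤ : ℕ∞) f := hη.sub (contDiff_const.mul hr1)
    have hfs : HasCompactSupport f := hηc.sub (hr2.mul_left)
    have hf0 : ∫ x, f x = 0 := by
      rw [integral_sub (hη.continuous.integrable_of_hasCompactSupport hηc)
        ((hr1.continuous.integrable_of_hasCompactSupport hr2).const_mul J), integral_const_mul, hr3]
      simp [J]
    obtain ⟨R, hR, h0⟩ := exists_pos_forall_lt_abs_eq_zero hfs
    set φ : ℝ → ℝ := fun x => ∫ t in (-R)..x, f t with hφ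
    have hφc : ContDiff ℝ (⊤ : ℕ∞) φ := contDiff_primitive hfc _
    have hφd : deriv φ = f := funext fun x =>
      (intervalIntegral.integral_hasDerivAt_right (hfc.continuous.intervalIntegrable _ _)
      (hfc.continuous.stronglyMeasurableAtFilter _ _) hfc.continuous.continuousAt).deriv
    have hφs : HasCompactSupport φ := by
      refine HasCompactSupport.intro (isCompact_Icc (a := -R) (b := R)) fun x hx => ?_
      have hx' : R < |x| := by
        by_contra hc
        exact hx (abs_le.1 (not_lt.1 hc))
      rcases lt_abs.1 hx' with h1 | h1
      · have e1 : ∫ t in R..x, f t = 0 := by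
          rw [intervalIntegral.integral_congr (g := fun _ => (0 : ℝ))]
          · simp
          · intro t ht
            rw [uIcc_of_le h1.le] at ht
            exact h0 t (ht.1.trans (le_abs_self t))
        have e2 : ∫ t in (-R)..R, f t = 0 := by
          rw [intervalIntegral.integral_of_le (by linarith), ← integral_Icc_eq_integral_Ioc,
            setIntegral_eq_integral_of_forall_compl_eq_zero, hf0]
          intro t ht
          refine h0 t ?_
          by_contra hc
          exact ht (abs_le.1 (not_le.1 hc).le)
        simp only [hφ]
        rw [← intervalIntegral.integral_add_adjacent_intervals
          (hfc.continuous.intervalIntegrable (-R) R) (hfc.continuous.intervalIntegrable R x),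
          e1, e2, add_zero]
      · simp only [hφ]
        rw [intervalIntegral.integral_congr (g := fun _ => (0 : ℝ))]
        · simp
        · intro t ht
          rw [uIcc_of_ge (by linarith)] at ht
          refine h0 t ?_
          have := neg_abs_le t
          linarith [ht.2]
    have := h φ hφc hφs
    rw [hφd] at this
    have hgi : ∀ ψ : ℝ → ℝ, Continuous ψ → HasCompactSupport ψ →
        Integrable fun x => g x * ((ψ x : ℝ) : ℂ) := by
      intro ψ h1 h2
      have h2' : HasCompactSupport fun x => ((ψ x : ℝ) : ℂ) := h2.comp_left Complex.ofReal_zero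
      have := hg.integrable_smul_right_of_hasCompactSupport
        (g := fun x => ((ψ x : ℝ) : ℂ)) (Complex.continuous_ofReal.comp h1) h2'
      simpa [smul_eq_mul] using this
    have e : ∀ x, g x * ((f x : ℝ) : ℂ) = g x * ((η x : ℝ) : ℂ) - J * (g x * ((r x : ℝ) : ℂ)) := by
      intro x; simp only [hf]; push_cast; ring
    simp_rw [e] at this
    rw [integral_sub (hgi η hη.continuous hηc) ((hgi r hr1.continuous hr2).const_mul _),
      integral_const_mul] at this
    exact sub_eq_zero.1 this
  refine ⟨∫ x, g x * ((r x : ℝ) : ℂ), ?_⟩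
  refine ae_eq_of_integral_contDiff_smul_eq hg (locallyIntegrable_const _) fun η hη hηc => ?_
  have := key η hη hηc
  simp only [Complex.real_smul]
  simp_rw [mul_comm ((η _ : ℝ) : ℂ)]
  rw [this, integral_const_mul, integral_complex_ofReal, mul_comm]

end

section
/-! ### The first-order system and the resolvent kernel -/

/-- The first-order system for `-u'' + W' u + k² u = 0`, with quasi-derivative `z = u' - W u`. -/
structure IsSolution (W : ℝ → ℝ) (k : ℂ) (u z : ℝ → ℂ) : Prop where
  deriv_left : ∀ x, HasDerivAt u (z x + W x * u x) x
  deriv_right : ∀ x, HasDerivAt z (k ^ 2 * u x - W x * (z x + W x * u x)) x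

namespace IsSolution

variable {W : ℝ → ℝ} {k : ℂ} {u z u' z' : ℝ → ℂ}

theorem continuous_left (h : IsSolution W k u z) : Continuous u :=
  continuous_iff_continuousAt.2 fun x => (h.deriv_left x).continuousAt

theorem continuous_right (h : IsSolution W k u z) : Continuous z :=
  continuous_iff_continuousAt.2 fun x => (h.deriv_right x).continuousAt

theorem continuous_deriv (h : IsSolution W k u z) (hW : Continuous W) :
    Continuous fun x => z x + W x * u x :=
  h.continuous_right.add ((Complex.continuous_ofReal.comp hW).mul h.continuous_left)

/-- The terms ±W z ū cancel and what remains besides k²|u|², namely |z|² - W²|u|², is real. The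
rough potential therefore disappears from the imaginary part. -/
theorem hasDerivAt_im (h : IsSolution W k u z) (x : ℝ) :
    HasDerivAt (fun x => (z x * (starRingEnd ℂ) (u x)).im) ((k ^ 2).im * ‖u x‖ ^ 2) x := by
  have h1 : HasDerivAt (fun x => (starRingEnd ℂ) (u x)) ((starRingEnd ℂ) (z x + W x * u x)) x :=
    (h.deriv_left x).star
  have h2 := (h.deriv_right x).mul h1
  have h3 := (Complex.imCLM.hasFDerivAt.comp_hasDerivAt x h2)
  refine h3.congr_deriv ?_
  rw [← Complex.normSq_eq_norm_sq, Complex.normSq_apply]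
  simp [Complex.mul_im, Complex.add_im, Complex.sub_im, Complex.mul_re, Complex.add_re,
    Complex.sub_re]
  ring

theorem add_mul (h : IsSolution W k u z) (h' : IsSolution W k u' z') (a b : ℂ) :
    IsSolution W k (fun x => a * u x + b * u' x) (fun x => a * z x + b * z' x) where
  deriv_left x := (((h.deriv_left x).const_mul a).add ((h'.deriv_left x).const_mul b)).congr_deriv
    (by ring)
  deriv_right x := (((h.deriv_right x).const_mul a).add
    ((h'.deriv_right x).const_mul b)).congr_deriv (by ring)

theorem wronskian_eq (h : IsSolution W k u z) (h' : IsSolution W k u' z') (x y : ℝ) :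
    u x * z' x - u' x * z x = u y * z' y - u' y * z y := by
  have hd : ∀ x, HasDerivAt (fun x => u x * z' x - u' x * z x) 0 x := fun x =>
    (((h.deriv_left x).mul (h'.deriv_right x)).sub
      ((h'.deriv_left x).mul (h.deriv_right x))).congr_deriv (by ring)
  exact is_const_of_deriv_eq_zero (fun x => (hd x).differentiableAt) (fun x => (hd x).deriv) x y

/-- Reflection `x ↦ -x` of the line. -/
theorem reflect (h : IsSolution W k u z) :
    IsSolution (fun x => -W (-x)) k (fun x => u (-x)) (fun x => -z (-x)) where
  deriv_left x := by
    have := (h.deriv_left (-x)).scomp x (hasDerivAt_neg x)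
    refine this.congr_deriv ?_
    simp
  deriv_right x := by
    have := ((h.deriv_right (-x)).scomp x (hasDerivAt_neg x)).neg
    refine this.congr_deriv ?_
    simp; ring

/-- Adding a constant to the primitive of the potential. -/
theorem add_const (h : IsSolution W k u z) (c : ℝ) :
    IsSolution (fun x => W x + c) k u (fun x => z x - c * u x) where
  deriv_left x := (h.deriv_left x).congr_deriv (by push_cast; ring)
  deriv_right x := ((h.deriv_right x).sub ((h.deriv_left x).const_mul (c : ℂ))).congr_deriv
    (by push_cast; ring)

end IsSolution

/-- A positive value would persist on a half-line of infinite measure. Applied to Im(z ū), this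
replaces boundary conditions at infinity. -/
theorem nonpos_of_monotoneOn_of_integrableOn {f : ℝ → ℝ} {a : ℝ} (hm : MonotoneOn f (Ici a))
    (hi : IntegrableOn f (Ici a)) {x : ℝ} (hx : a ≤ x) : f x ≤ 0 := by
  by_contra hpos
  push Not at hpos
  have h1 := Integrable.measure_norm_ge_lt_top hi hpos
  have h2 : Ici x ⊆ {y | f x ≤ ‖f y‖} ∩ Ici a := fun y hy =>
    ⟨(hm hx (le_trans hx hy) hy).trans (Real.le_norm_self _), le_trans hx hy⟩
  rw [Measure.restrict_apply' measurableSet_Ici] at h1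
  have h3 := measure_mono (μ := (volume : Measure ℝ)) h2
  rw [Real.volume_Ici] at h3
  exact absurd (h3.trans_lt h1) (lt_irrefl _)

theorem eq_zero_of_monotone_of_integrable {f : ℝ → ℝ} (hm : Monotone f) (hi : Integrable f)
    (x : ℝ) : f x = 0 := by
  refine le_antisymm (nonpos_of_monotoneOn_of_integrableOn (a := x) (hm.monotoneOn _)
    hi.integrableOn le_rfl) ?_
  have := nonpos_of_monotoneOn_of_integrableOn (f := fun y => -f (-y)) (a := -x) (x := -x)
    (fun a _ b _ hab => neg_le_neg (hm (neg_le_neg hab))) (hi.comp_neg.neg).integrableOn le_rfl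
  simpa using this

theorem HasH1Deriv.locallyIntegrable_left {u v : ℝ → ℂ} (h : HasH1Deriv u v) :
    LocallyIntegrable u := h.1.locallyIntegrable (by norm_num)

theorem HasH1Deriv.locallyIntegrable_right {u v : ℝ → ℂ} (h : HasH1Deriv u v) :
    LocallyIntegrable v := h.2.1.locallyIntegrable (by norm_num)

theorem HasH1Deriv.continuous {u v : ℝ → ℂ} (h : HasH1Deriv u v) : Continuous u := by
  have : u = fun x => u 0 + ∫ t in (0 : ℝ)..x, v t := by
    ext x; rw [← h.2.2]; ring
  rw [this]
  exact continuous_const.add (intervalIntegral.continuous_primitive (fun a b =>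
    (h.locallyIntegrable_right.integrableOn_isCompact isCompact_uIcc).intervalIntegrable) 0)

theorem HasH1Deriv.sub {u v u' v' : ℝ → ℂ} (h : HasH1Deriv u v) (h' : HasH1Deriv u' v') :
    HasH1Deriv (fun x => u x - u' x) (fun x => v x - v' x) := by
  refine ⟨h.1.sub h'.1, h.2.1.sub h'.2.1, fun a b => ?_⟩
  have e := fun {f : ℝ → ℂ} (hf : LocallyIntegrable f) =>
    (hf.integrableOn_isCompact (isCompact_uIcc (a := a) (b := b))).intervalIntegrable
  rw [intervalIntegral.integral_sub (e h.locallyIntegrable_right) (e h'.locallyIntegrable_right),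
    ← h.2.2, ← h'.2.2]
  ring

theorem integrable_mul_ofReal_of_hasCompactSupport {f : ℝ → ℂ} (hf : LocallyIntegrable f)
    {φ : ℝ → ℝ} (hφ : Continuous φ) (hc : HasCompactSupport φ) :
    Integrable fun x => f x * ((φ x : ℝ) : ℂ) := by
  have h2 : HasCompactSupport fun x => ((φ x : ℝ) : ℂ) := hc.comp_left Complex.ofReal_zero
  have := hf.integrable_smul_right_of_hasCompactSupport
    (g := fun x => ((φ x : ℝ) : ℂ)) (Complex.continuous_ofReal.comp hφ) h2
  simpa [smul_eq_mul] using this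

theorem locallyIntegrable_ofReal_mul {f : ℝ → ℂ} (hf : LocallyIntegrable f) {W : ℝ → ℝ}
    (hW : Continuous W) : LocallyIntegrable fun x => (W x : ℂ) * f x := by
  rw [← locallyIntegrableOn_univ] at hf ⊢
  exact hf.continuousOn_mul (Complex.continuous_ofReal.comp hW).continuousOn isOpen_univ.isLocallyClosed

/-- The left-hand side of the weak formulation, collected into one integral. -/
theorem weak_form_eq_integral {u v : ℝ → ℂ} (h : HasH1Deriv u v) {W : ℝ → ℝ} (hW : Continuous W)
    (k : ℂ) {φ : ℝ → ℝ} (hφ : ContDiff ℝ (⊤ : ℕ∞) φ) (hc : HasCompactSupport φ) :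
    (∫ x, v x * ((deriv φ x : ℝ) : ℂ))
        + (-∫ x, (W x : ℂ) * (v x * ((φ x : ℝ) : ℂ) + u x * ((deriv φ x : ℝ) : ℂ)))
        + k ^ 2 * ∫ x, u x * ((φ x : ℝ) : ℂ)
      = (∫ x, (v x - W x * u x) * ((deriv φ x : ℝ) : ℂ))
        + ∫ x, (k ^ 2 * u x - W x * v x) * ((φ x : ℝ) : ℂ) := by
  have hdc : Continuous (deriv φ) := (hφ.of_le (by simp)).continuous_deriv le_rfl
  have hv := h.locallyIntegrable_right
  have hu := h.locallyIntegrable_left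
  have i1 := integrable_mul_ofReal_of_hasCompactSupport hv hdc hc.deriv
  have i2 := integrable_mul_ofReal_of_hasCompactSupport (locallyIntegrable_ofReal_mul hv hW)
    hφ.continuous hc
  have i3 := integrable_mul_ofReal_of_hasCompactSupport (locallyIntegrable_ofReal_mul hu hW)
    hdc hc.deriv
  have i4 := integrable_mul_ofReal_of_hasCompactSupport hu hφ.continuous hc
  rw [← integral_const_mul, ← integral_neg, ← integral_add i1, ← integral_add, ← integral_add]
  · refine integral_congr_ae (Eventually.of_forall fun x => ?_)
    simp only
    ring
  · refine (i1.sub i3).congr (Eventually.of_forall fun x => ?_)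
    simp only [Pi.sub_apply]; ring
  · refine ((i4.const_mul (k ^ 2)).sub i2).congr (Eventually.of_forall fun x => ?_)
    simp only [Pi.sub_apply]; ring
  · refine ((i1.sub i2).sub i3).congr (Eventually.of_forall fun x => ?_)
    simp only [Pi.sub_apply]; ring
  · exact i4.const_mul _
  · refine (i2.add i3).neg.congr (Eventually.of_forall fun x => ?_)
    simp only [Pi.neg_apply, Pi.add_apply]; ring

/-- Du Bois-Reymond upgrades the weak equation to the classical first-order system, with z = v - Wu
almost everywhere. Then Im(z ū) = Im(v ū) is integrable because u and v are in L², and it is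
monotone; hence it vanishes, and so does its derivative Im(k²)|u|². -/
theorem eq_zero_of_weak_solution {u v : ℝ → ℂ} (h : HasH1Deriv u v) {W : ℝ → ℝ}
    (hW : Continuous W) {k : ℂ} (hk : 0 < (k ^ 2).im)
    (hweak : ∀ φ : ℝ → ℝ, ContDiff ℝ (⊤ : ℕ∞) φ → HasCompactSupport φ →
      (∫ x, v x * ((deriv φ x : ℝ) : ℂ))
        + (-∫ x, (W x : ℂ) * (v x * ((φ x : ℝ) : ℂ) + u x * ((deriv φ x : ℝ) : ℂ)))
        + k ^ 2 * ∫ x, u x * ((φ x : ℝ) : ℂ) = 0) : u = 0 := by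
  have hv := h.locallyIntegrable_right
  have hu := h.locallyIntegrable_left
  have hF : LocallyIntegrable fun x => k ^ 2 * u x - W x * v x :=
    (hu.smul (k ^ 2)).sub (locallyIntegrable_ofReal_mul hv hW)
  have hFi : ∀ a b, IntervalIntegrable (fun x => k ^ 2 * u x - W x * v x) volume a b := fun a b =>
    (hF.integrableOn_isCompact isCompact_uIcc).intervalIntegrable
  set G : ℝ → ℂ := fun x => ∫ t in (0 : ℝ)..x, (k ^ 2 * u t - W t * v t) with hG
  have hGc : Continuous G := intervalIntegral.continuous_primitive hFi 0
  have hg : LocallyIntegrable fun x => (v x - W x * u x) - G x :=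
    (hv.sub (locallyIntegrable_ofReal_mul hu hW)).sub hGc.locallyIntegrable
  obtain ⟨c, hc⟩ := exists_ae_eq_const_of_integral_mul_deriv_eq_zero hg (fun φ hφ hcs => by
    have h1 := hweak φ hφ hcs
    rw [weak_form_eq_integral h hW k hφ hcs,
      integral_mul_eq_neg_integral_mul_deriv hF (u := G)
        (fun a b => by
          simp only [hG]
          rw [intervalIntegral.integral_interval_sub_left (hFi _ _) (hFi _ _)])
        (hφ.of_le (by simp)) hcs] at h1
    have hdc : Continuous (deriv φ) := (hφ.of_le (by simp)).continuous_deriv le_rfl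
    simp_rw [sub_mul _ (G _)]
    rw [← sub_eq_add_neg] at h1
    rw [← h1]
    exact integral_sub (integrable_mul_ofReal_of_hasCompactSupport
        (hv.sub (locallyIntegrable_ofReal_mul hu hW)) hdc hcs.deriv)
      (integrable_mul_ofReal_of_hasCompactSupport hGc.locallyIntegrable hdc hcs.deriv))
  set z : ℝ → ℂ := fun x => G x + c with hz
  have hvz : v =ᵐ[volume] fun x => z x + W x * u x := by
    filter_upwards [hc] with x hx
    simp only [hz]
    linear_combination hx
  have hzc : Continuous z := hGc.add continuous_const
  have hvc : Continuous fun x => z x + W x * u x :=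
    hzc.add ((Complex.continuous_ofReal.comp hW).mul h.continuous)
  have hsol : IsSolution W k u z := by
    constructor
    · intro x
      have e : u = fun x => u 0 + ∫ t in (0 : ℝ)..x, (z t + W t * u t) := by
        ext x
        rw [← intervalIntegral.integral_congr_ae (hvz.mono fun t ht _ => ht), ← h.2.2]; ring
      have h1 := (intervalIntegral.integral_hasDerivAt_right (hvc.intervalIntegrable 0 x)
        (hvc.stronglyMeasurableAtFilter _ _) hvc.continuousAt).const_add (u 0)
      rw [e]
      refine h1.congr_deriv ?_
      simp only
      rw [← congrFun e x]
    · intro x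
      have hcont : Continuous fun t => k ^ 2 * u t - W t * (z t + W t * u t) :=
        (continuous_const.mul h.continuous).sub ((Complex.continuous_ofReal.comp hW).mul hvc)
      have e : z = fun x => (∫ t in (0 : ℝ)..x, (k ^ 2 * u t - W t * (z t + W t * u t))) + c := by
        ext x
        simp only [hz, hG]
        congr 1
        refine intervalIntegral.integral_congr_ae (hvz.mono fun t ht _ => ?_)
        rw [ht]
      have h1 := (intervalIntegral.integral_hasDerivAt_right (hcont.intervalIntegrable 0 x)
        (hcont.stronglyMeasurableAtFilter _ _) hcont.continuousAt).add_const c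
      rw [← e] at h1
      exact h1
  set f : ℝ → ℝ := fun x => (z x * (starRingEnd ℂ) (u x)).im with hf
  have hmono : Monotone f := monotone_of_deriv_nonneg
    (fun x => (hsol.hasDerivAt_im x).differentiableAt) (fun x => by
      rw [(hsol.hasDerivAt_im x).deriv]; positivity)
  have hint : Integrable f := by
    have h1 : Integrable fun x => v x * (starRingEnd ℂ) (u x) := by
      have := h.1.star.integrable_mul h.2.1
      refine this.congr (Eventually.of_forall fun x => ?_)
      simp [mul_comm]
    refine h1.im.congr ?_
    filter_upwards [hvz] with x hx
    simp only [hf, hx]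
    simp [Complex.mul_im]
    ring
  ext x
  have h0 : f = fun _ => 0 := funext fun x => eq_zero_of_monotone_of_integrable hmono hint x
  have h1 := hsol.hasDerivAt_im x
  rw [show (fun x => (z x * (starRingEnd ℂ) (u x)).im) = fun _ => 0 from h0] at h1
  have h2 := h1.unique (hasDerivAt_const x 0)
  have h3 : ‖u x‖ ^ 2 = 0 := by
    rcases mul_eq_zero.1 h2 with h | h
    · exact absurd h hk.ne'
    · exact h
  simpa using h3

theorem IsResolventDelta.unique {W : ℝ → ℝ} (hW : Continuous W) {k : ℂ} (hk : 0 < (k ^ 2).im)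
    {y : ℝ} {u u' : ℝ → ℂ} (h : IsResolventDelta W k y u) (h' : IsResolventDelta W k y u') :
    u = u' := by
  obtain ⟨v, hv, e⟩ := h
  obtain ⟨v', hv', e'⟩ := h'
  have := eq_zero_of_weak_solution (hv.sub hv') hW hk (fun φ hφ hc => by
    have h1 := e φ hφ hc
    have h2 := e' φ hφ hc
    rw [weak_form_eq_integral hv hW k hφ hc] at h1
    rw [weak_form_eq_integral hv' hW k hφ hc] at h2
    rw [weak_form_eq_integral (hv.sub hv') hW k hφ hc]
    have hdc : Continuous (deriv φ) := (hφ.of_le (by simp)).continuous_deriv le_rfl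
    have i := fun {u v : ℝ → ℂ} (h : HasH1Deriv u v) =>
      integrable_mul_ofReal_of_hasCompactSupport (h.locallyIntegrable_right.sub
        (locallyIntegrable_ofReal_mul h.locallyIntegrable_left hW)) hdc hc.deriv
    have j := fun {u v : ℝ → ℂ} (h : HasH1Deriv u v) =>
      integrable_mul_ofReal_of_hasCompactSupport ((h.locallyIntegrable_left.smul (k ^ 2)).sub
        (locallyIntegrable_ofReal_mul h.locallyIntegrable_right hW)) hφ.continuous hc
    have e1 : ∫ x, (v x - v' x - W x * (u x - u' x)) * ((deriv φ x : ℝ) : ℂ)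
        = (∫ x, (v x - W x * u x) * ((deriv φ x : ℝ) : ℂ))
          - ∫ x, (v' x - W x * u' x) * ((deriv φ x : ℝ) : ℂ) := by
      refine (integral_congr_ae (Eventually.of_forall fun x => ?_)).trans
        (integral_sub (i hv) (i hv'))
      ring
    have e2 : ∫ x, (k ^ 2 * (u x - u' x) - W x * (v x - v' x)) * ((φ x : ℝ) : ℂ)
        = (∫ x, (k ^ 2 * u x - W x * v x) * ((φ x : ℝ) : ℂ))
          - ∫ x, (k ^ 2 * u' x - W x * v' x) * ((φ x : ℝ) : ℂ) := by
      refine (integral_congr_ae (Eventually.of_forall fun x => ?_)).trans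
        (integral_sub (j hv) (j hv'))
      ring
    rw [e1, e2]
    linear_combination h1 - h2)
  ext x
  exact sub_eq_zero.1 (congrFun this x)

/-- The added constant contributes a multiple of the integral of (uφ)', which is zero. This is what
makes the arbitrary choice of primitive harmless. -/
theorem isResolventDelta_add_const_iff {W : ℝ → ℝ} (hW : Continuous W) {k : ℂ} (c : ℝ) {y : ℝ}
    {u : ℝ → ℂ} : IsResolventDelta (fun x => W x + c) k y u ↔ IsResolventDelta W k y u := by
  refine exists_congr fun v => and_congr_right fun h => forall_congr' fun φ =>
    forall_congr' fun hφ => forall_congr' fun hc => ?_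
  rw [weak_form_eq_integral h hW k hφ hc,
    weak_form_eq_integral h (show Continuous fun x => W x + c by fun_prop) k hφ hc]
  have hdc : Continuous (deriv φ) := (hφ.of_le (by simp)).continuous_deriv le_rfl
  have hv := h.locallyIntegrable_right
  have hu := h.locallyIntegrable_left
  have ibp := integral_mul_eq_neg_integral_mul_deriv hv h.2.2 (hφ.of_le (by simp)) hc
  have e1 : ∫ x, (v x - ((W x + c : ℝ) : ℂ) * u x) * ((deriv φ x : ℝ) : ℂ)
      = (∫ x, (v x - W x * u x) * ((deriv φ x : ℝ) : ℂ))
        - c * ∫ x, u x * ((deriv φ x : ℝ) : ℂ) := by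
    rw [← integral_const_mul]
    refine Eq.trans (integral_congr_ae (Eventually.of_forall fun x => ?_))
      (integral_sub (integrable_mul_ofReal_of_hasCompactSupport (hv.sub
        (locallyIntegrable_ofReal_mul hu hW)) hdc hc.deriv)
      ((integrable_mul_ofReal_of_hasCompactSupport hu hdc hc.deriv).const_mul _))
    dsimp only; push_cast; ring
  have e2 : ∫ x, (k ^ 2 * u x - ((W x + c : ℝ) : ℂ) * v x) * ((φ x : ℝ) : ℂ)
      = (∫ x, (k ^ 2 * u x - W x * v x) * ((φ x : ℝ) : ℂ))
        - c * ∫ x, v x * ((φ x : ℝ) : ℂ) := by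
    rw [← integral_const_mul]
    refine Eq.trans (integral_congr_ae (Eventually.of_forall fun x => ?_))
      (integral_sub (integrable_mul_ofReal_of_hasCompactSupport
        ((hu.smul (k ^ 2)).sub (locallyIntegrable_ofReal_mul hv hW)) hφ.continuous hc)
      ((integrable_mul_ofReal_of_hasCompactSupport hv hφ.continuous hc).const_mul _))
    dsimp only; push_cast; ring
  rw [e1, e2, ibp]
  constructor <;> intro h <;> linear_combination h

end

/-! ### Gluing half-line solutions into the resolvent kernel. -/

section
-- The classical kernel u₊(max) u₋(min)/w. It is continuous at y, and its quasi-derivative drops by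
-- exactly 1 there thanks to the normalization by the Wronskian; this jump is the delta function.
theorem isResolventDelta_of_isSolution {W : ℝ → ℝ} (hW : Continuous W) {k : ℂ}
    {up zp um zm : ℝ → ℂ} (hp : IsSolution W k up zp) (hm : IsSolution W k um zm)
    (hup : ∀ y, MemLp up 2 (volume.restrict (Ioi y)))
    (hvp : ∀ y, MemLp (fun x => zp x + W x * up x) 2 (volume.restrict (Ioi y)))
    (hum : ∀ y, MemLp um 2 (volume.restrict (Iic y)))
    (hvm : ∀ y, MemLp (fun x => zm x + W x * um x) 2 (volume.restrict (Iic y)))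
    {w : ℂ} (hw : w ≠ 0) (hwr : ∀ x, up x * zm x - um x * zp x = w) (y : ℝ) :
    IsResolventDelta W k y
      (fun x => if x ≤ y then up y / w * um x else um y / w * up x) := by
  set cm : ℂ := up y / w with hcm
  set cp : ℂ := um y / w with hcp
  set vm : ℝ → ℂ := fun x => zm x + W x * um x with hvm'
  set vp : ℝ → ℂ := fun x => zp x + W x * up x with hvp'
  have hvmc : Continuous vm := hm.continuous_deriv hW
  have hvpc : Continuous vp := hp.continuous_deriv hW
  set u : ℝ → ℂ := fun x => if x ≤ y then cm * um x else cp * up x with hu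
  set v : ℝ → ℂ := fun x => if x ≤ y then cm * vm x else cp * vp x with hv
  have split : ∀ f g : ℝ → ℂ, (fun x => if x ≤ y then f x else g x)
      = (Iic y).indicator f + (Ioi y).indicator g := by
    intro f g
    ext x
    by_cases hx : x ≤ y
    · simp [hx]
    · simp [hx, not_le.1 hx]
  have mem : ∀ f g : ℝ → ℂ, MemLp f 2 (volume.restrict (Iic y)) →
      MemLp g 2 (volume.restrict (Ioi y)) → MemLp (fun x => if x ≤ y then f x else g x) 2 := by
    intro f g hf hg
    rw [split]
    exact ((memLp_indicator_iff_restrict measurableSet_Iic).2 hf).add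
      ((memLp_indicator_iff_restrict measurableSet_Ioi).2 hg)
  have hv2 : MemLp v 2 := mem _ _ ((hvm y).const_mul cm) ((hvp y).const_mul cp)
  have hu2 : MemLp u 2 := mem _ _ ((hum y).const_mul cm) ((hup y).const_mul cp)
  have hvi : ∀ a b, IntervalIntegrable v volume a b := fun a b =>
    ((hv2.locallyIntegrable (by norm_num)).integrableOn_isCompact isCompact_uIcc).intervalIntegrable
  have huy : cm * um y = cp * up y := by rw [hcm, hcp]; ring
  have base : ∀ x, u x - u y = ∫ t in y..x, v t := by
    intro x
    rcases le_or_gt x y with hx | hx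
    · have : ∫ t in y..x, v t = ∫ t in y..x, cm * vm t := by
        refine intervalIntegral.integral_congr fun t ht => ?_
        rw [uIcc_of_ge hx] at ht
        simp [hv, ht.2]
      rw [this, intervalIntegral.integral_const_mul,
        intervalIntegral.integral_eq_sub_of_hasDerivAt (fun t _ => hm.deriv_left t)
          (hvmc.intervalIntegrable _ _)]
      simp only [hu, if_pos hx, le_refl, if_true]
      ring
    · have : ∫ t in y..x, v t = ∫ t in y..x, cp * vp t := by
        refine intervalIntegral.integral_congr_ae (Eventually.of_forall fun t ht => ?_)
        rw [uIoc_of_le hx.le] at ht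
        simp [hv, not_le.2 ht.1]
      rw [this, intervalIntegral.integral_const_mul,
        intervalIntegral.integral_eq_sub_of_hasDerivAt (fun t _ => hp.deriv_left t)
          (hvpc.intervalIntegrable _ _)]
      simp only [hu, if_neg (not_le.2 hx), le_refl, if_true]
      rw [huy]; ring
  have huv : ∀ a b : ℝ, u b - u a = ∫ x in a..b, v x := by
    intro a b
    rw [← intervalIntegral.integral_interval_sub_left (hvi y b) (hvi y a), ← base, ← base]
    ring
  have hH : HasH1Deriv u v := ⟨hu2, hv2, huv⟩
  refine ⟨v, hH, fun φ hφ hc => ?_⟩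
  rw [weak_form_eq_integral hH hW k hφ hc]
  have hdc : Continuous (deriv φ) := (hφ.of_le (by simp)).continuous_deriv le_rfl
  have hder : ∀ x, HasDerivAt (fun x => ((φ x : ℝ) : ℂ)) ((deriv φ x : ℝ) : ℂ) x := fun x =>
    ((hφ.differentiable (by simp)) x).hasDerivAt.ofReal_comp
  have i1 := integrable_mul_ofReal_of_hasCompactSupport (hH.locallyIntegrable_right.sub
        (locallyIntegrable_ofReal_mul hH.locallyIntegrable_left hW)) hdc hc.deriv
  have i2 := integrable_mul_ofReal_of_hasCompactSupport ((hH.locallyIntegrable_left.smul (k ^ 2)).sub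
        (locallyIntegrable_ofReal_mul hH.locallyIntegrable_right hW)) hφ.continuous hc
  set F : ℝ → ℂ := fun x => (v x - W x * u x) * ((deriv φ x : ℝ) : ℂ)
    + (k ^ 2 * u x - W x * v x) * ((φ x : ℝ) : ℂ) with hF
  have hFi : Integrable F := (i1.add i2).congr (Eventually.of_forall fun x => by
    simp [hF, smul_eq_mul])
  have hadd : (∫ x, (v x - W x * u x) * ((deriv φ x : ℝ) : ℂ))
        + ∫ x, (k ^ 2 * u x - W x * v x) * ((φ x : ℝ) : ℂ) = ∫ x, F x :=
    (integral_add i1 i2).symm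
  rw [hadd, ← intervalIntegral.integral_Iic_add_Ioi hFi.integrableOn hFi.integrableOn (b := y)]
  obtain ⟨R, hR, h0⟩ := exists_pos_forall_lt_abs_eq_zero hc
  have dz : ∀ (c : ℂ) {U Z : ℝ → ℂ}, IsSolution W k U Z → ∀ x,
      HasDerivAt (fun x => c * Z x * ((φ x : ℝ) : ℂ))
        (((c * (Z x + W x * U x)) - W x * (c * U x)) * ((deriv φ x : ℝ) : ℂ)
    + (k ^ 2 * (c * U x) - W x * (c * (Z x + W x * U x))) * ((φ x : ℝ) : ℂ)) x := by
    intro c U Z h x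
    exact (((h.deriv_right x).const_mul c).mul (hder x)).congr_deriv (by ring)
  have e1 : ∫ x in Iic y, F x = cm * zm y * ((φ y : ℝ) : ℂ) := by
    have := integral_Iic_of_hasDerivAt_of_tendsto (f := fun x => cm * zm x * ((φ x : ℝ) : ℂ))
      (f' := F) (a := y) (m := 0)
      (by exact (dz cm hm y).continuousAt.continuousWithinAt) (fun x hx => by
        refine (dz cm hm x).congr_deriv ?_
        simp only [hF, hu, hv, if_pos (le_of_lt (mem_Iio.1 hx)), hvm']) hFi.integrableOn
      (by
        refine tendsto_const_nhds.congr' ?_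
        filter_upwards [eventually_le_atBot (-R)] with x hx
        rw [h0 x (by linarith [neg_abs_le x])]; simp)
    rw [this, sub_zero]
  have e2 : ∫ x in Ioi y, F x = -(cp * zp y * ((φ y : ℝ) : ℂ)) := by
    have := integral_Ioi_of_hasDerivAt_of_tendsto (f := fun x => cp * zp x * ((φ x : ℝ) : ℂ))
      (f' := F) (a := y) (m := 0)
      (by exact (dz cp hp y).continuousAt.continuousWithinAt) (fun x hx => by
        refine (dz cp hp x).congr_deriv ?_
        simp only [hF, hu, hv, if_neg (not_le.2 (mem_Ioi.1 hx)), hvp']) hFi.integrableOn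
      (by
        refine tendsto_const_nhds.congr' ?_
        filter_upwards [eventually_ge_atTop R] with x hx
        rw [h0 x (by linarith [le_abs_self x])]; simp)
    rw [this, zero_sub]
  rw [e1, e2]
  have := hwr y
  -- The two boundary terms at y differ by the Wronskian over itself.
  have h3 : cm * zm y - cp * zp y = 1 := by
    rw [hcm, hcp]
    field_simp
    linear_combination this
  linear_combination ((φ y : ℝ) : ℂ) * h3

end

section
/-! ### Global solutions of linear-growth ODEs through Picard iteration -/

section Picard

variable {E : Type*} [NormedAddCommGroup E] [NormedSpace ℝ E]

/-- Picard iterates for `y' = f(t, y)`, `y(0) = v`. -/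
def picardIterate (f : ℝ → E → E) (v : E) : ℕ → ℝ → E
  | 0, _ => v
  | n + 1, t => v + ∫ s in (0 : ℝ)..t, f s (picardIterate f v n s)

/-- The limit of the Picard iterates. -/
def picardLimit (f : ℝ → E → E) (v : E) (t : ℝ) : E :=
  v + ∑' n : ℕ, (picardIterate f v (n + 1) t - picardIterate f v n t)

theorem continuous_picardIterate {f : ℝ → E → E} (hf : Continuous (Function.uncurry f)) (v : E)
    (n : ℕ) : Continuous (picardIterate f v n) := by
  induction n with
  | zero => exact continuous_const
  | succ n ih =>
    have h1 : Continuous fun s => f s (picardIterate f v n s) :=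
      hf.comp (continuous_id.prodMk ih)
    exact continuous_const.add
      (intervalIntegral.continuous_primitive (fun a b => h1.intervalIntegrable a b) 0)

variable {f : ℝ → E → E} {v : E} {R M : ℝ}

/-- Each integration from 0 raises the power of |t| by one and divides by the new exponent. The
factorial beats any Lipschitz constant, so the iterates converge on every bounded interval. Explicit
iterates are convenient here because their measurability in the noise can be read off by induction.
-/
theorem norm_picardIterate_succ_sub_le (hf : Continuous (Function.uncurry f))
    (hM : 0 ≤ M) (hL : ∀ t, |t| ≤ R → ∀ x y, ‖f t x - f t y‖ ≤ M * ‖x - y‖) {B : ℝ}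
    (hB : ∀ t, |t| ≤ R → ‖picardIterate f v 1 t - picardIterate f v 0 t‖ ≤ B) (n : ℕ) :
    ∀ t, |t| ≤ R → ‖picardIterate f v (n + 1) t - picardIterate f v n t‖
      ≤ B * ((M * |t|) ^ n / n.factorial) := by
  induction n with
  | zero => intro t ht; simpa using hB t ht
  | succ n ih =>
    intro t ht
    have hc : ∀ n, Continuous fun s => f s (picardIterate f v n s) := fun n =>
      hf.comp (continuous_id.prodMk (continuous_picardIterate hf v n))
    have e : picardIterate f v (n + 1 + 1) t - picardIterate f v (n + 1) t
        = ∫ s in (0 : ℝ)..t, (f s (picardIterate f v (n + 1) s) - f s (picardIterate f v n s)) := by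
      rw [intervalIntegral.integral_sub ((hc _).intervalIntegrable _ _)
        ((hc _).intervalIntegrable _ _)]
      simp only [picardIterate]
      abel
    have hB0 : 0 ≤ B := le_trans (norm_nonneg _) (hB t ht)
    rw [e, intervalIntegral.norm_integral_eq_norm_integral_uIoc]
    have hbound : ∀ s ∈ uIoc 0 t, ‖f s (picardIterate f v (n + 1) s) - f s (picardIterate f v n s)‖
        ≤ B * M ^ (n + 1) / n.factorial * |s - 0| ^ n := by
      intro s hs
      have hs' : |s| ≤ R := by
        refine le_trans ?_ ht
        rw [mem_uIoc] at hs
        rcases hs with hs | hs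
        · rw [abs_of_pos hs.1, abs_of_pos (hs.1.trans_le hs.2)]; exact hs.2
        · rw [abs_of_nonpos hs.2, abs_of_nonpos (hs.1.le.trans hs.2)]; linarith [hs.1]
      refine (hL s hs' _ _).trans ((mul_le_mul_of_nonneg_left (ih s hs') hM).trans (le_of_eq ?_))
      rw [sub_zero, mul_pow, pow_succ]; ring
    refine (norm_integral_le_of_norm_le (g := fun s => B * M ^ (n + 1) / n.factorial * |s - 0| ^ n)
      ?_ ?_).trans (le_of_eq ?_)
    · exact (Continuous.integrableOn_uIoc (by fun_prop))
    · exact (ae_restrict_iff' measurableSet_uIoc).2 (Eventually.of_forall hbound)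
    · rw [integral_const_mul, integral_pow_abs_sub_uIoc, sub_zero, Nat.factorial_succ]
      push_cast
      have h1 : (n.factorial : ℝ) ≠ 0 := by positivity
      rw [mul_pow]
      field_simp

theorem exists_bound_picardIterate (hf : Continuous (Function.uncurry f)) (hR : 0 ≤ R)
    (hL : ∀ R : ℝ, ∃ M : ℝ, 0 ≤ M ∧ ∀ t, |t| ≤ R → ∀ x y, ‖f t x - f t y‖ ≤ M * ‖x - y‖) :
    ∃ b : ℕ → ℝ, Summable b ∧ ∀ n t, |t| ≤ R →
      ‖picardIterate f v (n + 1) t - picardIterate f v n t‖ ≤ b n := by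
  obtain ⟨M, hM, hL⟩ := hL R
  have hc : Continuous fun t => ‖picardIterate f v 1 t - picardIterate f v 0 t‖ :=
    ((continuous_picardIterate hf v 1).sub (continuous_picardIterate hf v 0)).norm
  obtain ⟨B, hB⟩ := (isCompact_Icc (a := -R) (b := R)).bddAbove_image hc.continuousOn
  have hB' : ∀ t, |t| ≤ R → ‖picardIterate f v 1 t - picardIterate f v 0 t‖ ≤ B := fun t ht =>
    hB (mem_image_of_mem _ (abs_le.1 ht))
  have hB0 : 0 ≤ B := le_trans (norm_nonneg _) (hB' 0 (by simpa using hR))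
  refine ⟨fun n => B * ((M * R) ^ n / n.factorial),
    (Real.summable_pow_div_factorial (M * R)).mul_left B, fun n t ht => ?_⟩
  refine (norm_picardIterate_succ_sub_le hf hM hL hB' n t ht).trans ?_
  have h1 : (M * |t|) ^ n ≤ (M * R) ^ n :=
    pow_le_pow_left₀ (by positivity) (mul_le_mul_of_nonneg_left ht hM) n
  exact mul_le_mul_of_nonneg_left (div_le_div_of_nonneg_right h1 (by positivity)) hB0

variable [CompleteSpace E]

theorem tendstoUniformlyOn_picardIterate (hf : Continuous (Function.uncurry f)) (hR : 0 ≤ R)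
    (hL : ∀ R : ℝ, ∃ M : ℝ, 0 ≤ M ∧ ∀ t, |t| ≤ R → ∀ x y, ‖f t x - f t y‖ ≤ M * ‖x - y‖) :
    TendstoUniformlyOn (picardIterate f v) (picardLimit f v) atTop {t | |t| ≤ R} := by
  obtain ⟨b, hb, hbn⟩ := exists_bound_picardIterate (v := v) hf hR hL
  have h1 := tendstoUniformlyOn_tsum_nat (s := {t : ℝ | |t| ≤ R}) hb
    (f := fun n t => picardIterate f v (n + 1) t - picardIterate f v n t) (fun n t ht => hbn n t ht)
  have h2 : ∀ N t, ∑ n ∈ Finset.range N, (picardIterate f v (n + 1) t - picardIterate f v n t)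
      = picardIterate f v N t - v := fun N t =>
    (Finset.sum_range_sub (fun n => picardIterate f v n t) N)
  rw [Metric.tendstoUniformlyOn_iff] at h1 ⊢
  intro ε hε
  filter_upwards [h1 ε hε] with N hN t ht
  have := hN t ht
  rw [h2, dist_eq_norm] at this
  rw [dist_eq_norm, picardLimit]
  convert this using 2
  abel

theorem tendsto_picardIterate (hf : Continuous (Function.uncurry f))
    (hL : ∀ R : ℝ, ∃ M : ℝ, 0 ≤ M ∧ ∀ t, |t| ≤ R → ∀ x y, ‖f t x - f t y‖ ≤ M * ‖x - y‖) (t : ℝ) :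
    Tendsto (fun n => picardIterate f v n t) atTop (𝓝 (picardLimit f v t)) :=
  (tendstoUniformlyOn_picardIterate hf (abs_nonneg t) hL).tendsto_at (le_refl |t|)

theorem continuous_picardLimit (hf : Continuous (Function.uncurry f))
    (hL : ∀ R : ℝ, ∃ M : ℝ, 0 ≤ M ∧ ∀ t, |t| ≤ R → ∀ x y, ‖f t x - f t y‖ ≤ M * ‖x - y‖) :
    Continuous (picardLimit f v) := by
  rw [continuous_iff_continuousAt]
  intro t
  have h1 := (tendstoUniformlyOn_picardIterate (v := v) hf (R := |t| + 1) (by positivity) hL)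
  have h2 : ContinuousOn (picardLimit f v) {s | |s| ≤ |t| + 1} :=
    h1.continuousOn (Eventually.of_forall fun n =>
      (continuous_picardIterate hf v n).continuousOn).frequently
  refine h2.continuousAt ?_
  filter_upwards [(isOpen_lt continuous_abs continuous_const).mem_nhds
    (show |t| < |t| + 1 by linarith)] with s hs using le_of_lt hs

theorem picardLimit_eq_integral (hf : Continuous (Function.uncurry f))
    (hL : ∀ R : ℝ, ∃ M : ℝ, 0 ≤ M ∧ ∀ t, |t| ≤ R → ∀ x y, ‖f t x - f t y‖ ≤ M * ‖x - y‖) (t : ℝ) :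
    picardLimit f v t = v + ∫ s in (0 : ℝ)..t, f s (picardLimit f v s) := by
  refine tendsto_nhds_unique ((tendsto_add_atTop_iff_nat 1).2 (tendsto_picardIterate hf hL t)) ?_
  refine tendsto_const_nhds.add ?_
  obtain ⟨M, hM, hLM⟩ := hL |t|
  have hyc := continuous_picardLimit (v := v) hf hL
  have hcl : Continuous fun s => f s (picardLimit f v s) := hf.comp (continuous_id.prodMk hyc)
  have hmem : ∀ s ∈ uIoc 0 t, |s| ≤ |t| := by
    intro s hs
    rw [mem_uIoc] at hs
    rcases hs with hs | hs
    · rw [abs_of_pos hs.1, abs_of_pos (hs.1.trans_le hs.2)]; exact hs.2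
    · rw [abs_of_nonpos hs.2, abs_of_nonpos (hs.1.le.trans hs.2)]; linarith [hs.1]
  have hunif := tendstoUniformlyOn_picardIterate (v := v) hf (abs_nonneg t) hL
  rw [Metric.tendstoUniformlyOn_iff] at hunif
  refine intervalIntegral.tendsto_integral_filter_of_dominated_convergence
    (fun s => ‖f s (picardLimit f v s)‖ + M) ?_ ?_ ?_ ?_
  · exact Eventually.of_forall fun n => (hf.comp (continuous_id.prodMk
      (continuous_picardIterate hf v n))).aestronglyMeasurable
  · filter_upwards [hunif 1 one_pos] with n hn
    refine Eventually.of_forall fun s hs => ?_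
    have h1 := hLM s (hmem s hs) (picardIterate f v n s) (picardLimit f v s)
    have h2 := hn s (hmem s hs)
    rw [dist_comm, dist_eq_norm] at h2
    have h3 := norm_le_norm_add_norm_sub' (f s (picardIterate f v n s)) (f s (picardLimit f v s))
    nlinarith
  · exact (hcl.norm.add continuous_const).intervalIntegrable _ _
  · refine Eventually.of_forall fun s hs => ?_
    exact ((hf.comp (Continuous.prodMk_right s)).tendsto _).comp (tendsto_picardIterate hf hL s)

theorem hasDerivAt_picardLimit (hf : Continuous (Function.uncurry f))
    (hL : ∀ R : ℝ, ∃ M : ℝ, 0 ≤ M ∧ ∀ t, |t| ≤ R → ∀ x y, ‖f t x - f t y‖ ≤ M * ‖x - y‖) (t : ℝ) :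
    HasDerivAt (picardLimit f v) (f t (picardLimit f v t)) t := by
  have hcl : Continuous fun s => f s (picardLimit f v s) :=
    hf.comp (continuous_id.prodMk (continuous_picardLimit hf hL))
  have := (intervalIntegral.integral_hasDerivAt_right (hcl.intervalIntegrable 0 t)
    (hcl.stronglyMeasurableAtFilter _ _) hcl.continuousAt).const_add v
  rwa [← funext (picardLimit_eq_integral hf hL)] at this

theorem picardLimit_zero (hf : Continuous (Function.uncurry f))
    (hL : ∀ R : ℝ, ∃ M : ℝ, 0 ≤ M ∧ ∀ t, |t| ≤ R → ∀ x y, ‖f t x - f t y‖ ≤ M * ‖x - y‖) :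
    picardLimit f v 0 = v := by
  rw [picardLimit_eq_integral hf hL]; simp

end Picard

/-! ### Global solutions of the Schrödinger system. -/

/-- The vector field of the first-order Schrödinger system. -/
def schrodingerField (W : ℝ → ℝ) (k : ℂ) (t : ℝ) (p : ℂ × ℂ) : ℂ × ℂ :=
  (p.2 + W t * p.1, k ^ 2 * p.1 - W t * (p.2 + W t * p.1))

theorem continuous_schrodingerField {W : ℝ → ℝ} (hW : Continuous W) (k : ℂ) :
    Continuous (Function.uncurry (schrodingerField W k)) := by
  unfold schrodingerField Function.uncurry
  fun_prop

theorem schrodingerField_lipschitz {W : ℝ → ℝ} (hW : Continuous W) (k : ℂ) (R : ℝ) :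
    ∃ M : ℝ, 0 ≤ M ∧ ∀ t, |t| ≤ R → ∀ x y,
      ‖schrodingerField W k t x - schrodingerField W k t y‖ ≤ M * ‖x - y‖ := by
  obtain ⟨C, hC⟩ := (isCompact_Icc (a := -R) (b := R)).bddAbove_image hW.abs.continuousOn
  refine ⟨1 + |C| + ‖k‖ ^ 2 + |C| * (1 + |C|), by positivity, fun t ht x y => ?_⟩
  have hWt : ‖(W t : ℂ)‖ ≤ |C| := by
    rw [Complex.norm_real]
    exact (hC (mem_image_of_mem _ (abs_le.1 ht))).trans (le_abs_self C)
  have e : schrodingerField W k t x - schrodingerField W k t y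
      = schrodingerField W k t (x - y) := by
    simp only [schrodingerField, Prod.mk_sub_mk, Prod.fst_sub, Prod.snd_sub]
    ext <;> simp <;> ring
  rw [e]
  set d := x - y
  have h1 : ‖d.1‖ ≤ ‖d‖ := norm_fst_le d
  have h2 : ‖d.2‖ ≤ ‖d‖ := norm_snd_le d
  have h3 : ‖d.2 + W t * d.1‖ ≤ (1 + |C|) * ‖d‖ := by
    refine (norm_add_le _ _).trans ?_
    rw [norm_mul, _root_.add_mul, one_mul]
    gcongr
  have h4 : ‖k ^ 2 * d.1 - W t * (d.2 + W t * d.1)‖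
      ≤ ‖k‖ ^ 2 * ‖d‖ + |C| * ((1 + |C|) * ‖d‖) := by
    refine (norm_sub_le _ _).trans ?_
    rw [norm_mul, norm_mul, norm_pow]
    gcongr
  have h0 := norm_nonneg d
  have hC0 := abs_nonneg C
  simp only [schrodingerField]
  refine max_le (h3.trans ?_) (h4.trans ?_)
  · nlinarith [mul_nonneg (sq_nonneg ‖k‖) h0, mul_nonneg (mul_nonneg hC0 (by positivity : 0 ≤ 1 + |C|)) h0]
  · nlinarith [mul_nonneg hC0 h0]

/-- The solution of the first-order Schrödinger system with data `p` at `0`. -/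
def schrodingerFlow (W : ℝ → ℝ) (k : ℂ) (p : ℂ × ℂ) (t : ℝ) : ℂ × ℂ :=
  picardLimit (schrodingerField W k) p t

theorem schrodingerFlow_zero {W : ℝ → ℝ} (hW : Continuous W) (k : ℂ) (p : ℂ × ℂ) :
    schrodingerFlow W k p 0 = p :=
  picardLimit_zero (continuous_schrodingerField hW k) (schrodingerField_lipschitz hW k)

theorem isSolution_schrodingerFlow {W : ℝ → ℝ} (hW : Continuous W) (k : ℂ) (p : ℂ × ℂ) :
    IsSolution W k (fun t => (schrodingerFlow W k p t).1) (fun t => (schrodingerFlow W k p t).2) where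
  deriv_left t := (hasDerivAt_picardLimit (v := p) (continuous_schrodingerField hW k)
    (schrodingerField_lipschitz hW k) t).fst
  deriv_right t := (hasDerivAt_picardLimit (v := p) (continuous_schrodingerField hW k)
    (schrodingerField_lipschitz hW k) t).snd

end

section
/-! ### The pointwise bound on the Weyl function -/

/-- The consequences of strict admissibility that are used below. -/
structure SectorialParameter (k : ℂ) : Prop where
  one_le : 1 ≤ ‖k‖
  re_ge : ‖k‖ / 2 ≤ k.re
  im_ge : ‖k‖ ^ 2 / 4 ≤ (k ^ 2).im

theorem SectorialParameter.im_pos {k : ℂ} (h : SectorialParameter k) : 0 < (k ^ 2).im := by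
  have := h.im_ge
  have h1 := h.one_le
  nlinarith

/-- The argument of k lies between π/16 and 3π/16, so its cosine exceeds cos(π/3), while Jordan's
inequality sin y ≥ 2y/π bounds the sine of twice the argument below by 1/4. The threshold 1 for Im
k² forces κ ≥ 1. -/
theorem StrictlyAdmissible.sectorialParameter {k : ℂ} (h : StrictlyAdmissible 1 k) :
    SectorialParameter k := by
  obtain ⟨h0, h1, h2, h3, h4⟩ := h
  rw [abs_lt] at h4
  have hpi := Real.pi_pos
  have hk : k = ‖k‖ * Complex.exp (k.arg * Complex.I) := (Complex.norm_mul_exp_arg_mul_I k).symm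
  have hre : k.re = ‖k‖ * Real.cos k.arg := by rw [Complex.norm_mul_cos_arg]
  have hk2 : (k ^ 2).im = ‖k‖ ^ 2 * Real.sin (2 * k.arg) := by
    rw [sq, Complex.mul_im, Real.sin_two_mul]
    have e1 : k.im = ‖k‖ * Real.sin k.arg := by rw [Complex.norm_mul_sin_arg]
    rw [hre, e1]; ring
  refine ⟨?_, ?_, ?_⟩
  · rw [hk2] at h3
    have := Real.sin_le_one (2 * k.arg)
    have h5 : (1 : ℝ) ≤ ‖k‖ ^ 2 := by nlinarith [sq_nonneg ‖k‖]
    nlinarith [norm_nonneg k]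
  · rw [hre]
    have : 1 / 2 ≤ Real.cos k.arg := by
      rw [← Real.cos_pi_div_three]
      exact Real.cos_le_cos_of_nonneg_of_le_pi h1 (by linarith) (by linarith)
    nlinarith [norm_nonneg k]
  · rw [hk2]
    have : 1 / 4 ≤ Real.sin (2 * k.arg) := by
      have h5 := Real.mul_le_sin (x := 2 * k.arg) (by linarith) (by linarith)
      refine le_trans ?_ h5
      rw [div_mul_eq_mul_div, le_div_iff₀ hpi]
      linarith
    nlinarith [sq_nonneg ‖k‖]

/-- The weight `κ (1 + κ t)² e^{-κ t}`. -/
def expWeight (κ t : ℝ) : ℝ := κ * (1 + κ * t) ^ 2 * Real.exp (-(κ * t))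

theorem expWeight_nonneg {κ : ℝ} (hκ : 0 ≤ κ) (t : ℝ) : 0 ≤ expWeight κ t := by
  unfold expWeight; positivity

theorem continuous_expWeight (κ : ℝ) : Continuous (expWeight κ) := by
  unfold expWeight; fun_prop

/-- The antiderivative is explicit, and the bound 5 is its value at t = 0 up to sign. Uniformity in
κ is the point. -/
theorem integral_expWeight_le {κ : ℝ} (hκ : 0 ≤ κ) : ∫ t in (0 : ℝ)..1, expWeight κ t ≤ 5 := by
  have hd : ∀ t, HasDerivAt
      (fun t : ℝ => -(((κ * t) ^ 2 + 4 * (κ * t) + 5) * Real.exp (-(κ * t)))) (expWeight κ t) t := by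
    intro t
    have h1 : HasDerivAt (fun t : ℝ => κ * t) κ t := by simpa using (hasDerivAt_id t).const_mul κ
    have h2 := ((((h1.pow 2).add (h1.const_mul 4)).add_const 5).mul h1.neg.exp).neg
    refine h2.congr_deriv ?_
    simp only [expWeight, Pi.add_apply, Pi.pow_apply, Pi.neg_apply]
    push_cast; ring
  rw [intervalIntegral.integral_eq_sub_of_hasDerivAt (fun t _ => hd t)
    ((continuous_expWeight κ).intervalIntegrable _ _)]
  have : 0 ≤ ((κ * 1) ^ 2 + 4 * (κ * 1) + 5) * Real.exp (-(κ * 1)) := by positivity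
  simp only [mul_zero, neg_zero, Real.exp_zero]
  linarith

/-- The normalized increment `|W (x + t) - W x| / √t`. -/
def normIncrement (W : ℝ → ℝ) (x t : ℝ) : ℝ := |W (x + t) - W x| / Real.sqrt t

theorem normIncrement_nonneg (W : ℝ → ℝ) (x t : ℝ) : 0 ≤ normIncrement W x t := by
  unfold normIncrement; positivity

/-- The local size of the noise to the right of `x` which controls the Weyl function at `x`. -/
def noiseSize (κ : ℝ) (W : ℝ → ℝ) (x : ℝ) : ℝ≥0∞ :=
  ∫⁻ t in Ioo (0 : ℝ) 1,
    ENNReal.ofReal (Real.exp (4 * normIncrement W x t) * (5 + expWeight κ t))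

/-- The left side is the failure of e^{-kt}(1-t²)² to solve the equation. With |w| = √t N, its
polynomial factor is at most 8(1+κt) + 10κ√t N + tN². Squaring costs a factor 3, and N² ≤ 2e^N, N⁴ ≤
24e^N give 864 = 3(64 + 200 + 24). The half power of t gained from the increment turns κ²w² into κ²t
N², which the weight absorbs; this is where the Brownian scale matters. -/
theorem sq_norm_remainder_le {k : ℂ} (hk : SectorialParameter k) {t w : ℝ} (ht0 : 0 < t)
    (ht1 : t ≤ 1) :
    ‖Complex.exp (-(k * t)) * ((-4 + 12 * t ^ 2 : ℝ) - 2 * k * (-4 * t * (1 - t ^ 2) : ℝ)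
      + 2 * w * ((-4 * t * (1 - t ^ 2) : ℝ) - k * ((1 - t ^ 2) ^ 2 : ℝ))
      + w ^ 2 * ((1 - t ^ 2) ^ 2 : ℝ))‖ ^ 2
      ≤ 864 * Real.exp (|w| / Real.sqrt t) * expWeight ‖k‖ t := by
  set κ := ‖k‖
  have hκ : 1 ≤ κ := hk.one_le
  set N := |w| / Real.sqrt t with hN
  have hs : 0 < Real.sqrt t := Real.sqrt_pos.2 ht0
  have hwN : |w| = Real.sqrt t * N := by rw [hN]; field_simp
  have hN0 : 0 ≤ N := by positivity
  have ht2 : t ^ 2 ≤ 1 := by nlinarith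
  have a1 : |(-4 + 12 * t ^ 2 : ℝ)| ≤ 8 := by rw [abs_le]; constructor <;> nlinarith
  have a2 : |(-4 * t * (1 - t ^ 2) : ℝ)| ≤ 4 * t := by
    rw [abs_le]; constructor <;> nlinarith [mul_nonneg ht0.le (sub_nonneg.2 ht2), pow_pos ht0 3]
  have a3 : |((1 - t ^ 2) ^ 2 : ℝ)| ≤ 1 := by
    rw [abs_of_nonneg (sq_nonneg _)]; nlinarith [sq_nonneg t]
  have hexp : ‖Complex.exp (-(k * t))‖ ^ 2 ≤ Real.exp (-(κ * t)) := by
    rw [Complex.norm_exp, ← Real.exp_nat_mul]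
    refine Real.exp_le_exp.2 ?_
    have := hk.re_ge
    simp only [Complex.neg_re, Complex.mul_re, Complex.ofReal_re, Complex.ofReal_im, mul_zero,
      sub_zero]
    push_cast
    nlinarith
  have hpoly : ‖((-4 + 12 * t ^ 2 : ℝ) - 2 * k * (-4 * t * (1 - t ^ 2) : ℝ)
      + 2 * w * ((-4 * t * (1 - t ^ 2) : ℝ) - k * ((1 - t ^ 2) ^ 2 : ℝ))
      + w ^ 2 * ((1 - t ^ 2) ^ 2 : ℝ) : ℂ)‖ ≤ 8 * (1 + κ * t) + 10 * κ * |w| + |w| ^ 2 := by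
    refine (norm_add_le _ _).trans (add_le_add ((norm_add_le _ _).trans
      (add_le_add ((norm_sub_le _ _).trans ?_) ?_)) ?_)
    · rw [norm_mul, norm_mul, Complex.norm_real, Complex.norm_real, Complex.norm_ofNat,
        Real.norm_eq_abs, Real.norm_eq_abs]
      have := mul_le_mul_of_nonneg_left a2 (by positivity : 0 ≤ 2 * κ)
      nlinarith
    · rw [norm_mul, norm_mul, Complex.norm_real, Complex.norm_ofNat, Real.norm_eq_abs]
      have h1 : ‖((-4 * t * (1 - t ^ 2) : ℝ) - k * ((1 - t ^ 2) ^ 2 : ℝ) : ℂ)‖ ≤ 5 * κ := by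
        refine (norm_sub_le _ _).trans ?_
        rw [norm_mul, Complex.norm_real, Complex.norm_real, Real.norm_eq_abs, Real.norm_eq_abs]
        have := mul_le_mul_of_nonneg_left a3 (by positivity : 0 ≤ κ)
        nlinarith
      have := mul_le_mul_of_nonneg_left h1 (by positivity : 0 ≤ 2 * |w|)
      linarith
    · rw [norm_mul, norm_pow, Complex.norm_real, Complex.norm_real, Real.norm_eq_abs,
        Real.norm_eq_abs]
      have := mul_le_mul_of_nonneg_left a3 (by positivity : 0 ≤ |w| ^ 2)
      linarith
  have hNe : N ^ 2 ≤ 2 * Real.exp N := by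
    have := Real.pow_div_factorial_le_exp N hN0 2
    norm_num [Nat.factorial] at this
    linarith
  have hNe4 : N ^ 4 ≤ 24 * Real.exp N := by
    have := Real.pow_div_factorial_le_exp N hN0 4
    norm_num [Nat.factorial] at this
    linarith
  have hNe0 : 1 ≤ Real.exp N := Real.one_le_exp hN0
  have hsq : |w| ^ 2 = t * N ^ 2 := by rw [hwN, mul_pow, Real.sq_sqrt ht0.le]
  have hA : (1 : ℝ) ≤ 1 + κ * t := by nlinarith
  have hpoly2 : (8 * (1 + κ * t) + 10 * κ * |w| + |w| ^ 2) ^ 2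
      ≤ 864 * Real.exp N * (κ * (1 + κ * t) ^ 2) := by
    have e1 : (8 * (1 + κ * t) + 10 * κ * |w| + |w| ^ 2) ^ 2
        ≤ 3 * (64 * (1 + κ * t) ^ 2 + 100 * κ ^ 2 * |w| ^ 2 + (|w| ^ 2) ^ 2) := by
      nlinarith [sq_nonneg (8 * (1 + κ * t) - 10 * κ * |w|), sq_nonneg (8 * (1 + κ * t) - |w| ^ 2),
        sq_nonneg (10 * κ * |w| - |w| ^ 2)]
    refine e1.trans ?_
    rw [hsq]
    set S := κ * (1 + κ * t) ^ 2 with hS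
    have s1 : (1 + κ * t) ^ 2 ≤ S := by
      rw [hS]; nlinarith [sq_nonneg (1 + κ * t)]
    have s2 : κ ^ 2 * t ≤ S := by
      rw [hS]
      have : κ * t ≤ (1 + κ * t) ^ 2 := by nlinarith
      nlinarith
    have s3 : t ^ 2 ≤ S := by nlinarith
    have hS0 : 0 ≤ S := by positivity
    have r2 : κ ^ 2 * (t * N ^ 2) ≤ S * (2 * Real.exp N) := by
      have : κ ^ 2 * (t * N ^ 2) = (κ ^ 2 * t) * N ^ 2 := by ring
      rw [this]; exact mul_le_mul s2 hNe (by positivity) hS0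
    have r3 : (t * N ^ 2) ^ 2 ≤ S * (24 * Real.exp N) := by
      have : (t * N ^ 2) ^ 2 = t ^ 2 * N ^ 4 := by ring
      rw [this]; exact mul_le_mul s3 hNe4 (by positivity) hS0
    have r1 : (1 + κ * t) ^ 2 ≤ S * Real.exp N := by
      refine s1.trans (le_mul_of_one_le_right hS0 hNe0)
    nlinarith
  rw [norm_mul, mul_pow]
  calc _ ≤ Real.exp (-(κ * t)) * (864 * Real.exp N * (κ * (1 + κ * t) ^ 2)) := by
        refine mul_le_mul hexp ((pow_le_pow_left₀ (norm_nonneg _) hpoly 2).trans hpoly2)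
          (by positivity) (by positivity)
    _ = _ := by simp only [expWeight]; ring

theorem exp_integral_le_integral_exp {f : ℝ → ℝ} (hf : Continuous f) :
    Real.exp (∫ t in (0 : ℝ)..1, f t) ≤ ∫ t in (0 : ℝ)..1, Real.exp (f t) := by
  set c := ∫ t in (0 : ℝ)..1, f t with hc
  have h1 : ∫ t in (0 : ℝ)..1, Real.exp c * (1 + (f t - c)) = Real.exp c := by
    rw [intervalIntegral.integral_const_mul, intervalIntegral.integral_add (by simp)
      ((by fun_prop : Continuous fun t => f t - c).intervalIntegrable _ _),
      intervalIntegral.integral_sub (hf.intervalIntegrable _ _) (by simp)]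
    simp [← hc]
  rw [← h1]
  refine intervalIntegral.integral_mono_on zero_le_one
    ((by fun_prop : Continuous fun t => Real.exp c * (1 + (f t - c))).intervalIntegrable _ _)
    ((Real.continuous_exp.comp hf).intervalIntegrable _ _) fun t _ => ?_
  have := Real.add_one_le_exp (f t - c)
  calc Real.exp c * (1 + (f t - c)) ≤ Real.exp c * Real.exp (f t - c) := by
        refine mul_le_mul_of_nonneg_left ?_ (Real.exp_pos c).le
        linarith
    _ = Real.exp (f t) := by rw [← Real.exp_add]; congr 1; ring

/-- The Weyl-function bound at the base point `0`, for a primitive with `W 0 = 0`. -/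
theorem norm_add_le_of_isSolution_zero {W : ℝ → ℝ} (hW : Continuous W) (hW0 : W 0 = 0) {k : ℂ}
    (hk : SectorialParameter k) {u z : ℝ → ℂ} (h : IsSolution W k u z) (hu0 : u 0 = 1)
    (hweyl : (k ^ 2).im * ∫ t in (0 : ℝ)..1, ‖u t‖ ^ 2 ≤ -(z 0).im) :
    ENNReal.ofReal ‖z 0 + k‖
      ≤ ENNReal.ofReal (1 / Real.sqrt ‖k‖) * (1 + 3456 * noiseSize ‖k‖ W 0) := by
  set κ := ‖k‖ with hκ'
  have hκ : 1 ≤ κ := hk.one_le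
  set V : ℝ → ℝ := fun t => ∫ s in (0 : ℝ)..t, W s with hV
  have hVd : ∀ t, HasDerivAt V (W t) t := fun t =>
    intervalIntegral.integral_hasDerivAt_right (hW.intervalIntegrable _ _)
      (hW.stronglyMeasurableAtFilter _ _) hW.continuousAt
  have hVc : Continuous V := continuous_iff_continuousAt.2 fun t => (hVd t).continuousAt
  set G : ℝ → ℂ := fun t => Complex.exp (-(k * t)) *
    ((-4 + 12 * t ^ 2 : ℝ) - 2 * k * (-4 * t * (1 - t ^ 2) : ℝ)
      + 2 * W t * ((-4 * t * (1 - t ^ 2) : ℝ) - k * ((1 - t ^ 2) ^ 2 : ℝ))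
      + W t ^ 2 * ((1 - t ^ 2) ^ 2 : ℝ)) with hG
  have hGc : Continuous G := by
    simp only [hG]; fun_prop
  -- the bracket
  set η : ℝ → ℂ := fun t => Complex.exp (-(k * t)) * (1 - t ^ 2) ^ 2 with hη
  set η₁ : ℝ → ℂ := fun t => Complex.exp (-(k * t)) * (-4 * t * (1 - t ^ 2) - k * (1 - t ^ 2) ^ 2)
    with hη₁
  have hid : ∀ t : ℝ, HasDerivAt (fun t : ℝ => (t : ℂ)) 1 t := fun t =>
    (hasDerivAt_id t).ofReal_comp
  have hexp : ∀ t : ℝ, HasDerivAt (fun t : ℝ => Complex.exp (-(k * t)))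
      (Complex.exp (-(k * t)) * (-k)) t := fun t => by
    have := (((hid t).const_mul k).neg).cexp
    exact this.congr_deriv (by simp only [Pi.neg_apply]; ring)
  have hηd : ∀ t, HasDerivAt η (η₁ t) t := by
    intro t
    have := (hexp t).mul ((((hid t).pow 2).const_sub 1).pow 2)
    refine this.congr_deriv ?_
    simp only [hη₁, Pi.pow_apply]; push_cast; ring
  have hη₁d : ∀ t : ℝ, HasDerivAt η₁ (Complex.exp (-(k * t)) *
      ((-4 + 12 * t ^ 2) - 2 * k * (-4 * t * (1 - t ^ 2)) + k ^ 2 * (1 - t ^ 2) ^ 2)) t := by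
    intro t
    have h1 := (((hid t).const_mul (-4)).mul (((hid t).pow 2).const_sub 1)).sub
      (((((hid t).pow 2).const_sub 1).pow 2).const_mul k)
    have := (hexp t).mul h1
    refine this.congr_deriv ?_
    simp only [Pi.pow_apply, Pi.sub_apply, Pi.mul_apply]; push_cast; ring
  have hE : ∀ t, HasDerivAt (fun t => (Real.exp (V t) : ℂ)) (Real.exp (V t) * W t : ℂ) t := by
    intro t
    have := (hVd t).exp.ofReal_comp
    exact this.congr_deriv (by push_cast; ring)
  -- The factor e^V with V' = W removes z from the derivative of the bracket, leaving u times a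
  -- known function. The cut-off (1-t²)² vanishes to second order at t = 1, so only the value -(z(0)
  -- + k) at t = 0 survives.
  have hB : ∀ t, HasDerivAt (fun t => (Real.exp (V t) : ℂ) * (u t * η₁ t - z t * η t))
      (Real.exp (V t) * (u t * G t)) t := by
    intro t
    have := (hE t).mul (((h.deriv_left t).mul (hη₁d t)).sub ((h.deriv_right t).mul (hηd t)))
    refine this.congr_deriv ?_
    simp only [hG, hη, hη₁, Pi.sub_apply, Pi.mul_apply]
    push_cast
    ring
  have hint : ∫ t in (0 : ℝ)..1, (Real.exp (V t) : ℂ) * (u t * G t) = z 0 + k := by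
    have hc : Continuous fun t => (Real.exp (V t) : ℂ) * (u t * G t) := by
      have := h.continuous_left
      fun_prop
    rw [intervalIntegral.integral_eq_sub_of_hasDerivAt (fun t _ => hB t)
      (hc.intervalIntegrable _ _)]
    have hV0 : V 0 = 0 := by simp [hV]
    simp [hη, hη₁, hu0, hV0]
  set r := ‖z 0 + k‖ with hr
  set T := ∫ t in (0 : ℝ)..1, Real.exp (V t) ^ 2 * ‖G t‖ ^ 2 with hT
  set s := Real.sqrt κ with hs
  have hs1 : 1 ≤ s := by rw [hs]; exact Real.one_le_sqrt.2 hκ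
  have hss : s ^ 2 = κ := Real.sq_sqrt (by linarith)
  have huc := h.continuous_left
  have hu2c : Continuous fun t => ‖u t‖ ^ 2 := by fun_prop
  have hTc : Continuous fun t => Real.exp (V t) ^ 2 * ‖G t‖ ^ 2 := by fun_prop
  -- Young's inequality with weights s/8 and 2/s, whose product is 1/4.
  have hr_le : r ≤ s / 8 * (∫ t in (0 : ℝ)..1, ‖u t‖ ^ 2) + 2 / s * T := by
    rw [hr, ← hint, hT, ← intervalIntegral.integral_const_mul, ← intervalIntegral.integral_const_mul,
      ← intervalIntegral.integral_add ((hu2c.const_mul _).intervalIntegrable _ _)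
        ((hTc.const_mul _).intervalIntegrable _ _)]
    refine intervalIntegral.norm_integral_le_of_norm_le zero_le_one ?_
      (((hu2c.const_mul _).add (hTc.const_mul _)).intervalIntegrable _ _)
    refine Eventually.of_forall fun t _ => ?_
    rw [norm_mul, norm_mul, Complex.norm_real, Real.norm_of_nonneg (Real.exp_pos _).le]
    have h2 : 0 ≤ (s / 4 * ‖u t‖ - Real.exp (V t) * ‖G t‖) ^ 2 := sq_nonneg _
    have h3 : 0 < s := by linarith
    have h4 : s / 8 * ‖u t‖ ^ 2 + 2 / s * (Real.exp (V t) ^ 2 * ‖G t‖ ^ 2)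
        - Real.exp (V t) * (‖u t‖ * ‖G t‖)
        = 2 / s * (s / 4 * ‖u t‖ - Real.exp (V t) * ‖G t‖) ^ 2 := by
      field_simp; ring
    have h5 : 0 ≤ 2 / s * (s / 4 * ‖u t‖ - Real.exp (V t) * ‖G t‖) ^ 2 := by positivity
    linarith
  have hT0 : 0 ≤ T := by
    rw [hT]
    exact intervalIntegral.integral_nonneg zero_le_one fun t _ => by positivity
  -- The Weyl inequality bounds the mass by |z(0)|/Im k², hence in terms of the very quantity r
  -- being estimated.
  have hU : ∫ t in (0 : ℝ)..1, ‖u t‖ ^ 2 ≤ 4 * (κ + r) / κ ^ 2 := by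
    have hU0 : 0 ≤ ∫ t in (0 : ℝ)..1, ‖u t‖ ^ 2 :=
      intervalIntegral.integral_nonneg zero_le_one fun t _ => by positivity
    have h1 : -(z 0).im ≤ κ + r := by
      have e1 : |(z 0).im| ≤ ‖z 0‖ := Complex.abs_im_le_norm _
      have e2 : ‖z 0‖ ≤ ‖z 0 + k‖ + ‖k‖ := by
        have := norm_sub_le (z 0 + k) k
        simpa using this
      linarith [neg_le_abs (z 0).im]
    rw [le_div_iff₀ (by positivity)]
    have := hk.im_ge
    nlinarith
  -- The weight s/8 makes the coefficient of r on the right at most 1/2, since s ≥ 1; that term is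
  -- absorbed on the left.
  have hr_fin : r ≤ 1 / s * (1 + 4 * T) := by
    have h3 : 0 < s := by linarith
    have e1 : s / 8 * (4 * (κ + r) / κ ^ 2) ≤ 1 / 2 * (1 / s) + 1 / 2 * r := by
      rw [← hss]
      have : s / 8 * (4 * (s ^ 2 + r) / (s ^ 2) ^ 2) = 1 / 2 * (1 / s) + 1 / 2 * (r / s ^ 3) := by
        field_simp; ring
      rw [this]
      have : r / s ^ 3 ≤ r := div_le_self (norm_nonneg _) (one_le_pow₀ hs1)
      linarith
    have e2 := mul_le_mul_of_nonneg_left hU (by positivity : 0 ≤ s / 8)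
    have e3 : 1 / s * (1 + 4 * T) = 1 / s + 2 * (2 / s * T) := by ring
    linarith
  -- the bound on `T`
  set N : ℝ → ℝ := fun t => normIncrement W 0 t with hNdef
  have hWN : ∀ t ∈ Ioo (0 : ℝ) 1, |W t| ≤ N t ∧ |W t| / Real.sqrt t = N t := by
    intro t ht
    have e : N t = |W t| / Real.sqrt t := by simp [hNdef, normIncrement, hW0]
    refine ⟨?_, e.symm⟩
    rw [e]
    have : Real.sqrt t ≤ 1 := Real.sqrt_le_one.2 ht.2.le
    exact le_div_self (abs_nonneg _) (Real.sqrt_pos.2 ht.1) this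
  set A := ∫ t in (0 : ℝ)..1, Real.exp (4 * |W t|) with hA
  have hAc : Continuous fun t => Real.exp (4 * |W t|) := by fun_prop
  have hexpV : ∀ t ∈ Icc (0 : ℝ) 1, Real.exp (V t) ^ 2 ≤ ∫ t in (0 : ℝ)..1, Real.exp (2 * |W t|) := by
    intro t ht
    refine le_trans ?_ (exp_integral_le_integral_exp (f := fun t => 2 * |W t|) (by fun_prop))
    rw [← Real.exp_nat_mul, intervalIntegral.integral_const_mul]
    refine Real.exp_le_exp.2 ?_
    have habs : Continuous fun t => |W t| := hW.abs
    have h1 : V t ≤ ∫ s in (0 : ℝ)..t, |W s| :=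
      intervalIntegral.integral_mono_on ht.1 (hW.intervalIntegrable _ _)
        (habs.intervalIntegrable _ _) fun s _ => le_abs_self _
    have h2 : ∫ s in (0 : ℝ)..t, |W s| ≤ ∫ s in (0 : ℝ)..1, |W s| :=
      intervalIntegral.integral_mono_interval le_rfl ht.1 ht.2
        (Eventually.of_forall fun s => abs_nonneg _) (habs.intervalIntegrable _ _)
    push_cast
    linarith
  -- The nonlocal factor e^{2V} is replaced by an average of e^{2|W|} by Jensen, and its product
  -- with e^N is split by ab ≤ a² + b². This separation explains the exponent 4 and the constant 5
  -- (the mass of the weight) in `noiseSize`.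
  have hpt : ∀ t ∈ Ioo (0 : ℝ) 1, Real.exp (V t) ^ 2 * ‖G t‖ ^ 2
      ≤ 864 * (A * expWeight κ t + Real.exp (2 * N t) * expWeight κ t) := by
    intro t ht
    have h1 := sq_norm_remainder_le hk (w := W t) ht.1 ht.2.le
    rw [(hWN t ht).2] at h1
    have hρ := expWeight_nonneg (by linarith : 0 ≤ κ) t
    have h2 : (∫ t in (0 : ℝ)..1, Real.exp (2 * |W t|)) * Real.exp (N t)
        ≤ A + Real.exp (2 * N t) := by
      have : A + Real.exp (2 * N t) = ∫ s in (0 : ℝ)..1, (Real.exp (4 * |W s|) + Real.exp (2 * N t)) := by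
        rw [intervalIntegral.integral_add (hAc.intervalIntegrable _ _) (by simp)]
        simp [hA]
      rw [this, ← intervalIntegral.integral_mul_const]
      refine intervalIntegral.integral_mono_on zero_le_one
        ((by fun_prop : Continuous fun s => Real.exp (2 * |W s|) * Real.exp (N t)).intervalIntegrable _ _)
        ((by fun_prop : Continuous fun s => Real.exp (4 * |W s|) + Real.exp (2 * N t)).intervalIntegrable _ _)
        fun s _ => ?_
      have e1 : Real.exp (4 * |W s|) = Real.exp (2 * |W s|) ^ 2 := by
        rw [← Real.exp_nat_mul]; congr 1; push_cast; ring
      have e2 : Real.exp (2 * N t) = Real.exp (N t) ^ 2 := by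
        rw [← Real.exp_nat_mul]; congr 1
      rw [e1, e2]
      nlinarith [sq_nonneg (Real.exp (2 * |W s|) - Real.exp (N t)), sq_nonneg (Real.exp (2 * |W s|)),
        sq_nonneg (Real.exp (N t))]
    have hexp0 : 0 ≤ Real.exp (V t) ^ 2 := by positivity
    calc Real.exp (V t) ^ 2 * ‖G t‖ ^ 2
        ≤ (∫ t in (0 : ℝ)..1, Real.exp (2 * |W t|)) * (864 * Real.exp (N t) * expWeight κ t) :=
          mul_le_mul (hexpV t (Ioo_subset_Icc_self ht)) h1 (by positivity)
            (le_trans hexp0 (hexpV t (Ioo_subset_Icc_self ht)))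
      _ = 864 * (((∫ t in (0 : ℝ)..1, Real.exp (2 * |W t|)) * Real.exp (N t)) * expWeight κ t) := by
          ring
      _ ≤ 864 * ((A + Real.exp (2 * N t)) * expWeight κ t) := by gcongr
      _ = _ := by ring
  have hofReal : ∀ f : ℝ → ℝ, Continuous f → (∀ t, 0 ≤ f t) →
      ENNReal.ofReal (∫ t in (0 : ℝ)..1, f t) = ∫⁻ t in Ioo (0 : ℝ) 1, ENNReal.ofReal (f t) := by
    intro f hf hf0
    rw [intervalIntegral.integral_of_le zero_le_one, integral_Ioc_eq_integral_Ioo,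
      ofReal_integral_eq_lintegral_ofReal]
    · exact (hf.integrableOn_Icc (a := 0) (b := 1)).mono_set Ioo_subset_Icc_self
    · exact Eventually.of_forall hf0
  have hA0 : 0 ≤ A := intervalIntegral.integral_nonneg zero_le_one fun t _ => (Real.exp_pos _).le
  have hTle : ENNReal.ofReal T ≤ 864 * noiseSize κ W 0 := by
    rw [hT, hofReal _ hTc (fun t => by positivity)]
    have hNm : Measurable N := by
      simp only [hNdef, normIncrement]
      have := hW.measurable
      fun_prop
    have hρm : Measurable (expWeight κ) := (continuous_expWeight κ).measurable
    calc ∫⁻ t in Ioo (0 : ℝ) 1, ENNReal.ofReal (Real.exp (V t) ^ 2 * ‖G t‖ ^ 2)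
        ≤ ∫⁻ t in Ioo (0 : ℝ) 1, 864 * (ENNReal.ofReal A * ENNReal.ofReal (expWeight κ t)
            + ENNReal.ofReal (Real.exp (2 * N t) * expWeight κ t)) := by
          refine setLIntegral_mono' measurableSet_Ioo fun t ht => ?_
          refine (ENNReal.ofReal_le_ofReal (hpt t ht)).trans (le_of_eq ?_)
          have hρ := expWeight_nonneg (by linarith : 0 ≤ κ) t
          rw [ENNReal.ofReal_mul (by norm_num), ENNReal.ofReal_add (by positivity) (by positivity),
            ENNReal.ofReal_mul hA0]
          norm_num
      _ = 864 * (ENNReal.ofReal A * (∫⁻ t in Ioo (0 : ℝ) 1, ENNReal.ofReal (expWeight κ t))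
            + ∫⁻ t in Ioo (0 : ℝ) 1, ENNReal.ofReal (Real.exp (2 * N t) * expWeight κ t)) := by
          rw [lintegral_const_mul _ (by fun_prop), lintegral_add_left (by fun_prop),
            lintegral_const_mul _ (by fun_prop)]
      _ ≤ 864 * ((∫⁻ t in Ioo (0 : ℝ) 1, ENNReal.ofReal (Real.exp (4 * N t))) * 5
            + ∫⁻ t in Ioo (0 : ℝ) 1, ENNReal.ofReal (Real.exp (4 * N t) * expWeight κ t)) := by
          refine mul_le_mul' le_rfl (add_le_add (mul_le_mul' ?_ ?_) ?_)
          · rw [hA, hofReal _ hAc (fun t => (Real.exp_pos _).le)]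
            refine setLIntegral_mono' measurableSet_Ioo fun t ht => ?_
            have := (hWN t ht).1
            gcongr
          · rw [← hofReal _ (continuous_expWeight κ) (expWeight_nonneg (by linarith))]
            refine (ENNReal.ofReal_le_ofReal (integral_expWeight_le (by linarith))).trans ?_
            norm_num
          · refine lintegral_mono fun t => ?_
            have h1 := expWeight_nonneg (by linarith : 0 ≤ κ) t
            have h2 : 0 ≤ N t := normIncrement_nonneg _ _ _
            gcongr
            norm_num
      _ = 864 * noiseSize κ W 0 := by
          rw [noiseSize, ← lintegral_mul_const _ (by fun_prop), ← lintegral_add_left (by fun_prop)]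
          congr 1
          refine lintegral_congr fun t => ?_
          have h1 := expWeight_nonneg (by linarith : 0 ≤ κ) t
          rw [mul_add, ENNReal.ofReal_add (by positivity) (by positivity),
            ENNReal.ofReal_mul (p := Real.exp _) (q := 5) (by positivity)]
          norm_num [hNdef]
  calc ENNReal.ofReal r ≤ ENNReal.ofReal (1 / s * (1 + 4 * T)) := ENNReal.ofReal_le_ofReal hr_fin
    _ = ENNReal.ofReal (1 / s) * (1 + 4 * ENNReal.ofReal T) := by
        rw [ENNReal.ofReal_mul (by positivity), ENNReal.ofReal_add (by norm_num) (by positivity),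
          ENNReal.ofReal_mul (by norm_num)]
        norm_num
    _ ≤ ENNReal.ofReal (1 / s) * (1 + 4 * (864 * noiseSize κ W 0)) := by gcongr
    _ = _ := by
        rw [← mul_assoc]; norm_num

theorem IsSolution.translate {W : ℝ → ℝ} {k : ℂ} {u z : ℝ → ℂ} (h : IsSolution W k u z) (x : ℝ) :
    IsSolution (fun t => W (x + t)) k (fun t => u (x + t)) (fun t => z (x + t)) where
  deriv_left t := HasDerivAt.comp_const_add x t (h.deriv_left (x + t))
  deriv_right t := HasDerivAt.comp_const_add x t (h.deriv_right (x + t))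

/-- The pointwise bound on the Weyl function `m = -u'/u` of a solution satisfying the Weyl
inequality on `[x, x + 1]`. -/
theorem norm_weyl_sub_le {W : ℝ → ℝ} (hW : Continuous W) {k : ℂ} (hk : SectorialParameter k)
    {u z : ℝ → ℂ} (h : IsSolution W k u z) {x : ℝ} (hu0 : u x ≠ 0)
    (hweyl : (k ^ 2).im * ∫ t in x..(x + 1), ‖u t‖ ^ 2 ≤ -(z x * (starRingEnd ℂ) (u x)).im) :
    ENNReal.ofReal ‖-(z x + W x * u x) / u x - k‖
      ≤ ENNReal.ofReal (1 / Real.sqrt ‖k‖) * (1 + 3456 * noiseSize ‖k‖ W x) := by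
  -- Reduction to the base point 0: translate, subtract the constant W(x) from the primitive, and
  -- divide the solution by u(x). The change of z by W(x)u is invisible in Im(z ū), as W is real.
  have h1 := (h.translate x).add_const (-W x)
  have h2 := h1.add_mul h1 (1 / u x) 0
  have h3 := norm_add_le_of_isSolution_zero (W := fun t => W (x + t) + -W x) (by fun_prop)
    (by simp) hk h2 (by simp [hu0]) (by
      have e1 : ∀ t, ‖1 / u x * u (x + t) + 0 * u (x + t)‖ ^ 2 = 1 / ‖u x‖ ^ 2 * ‖u (x + t)‖ ^ 2 := by
        intro t; simp [mul_pow]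
      simp_rw [e1]
      rw [intervalIntegral.integral_const_mul,
        intervalIntegral.integral_comp_add_left (fun t => ‖u t‖ ^ 2) x]
      have hpos : 0 < ‖u x‖ ^ 2 := by positivity
      have e2 : (1 / u x * (z (x + 0) - ((-W x : ℝ) : ℂ) * u (x + 0))
          + 0 * (z (x + 0) - ((-W x : ℝ) : ℂ) * u (x + 0))).im
          = 1 / ‖u x‖ ^ 2 * (z x * (starRingEnd ℂ) (u x)).im := by
        have : (1 / u x * (z (x + 0) - ((-W x : ℝ) : ℂ) * u (x + 0))
          + 0 * (z (x + 0) - ((-W x : ℝ) : ℂ) * u (x + 0)))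
          = ((1 / ‖u x‖ ^ 2 : ℝ) : ℂ) * (z x * (starRingEnd ℂ) (u x)) + (W x : ℂ) := by
          have hc : (starRingEnd ℂ) (u x) ≠ 0 := by simpa using hu0
          have : ((‖u x‖ ^ 2 : ℝ) : ℂ) = u x * (starRingEnd ℂ) (u x) := by
            rw [Complex.mul_conj, Complex.normSq_eq_norm_sq]
          rw [Complex.ofReal_div, this]
          simp only [add_zero]
          push_cast
          field_simp
          ring
        rw [this, Complex.add_im, Complex.ofReal_im, add_zero, Complex.im_ofReal_mul]
      rw [e2]
      simp only [add_zero]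
      calc _ = 1 / ‖u x‖ ^ 2 * ((k ^ 2).im * ∫ t in x..(x + 1), ‖u t‖ ^ 2) := by ring
        _ ≤ 1 / ‖u x‖ ^ 2 * -(z x * (starRingEnd ℂ) (u x)).im := by gcongr
        _ = _ := by ring)
  have e3 : noiseSize ‖k‖ (fun t => W (x + t) + -W x) 0 = noiseSize ‖k‖ W x := by
    simp [noiseSize, normIncrement, sub_eq_add_neg]
  rw [e3] at h3
  convert h3 using 2
  rw [← norm_neg]
  congr 1
  simp only [add_zero]
  push_cast
  field_simp
  ring

end

section
/-! ### Weyl solutions -/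

/-- A solution normalized at `0` which satisfies the Weyl inequality at every point. -/
structure IsWeylSolution (W : ℝ → ℝ) (k : ℂ) (u z : ℝ → ℂ) : Prop extends IsSolution W k u z where
  zero_eq : u 0 = 1
  weyl : ∀ x y : ℝ, x ≤ y →
    (k ^ 2).im * ∫ t in x..y, ‖u t‖ ^ 2 ≤ -(z x * (starRingEnd ℂ) (u x)).im

/-- The logarithmic derivative `-u'/u`. -/
def weylRatio (W : ℝ → ℝ) (u z : ℝ → ℂ) (x : ℝ) : ℂ := -(z x + W x * u x) / u x

variable {W : ℝ → ℝ} {k : ℂ} {u z : ℝ → ℂ}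

theorem IsSolution.integral_sq_norm (h : IsSolution W k u z) (x y : ℝ) :
    (k ^ 2).im * ∫ t in x..y, ‖u t‖ ^ 2
      = (z y * (starRingEnd ℂ) (u y)).im - (z x * (starRingEnd ℂ) (u x)).im := by
  have hc : Continuous fun t => (k ^ 2).im * ‖u t‖ ^ 2 := by
    have := h.continuous_left
    fun_prop
  rw [← intervalIntegral.integral_const_mul, intervalIntegral.integral_eq_sub_of_hasDerivAt
    (fun t _ => h.hasDerivAt_im t) (hc.intervalIntegrable _ _)]

theorem IsSolution.eq_zero_of_integral_eq_zero (h : IsSolution W k u z) {x y : ℝ} (hxy : x < y)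
    (h0 : ∫ t in x..y, ‖u t‖ ^ 2 = 0) : ∃ t, u t = 0 ∧ z t = 0 := by
  have hc : Continuous fun t => ‖u t‖ ^ 2 := by
    have := h.continuous_left
    fun_prop
  have hz : ∀ t ∈ Ioo x y, u t = 0 := by
    intro t ht
    by_contra hne
    have := intervalIntegral.integral_pos hxy hc.continuousOn (fun s _ => by positivity)
      ⟨t, Ioo_subset_Icc_self ht, by positivity⟩
    linarith
  obtain ⟨t, ht⟩ := nonempty_Ioo.2 hxy
  refine ⟨t, hz t ht, ?_⟩
  have h1 : u =ᶠ[𝓝 t] fun _ => 0 := by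
    filter_upwards [isOpen_Ioo.mem_nhds ht] with s hs using hz s hs
  have h2 := ((h.deriv_left t).congr_of_eventuallyEq h1.symm).unique (hasDerivAt_const t (0 : ℂ))
  rwa [hz t ht, mul_zero, add_zero] at h2

/-! ### Fundamental solutions and first consequences of the Weyl inequality. -/

/-- The solution with data `(1, 0)` at `0`. -/
def cosSolution (W : ℝ → ℝ) (k : ℂ) : ℝ → ℂ × ℂ := schrodingerFlow W k (1, 0)

/-- The solution with data `(0, 1)` at `0`. -/
def sinSolution (W : ℝ → ℝ) (k : ℂ) : ℝ → ℂ × ℂ := schrodingerFlow W k (0, 1)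

/-- The solution with data `(1, c)` at `0`. -/
def coneSolution (W : ℝ → ℝ) (k c : ℂ) (x : ℝ) : ℂ × ℂ := cosSolution W k x + c • sinSolution W k x

theorem isSolution_coneSolution (hW : Continuous W) (k c : ℂ) :
    IsSolution W k (fun x => (coneSolution W k c x).1) (fun x => (coneSolution W k c x).2) := by
  have := (isSolution_schrodingerFlow hW k (1, 0)).add_mul (isSolution_schrodingerFlow hW k (0, 1)) 1 c
  simpa [coneSolution, cosSolution, sinSolution] using this

theorem coneSolution_zero (hW : Continuous W) (k c : ℂ) : coneSolution W k c 0 = (1, c) := by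
  simp [coneSolution, cosSolution, sinSolution, schrodingerFlow_zero hW]

theorem wronskian_coneSolution (hW : Continuous W) (k c : ℂ) (x : ℝ) :
    (coneSolution W k c x).1 * (sinSolution W k x).2
      - (sinSolution W k x).1 * (coneSolution W k c x).2 = 1 := by
  have := (isSolution_coneSolution hW k c).wronskian_eq (isSolution_schrodingerFlow hW k (0, 1)) x 0
  simp only [coneSolution_zero hW, schrodingerFlow_zero hW] at this
  simpa [sinSolution] using this

theorem sinSolution_not_zero (hW : Continuous W) (k : ℂ) :
    ¬ ∃ t, (sinSolution W k t).1 = 0 ∧ (sinSolution W k t).2 = 0 := by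
  rintro ⟨t, h1, h2⟩
  have := wronskian_coneSolution hW k 0 t
  rw [h1, h2] at this
  simp at this

/-- A second zero at x would kill both boundary terms of the energy identity on [0, x], so the
solution would vanish there. -/
theorem sinSolution_ne_zero (hW : Continuous W) (hk : 0 < (k ^ 2).im) {x : ℝ} (hx : 0 < x) :
    (sinSolution W k x).1 ≠ 0 := by
  intro h0
  have hs := isSolution_schrodingerFlow hW k (0, 1)
  have h1 := hs.integral_sq_norm 0 x
  have e : (schrodingerFlow W k (0, 1) x).1 = 0 := h0
  rw [e, schrodingerFlow_zero hW] at h1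
  simp only [map_zero, mul_zero, Complex.zero_im, sub_self, mul_eq_zero] at h1
  exact sinSolution_not_zero hW k
    (hs.eq_zero_of_integral_eq_zero hx (h1.resolve_left hk.ne'))

/-- If the energy on [x, x+1] were zero, u and z would vanish together at a point, contradicting the
constancy of the Wronskian with the sine-type solution, which is 1 at 0. -/
theorem IsWeylSolution.pos (h : IsWeylSolution W k u z) (hW : Continuous W) (hk : 0 < (k ^ 2).im)
    (x : ℝ) : 0 < -(z x * (starRingEnd ℂ) (u x)).im := by
  have h1 := h.weyl x (x + 1) (by linarith)
  have hc : Continuous fun t => ‖u t‖ ^ 2 := by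
    have := h.continuous_left
    fun_prop
  have h0 : 0 ≤ ∫ t in x..(x + 1), ‖u t‖ ^ 2 :=
    intervalIntegral.integral_nonneg (by linarith) fun t _ => by positivity
  rcases h0.lt_or_eq with h2 | h2
  · exact lt_of_lt_of_le (by positivity) h1
  · obtain ⟨t, ht1, ht2⟩ := h.toIsSolution.eq_zero_of_integral_eq_zero (by linarith) h2.symm
    have h3 := h.toIsSolution.wronskian_eq (isSolution_schrodingerFlow hW k (0, 1)) t 0
    simp [ht1, ht2, schrodingerFlow_zero hW, h.zero_eq] at h3

theorem IsWeylSolution.ne_zero (h : IsWeylSolution W k u z) (hW : Continuous W)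
    (hk : 0 < (k ^ 2).im) (x : ℝ) : u x ≠ 0 := by
  intro h0
  have := h.pos hW hk x
  simp [h0] at this

theorem im_weylRatio (z : ℝ → ℂ) {x : ℝ} (hu : u x ≠ 0) :
    (weylRatio W u z x).im * ‖u x‖ ^ 2 = -(z x * (starRingEnd ℂ) (u x)).im := by
  have hc : (starRingEnd ℂ) (u x) ≠ 0 := by simpa using hu
  have h1 : weylRatio W u z x * ((‖u x‖ ^ 2 : ℝ) : ℂ)
      = -(z x * (starRingEnd ℂ) (u x)) - ((W x * ‖u x‖ ^ 2 : ℝ) : ℂ) := by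
    have : ((‖u x‖ ^ 2 : ℝ) : ℂ) = u x * (starRingEnd ℂ) (u x) := by
      rw [Complex.mul_conj, Complex.normSq_eq_norm_sq]
    rw [Complex.ofReal_mul, this, weylRatio]
    field_simp
    ring
  have h2 := congrArg Complex.im h1
  rwa [Complex.im_mul_ofReal, Complex.sub_im, Complex.ofReal_im, sub_zero, Complex.neg_im] at h2

theorem IsWeylSolution.continuous_weylRatio (h : IsWeylSolution W k u z) (hW : Continuous W)
    (hk : 0 < (k ^ 2).im) : Continuous (weylRatio W u z) :=
  (h.toIsSolution.continuous_deriv hW).neg.div h.continuous_left (h.ne_zero hW hk)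

theorem IsWeylSolution.norm_weylRatio_sub_le (h : IsWeylSolution W k u z) (hW : Continuous W)
    (hk : SectorialParameter k) (x : ℝ) :
    ENNReal.ofReal ‖weylRatio W u z x - k‖
      ≤ ENNReal.ofReal (1 / Real.sqrt ‖k‖) * (1 + 3456 * noiseSize ‖k‖ W x) :=
  norm_weyl_sub_le hW hk h.toIsSolution (h.ne_zero hW hk.im_pos x) (h.weyl x (x + 1) (by linarith))

/-! ### Decay of Weyl solutions -/

section Decay

/-- P = -Im(z ū) satisfies P' = -b|u|² and P ≤ |m||u|², so P decays at a rate of about b/|m|. An L²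
bound for m on a unit interval is enough to make this quantitative, and also prevents |u|² from
oscillating by more than e^{2B} there. -/
theorem IsWeylSolution.step (h : IsWeylSolution W k u z) (hW : Continuous W)
    (hk : 0 < (k ^ 2).im) {a B : ℝ} (hB : 0 < B)
    (hint : ∫ t in a..(a + 1), ‖weylRatio W u z t‖ ^ 2 ≤ B ^ 2) :
    -(z (a + 1) * (starRingEnd ℂ) (u (a + 1))).im
        ≤ -(z a * (starRingEnd ℂ) (u a)).im * Real.exp (-((k ^ 2).im / B)) ∧
      ∫ t in a..(a + 1), ‖z t + W t * u t‖ ^ 2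
        ≤ B ^ 2 * Real.exp (2 * B) * (-(z a * (starRingEnd ℂ) (u a)).im / (k ^ 2).im) := by
  set b := (k ^ 2).im with hb
  set m := weylRatio W u z with hm
  have hmc : Continuous m := h.continuous_weylRatio hW hk
  have hmn : Continuous fun t => ‖m t‖ := hmc.norm
  have hmn2 : Continuous fun t => ‖m t‖ ^ 2 := hmn.pow 2
  have huc := h.continuous_left
  have hu2 : Continuous fun t => ‖u t‖ ^ 2 := huc.norm.pow 2
  have hune := h.ne_zero hW hk
  have hii : ∀ f : ℝ → ℝ, Continuous f → ∀ x y, IntervalIntegrable f volume x y :=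
    fun f hf x y => hf.intervalIntegrable x y
  have hle : a ≤ a + 1 := by linarith
  have hm1 : ∫ t in a..(a + 1), ‖m t‖ ≤ B := by
    have : ∫ t in a..(a + 1), ‖m t‖ ≤ ∫ t in a..(a + 1), (1 / 2 * B + 1 / (2 * B) * ‖m t‖ ^ 2) := by
      refine intervalIntegral.integral_mono_on hle (hii _ hmn _ _)
        (hii _ (continuous_const.add (hmn2.const_mul _)) _ _) fun t _ => ?_
      have : 1 / 2 * B + 1 / (2 * B) * ‖m t‖ ^ 2 - ‖m t‖ = 1 / (2 * B) * (B - ‖m t‖) ^ 2 := by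
        field_simp; ring
      have h2 : 0 ≤ 1 / (2 * B) * (B - ‖m t‖) ^ 2 := by positivity
      linarith
    refine this.trans ?_
    rw [intervalIntegral.integral_add (by simp) (hii _ (hmn2.const_mul _) _ _),
      intervalIntegral.integral_const_mul (1 / (2 * B))]
    have h3 : 1 / (2 * B) * ∫ t in a..(a + 1), ‖m t‖ ^ 2 ≤ 1 / (2 * B) * B ^ 2 := by gcongr
    have h4 : 1 / (2 * B) * B ^ 2 = B / 2 := by field_simp
    simp only [intervalIntegral.integral_const, smul_eq_mul]
    linarith
  set Pf : ℝ → ℝ := fun x => -(z x * (starRingEnd ℂ) (u x)).im with hPf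
  have hPpos : ∀ x, 0 < Pf x := h.pos hW hk
  have hPd : ∀ x, HasDerivAt Pf (-(b * ‖u x‖ ^ 2)) x := fun x => (h.toIsSolution.hasDerivAt_im x).neg
  have hPm : ∀ x, Pf x ≤ ‖m x‖ * ‖u x‖ ^ 2 := by
    intro x
    have e : (m x).im * ‖u x‖ ^ 2 = Pf x := im_weylRatio z (hune x)
    rw [← e]
    exact mul_le_mul_of_nonneg_right ((le_abs_self _).trans (Complex.abs_im_le_norm _)) (by positivity)
  constructor
  -- The tangent line at B to the convex function 1/y: 1/|m| ≥ 2/B - |m|/B². It avoids dividing by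
  -- |m| and has integral at least 1/B.
  · set g : ℝ → ℝ := fun t => 2 * (1 / B) - (1 / B) ^ 2 * ‖m t‖ with hg
    have hgc : Continuous g := by fun_prop
    set Q : ℝ → ℝ := fun x => Pf x * Real.exp (b * ∫ t in a..x, g t) with hQ
    have hQd : ∀ x, HasDerivAt Q ((-(b * ‖u x‖ ^ 2) + b * (Pf x * g x))
        * Real.exp (b * ∫ t in a..x, g t)) x := by
      intro x
      have h1 := (intervalIntegral.integral_hasDerivAt_right (hgc.intervalIntegrable a x)
        (hgc.stronglyMeasurableAtFilter _ _) hgc.continuousAt).const_mul b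
      exact ((hPd x).mul h1.exp).congr_deriv (by ring)
    have hanti : Antitone Q := antitone_of_deriv_nonpos (fun x => (hQd x).differentiableAt)
      fun x => by
        rw [(hQd x).deriv]
        refine mul_nonpos_of_nonpos_of_nonneg ?_ (Real.exp_pos _).le
        have h1 : Pf x * g x ≤ ‖u x‖ ^ 2 := by
          rcases le_or_gt (g x) 0 with hgx | hgx
          · nlinarith [hPpos x, sq_nonneg ‖u x‖]
          · calc Pf x * g x ≤ ‖m x‖ * ‖u x‖ ^ 2 * g x := mul_le_mul_of_nonneg_right (hPm x) hgx.le
              _ = ‖u x‖ ^ 2 * (1 - (1 - 1 / B * ‖m x‖) ^ 2) := by simp only [hg]; ring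
              _ ≤ ‖u x‖ ^ 2 := by
                  have h3 := mul_nonneg (sq_nonneg ‖u x‖) (sq_nonneg (1 - 1 / B * ‖m x‖))
                  linarith
        nlinarith
    have hQ1 := hanti hle
    have hg1 : 1 / B ≤ ∫ t in a..(a + 1), g t := by
      simp only [hg]
      rw [intervalIntegral.integral_sub (by simp) (hii _ (hmn.const_mul _) _ _),
        intervalIntegral.integral_const_mul ((1 / B) ^ 2)]
      have h3 : (1 / B) ^ 2 * ∫ t in a..(a + 1), ‖m t‖ ≤ (1 / B) ^ 2 * B := by gcongr
      have h4 : (1 / B) ^ 2 * B = 1 / B := by field_simp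
      simp only [intervalIntegral.integral_const, smul_eq_mul]
      linarith
    simp only [hQ, intervalIntegral.integral_same, mul_zero, Real.exp_zero, mul_one] at hQ1
    have h5 : Real.exp (b / B) ≤ Real.exp (b * ∫ t in a..(a + 1), g t) := by
      refine Real.exp_le_exp.2 ?_
      have := mul_le_mul_of_nonneg_left hg1 hk.le
      rwa [mul_one_div] at this
    have h6 : Pf (a + 1) * Real.exp (b / B) ≤ Pf a :=
      (mul_le_mul_of_nonneg_left h5 (hPpos _).le).trans hQ1
    change Pf (a + 1) ≤ Pf a * _
    rw [Real.exp_neg, ← div_eq_mul_inv, le_div_iff₀ (Real.exp_pos _)]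
    exact h6
  · set L : ℝ → ℝ := fun x => ‖u x‖ ^ 2 with hL
    have hLd : ∀ x, HasDerivAt L (2 * ((starRingEnd ℂ) (u x) * (z x + W x * u x)).re) x := by
      intro x
      have := (h.deriv_left x).norm_sq
      refine this.congr_deriv ?_
      rw [Complex.inner, mul_comm (z x + _)]
    have hLbound : ∀ x, |2 * ((starRingEnd ℂ) (u x) * (z x + W x * u x)).re| ≤ 2 * ‖m x‖ * L x := by
      intro x
      rw [abs_mul, abs_two]
      have h1 : z x + W x * u x = -(m x * u x) := by
        simp only [hm, weylRatio]
        field_simp [hune x]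
      have h2 := Complex.abs_re_le_norm ((starRingEnd ℂ) (u x) * (z x + W x * u x))
      rw [h1, norm_mul, norm_neg, norm_mul, Complex.norm_conj] at h2
      rw [h1]
      simp only [hL]
      nlinarith
    set I : ℝ → ℝ := fun x => ∫ t in a..x, ‖m t‖ with hI
    have hId : ∀ x, HasDerivAt I ‖m x‖ x := fun x =>
      intervalIntegral.integral_hasDerivAt_right (hmn.intervalIntegrable a x)
        (hmn.stronglyMeasurableAtFilter _ _) hmn.continuousAt
    have hIa : ∀ x ∈ Icc a (a + 1), 0 ≤ I x ∧ I x ≤ B := fun x hx =>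
      ⟨intervalIntegral.integral_nonneg hx.1 fun t _ => norm_nonneg _,
        (intervalIntegral.integral_mono_interval le_rfl hx.1 hx.2
          (Eventually.of_forall fun t => norm_nonneg _) (hii _ hmn _ _)).trans hm1⟩
    have hmono : Monotone fun x => L x * Real.exp (2 * I x) := by
      have hd : ∀ x, HasDerivAt (fun x => L x * Real.exp (2 * I x))
          ((2 * ((starRingEnd ℂ) (u x) * (z x + W x * u x)).re + 2 * ‖m x‖ * L x)
            * Real.exp (2 * I x)) x := fun x =>
        ((hLd x).mul ((hId x).const_mul 2).exp).congr_deriv (by ring)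
      refine monotone_of_deriv_nonneg (fun x => (hd x).differentiableAt) fun x => ?_
      rw [(hd x).deriv]
      have := (abs_le.1 (hLbound x)).1
      exact mul_nonneg (by linarith) (Real.exp_pos _).le
    have hanti : Antitone fun x => L x * Real.exp (-(2 * I x)) := by
      have hd : ∀ x, HasDerivAt (fun x => L x * Real.exp (-(2 * I x)))
          ((2 * ((starRingEnd ℂ) (u x) * (z x + W x * u x)).re - 2 * ‖m x‖ * L x)
            * Real.exp (-(2 * I x))) x := fun x =>
        ((hLd x).mul ((hId x).const_mul 2).neg.exp).congr_deriv (by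
          simp only [Pi.neg_apply]; ring)
      refine antitone_of_deriv_nonpos (fun x => (hd x).differentiableAt) fun x => ?_
      rw [(hd x).deriv]
      have := (abs_le.1 (hLbound x)).2
      exact mul_nonpos_of_nonpos_of_nonneg (by linarith) (Real.exp_pos _).le
    have hL0 : ∀ x, 0 ≤ L x := fun x => by positivity
    -- A Harnack inequality from |L'| ≤ 2|m|L. It turns the integral bound on |u|² into a pointwise
    -- one, which can then be multiplied by |m|² = |u'/u|².
    have hcomp : ∀ x ∈ Icc a (a + 1), ∀ y ∈ Icc a (a + 1), L x ≤ Real.exp (2 * B) * L y := by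
      intro x hx y hy
      obtain ⟨x0, x1⟩ := hIa x hx
      obtain ⟨y0, y1⟩ := hIa y hy
      rcases le_total x y with hxy | hxy
      · have h1 := hmono hxy
        simp only at h1
        have h2 : L x ≤ L x * Real.exp (2 * I x) :=
          le_mul_of_one_le_right (hL0 x) (Real.one_le_exp (by linarith))
        have h3 : L y * Real.exp (2 * I y) ≤ L y * Real.exp (2 * B) :=
          mul_le_mul_of_nonneg_left (Real.exp_le_exp.2 (by linarith)) (hL0 y)
        linarith
      · have h1 := hanti hxy
        simp only at h1
        have h2 : L y * Real.exp (-(2 * I y)) ≤ L y * 1 :=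
          mul_le_mul_of_nonneg_left (Real.exp_le_one_iff.2 (by linarith)) (hL0 y)
        have h3 : L x * Real.exp (-(2 * B)) ≤ L x * Real.exp (-(2 * I x)) :=
          mul_le_mul_of_nonneg_left (Real.exp_le_exp.2 (by linarith)) (hL0 x)
        have h4 : L x * Real.exp (-(2 * B)) ≤ L y := by linarith
        rw [Real.exp_neg, ← div_eq_mul_inv, div_le_iff₀ (Real.exp_pos _)] at h4
        linarith
    have hLint : ∫ t in a..(a + 1), L t ≤ Pf a / b := by
      rw [le_div_iff₀ hk, mul_comm]
      exact h.weyl a (a + 1) hle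
    have hLx : ∀ x ∈ Icc a (a + 1), L x ≤ Real.exp (2 * B) * (Pf a / b) := by
      intro x hx
      have h1 : ∫ y in a..(a + 1), L x ≤ ∫ y in a..(a + 1), Real.exp (2 * B) * L y :=
        intervalIntegral.integral_mono_on hle (by simp) (hii _ (hu2.const_mul _) _ _)
          fun y hy => hcomp x hx y hy
      rw [intervalIntegral.integral_const_mul] at h1
      simp only [intervalIntegral.integral_const, smul_eq_mul, add_sub_cancel_left, one_mul] at h1
      exact h1.trans (by gcongr)
    have hfin : ∫ t in a..(a + 1), ‖z t + W t * u t‖ ^ 2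
        ≤ ∫ t in a..(a + 1), ‖m t‖ ^ 2 * (Real.exp (2 * B) * (Pf a / b)) := by
      refine intervalIntegral.integral_mono_on hle
        (hii _ ((h.toIsSolution.continuous_deriv hW).norm.pow 2) _ _)
        (hii _ (hmn2.mul continuous_const) _ _) fun t ht => ?_
      have h1 : z t + W t * u t = -(m t * u t) := by
        simp only [hm, weylRatio]
        field_simp [hune t]
      rw [h1, norm_neg, norm_mul, mul_pow]
      exact mul_le_mul_of_nonneg_left (hLx t ht) (by positivity)
    rw [intervalIntegral.integral_mul_const] at hfin
    refine hfin.trans ?_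
    have h7 : 0 ≤ Real.exp (2 * B) * (Pf a / b) := by
      have := hPpos a
      positivity
    calc _ ≤ B ^ 2 * (Real.exp (2 * B) * (Pf a / b)) := mul_le_mul_of_nonneg_right hint h7
      _ = _ := by ring

/-- With step sizes growing like y = (1+n)^{1/4}, the accumulated decay is exp(-cy³) while the loss
per interval is only y² exp(2Cy). Any growth exponent of B below 1/2 would leave the same margin. -/
theorem summable_of_step {Pn I : ℕ → ℝ} {b C : ℝ} (hb : 0 < b) (hC : 1 ≤ C) (hP : ∀ n, 0 ≤ Pn n)
    (h1 : ∀ n : ℕ, Pn (n + 1) ≤ Pn n * Real.exp (-(b / (C * (1 + n : ℝ) ^ (1 / 4 : ℝ)))))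
    (hI0 : ∀ n, 0 ≤ I n)
    (h2 : ∀ n : ℕ, I n ≤ (C * (1 + n : ℝ) ^ (1 / 4 : ℝ)) ^ 2
      * Real.exp (2 * (C * (1 + n : ℝ) ^ (1 / 4 : ℝ))) * (Pn n / b)) : Summable I := by
  set y : ℕ → ℝ := fun n => (1 + n : ℝ) ^ (1 / 4 : ℝ) with hy
  have hy0 : ∀ n, 1 ≤ y n := fun n => Real.one_le_rpow (by linarith [n.cast_nonneg (α := ℝ)]) (by norm_num)
  have hy4 : ∀ n, y n ^ 4 = 1 + n := fun n => by
    simp only [hy]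
    rw [← Real.rpow_natCast, ← Real.rpow_mul (by positivity)]
    norm_num
  have hymono : ∀ i j, i ≤ j → y i ≤ y j := fun i j hij => by
    simp only [hy]
    refine Real.rpow_le_rpow (by positivity) ?_ (by norm_num)
    have : (i : ℝ) ≤ j := by exact_mod_cast hij
    linarith
  have hPn : ∀ n j, j ≤ n → Pn j ≤ Pn 0 * Real.exp (-(j * (b / (C * y n)))) := by
    intro n j
    induction j with
    | zero => intro _; simp
    | succ j ih =>
      intro hj
      have e1 := ih (by omega)
      have e2 := h1 j
      have e3 : b / (C * y n) ≤ b / (C * y j) := by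
        have := hymono j n (by omega)
        have := hy0 j
        gcongr
      calc Pn (j + 1) ≤ Pn j * Real.exp (-(b / (C * y j))) := e2
        _ ≤ (Pn 0 * Real.exp (-(j * (b / (C * y n))))) * Real.exp (-(b / (C * y n))) := by
            gcongr
            exact mul_nonneg (hP 0) (Real.exp_pos _).le
        _ = _ := by
            rw [mul_assoc, ← Real.exp_add]; congr 2; push_cast; ring
  set c := b / (2 * C) with hc
  have hc0 : 0 < c := by positivity
  -- `2 C y - c y³ ≤ K - y`
  set Y := Real.sqrt ((2 * C + 1) / c) with hY
  have hYsq : c * Y ^ 2 = 2 * C + 1 := by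
    rw [hY, Real.sq_sqrt (by positivity)]; field_simp
  have hYn : 0 ≤ Y := Real.sqrt_nonneg _
  have hK : ∀ t : ℝ, 0 ≤ t → 2 * (C * t) - c * t ^ 3 ≤ (2 * C + 1) * Y - t := by
    intro t ht
    rcases le_total t Y with h | h
    · have : 0 ≤ c * t ^ 3 := by positivity
      nlinarith
    · have : c * Y ^ 2 * t ≤ c * t ^ 2 * t := by gcongr
      have h3 : 0 ≤ (2 * C + 1) * Y := by positivity
      nlinarith
  set D := C ^ 2 * (Pn 0 / b) * Real.exp ((2 * C + 1) * Y + b) * (Nat.factorial 10) with hD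
  have hmain : ∀ n : ℕ, I n ≤ D * (1 / ((n + 1 : ℕ) : ℝ) ^ 2) := by
    intro n
    have hyn := hy0 n
    have e1 := hPn n n le_rfl
    have e2 : -(n * (b / (C * y n))) ≤ b - c * y n ^ 3 := by
      have hn : (n : ℝ) = y n ^ 4 - 1 := by rw [hy4]; ring
      rw [hn]
      have : (y n ^ 4 - 1) * (b / (C * y n)) = 2 * c * y n ^ 3 - b / (C * y n) := by
        rw [hc]; field_simp
      rw [this]
      have h5 : b / (C * y n) ≤ b := div_le_self hb.le (by nlinarith)
      have h6 : 0 ≤ c * y n ^ 3 := by positivity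
      nlinarith
    -- The power 10 leaves y² · y^{-10} = (n+1)^{-2} after the prefactor.
    have e3 : Real.exp (-(y n)) ≤ (Nat.factorial 10) / y n ^ 10 := by
      rw [Real.exp_neg, inv_le_comm₀ (Real.exp_pos _) (by positivity), inv_div]
      exact Real.pow_div_factorial_le_exp (y n) (by linarith) 10
    calc I n ≤ (C * y n) ^ 2 * Real.exp (2 * (C * y n)) * (Pn n / b) := h2 n
      _ ≤ (C * y n) ^ 2 * Real.exp (2 * (C * y n)) * (Pn 0 * Real.exp (b - c * y n ^ 3) / b) := by
          have := e1.trans (mul_le_mul_of_nonneg_left (Real.exp_le_exp.2 e2) (hP 0))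
          gcongr
      _ = C ^ 2 * (Pn 0 / b) * Real.exp b * (y n ^ 2 * Real.exp (2 * (C * y n) - c * y n ^ 3)) := by
          rw [sub_eq_add_neg b, sub_eq_add_neg, Real.exp_add, Real.exp_add]; ring
      _ ≤ C ^ 2 * (Pn 0 / b) * Real.exp b * (y n ^ 2 * Real.exp ((2 * C + 1) * Y - y n)) := by
          have := hK (y n) (by linarith)
          have h8 : 0 ≤ Pn 0 / b := div_nonneg (hP 0) hb.le
          gcongr
      _ = C ^ 2 * (Pn 0 / b) * Real.exp ((2 * C + 1) * Y + b) * (y n ^ 2 * Real.exp (-(y n))) := by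
          rw [sub_eq_add_neg, Real.exp_add, Real.exp_add]; ring
      _ ≤ C ^ 2 * (Pn 0 / b) * Real.exp ((2 * C + 1) * Y + b)
            * (y n ^ 2 * ((Nat.factorial 10) / y n ^ 10)) := by
          have h8 : 0 ≤ Pn 0 / b := div_nonneg (hP 0) hb.le
          gcongr
      _ = D * (1 / ((n + 1 : ℕ) : ℝ) ^ 2) := by
          have : ((n + 1 : ℕ) : ℝ) = y n ^ 4 := by rw [hy4]; push_cast; ring
          rw [this, hD]
          have : y n ≠ 0 := by linarith
          field_simp
  refine Summable.of_nonneg_of_le hI0 hmain (Summable.mul_left D ?_)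
  have := (summable_nat_add_iff 1).2 (Real.summable_one_div_nat_pow.2 (by norm_num : 1 < 2))
  exact this

theorem integrableOn_Ioi_of_integral_nat_le {f : ℝ → ℝ} (hf : Continuous f) (h0 : ∀ x, 0 ≤ f x)
    {C : ℝ} (h : ∀ n : ℕ, ∫ t in (0 : ℝ)..n, f t ≤ C) : IntegrableOn f (Ioi 0) := by
  refine integrableOn_Ioi_of_intervalIntegral_norm_bounded (l := atTop) (b := fun n : ℕ => (n : ℝ))
    C 0 (fun n => ?_) tendsto_natCast_atTop_atTop (Eventually.of_forall fun n => ?_)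
  · exact (hf.intervalIntegrable 0 (n : ℝ)).1
  · simp_rw [Real.norm_of_nonneg (h0 _)]
    exact h n

/-- Condition on the primitive which makes the Weyl solution decay. -/
structure TameNoise (κ : ℝ) (W : ℝ → ℝ) : Prop where
  zero_lt_top : noiseSize κ W 0 < ∞
  growth : ∃ C : ℝ, ∀ n : ℕ, ∫⁻ x in Ioc (n : ℝ) (n + 1), (1 + 3456 * noiseSize κ W x) ^ 2
    ≤ ENNReal.ofReal (C * (1 + n : ℝ) ^ (1 / 2 : ℝ))

theorem IsWeylSolution.integral_weylRatio_le (h : IsWeylSolution W k u z) (hW : Continuous W)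
    (hk : SectorialParameter k) (ht : TameNoise ‖k‖ W) :
    ∃ C : ℝ, 1 ≤ C ∧ ∀ n : ℕ, ∫ t in (n : ℝ)..(n + 1), ‖weylRatio W u z t‖ ^ 2
      ≤ (C * (1 + n : ℝ) ^ (1 / 4 : ℝ)) ^ 2 := by
  obtain ⟨C, hC⟩ := ht.growth
  set κ := ‖k‖
  have hκ : 1 ≤ κ := hk.one_le
  set m := weylRatio W u z with hm
  have hmc : Continuous m := h.continuous_weylRatio hW hk.im_pos
  refine ⟨1 + 2 * κ + 2 * |C|, by linarith [abs_nonneg C], fun n => ?_⟩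
  set Y := (1 + n : ℝ) ^ (1 / 4 : ℝ) with hY
  have hY1 : 1 ≤ Y := Real.one_le_rpow (by linarith [n.cast_nonneg (α := ℝ)]) (by norm_num)
  have hY2 : (1 + n : ℝ) ^ (1 / 2 : ℝ) = Y ^ 2 := by
    rw [hY, ← Real.rpow_natCast, ← Real.rpow_mul (by positivity)]; norm_num
  have hsub : Continuous fun t => ‖m t - k‖ ^ 2 := by fun_prop
  have h1 : ∫ t in (n : ℝ)..(n + 1), ‖m t - k‖ ^ 2 ≤ |C| * Y ^ 2 := by
    rw [intervalIntegral.integral_of_le (by linarith),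
      ← ENNReal.ofReal_le_ofReal_iff (by positivity),
      ofReal_integral_eq_lintegral_ofReal (hsub.integrableOn_Ioc)
        (Eventually.of_forall fun t => by positivity)]
    calc ∫⁻ t in Ioc (n : ℝ) (n + 1), ENNReal.ofReal (‖m t - k‖ ^ 2)
        ≤ ∫⁻ t in Ioc (n : ℝ) (n + 1), (1 + 3456 * noiseSize κ W t) ^ 2 := by
          refine lintegral_mono fun t => ?_
          rw [ENNReal.ofReal_pow (norm_nonneg _)]
          refine pow_le_pow_left' ((h.norm_weylRatio_sub_le hW hk t).trans ?_) 2
          refine mul_le_of_le_one_left' ?_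
          rw [ENNReal.ofReal_le_one]
          rw [div_le_one (Real.sqrt_pos.2 (by linarith))]
          exact Real.one_le_sqrt.2 hκ
      _ ≤ ENNReal.ofReal (C * (1 + n : ℝ) ^ (1 / 2 : ℝ)) := hC n
      _ ≤ ENNReal.ofReal (|C| * Y ^ 2) := by
          rw [hY2]
          refine ENNReal.ofReal_le_ofReal ?_
          have := le_abs_self C
          gcongr
  have h2 : ∫ t in (n : ℝ)..(n + 1), ‖m t‖ ^ 2
      ≤ ∫ t in (n : ℝ)..(n + 1), (2 * ‖m t - k‖ ^ 2 + 2 * κ ^ 2) := by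
    refine intervalIntegral.integral_mono_on (by linarith)
      ((hmc.norm.pow 2).intervalIntegrable _ _)
      (((hsub.const_mul 2).add continuous_const).intervalIntegrable _ _) fun t _ => ?_
    have h3 : ‖m t‖ ≤ ‖m t - k‖ + κ := by
      have := norm_add_le (m t - k) k
      simpa using this
    nlinarith [sq_nonneg (‖m t - k‖ - κ), norm_nonneg (m t), norm_nonneg (m t - k)]
  rw [intervalIntegral.integral_add ((hsub.const_mul 2).intervalIntegrable _ _) (by simp),
    intervalIntegral.integral_const_mul] at h2
  simp only [intervalIntegral.integral_const, smul_eq_mul, add_sub_cancel_left, one_mul] at h2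
  have hC0 := abs_nonneg C
  have hYs : 1 ≤ Y ^ 2 := one_le_pow₀ hY1
  calc _ ≤ 2 * (|C| * Y ^ 2) + 2 * κ ^ 2 := by linarith
    _ ≤ (2 * |C| + 2 * κ ^ 2) * Y ^ 2 := by nlinarith [sq_nonneg κ]
    _ ≤ (1 + 2 * κ + 2 * |C|) ^ 2 * Y ^ 2 := by
        refine mul_le_mul_of_nonneg_right ?_ (by positivity)
        nlinarith
    _ = _ := by ring

/-- Square integrability of u is immediate from the Weyl inequality. That of u' is not, and requires
the decay over unit intervals together with the slow growth of the noise. -/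
theorem IsWeylSolution.integrableOn (h : IsWeylSolution W k u z) (hW : Continuous W)
    (hk : SectorialParameter k) (ht : TameNoise ‖k‖ W) :
    IntegrableOn (fun x => ‖u x‖ ^ 2) (Ioi 0) ∧
      IntegrableOn (fun x => ‖z x + W x * u x‖ ^ 2) (Ioi 0) := by
  have hb := hk.im_pos
  have hu2 : Continuous fun x => ‖u x‖ ^ 2 := h.continuous_left.norm.pow 2
  have hv2 : Continuous fun x => ‖z x + W x * u x‖ ^ 2 :=
    (h.toIsSolution.continuous_deriv hW).norm.pow 2
  constructor
  · refine integrableOn_Ioi_of_integral_nat_le hu2 (fun x => by positivity)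
      (C := -(z 0 * (starRingEnd ℂ) (u 0)).im / (k ^ 2).im) fun n => ?_
    rw [le_div_iff₀ hb, mul_comm]
    exact h.weyl 0 n n.cast_nonneg
  · obtain ⟨C, hC1, hC⟩ := h.integral_weylRatio_le hW hk ht
    have hs : ∀ n : ℕ, 0 < C * (1 + n : ℝ) ^ (1 / 4 : ℝ) := fun n => by positivity
    have hsum := summable_of_step (Pn := fun n => -(z n * (starRingEnd ℂ) (u n)).im)
      (I := fun n : ℕ => ∫ t in (n : ℝ)..(n + 1), ‖z t + W t * u t‖ ^ 2) hb hC1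
      (fun n => (h.pos hW hb n).le)
      (fun n => by
        have := (h.step hW hb (hs n) (hC n)).1
        push_cast
        exact this)
      (fun n => intervalIntegral.integral_nonneg (by linarith) fun t _ => by positivity)
      (fun n => (h.step hW hb (hs n) (hC n)).2)
    refine integrableOn_Ioi_of_integral_nat_le hv2 (fun x => by positivity)
      (C := ∑' n : ℕ, ∫ t in (n : ℝ)..(n + 1), ‖z t + W t * u t‖ ^ 2) fun n => ?_
    have e := intervalIntegral.sum_integral_adjacent_intervals (f := fun t => ‖z t + W t * u t‖ ^ 2)
      (μ := volume) (a := fun i : ℕ => (i : ℝ)) (n := n)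
      (fun i _ => hv2.intervalIntegrable _ _)
    simp only [Nat.cast_zero, Nat.cast_add, Nat.cast_one] at e
    rw [← e]
    exact hsum.sum_le_tsum _ fun i _ =>
      intervalIntegral.integral_nonneg (by linarith) fun t _ => by positivity

end Decay

end

section
/-! ### The Weyl coefficient and the diagonal Green's function -/

variable {W : ℝ → ℝ} {k : ℂ}

/-- The initial quasi-derivative of the solution with `u 0 = 1` and `u n = 0`. -/
def weylApprox (W : ℝ → ℝ) (k : ℂ) (n : ℕ) : ℂ := -(cosSolution W k n).1 / (sinSolution W k n).1

/-- The initial quasi-derivative of the Weyl solution at `+∞`. -/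
def weylCoeff (W : ℝ → ℝ) (k : ℂ) : ℂ := limUnder atTop (weylApprox W k)

/-- The Weyl function `m = -ψ'/ψ` of the half-lines `[x, ∞)`. -/
def weylM (W : ℝ → ℝ) (k : ℂ) (x : ℝ) : ℂ :=
  weylRatio W (fun x => (coneSolution W k (weylCoeff W k) x).1)
    (fun x => (coneSolution W k (weylCoeff W k) x).2) x

theorem coneSolution_weylApprox (hW : Continuous W) (hk : 0 < (k ^ 2).im) {n : ℕ} (hn : 0 < n) :
    (coneSolution W k (weylApprox W k n) n).1 = 0 := by
  have := sinSolution_ne_zero hW hk (x := n) (by exact_mod_cast hn)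
  simp only [coneSolution, weylApprox, Prod.fst_add, Prod.smul_fst, smul_eq_mul]
  field_simp
  ring

/-- Since u(n) = 0, the energy identity on [x, n] is an equality, and dropping the mass on [y, n]
leaves an inequality. At n = 0 the approximant is a division by zero, so it is excluded. -/
theorem weyl_le_of_weylApprox (hW : Continuous W) (hk : 0 < (k ^ 2).im) {n : ℕ} (hn : 0 < n)
    {x y : ℝ} (hyn : y ≤ n) :
    (k ^ 2).im * ∫ t in x..y, ‖(coneSolution W k (weylApprox W k n) t).1‖ ^ 2
      ≤ -((coneSolution W k (weylApprox W k n) x).2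
        * (starRingEnd ℂ) (coneSolution W k (weylApprox W k n) x).1).im := by
  have hs := isSolution_coneSolution hW k (weylApprox W k n)
  have h1 := hs.integral_sq_norm x y
  have h2 := hs.integral_sq_norm y n
  simp only [coneSolution_weylApprox hW hk hn, map_zero, mul_zero, Complex.zero_im] at h2
  have h3 : 0 ≤ ∫ t in y..(n : ℝ), ‖(coneSolution W k (weylApprox W k n) t).1‖ ^ 2 :=
    intervalIntegral.integral_nonneg hyn fun t _ => by positivity
  have := mul_nonneg hk.le h3
  linarith

theorem continuous_coneSolution_fst (hW : Continuous W) (k : ℂ) :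
    Continuous fun p : ℂ × ℝ => (coneSolution W k p.1 p.2).1 := by
  have h1 := (isSolution_schrodingerFlow hW k (1, 0)).continuous_left
  have h2 := (isSolution_schrodingerFlow hW k (0, 1)).continuous_left
  simp only [coneSolution, Prod.fst_add, Prod.smul_fst, smul_eq_mul, cosSolution, sinSolution]
  exact (h1.comp continuous_snd).add (continuous_fst.mul (h2.comp continuous_snd))

theorem continuous_coneSolution_snd (hW : Continuous W) (k : ℂ) :
    Continuous fun p : ℂ × ℝ => (coneSolution W k p.1 p.2).2 := by
  have h1 := (isSolution_schrodingerFlow hW k (1, 0)).continuous_right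
  have h2 := (isSolution_schrodingerFlow hW k (0, 1)).continuous_right
  simp only [coneSolution, Prod.snd_add, Prod.smul_snd, smul_eq_mul, cosSolution, sinSolution]
  exact (h1.comp continuous_snd).add (continuous_fst.mul (h2.comp continuous_snd))

/-- For fixed x and y both sides of the Weyl inequality are continuous in the initial
quasi-derivative, so the inequality passes to the limit. -/
theorem isWeylSolution_of_tendsto (hW : Continuous W) (hk : 0 < (k ^ 2).im) {c : ℂ} {φ : ℕ → ℕ}
    (hφ : Tendsto φ atTop atTop) (hc : Tendsto (fun j => weylApprox W k (φ j)) atTop (𝓝 c)) :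
    IsWeylSolution W k (fun x => (coneSolution W k c x).1) (fun x => (coneSolution W k c x).2) := by
  refine ⟨isSolution_coneSolution hW k c, by simp [coneSolution_zero hW], fun x y _ => ?_⟩
  have h1 := continuous_coneSolution_fst hW k
  have h2 := continuous_coneSolution_snd hW k
  have hL : Continuous fun c : ℂ => (k ^ 2).im * ∫ t in x..y, ‖(coneSolution W k c t).1‖ ^ 2 := by
    refine continuous_const.mul ?_
    have h3 : Continuous fun p : ℂ × ℝ => ‖(coneSolution W k p.1 p.2).1‖ ^ 2 := h1.norm.pow 2
    exact intervalIntegral.continuous_parametric_intervalIntegral_of_continuous'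
      (f := fun c t => ‖(coneSolution W k c t).1‖ ^ 2) h3 x y
  have hR : Continuous fun c : ℂ => -((coneSolution W k c x).2
      * (starRingEnd ℂ) (coneSolution W k c x).1).im := by
    have e1 := h1.comp (Continuous.prodMk_left x)
    have e2 := h2.comp (Continuous.prodMk_left x)
    exact (Complex.continuous_im.comp (e2.mul (Complex.continuous_conj.comp e1))).neg
  refine le_of_tendsto_of_tendsto ((hL.tendsto c).comp hc) ((hR.tendsto c).comp hc) ?_
  obtain ⟨N, hN⟩ := exists_nat_ge y
  filter_upwards [hφ.eventually_ge_atTop (N + 1)] with j hj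
  refine weyl_le_of_weylApprox hW hk (by omega) (hN.trans ?_)
  exact_mod_cast (by omega : N ≤ φ j)

/-- The pointwise bound needs the Weyl inequality only on [0, 1], where every approximant with n ≥ 1
already satisfies it. The same noise functional thus serves for compactness. -/
theorem isBounded_weylApprox (hW : Continuous W) (hk : SectorialParameter k)
    (h0 : noiseSize ‖k‖ W 0 < ∞) :
    ∃ R : ℝ, ∀ n : ℕ, 0 < n → weylApprox W k n ∈ Metric.closedBall (0 : ℂ) R := by
  set B : ℝ≥0∞ := ENNReal.ofReal (1 / Real.sqrt ‖k‖) * (1 + 3456 * noiseSize ‖k‖ W 0) with hB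
  have hBt : B < ∞ := ENNReal.mul_lt_top ENNReal.ofReal_lt_top
    (ENNReal.add_lt_top.2 ⟨ENNReal.one_lt_top, ENNReal.mul_lt_top (by simp) h0⟩)
  refine ⟨B.toReal + ‖k‖ + |W 0|, fun n hn => ?_⟩
  have h1 := norm_weyl_sub_le hW hk (x := 0) (isSolution_coneSolution hW k (weylApprox W k n))
    (by simp [coneSolution_zero hW]) (weyl_le_of_weylApprox hW hk.im_pos hn (by
      have : (1 : ℝ) ≤ n := by exact_mod_cast hn
      simpa using this))
  have h2 := ENNReal.toReal_mono hBt.ne h1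
  rw [ENNReal.toReal_ofReal (norm_nonneg _)] at h2
  simp only [coneSolution_zero hW, mul_one, div_one] at h2
  rw [mem_closedBall_zero_iff]
  have h3 : weylApprox W k n = -((-(weylApprox W k n + W 0) - k) + k + W 0) := by ring
  rw [h3, norm_neg]
  refine (norm_add_le _ _).trans (add_le_add ((norm_add_le _ _).trans (add_le_add h2 le_rfl)) ?_)
  rw [Complex.norm_real, Real.norm_eq_abs]

/-- The difference of two Weyl solutions is a multiple of the solution with data (0, 1), which would
then lie in L² on the half-line together with its derivative. Its Im(z ū) is monotone, integrable
and zero at 0, hence zero on the half-line: the limit-point case. -/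
theorem weylSolution_unique (hW : Continuous W) (hk : SectorialParameter k)
    (ht : TameNoise ‖k‖ W) {c c' : ℂ}
    (h : IsWeylSolution W k (fun x => (coneSolution W k c x).1) (fun x => (coneSolution W k c x).2))
    (h' : IsWeylSolution W k (fun x => (coneSolution W k c' x).1)
      (fun x => (coneSolution W k c' x).2)) : c = c' := by
  by_contra hne
  have hsub : c - c' ≠ 0 := sub_ne_zero.2 hne
  set f : ℝ → ℂ := fun x => (sinSolution W k x).1 with hf
  set g : ℝ → ℂ := fun x => (sinSolution W k x).2 + W x * (sinSolution W k x).1 with hg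
  have hs : IsSolution W k f (fun x => (sinSolution W k x).2) :=
    isSolution_schrodingerFlow hW k (0, 1)
  have hmem : ∀ {F : ℝ → ℂ}, Continuous F → IntegrableOn (fun x => ‖F x‖ ^ 2) (Ioi 0) →
      MemLp F 2 (volume.restrict (Ioi 0)) := fun hF hi =>
    (memLp_two_iff_integrable_sq_norm hF.aestronglyMeasurable).2 hi
  obtain ⟨i1, i2⟩ := h.integrableOn hW hk ht
  obtain ⟨i1', i2'⟩ := h'.integrableOn hW hk ht
  have m1 := (hmem h.continuous_left i1).sub (hmem h'.continuous_left i1')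
  have m2 := (hmem (h.toIsSolution.continuous_deriv hW) i2).sub
    (hmem (h'.toIsSolution.continuous_deriv hW) i2')
  have mf : MemLp f 2 (volume.restrict (Ioi 0)) := by
    refine (m1.const_mul (1 / (c - c'))).ae_eq (Eventually.of_forall fun x => ?_)
    simp only [Pi.sub_apply, hf, coneSolution, Prod.fst_add, Prod.smul_fst, smul_eq_mul]
    field_simp
    ring
  have mg : MemLp g 2 (volume.restrict (Ioi 0)) := by
    refine (m2.const_mul (1 / (c - c'))).ae_eq (Eventually.of_forall fun x => ?_)
    simp only [Pi.sub_apply, hg, coneSolution, Prod.fst_add, Prod.smul_fst, smul_eq_mul,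
      Prod.snd_add, Prod.smul_snd]
    field_simp
    ring
  set F : ℝ → ℝ := fun x => ((sinSolution W k x).2 * (starRingEnd ℂ) (f x)).im with hF
  have hFd : ∀ x, HasDerivAt F ((k ^ 2).im * ‖f x‖ ^ 2) x := hs.hasDerivAt_im
  have hmono : Monotone F := monotone_of_deriv_nonneg (fun x => (hFd x).differentiableAt) fun x => by
    rw [(hFd x).deriv]
    have := hk.im_pos
    positivity
  have hint : IntegrableOn F (Ici 0) := by
    rw [integrableOn_Ici_iff_integrableOn_Ioi]
    have h1 : IntegrableOn (fun x => g x * (starRingEnd ℂ) (f x)) (Ioi 0) := by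
      have := mf.star.integrable_mul mg
      refine this.congr (Eventually.of_forall fun x => ?_)
      simp [mul_comm]
    refine h1.im.congr (Eventually.of_forall fun x => ?_)
    simp only [hF, hg, hf]
    simp [Complex.mul_im]
    ring
  have hF0 : F 0 = 0 := by simp [hF, hf, sinSolution, schrodingerFlow_zero hW]
  have hFz : ∀ x, 0 ≤ x → F x = 0 := fun x hx =>
    le_antisymm (nonpos_of_monotoneOn_of_integrableOn (hmono.monotoneOn _) hint hx)
      (hF0 ▸ hmono hx)
  have h01 := hs.integral_sq_norm 0 1
  have e0 := hFz 0 le_rfl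
  have e1 := hFz 1 zero_le_one
  simp only [hF] at e0 e1
  rw [e0, e1, sub_zero, mul_eq_zero] at h01
  exact sinSolution_not_zero hW k
    (hs.eq_zero_of_integral_eq_zero zero_lt_one (h01.resolve_left hk.im_pos.ne'))

/-- The approximants are bounded and all their subsequential limits agree. Convergence of the whole
sequence matters: a limit along integers is measurable in the noise, a chosen subsequence would not
obviously be. -/
theorem tendsto_weylApprox (hW : Continuous W) (hk : SectorialParameter k)
    (ht : TameNoise ‖k‖ W) :
    Tendsto (weylApprox W k) atTop (𝓝 (weylCoeff W k)) ∧
      IsWeylSolution W k (fun x => (coneSolution W k (weylCoeff W k) x).1)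
        (fun x => (coneSolution W k (weylCoeff W k) x).2) := by
  obtain ⟨R, hR⟩ := isBounded_weylApprox hW hk ht.zero_lt_top
  have hsub : ∀ φ : ℕ → ℕ, Tendsto φ atTop atTop → ∃ (c : ℂ) (ψ : ℕ → ℕ), StrictMono ψ ∧
      Tendsto (fun j => weylApprox W k (φ (ψ j))) atTop (𝓝 c) := by
    intro φ hφ
    have hfreq : ∃ᶠ j in atTop, weylApprox W k (φ j) ∈ Metric.closedBall (0 : ℂ) R := by
      refine Eventually.frequently ?_
      filter_upwards [hφ.eventually_ge_atTop 1] with j hj using hR _ hj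
    obtain ⟨c, _, ψ, hψ, hc⟩ := tendsto_subseq_of_frequently_bounded
      (Metric.isBounded_closedBall) hfreq
    exact ⟨c, ψ, hψ, hc⟩
  obtain ⟨c, ψ, hψ, hc⟩ := hsub id tendsto_id
  have hcW := isWeylSolution_of_tendsto hW hk.im_pos hψ.tendsto_atTop hc
  have hlim : Tendsto (weylApprox W k) atTop (𝓝 c) := by
    refine tendsto_of_subseq_tendsto fun φ hφ => ?_
    obtain ⟨c', ψ', hψ', hc'⟩ := hsub φ hφ
    have := isWeylSolution_of_tendsto hW hk.im_pos (hφ.comp hψ'.tendsto_atTop) hc'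
    rw [← weylSolution_unique hW hk ht hcW this] at hc'
    exact ⟨ψ', hc'⟩
  have e : weylCoeff W k = c := hlim.limUnder_eq
  rw [e]
  exact ⟨hlim, hcW⟩

theorem norm_weylM_sub_le (hW : Continuous W) (hk : SectorialParameter k) (ht : TameNoise ‖k‖ W)
    (x : ℝ) : ENNReal.ofReal ‖weylM W k x - k‖
      ≤ ENNReal.ofReal (1 / Real.sqrt ‖k‖) * (1 + 3456 * noiseSize ‖k‖ W x) :=
  (tendsto_weylApprox hW hk ht).2.norm_weylRatio_sub_le hW hk x

theorem continuous_weylM (hW : Continuous W) (hk : SectorialParameter k) (ht : TameNoise ‖k‖ W) :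
    Continuous (weylM W k) :=
  (tendsto_weylApprox hW hk ht).2.continuous_weylRatio hW hk.im_pos

theorem im_weylM_pos (hW : Continuous W) (hk : SectorialParameter k) (ht : TameNoise ‖k‖ W)
    (x : ℝ) : 0 < (weylM W k x).im := by
  have h := (tendsto_weylApprox hW hk ht).2
  have hu := h.ne_zero hW hk.im_pos x
  have h1 := im_weylRatio (W := W) (u := fun x => (coneSolution W k (weylCoeff W k) x).1)
    (fun x => (coneSolution W k (weylCoeff W k) x).2) (x := x) hu
  have h2 := h.pos hW hk.im_pos x
  rw [← h1] at h2
  exact pos_of_mul_pos_left h2 (by positivity)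

/-- The Riccati equation. -/
theorem hasDerivAt_weylM_add (hW : Continuous W) (hk : SectorialParameter k)
    (ht : TameNoise ‖k‖ W) (x : ℝ) :
    HasDerivAt (fun x => weylM W k x + W x) (weylM W k x ^ 2 - k ^ 2) x := by
  have h := (tendsto_weylApprox hW hk ht).2
  have hu := h.ne_zero hW hk.im_pos
  have h1 := ((h.deriv_right x).div (h.deriv_left x) (hu x)).neg
  have e : (fun x => weylM W k x + W x) = fun x => -((coneSolution W k (weylCoeff W k) x).2
      / (coneSolution W k (weylCoeff W k) x).1) := by
    ext x
    have := hu x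
    simp only [weylM, weylRatio] at *
    field_simp
    ring
  rw [e]
  refine h1.congr_deriv ?_
  have := hu x
  simp only [weylM, weylRatio] at *
  field_simp
  ring

/-! ### The left half-line by reflection, and the diagonal Green's function. -/

/-- The primitive of the reflected potential. -/
def reflectPrimitive (W : ℝ → ℝ) (x : ℝ) : ℝ := -W (-x)

theorem continuous_reflectPrimitive (hW : Continuous W) : Continuous (reflectPrimitive W) :=
  (hW.comp continuous_neg).neg

theorem memLp_Ioi_of_integrableOn {f : ℝ → ℂ} (hf : Continuous f)
    (h : IntegrableOn (fun x => ‖f x‖ ^ 2) (Ioi 0)) (y : ℝ) :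
    MemLp f 2 (volume.restrict (Ioi y)) := by
  refine (memLp_two_iff_integrable_sq_norm hf.aestronglyMeasurable).2 ?_
  have h1 : IntegrableOn (fun x => ‖f x‖ ^ 2) (Icc y 0) := (hf.norm.pow 2).integrableOn_Icc
  refine (h1.union h).mono_set fun x hx => ?_
  rcases le_or_gt x 0 with h | h
  · exact Or.inl ⟨le_of_lt hx, h⟩
  · exact Or.inr h

theorem memLp_Iic_comp_neg {f : ℝ → ℂ} (h : ∀ y, MemLp f 2 (volume.restrict (Ioi y))) (y : ℝ) :
    MemLp (fun x => f (-x)) 2 (volume.restrict (Iic y)) := by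
  have hp := (Measure.measurePreserving_neg (volume : Measure ℝ)).restrict_preimage
    (measurableSet_Ioi (a := -y - 1))
  refine ((h (-y - 1)).comp_measurePreserving hp).mono_measure
    (Measure.restrict_mono (fun x hx => ?_) le_rfl)
  simp only [mem_Iic] at hx
  simp only [mem_preimage, mem_Ioi]
  linarith

/-- The sum of the Weyl functions of the two half-lines, i.e. the reciprocal of the diagonal
Green's function. -/
def weylSum (W : ℝ → ℝ) (k : ℂ) (x : ℝ) : ℂ := weylM W k x + weylM (reflectPrimitive W) k (-x)

theorem weylSum_ne_zero (hW : Continuous W) (hk : SectorialParameter k) (ht : TameNoise ‖k‖ W)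
    (ht' : TameNoise ‖k‖ (reflectPrimitive W)) (x : ℝ) : weylSum W k x ≠ 0 := by
  intro h
  have h1 := im_weylM_pos hW hk ht x
  have h2 := im_weylM_pos (continuous_reflectPrimitive hW) hk ht' (-x)
  have h3 := congrArg Complex.im h
  simp only [weylSum, Complex.add_im, Complex.zero_im] at h3
  linarith

/-- The glued kernel on the diagonal is u₊u₋/w, and w = u₊u₋(m₊ + m₋). The Wronskian is nonzero
because both Weyl functions have positive imaginary part. -/
theorem hasDiagGreen_and_eq (hW : Continuous W) (hk : SectorialParameter k) (ht : TameNoise ‖k‖ W)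
    (ht' : TameNoise ‖k‖ (reflectPrimitive W)) :
    HasDiagGreen W k ∧ ∀ x, diagGreen W k x = 1 / weylSum W k x := by
  have hW' := continuous_reflectPrimitive hW
  have hp := (tendsto_weylApprox hW hk ht).2
  have hm := (tendsto_weylApprox hW' hk ht').2
  set cp := weylCoeff W k
  set cm := weylCoeff (reflectPrimitive W) k
  set up : ℝ → ℂ := fun x => (coneSolution W k cp x).1 with hup
  set zp : ℝ → ℂ := fun x => (coneSolution W k cp x).2 with hzp
  set um : ℝ → ℂ := fun x => (coneSolution (reflectPrimitive W) k cm (-x)).1 with hum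
  set zm : ℝ → ℂ := fun x => -(coneSolution (reflectPrimitive W) k cm (-x)).2 with hzm
  have hupne : ∀ x, up x ≠ 0 := hp.ne_zero hW hk.im_pos
  have humne : ∀ x, um x ≠ 0 := fun x => hm.ne_zero hW' hk.im_pos (-x)
  have sm : IsSolution W k um zm := by
    have := hm.toIsSolution.reflect
    simpa [reflectPrimitive] using this
  obtain ⟨i1, i2⟩ := hp.integrableOn hW hk ht
  obtain ⟨j1, j2⟩ := hm.integrableOn hW' hk ht'
  have L1 := memLp_Ioi_of_integrableOn hp.continuous_left i1
  have L2 := memLp_Ioi_of_integrableOn (hp.toIsSolution.continuous_deriv hW) i2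
  have L3 := memLp_Iic_comp_neg (memLp_Ioi_of_integrableOn hm.continuous_left j1)
  have L4 := memLp_Iic_comp_neg
    (memLp_Ioi_of_integrableOn (hm.toIsSolution.continuous_deriv hW') j2)
  have L4' : ∀ y, MemLp (fun x => zm x + W x * um x) 2 (volume.restrict (Iic y)) := fun y => by
    refine (L4 y).neg.ae_eq (Eventually.of_forall fun x => ?_)
    simp only [Pi.neg_apply, hzm, hum, reflectPrimitive, neg_neg]
    push_cast; ring
  set w : ℂ := up 0 * zm 0 - um 0 * zp 0 with hw
  have hwr : ∀ x, up x * zm x - um x * zp x = w := fun x => hp.toIsSolution.wronskian_eq sm x 0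
  have hsum : ∀ x, up x * um x * weylSum W k x = w := by
    intro x
    rw [← hwr x]
    have h1 : weylM W k x * up x = -(zp x + W x * up x) := by
      have := hupne x
      simp only [weylM, weylRatio]
      exact div_mul_cancel₀ _ this
    have h2 : weylM (reflectPrimitive W) k (-x) * um x = zm x + W x * um x := by
      have := humne x
      simp only [weylM, weylRatio]
      rw [div_mul_cancel₀ _ this]
      simp only [hzm, hum, reflectPrimitive, neg_neg, cm]
      push_cast; ring
    simp only [weylSum]
    linear_combination um x * h1 + up x * h2
  have hw0 : w ≠ 0 := by
    rw [← hsum 0]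
    exact mul_ne_zero (mul_ne_zero (hupne 0) (humne 0)) (weylSum_ne_zero hW hk ht ht' 0)
  have hres := isResolventDelta_of_isSolution hW hp.toIsSolution sm L1 L2 L3 L4' hw0 hwr
  have hval : ∀ x, diagGreen W k x = 1 / weylSum W k x := by
    intro x
    have hex : ∃ u, IsResolventDelta W k x u := ⟨_, hres x⟩
    rw [diagGreen, dif_pos hex]
    have := IsResolventDelta.unique hW hk.im_pos hex.choose_spec (hres x)
    rw [this]
    simp only [le_refl, if_true]
    rw [← hsum x]
    have := hupne x
    have := humne x
    have := weylSum_ne_zero hW hk ht ht' x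
    change up x / (up x * um x * weylSum W k x) * um x = _
    field_simp
  refine ⟨fun x => ⟨⟨_, hres x, fun u hu => IsResolventDelta.unique hW hk.im_pos hu (hres x)⟩, ?_⟩,
    hval⟩
  rw [hval]
  exact one_div_ne_zero (weylSum_ne_zero hW hk ht ht' x)

theorem isResolventDelta_add_const_eq (hW : Continuous W) (k : ℂ) (c : ℝ) :
    IsResolventDelta (fun x => W x + c) k = IsResolventDelta W k := by
  ext y u
  exact isResolventDelta_add_const_iff hW c

theorem diagGreen_add_const (hW : Continuous W) (k : ℂ) (c : ℝ) :
    diagGreen (fun x => W x + c) k = diagGreen W k := by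
  ext x
  unfold diagGreen
  rw [isResolventDelta_add_const_eq hW]

theorem hasDiagGreen_add_const (hW : Continuous W) (k : ℂ) (c : ℝ) :
    HasDiagGreen (fun x => W x + c) k ↔ HasDiagGreen W k := by
  simp only [HasDiagGreen, isResolventDelta_add_const_eq hW, diagGreen_add_const hW]

end

section
open scoped NNReal

/-! ### Moments -/

/-- Jensen's inequality for powers. -/
theorem rpow_lintegral_le {α : Type*} [MeasurableSpace α] {μ : Measure α} {f : α → ℝ≥0∞}
    (hf : AEMeasurable f μ) {p : ℝ} (hp : 1 ≤ p) :
    (∫⁻ x, f x ∂μ) ^ p ≤ μ univ ^ (p - 1) * ∫⁻ x, f x ^ p ∂μ := by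
  rcases hp.eq_or_lt with rfl | hp
  · simp
  have hpq := Real.HolderConjugate.conjExponent hp
  have h := ENNReal.lintegral_mul_le_Lp_mul_Lq μ hpq hf (aemeasurable_const (b := (1 : ℝ≥0∞)))
  simp only [Pi.mul_apply, mul_one, ENNReal.one_rpow, lintegral_const, one_mul] at h
  have hp0 : 0 < p := by linarith
  have h2 := ENNReal.rpow_le_rpow h hp0.le
  rw [ENNReal.mul_rpow_of_nonneg _ _ hp0.le, ← ENNReal.rpow_mul, ← ENNReal.rpow_mul,
    one_div_mul_cancel hp0.ne', ENNReal.rpow_one, mul_comm] at h2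
  have e : 1 / Real.conjExponent p * p = p - 1 := by
    have : p - 1 ≠ 0 := by linarith
    rw [Real.conjExponent]; field_simp
  rwa [e] at h2

/-- Jensen's inequality for powers, with a weight. -/
theorem rpow_lintegral_mul_le {α : Type*} [MeasurableSpace α] {μ : Measure α} {f g : α → ℝ≥0∞}
    (hf : Measurable f) (hg : Measurable g) {p : ℝ} (hp : 1 ≤ p) :
    (∫⁻ x, f x * g x ∂μ) ^ p ≤ (∫⁻ x, g x ∂μ) ^ (p - 1) * ∫⁻ x, f x ^ p * g x ∂μ := by
  have h := rpow_lintegral_le (μ := μ.withDensity g) hf.aemeasurable hp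
  rw [lintegral_withDensity_eq_lintegral_mul _ hg hf,
    lintegral_withDensity_eq_lintegral_mul _ hg (hf.pow_const p), withDensity_apply _ .univ,
    setLIntegral_univ] at h
  simpa only [Pi.mul_apply, mul_comm (g _)] using h

theorem rpow_add_le {a b : ℝ≥0∞} {p : ℝ} (hp : 1 ≤ p) :
    (a + b) ^ p ≤ 2 ^ (p - 1) * (a ^ p + b ^ p) :=
  ENNReal.rpow_add_le_mul_rpow_add_rpow a b hp

theorem lintegral_add_rpow_le {α : Type*} [MeasurableSpace α] {μ : Measure α} {f g : α → ℝ≥0∞}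
    (hf : AEMeasurable f μ) {p : ℝ} (hp : 1 ≤ p) {a b : ℝ≥0∞}
    (h1 : ∫⁻ x, f x ^ p ∂μ ≤ a) (h2 : ∫⁻ x, g x ^ p ∂μ ≤ b) :
    ∫⁻ x, (f x + g x) ^ p ∂μ ≤ 2 ^ (p - 1) * (a + b) := by
  calc ∫⁻ x, (f x + g x) ^ p ∂μ ≤ ∫⁻ x, 2 ^ (p - 1) * (f x ^ p + g x ^ p) ∂μ :=
        lintegral_mono fun x => rpow_add_le hp
    _ = 2 ^ (p - 1) * (∫⁻ x, f x ^ p ∂μ + ∫⁻ x, g x ^ p ∂μ) := by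
        rw [lintegral_const_mul' _ _ (ENNReal.rpow_ne_top_of_nonneg (by linarith) (by simp)),
          lintegral_add_left' (hf.pow_const p)]
    _ ≤ _ := by gcongr

/-! ### Processes with exponentially integrable increments -/

/-- A continuous process whose increments over distances at most `2`, on the Brownian scale, have
exponential moments bounded by `C`. -/
structure RegularProcess {Ω : Type*} [MeasurableSpace Ω] (P : Measure Ω) (W : Ω → ℝ → ℝ)
    (C : ℝ → ℝ≥0) : Prop where
  continuous : ∀ ω, Continuous (W ω)
  measurable : ∀ t, Measurable fun ω => W ω t
  exp_moment : ∀ a s t : ℝ, 0 ≤ a → s < t → t ≤ s + 2 →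
    ∫⁻ ω, ENNReal.ofReal (Real.exp (a * (|W ω t - W ω s| / Real.sqrt (t - s)))) ∂P ≤ C a

/-- The bound on `√κ |m - k|`. -/
def noiseBound (κ : ℝ) (W : ℝ → ℝ) (x : ℝ) : ℝ≥0∞ := 1 + 3456 * noiseSize κ W x

theorem one_le_noiseBound (κ : ℝ) (W : ℝ → ℝ) (x : ℝ) : 1 ≤ noiseBound κ W x := le_self_add

/-- The bound on the moments of `noiseBound`. -/
def noiseMoment (C : ℝ → ℝ≥0) (p : ℝ) : ℝ≥0∞ :=
  2 ^ (p - 1) * (1 + 3456 ^ p * (10 ^ p * C (4 * p)))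

theorem noiseMoment_lt_top (C : ℝ → ℝ≥0) {p : ℝ} (hp : 1 ≤ p) : noiseMoment C p < ∞ := by
  unfold noiseMoment
  have h (a : ℝ≥0∞) (ha : a ≠ ⊤) {q : ℝ} (hq : 0 ≤ q) : a ^ q < ∞ :=
    (ENNReal.rpow_ne_top_of_nonneg hq ha).lt_top
  exact ENNReal.mul_lt_top (h _ (by simp) (by linarith)) (ENNReal.add_lt_top.2 ⟨by simp,
    ENNReal.mul_lt_top (h _ (by simp) (by linarith))
      (ENNReal.mul_lt_top (h _ (by simp) (by linarith)) (by simp))⟩)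

section
variable {Ω : Type*} [MeasurableSpace Ω] {P : Measure Ω} {W : Ω → ℝ → ℝ} {C : ℝ → ℝ≥0}

theorem RegularProcess.measurable_uncurry (h : RegularProcess P W C) :
    Measurable (Function.uncurry W) := by
  have : Measurable (Function.uncurry fun (t : ℝ) (ω : Ω) => W ω t) :=
    measurable_uncurry_of_continuous_of_measurable (u := fun (t : ℝ) (ω : Ω) => W ω t)
      h.continuous h.measurable
  exact this.comp measurable_swap

theorem RegularProcess.reflect (h : RegularProcess P W C) :
    RegularProcess P (fun ω => reflectPrimitive (W ω)) C where
  continuous ω := continuous_reflectPrimitive (h.continuous ω)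
  measurable t := (h.measurable (-t)).neg
  exp_moment a s t ha hst ht := by
    have := h.exp_moment a (-t) (-s) ha (by linarith) (by linarith)
    have e (ω : Ω) : |W ω (-s) - W ω (-t)| / √(-s - -t)
        = |reflectPrimitive (W ω) t - reflectPrimitive (W ω) s| / √(t - s) := by
      simp only [reflectPrimitive]; ring_nf
    simpa only [e] using this

theorem RegularProcess.measurable_noiseSize_integrand (h : RegularProcess P W C) :
    Measurable fun p : (Ω × ℝ) × ℝ =>
      ENNReal.ofReal (Real.exp (4 * normIncrement (W p.1.1) p.1.2 p.2)) := by
  have hm := h.measurable_uncurry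
  have h1 : Measurable fun p : (Ω × ℝ) × ℝ => W p.1.1 (p.1.2 + p.2) :=
    hm.comp ((measurable_fst.comp measurable_fst).prodMk
      ((measurable_snd.comp measurable_fst).add measurable_snd))
  have h2 : Measurable fun p : (Ω × ℝ) × ℝ => W p.1.1 p.1.2 := hm.comp measurable_fst
  unfold normIncrement
  have := (h1.sub h2).abs.div measurable_snd.sqrt
  exact (this.const_mul 4).exp.ennreal_ofReal

theorem measurable_noiseWeight (κ : ℝ) :
    Measurable fun t : ℝ => ENNReal.ofReal (5 + expWeight κ t) :=
  (continuous_const.add (continuous_expWeight κ)).measurable.ennreal_ofReal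

theorem noiseSize_eq (κ : ℝ) (W : ℝ → ℝ) (x : ℝ) :
    noiseSize κ W x = ∫⁻ t in Ioo (0 : ℝ) 1,
      ENNReal.ofReal (Real.exp (4 * normIncrement W x t)) * ENNReal.ofReal (5 + expWeight κ t) := by
  unfold noiseSize
  simp_rw [ENNReal.ofReal_mul (Real.exp_pos _).le]

theorem lintegral_noiseWeight_le {κ : ℝ} (hκ : 0 ≤ κ) :
    ∫⁻ t in Ioo (0 : ℝ) 1, ENNReal.ofReal (5 + expWeight κ t) ≤ 10 := by
  have hc : Continuous fun t : ℝ => 5 + expWeight κ t :=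
    continuous_const.add (continuous_expWeight κ)
  rw [← ofReal_integral_eq_lintegral_ofReal]
  · rw [← integral_Ioc_eq_integral_Ioo, ← intervalIntegral.integral_of_le zero_le_one,
      intervalIntegral.integral_add (by simp) ((continuous_expWeight κ).intervalIntegrable _ _)]
    have := integral_expWeight_le hκ
    rw [show (10 : ℝ≥0∞) = ENNReal.ofReal 10 by norm_num]
    refine ENNReal.ofReal_le_ofReal ?_
    simp only [intervalIntegral.integral_const, sub_zero, smul_eq_mul]
    linarith
  · exact (hc.integrableOn_Icc (a := 0) (b := 1)).mono_set Ioo_subset_Icc_self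
  · exact Eventually.of_forall fun t => add_nonneg (by norm_num) (expWeight_nonneg hκ t)

theorem RegularProcess.measurable_noiseSize (h : RegularProcess P W C) (κ : ℝ) :
    Measurable fun p : Ω × ℝ => noiseSize κ (W p.1) p.2 := by
  simp_rw [noiseSize_eq]
  exact ((h.measurable_noiseSize_integrand).mul
    ((measurable_noiseWeight κ).comp measurable_snd)).lintegral_prod_right'

theorem RegularProcess.measurable_noiseBound (h : RegularProcess P W C) (κ : ℝ) :
    Measurable fun p : Ω × ℝ => noiseBound κ (W p.1) p.2 :=
  ((h.measurable_noiseSize κ).const_mul _).const_add _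

/-- Jensen for the measure (5 + weight) dt, of mass at most 10, followed by Fubini: 10^{p-1} from
Jensen and 10 from the remaining integral. -/
theorem RegularProcess.lintegral_noiseSize_rpow_le [SFinite P] (h : RegularProcess P W C) {κ : ℝ}
    (hκ : 0 ≤ κ) (x : ℝ) {p : ℝ} (hp : 1 ≤ p) :
    ∫⁻ ω, noiseSize κ (W ω) x ^ p ∂P ≤ 10 ^ p * C (4 * p) := by
  have hm := h.measurable_noiseSize_integrand
  have hmx : Measurable fun q : Ω × ℝ =>
      ENNReal.ofReal (Real.exp (4 * normIncrement (W q.1) x q.2)) := by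
    have hf : Measurable fun q : Ω × ℝ => ((q.1, x), q.2) :=
      (measurable_fst.prodMk measurable_const).prodMk measurable_snd
    have h3 := hm.fun_comp hf
    exact h3
  have hmb := measurable_noiseWeight κ
  have hb := lintegral_noiseWeight_le hκ
  have hinner (t : ℝ) (ht : t ∈ Ioo (0 : ℝ) 1) :
      ∫⁻ ω, ENNReal.ofReal (Real.exp (4 * normIncrement (W ω) x t)) ^ p ∂P ≤ C (4 * p) := by
    refine le_trans (lintegral_mono fun ω => ?_) (h.exp_moment (4 * p) x (x + t) (by linarith)
      (by linarith [ht.1]) (by linarith [ht.2]))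
    rw [ENNReal.ofReal_rpow_of_pos (Real.exp_pos _), ← Real.exp_mul]
    refine ENNReal.ofReal_le_ofReal (Real.exp_le_exp.2 (le_of_eq ?_))
    simp only [normIncrement, add_sub_cancel_left]
    ring
  calc ∫⁻ ω, noiseSize κ (W ω) x ^ p ∂P
      ≤ ∫⁻ ω, (10 ^ (p - 1) * ∫⁻ t in Ioo (0 : ℝ) 1,
        ENNReal.ofReal (Real.exp (4 * normIncrement (W ω) x t)) ^ p
          * ENNReal.ofReal (5 + expWeight κ t)) ∂P := by
        refine lintegral_mono fun ω => ?_
        rw [noiseSize_eq]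
        have hmω : Measurable fun t : ℝ =>
          ENNReal.ofReal (Real.exp (4 * normIncrement (W ω) x t)) :=
          by
          have := hmx.fun_comp (measurable_prodMk_left (x := ω))
          exact this
        refine (rpow_lintegral_mul_le hmω hmb hp).trans ?_
        gcongr
    _ = 10 ^ (p - 1) * ∫⁻ t in Ioo (0 : ℝ) 1, (∫⁻ ω,
        ENNReal.ofReal (Real.exp (4 * normIncrement (W ω) x t)) ^ p ∂P)
          * ENNReal.ofReal (5 + expWeight κ t) := by
        rw [lintegral_const_mul' _ _ (ENNReal.rpow_ne_top_of_nonneg (by linarith) (by simp)),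
          lintegral_lintegral_swap]
        · congr 1
          refine lintegral_congr fun t => ?_
          rw [lintegral_mul_const' _ _ ENNReal.ofReal_ne_top]
        · exact ((hmx.pow_const p).mul (hmb.comp measurable_snd)).aemeasurable
    _ ≤ 10 ^ (p - 1) * ∫⁻ t in Ioo (0 : ℝ) 1, C (4 * p) * ENNReal.ofReal (5 + expWeight κ t) := by
        refine mul_le_mul_right (setLIntegral_mono' measurableSet_Ioo fun t ht => ?_) _
        gcongr
        exact hinner t ht
    _ ≤ 10 ^ (p - 1) * (C (4 * p) * 10) := by
        rw [lintegral_const_mul' _ _ (by simp)]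
        gcongr
    _ = 10 ^ p * C (4 * p) := by
        have e : (10 : ℝ≥0∞) ^ p = 10 ^ (p - 1) * 10 := by
          have := ENNReal.rpow_add (p - 1) 1 (x := 10) (by simp) (by simp)
          rwa [sub_add_cancel, ENNReal.rpow_one] at this
        rw [e, mul_comm (C (4 * p) : ℝ≥0∞), mul_assoc]

theorem RegularProcess.lintegral_noiseBound_rpow_le [IsProbabilityMeasure P]
    (h : RegularProcess P W C) {κ : ℝ} (hκ : 0 ≤ κ) (x : ℝ) {p : ℝ} (hp : 1 ≤ p) :
    ∫⁻ ω, noiseBound κ (W ω) x ^ p ∂P ≤ noiseMoment C p := by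
  refine lintegral_add_rpow_le aemeasurable_const hp (by simp) ?_
  simp_rw [ENNReal.mul_rpow_of_nonneg _ _ (zero_le_one.trans hp)]
  rw [lintegral_const_mul' _ _ (ENNReal.rpow_ne_top_of_nonneg (by linarith) (by simp))]
  gcongr
  exact h.lintegral_noiseSize_rpow_le hκ x hp

/-- The integral of the squared bound over a unit interval has fourth moments bounded uniformly in
n, so the fourth powers weighted by (1+n)^{-2} are summable almost surely. Taking fourth roots
produces exactly the growth (1+n)^{1/2}. -/
theorem RegularProcess.ae_tameNoise [IsProbabilityMeasure P] (h : RegularProcess P W C) {κ : ℝ}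
    (hκ : 0 ≤ κ) : ∀ᵐ ω ∂P, TameNoise κ (W ω) := by
  have hm := h.measurable_noiseBound κ
  have h0 : ∀ᵐ ω ∂P, noiseSize κ (W ω) 0 < ∞ := by
    have hf : Measurable fun ω : Ω => (ω, (0 : ℝ)) := measurable_prodMk_right
    have h3 := (h.measurable_noiseSize κ).fun_comp hf
    refine ae_lt_top h3 ?_
    have := h.lintegral_noiseSize_rpow_le hκ 0 (p := 1) le_rfl
    simp only [ENNReal.rpow_one] at this
    exact (this.trans_lt (ENNReal.mul_lt_top (by simp) (by simp))).ne
  set Y : ℕ → Ω → ℝ≥0∞ := fun n ω => ∫⁻ x in Ioc (n : ℝ) (n + 1), noiseBound κ (W ω) x ^ 2 with hY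
  have hYm (n : ℕ) : Measurable (Y n) := (hm.pow_const 2).lintegral_prod_right'
  have hY4 (n : ℕ) : ∫⁻ ω, Y n ω ^ (4 : ℝ) ∂P ≤ noiseMoment C 8 := by
    calc ∫⁻ ω, Y n ω ^ (4 : ℝ) ∂P
        ≤ ∫⁻ ω, (∫⁻ x in Ioc (n : ℝ) (n + 1), noiseBound κ (W ω) x ^ (8 : ℝ)) ∂P := by
          refine lintegral_mono fun ω => ?_
          have := rpow_lintegral_le (μ := volume.restrict (Ioc (n : ℝ) (n + 1)))
            (f := fun x => noiseBound κ (W ω) x ^ 2)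
            ((hm.fun_comp measurable_prodMk_left).pow_const 2).aemeasurable (p := 4) (by norm_num)
          refine this.trans (le_of_eq ?_)
          simp only [Measure.restrict_apply_univ, Real.volume_Ioc, add_sub_cancel_left,
            ENNReal.ofReal_one, ENNReal.one_rpow, one_mul]
          refine lintegral_congr fun x => ?_
          rw [← ENNReal.rpow_natCast, ← ENNReal.rpow_mul]
          norm_num
      _ = ∫⁻ x in Ioc (n : ℝ) (n + 1), ∫⁻ ω, noiseBound κ (W ω) x ^ (8 : ℝ) ∂P :=
          lintegral_lintegral_swap (hm.pow_const 8).aemeasurable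
      _ ≤ ∫⁻ x in Ioc (n : ℝ) (n + 1), noiseMoment C 8 :=
          lintegral_mono fun x => h.lintegral_noiseBound_rpow_le hκ x (by norm_num)
      _ = noiseMoment C 8 := by simp
  have hS : ∀ᵐ ω ∂P, ∑' n : ℕ, ENNReal.ofReal (1 / (1 + n : ℝ) ^ 2) * Y n ω ^ (4 : ℝ) < ∞ := by
    refine ae_lt_top (Measurable.tsum fun n => ((hYm n).pow_const 4).const_mul _) ?_
    rw [lintegral_tsum fun n => (((hYm n).pow_const 4).const_mul _).aemeasurable]
    refine ne_of_lt ?_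
    calc ∑' n : ℕ, ∫⁻ ω, ENNReal.ofReal (1 / (1 + n : ℝ) ^ 2) * Y n ω ^ (4 : ℝ) ∂P
        ≤ ∑' n : ℕ, ENNReal.ofReal (1 / (1 + n : ℝ) ^ 2) * noiseMoment C 8 := by
          refine ENNReal.tsum_le_tsum fun n => ?_
          rw [lintegral_const_mul' _ _ ENNReal.ofReal_ne_top]
          gcongr
          exact hY4 n
      _ < ∞ := by
          rw [ENNReal.tsum_mul_right]
          refine ENNReal.mul_lt_top ?_ (noiseMoment_lt_top C (by norm_num))
          have hs : Summable fun n : ℕ => 1 / (1 + n : ℝ) ^ 2 := by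
            have := (summable_nat_add_iff 1).2 (Real.summable_one_div_nat_pow.2 one_lt_two)
            refine this.congr fun n => ?_
            push_cast
            rw [add_comm]
          rw [← ENNReal.ofReal_tsum_of_nonneg (fun n => by positivity) hs]
          exact ENNReal.ofReal_lt_top
  filter_upwards [h0, hS] with ω h0 hS
  refine ⟨h0, ?_⟩
  set S := ∑' n : ℕ, ENNReal.ofReal (1 / (1 + n : ℝ) ^ 2) * Y n ω ^ (4 : ℝ) with hSdef
  refine ⟨(S ^ (1 / 4 : ℝ)).toReal, fun n => ?_⟩
  change Y n ω ≤ _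
  have hn : (0 : ℝ) < 1 + n := by positivity
  have h1 : ENNReal.ofReal (1 / (1 + n : ℝ) ^ 2) * Y n ω ^ (4 : ℝ) ≤ S := ENNReal.le_tsum n
  have h2 : Y n ω ^ (4 : ℝ) ≤ S * ENNReal.ofReal ((1 + n : ℝ) ^ 2) := by
    calc Y n ω ^ (4 : ℝ) = ENNReal.ofReal (1 / (1 + n : ℝ) ^ 2) * Y n ω ^ (4 : ℝ)
          * ENNReal.ofReal ((1 + n : ℝ) ^ 2) := by
          rw [mul_right_comm, ← ENNReal.ofReal_mul (by positivity),
            one_div_mul_cancel (by positivity), ENNReal.ofReal_one, one_mul]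
      _ ≤ _ := by gcongr
  have h3 := ENNReal.rpow_le_rpow h2 (z := 1 / 4) (by norm_num)
  rw [← ENNReal.rpow_mul, show (4 : ℝ) * (1 / 4) = 1 by norm_num, ENNReal.rpow_one,
    ENNReal.mul_rpow_of_nonneg _ _ (by norm_num), ENNReal.ofReal_rpow_of_pos (by positivity)] at h3
  refine h3.trans (le_of_eq ?_)
  rw [ENNReal.ofReal_mul ENNReal.toReal_nonneg, ENNReal.ofReal_toReal
    (ENNReal.rpow_ne_top_of_nonneg (by norm_num) hS.ne)]
  congr 2
  rw [← Real.rpow_natCast, ← Real.rpow_mul hn.le]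
  norm_num

end

end

section
open scoped NNReal

/-! ### Measurability of the Weyl function in the noise -/

section
variable {Ω : Type*} [MeasurableSpace Ω] {P : Measure Ω} {W : Ω → ℝ → ℝ} {C : ℝ → ℝ≥0}

theorem measurable_uncurry_of_continuous_right {E : Type*} [TopologicalSpace E]
    [TopologicalSpace.PseudoMetrizableSpace E] [MeasurableSpace E] [BorelSpace E] {u : Ω → ℝ → E}
    (hc : ∀ ω, Continuous (u ω)) (hm : ∀ t, Measurable fun ω => u ω t) :
    Measurable (Function.uncurry u) := by
  have : Measurable (Function.uncurry fun (t : ℝ) (ω : Ω) => u ω t) :=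
    measurable_uncurry_of_continuous_of_measurable (u := fun (t : ℝ) (ω : Ω) => u ω t) hc hm
  exact this.comp measurable_swap

theorem measurable_intervalIntegral {E : Type*} [NormedAddCommGroup E] [NormedSpace ℝ E]
    [SecondCountableTopology E] [MeasurableSpace E] [BorelSpace E] {f : Ω → ℝ → E}
    (hf : Measurable (Function.uncurry f)) (a b : ℝ) : Measurable fun ω => ∫ t in a..b, f ω t := by
  simp only [intervalIntegral]
  exact (hf.stronglyMeasurable.integral_prod_right (ν := volume.restrict (Ioc a b))).measurable.sub
    (hf.stronglyMeasurable.integral_prod_right (ν := volume.restrict (Ioc b a))).measurable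

theorem measurable_picardIterate_schrodingerField (hc : ∀ ω, Continuous (W ω))
    (hm : ∀ t, Measurable fun ω => W ω t) (k : ℂ) (v : ℂ × ℂ) (n : ℕ) :
    Measurable (Function.uncurry fun ω t => picardIterate (schrodingerField (W ω) k) v n t) := by
  induction n with
  | zero => exact measurable_const
  | succ n ih =>
    refine measurable_uncurry_of_continuous_right
      (fun ω => continuous_picardIterate (continuous_schrodingerField (hc ω) k) v (n + 1))
      fun t => ?_
    have hW : Measurable (Function.uncurry W) := measurable_uncurry_of_continuous_right hc hm
    have hW' : Measurable fun p : Ω × ℝ => ((W p.1 p.2 : ℝ) : ℂ) :=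
      Complex.measurable_ofReal.comp hW
    have ih1 : Measurable fun p : Ω × ℝ =>
        (picardIterate (schrodingerField (W p.1) k) v n p.2).1 := measurable_fst.comp ih
    have ih2 : Measurable fun p : Ω × ℝ =>
        (picardIterate (schrodingerField (W p.1) k) v n p.2).2 := measurable_snd.comp ih
    have hint : Measurable (Function.uncurry fun ω s =>
        schrodingerField (W ω) k s (picardIterate (schrodingerField (W ω) k) v n s)) := by
      simp only [schrodingerField]
      exact (ih2.add (hW'.mul ih1)).prodMk
        ((ih1.const_mul _).sub (hW'.mul (ih2.add (hW'.mul ih1))))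
    exact (measurable_intervalIntegral hint 0 t).const_add v

theorem measurable_schrodingerFlow (hc : ∀ ω, Continuous (W ω))
    (hm : ∀ t, Measurable fun ω => W ω t) (k : ℂ) (v : ℂ × ℂ) :
    Measurable (Function.uncurry fun ω t => schrodingerFlow (W ω) k v t) := by
  refine measurable_of_tendsto_metrizable
    (fun n => measurable_picardIterate_schrodingerField hc hm k v n) ?_
  rw [tendsto_pi_nhds]
  rintro ⟨ω, t⟩
  exact tendsto_picardIterate (continuous_schrodingerField (hc ω) k)
    (schrodingerField_lipschitz (hc ω) k) t

/-- The Weyl coefficient is an almost sure limit of measurable functions of the noise. Replacing it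
by a measurable version yields a jointly measurable function agreeing with m at all x at once, off
one null set. -/
theorem RegularProcess.exists_measurable_weylM [IsProbabilityMeasure P]
    (h : RegularProcess P W C) {k : ℂ} (hk : SectorialParameter k) :
    ∃ G : Ω → ℝ → ℂ, Measurable (Function.uncurry G) ∧
      ∀ᵐ ω ∂P, ∀ x, weylM (W ω) k x = G ω x := by
  have hcos := measurable_schrodingerFlow h.continuous h.measurable k (1, 0)
  have hsin := measurable_schrodingerFlow h.continuous h.measurable k (0, 1)
  have hap (n : ℕ) : Measurable fun ω => weylApprox (W ω) k n := by
    have h1 := hcos.fun_comp (measurable_prodMk_right (y := (n : ℝ)))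
    have h2 := hsin.fun_comp (measurable_prodMk_right (y := (n : ℝ)))
    have h3 := h1.fst.neg.div h2.fst
    exact h3
  have hM : AEMeasurable (fun ω => weylCoeff (W ω) k) P := by
    refine aemeasurable_of_tendsto_metrizable_ae' (f := fun n ω => weylApprox (W ω) k n)
      (fun n => (hap n).aemeasurable) ?_
    filter_upwards [h.ae_tameNoise (norm_nonneg k)] with ω hω
    exact (tendsto_weylApprox (h.continuous ω) hk hω).1
  set M := hM.mk
  have hMm : Measurable M := hM.measurable_mk
  set U : Ω × ℝ → ℂ × ℂ := fun p => coneSolution (W p.1) k (M p.1) p.2 with hU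
  have hUm : Measurable U := hcos.add ((hMm.comp measurable_fst).smul hsin)
  have hW : Measurable fun p : Ω × ℝ => ((W p.1 p.2 : ℝ) : ℂ) :=
    Complex.measurable_ofReal.comp h.measurable_uncurry
  refine ⟨fun ω x => -((U (ω, x)).2 + W ω x * (U (ω, x)).1) / (U (ω, x)).1,
    (hUm.snd.add (hW.mul hUm.fst)).neg.div hUm.fst, ?_⟩
  filter_upwards [hM.ae_eq_mk] with ω hω x
  simp only [weylM, weylRatio, hU]
  rw [hω]

end

/-! ### Pathwise bounds -/

section
variable {W : ℝ → ℝ} {k : ℂ}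

theorem enorm_weylM_sub_le (hW : Continuous W) (hk : SectorialParameter k) (ht : TameNoise ‖k‖ W)
    (x : ℝ) : ‖weylM W k x - k‖ₑ ≤ ENNReal.ofReal (1 / √‖k‖) * noiseBound ‖k‖ W x := by
  rw [← ofReal_norm]
  exact norm_weylM_sub_le hW hk ht x

theorem SectorialParameter.one_div_sqrt_le (hk : SectorialParameter k) : 1 / √‖k‖ ≤ 1 := by
  rw [div_le_one (Real.sqrt_pos.2 (by linarith [hk.one_le]))]
  exact Real.one_le_sqrt.2 hk.one_le

theorem enorm_weylM_le (hW : Continuous W) (hk : SectorialParameter k) (ht : TameNoise ‖k‖ W)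
    (x : ℝ) : ‖weylM W k x‖ₑ ≤ 2 * (ENNReal.ofReal ‖k‖ * noiseBound ‖k‖ W x) := by
  have h1 := enorm_weylM_sub_le hW hk ht x
  calc ‖weylM W k x‖ₑ = ‖(weylM W k x - k) + k‖ₑ := by rw [sub_add_cancel]
    _ ≤ ‖weylM W k x - k‖ₑ + ‖k‖ₑ := enorm_add_le _ _
    _ ≤ ENNReal.ofReal ‖k‖ * noiseBound ‖k‖ W x + ENNReal.ofReal ‖k‖ * noiseBound ‖k‖ W x := by
        refine add_le_add (h1.trans ?_) ?_
        · exact mul_le_mul_left (ENNReal.ofReal_le_ofReal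
            (hk.one_div_sqrt_le.trans hk.one_le)) _
        · rw [← ofReal_norm]
          exact le_mul_of_one_le_right' (one_le_noiseBound _ _ _)
    _ = _ := by rw [two_mul]

/-- The bound on the Hölder quotient of the Weyl function between `y` and `z`. -/
def incrementBound (κ : ℝ) (W : ℝ → ℝ) (y z : ℝ) : ℝ≥0∞ :=
  noiseBound κ W z + noiseBound κ W y + ENNReal.ofReal (|W z - W y| / √(z - y))
    + 3 * (ENNReal.ofReal (1 / (z - y)) * ∫⁻ x in Ioc y z, noiseBound κ W x ^ 2)

/-- Factor as (m - k)(m + k): the first factor is of order κ^{-1/2}, the second of order κ. -/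
theorem enorm_weylM_sq_sub_le (hW : Continuous W) (hk : SectorialParameter k)
    (ht : TameNoise ‖k‖ W) (x : ℝ) :
    ‖weylM W k x ^ 2 - k ^ 2‖ₑ ≤ ENNReal.ofReal (3 * √‖k‖) * noiseBound ‖k‖ W x ^ 2 := by
  have h1 := enorm_weylM_sub_le hW hk ht x
  have hR := one_le_noiseBound ‖k‖ W x
  set R := noiseBound ‖k‖ W x
  have h2 : ‖weylM W k x + k‖ₑ ≤ ENNReal.ofReal (3 * ‖k‖) * R := by
    calc ‖weylM W k x + k‖ₑ ≤ ‖weylM W k x‖ₑ + ‖k‖ₑ := enorm_add_le _ _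
      _ ≤ 2 * (ENNReal.ofReal ‖k‖ * R) + ENNReal.ofReal ‖k‖ * R := by
          refine add_le_add (enorm_weylM_le hW hk ht x) ?_
          rw [← ofReal_norm]
          exact le_mul_of_one_le_right' hR
      _ = _ := by
          rw [ENNReal.ofReal_mul (by norm_num), ENNReal.ofReal_ofNat]; ring
  calc ‖weylM W k x ^ 2 - k ^ 2‖ₑ = ‖weylM W k x - k‖ₑ * ‖weylM W k x + k‖ₑ := by
        rw [← enorm_mul]; congr 1; ring
    _ ≤ ENNReal.ofReal (1 / √‖k‖) * R * (ENNReal.ofReal (3 * ‖k‖) * R) := mul_le_mul' h1 h2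
    _ = ENNReal.ofReal (1 / √‖k‖ * (3 * ‖k‖)) * R ^ 2 := by
        rw [ENNReal.ofReal_mul (p := 1 / √‖k‖) (by positivity)]; ring
    _ = _ := by
        congr 2
        have hk0 : 0 < √‖k‖ := Real.sqrt_pos.2 (by linarith [hk.one_le])
        have := Real.mul_self_sqrt (norm_nonneg k)
        field_simp
        linarith

/-- If κ(z - y) ≥ 1, both values are within κ^{-1/2} ≤ √(z-y) of k, up to the noise bound. Otherwise
the Riccati equation gives the increment of m as that of -W plus an integral whose integrand is of
order √κ ≤ 1/√(z-y). No power of κ is lost in either regime. -/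
theorem enorm_weylM_sub_weylM_le (hW : Continuous W) (hk : SectorialParameter k)
    (ht : TameNoise ‖k‖ W) {y z : ℝ} (hyz : y < z) :
    ‖weylM W k z - weylM W k y‖ₑ ≤ ENNReal.ofReal √(z - y) * incrementBound ‖k‖ W y z := by
  have hκ : 0 < ‖k‖ := by linarith [hk.one_le]
  have hd : 0 < z - y := by linarith
  unfold incrementBound
  rcases le_or_gt 1 (‖k‖ * (z - y)) with hcase | hcase
  · have hs : 1 / √‖k‖ ≤ √(z - y) := by
      rw [div_le_iff₀ (Real.sqrt_pos.2 hκ), ← Real.sqrt_mul hd.le, mul_comm]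
      exact Real.one_le_sqrt.2 hcase
    calc ‖weylM W k z - weylM W k y‖ₑ = ‖(weylM W k z - k) - (weylM W k y - k)‖ₑ := by
          congr 1; ring
      _ ≤ ‖weylM W k z - k‖ₑ + ‖weylM W k y - k‖ₑ := enorm_sub_le
      _ ≤ ENNReal.ofReal √(z - y) * noiseBound ‖k‖ W z
          + ENNReal.ofReal √(z - y) * noiseBound ‖k‖ W y :=
          add_le_add
            ((enorm_weylM_sub_le hW hk ht z).trans
              (mul_le_mul_left (ENNReal.ofReal_le_ofReal hs) _))
            ((enorm_weylM_sub_le hW hk ht y).trans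
              (mul_le_mul_left (ENNReal.ofReal_le_ofReal hs) _))
      _ = ENNReal.ofReal √(z - y) * (noiseBound ‖k‖ W z + noiseBound ‖k‖ W y) := by rw [mul_add]
      _ ≤ _ := by
          refine mul_le_mul_right ?_ _
          rw [add_assoc (_ + _)]
          exact le_self_add
  · have hcM := continuous_weylM hW hk ht
    have hint : ∫ x in y..z, (weylM W k x ^ 2 - k ^ 2)
        = (weylM W k z + W z) - (weylM W k y + W y) :=
      intervalIntegral.integral_eq_sub_of_hasDerivAt
        (fun x _ => hasDerivAt_weylM_add hW hk ht x)
        ((hcM.pow 2).sub continuous_const |>.intervalIntegrable _ _)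
    have hs0 : 0 < √(z - y) := Real.sqrt_pos.2 hd
    have hs : 3 * √‖k‖ ≤ √(z - y) * (3 * (1 / (z - y))) := by
      have h1 : √‖k‖ * √(z - y) ≤ 1 := by
        rw [← Real.sqrt_mul hκ.le]
        exact Real.sqrt_le_one.2 hcase.le
      have h2 := Real.mul_self_sqrt hd.le
      have h3 : √(z - y) * (3 * (1 / (z - y))) = 3 / √(z - y) := by
        rw [← mul_assoc, mul_one_div, div_eq_div_iff hd.ne' hs0.ne']
        linear_combination 3 * h2
      rw [h3, le_div_iff₀ hs0]
      linarith
    have e : weylM W k z - weylM W k y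
        = (∫ x in y..z, (weylM W k x ^ 2 - k ^ 2)) - (((W z - W y : ℝ)) : ℂ) := by
      rw [hint]; push_cast; ring
    have hA : ‖∫ x in y..z, (weylM W k x ^ 2 - k ^ 2)‖ₑ
        ≤ ENNReal.ofReal √(z - y) * (3 * (ENNReal.ofReal (1 / (z - y))
          * ∫⁻ x in Ioc y z, noiseBound ‖k‖ W x ^ 2)) := by
      rw [intervalIntegral.integral_of_le hyz.le]
      refine (enorm_integral_le_lintegral_enorm _).trans ?_
      refine (lintegral_mono fun x => enorm_weylM_sq_sub_le hW hk ht x).trans ?_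
      rw [lintegral_const_mul' _ _ ENNReal.ofReal_ne_top]
      refine (mul_le_mul_left (ENNReal.ofReal_le_ofReal hs) _).trans (le_of_eq ?_)
      rw [ENNReal.ofReal_mul hs0.le, ENNReal.ofReal_mul (by norm_num), ENNReal.ofReal_ofNat]
      ring
    have hB : ‖(((W z - W y : ℝ)) : ℂ)‖ₑ
        = ENNReal.ofReal √(z - y) * ENNReal.ofReal (|W z - W y| / √(z - y)) := by
      rw [← ENNReal.ofReal_mul hs0.le, mul_div_cancel₀ _ hs0.ne', ← ofReal_norm,
        Complex.norm_real, Real.norm_eq_abs]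
    rw [e]
    refine enorm_sub_le.trans ((add_le_add hA hB.le).trans ?_)
    rw [← mul_add]
    refine mul_le_mul_right ?_ _
    rw [add_comm, add_assoc (_ + _)]
    exact le_add_self

/-! ### The sum of the two Weyl functions and its derivative. -/

/-- `m₊² - m₋²`, the derivative of `weylSum`. -/
def weylSqDiff (W : ℝ → ℝ) (k : ℂ) (x : ℝ) : ℂ :=
  weylM W k x ^ 2 - weylM (reflectPrimitive W) k (-x) ^ 2

/-- The primitive of the reflected potential at -x is -W(x), so adding the two Riccati equations
eliminates the nowhere smooth term and 1/g becomes differentiable. -/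
theorem hasDerivAt_weylSum (hW : Continuous W) (hk : SectorialParameter k) (ht : TameNoise ‖k‖ W)
    (ht' : TameNoise ‖k‖ (reflectPrimitive W)) (x : ℝ) :
    HasDerivAt (weylSum W k) (weylSqDiff W k x) x := by
  have h1 := hasDerivAt_weylM_add hW hk ht x
  have h2 := (hasDerivAt_weylM_add (continuous_reflectPrimitive hW) hk ht' (-x)).scomp x
    (hasDerivAt_neg x)
  have h3 := h1.add h2
  have e : weylSum W k = (fun x => weylM W k x + W x)
      + ((fun x => weylM (reflectPrimitive W) k x + reflectPrimitive W x) ∘ fun x => -x) := by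
    ext x
    simp [weylSum, reflectPrimitive]
    ring
  rw [e]
  refine h3.congr_deriv ?_
  simp only [weylSqDiff, neg_smul, one_smul]
  ring

/-- The sum of the bounds for the two half-lines. -/
def twoSidedBound (κ : ℝ) (W : ℝ → ℝ) (x : ℝ) : ℝ≥0∞ :=
  noiseBound κ W x + noiseBound κ (reflectPrimitive W) (-x)

theorem one_le_twoSidedBound (κ : ℝ) (W : ℝ → ℝ) (x : ℝ) : 1 ≤ twoSidedBound κ W x :=
  (one_le_noiseBound κ W x).trans le_self_add

/-- A bound for all the Hölder quotients between `y` and `z`. -/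
def pairBound (κ : ℝ) (W : ℝ → ℝ) (y z : ℝ) : ℝ≥0∞ :=
  incrementBound κ W y z + incrementBound κ (reflectPrimitive W) (-z) (-y)
    + (twoSidedBound κ W y + twoSidedBound κ W z)

theorem enorm_weylSum_le (hW : Continuous W) (hk : SectorialParameter k) (ht : TameNoise ‖k‖ W)
    (ht' : TameNoise ‖k‖ (reflectPrimitive W)) (x : ℝ) :
    ‖weylSum W k x‖ₑ ≤ 2 * (ENNReal.ofReal ‖k‖ * twoSidedBound ‖k‖ W x) := by
  calc ‖weylSum W k x‖ₑ ≤ ‖weylM W k x‖ₑ + ‖weylM (reflectPrimitive W) k (-x)‖ₑ := enorm_add_le _ _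
    _ ≤ _ := add_le_add (enorm_weylM_le hW hk ht x)
        (enorm_weylM_le (continuous_reflectPrimitive hW) hk ht' (-x))
    _ = _ := by rw [twoSidedBound]; ring

/-- As a product of m₊ - m₋, in which k cancels, and m₊ + m₋; only the second factor costs a power
of κ. -/
theorem enorm_weylSqDiff_le (hW : Continuous W) (hk : SectorialParameter k) (ht : TameNoise ‖k‖ W)
    (ht' : TameNoise ‖k‖ (reflectPrimitive W)) (x : ℝ) :
    ‖weylSqDiff W k x‖ₑ ≤ 2 * (ENNReal.ofReal ‖k‖ * twoSidedBound ‖k‖ W x ^ 2) := by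
  have h1 := enorm_weylSum_le hW hk ht ht' x
  have h2 : ‖weylM W k x - weylM (reflectPrimitive W) k (-x)‖ₑ ≤ twoSidedBound ‖k‖ W x := by
    have hle : ENNReal.ofReal (1 / √‖k‖) ≤ 1 := by
      rw [← ENNReal.ofReal_one]; exact ENNReal.ofReal_le_ofReal hk.one_div_sqrt_le
    calc _ = ‖(weylM W k x - k) - (weylM (reflectPrimitive W) k (-x) - k)‖ₑ := by congr 1; ring
      _ ≤ _ := enorm_sub_le
      _ ≤ _ := add_le_add ((enorm_weylM_sub_le hW hk ht x).trans (mul_le_of_le_one_left' hle))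
        ((enorm_weylM_sub_le (continuous_reflectPrimitive hW) hk ht' (-x)).trans
          (mul_le_of_le_one_left' hle))
  calc ‖weylSqDiff W k x‖ₑ
      = ‖weylM W k x - weylM (reflectPrimitive W) k (-x)‖ₑ * ‖weylSum W k x‖ₑ := by
        rw [← enorm_mul, weylSqDiff, weylSum]; congr 1; ring
    _ ≤ _ := mul_le_mul' h2 h1
    _ = _ := by ring

theorem enorm_weylSum_sub_le (hW : Continuous W) (hk : SectorialParameter k) (ht : TameNoise ‖k‖ W)
    (ht' : TameNoise ‖k‖ (reflectPrimitive W)) {y z : ℝ} (hyz : y < z) :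
    ‖weylSum W k z - weylSum W k y‖ₑ
      ≤ ENNReal.ofReal √(z - y) * pairBound ‖k‖ W y z := by
  have h1 := enorm_weylM_sub_weylM_le hW hk ht hyz
  have h2 := enorm_weylM_sub_weylM_le (continuous_reflectPrimitive hW) hk ht' (neg_lt_neg hyz)
  rw [show -y - -z = z - y by ring] at h2
  calc ‖weylSum W k z - weylSum W k y‖ₑ
      = ‖(weylM W k z - weylM W k y)
        - (weylM (reflectPrimitive W) k (-y) - weylM (reflectPrimitive W) k (-z))‖ₑ := by
        rw [weylSum, weylSum]; congr 1; ring
    _ ≤ _ := enorm_sub_le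
    _ ≤ _ := add_le_add h1 h2
    _ ≤ _ := by
        rw [← mul_add, pairBound]
        exact mul_le_mul_right le_self_add _

theorem enorm_weylSqDiff_sub_le (hW : Continuous W) (hk : SectorialParameter k)
    (ht : TameNoise ‖k‖ W) (ht' : TameNoise ‖k‖ (reflectPrimitive W)) {y z : ℝ} (hyz : y < z) :
    ‖weylSqDiff W k z - weylSqDiff W k y‖ₑ
      ≤ 2 * (ENNReal.ofReal ‖k‖ * (ENNReal.ofReal √(z - y) * pairBound ‖k‖ W y z ^ 2)) := by
  have h1 := enorm_weylM_sub_weylM_le hW hk ht hyz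
  have h2 := enorm_weylM_sub_weylM_le (continuous_reflectPrimitive hW) hk ht' (neg_lt_neg hyz)
  rw [show -y - -z = z - y by ring] at h2
  have h3 : ‖weylM W k z + weylM W k y‖ₑ ≤ 2 * (ENNReal.ofReal ‖k‖ * pairBound ‖k‖ W y z) := by
    refine (enorm_add_le _ _).trans ((add_le_add (enorm_weylM_le hW hk ht z)
      (enorm_weylM_le hW hk ht y)).trans ?_)
    rw [← mul_add, ← mul_add]
    refine mul_le_mul_right (mul_le_mul_right ?_ _) _
    rw [pairBound, add_comm]
    exact (add_le_add le_self_add le_self_add).trans le_add_self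
  have h4 : ‖weylM (reflectPrimitive W) k (-y) + weylM (reflectPrimitive W) k (-z)‖ₑ
      ≤ 2 * (ENNReal.ofReal ‖k‖ * pairBound ‖k‖ W y z) := by
    refine (enorm_add_le _ _).trans ((add_le_add
      (enorm_weylM_le (continuous_reflectPrimitive hW) hk ht' (-y))
      (enorm_weylM_le (continuous_reflectPrimitive hW) hk ht' (-z))).trans ?_)
    rw [← mul_add, ← mul_add]
    refine mul_le_mul_right (mul_le_mul_right ?_ _) _
    rw [pairBound]
    exact (add_le_add le_add_self le_add_self).trans le_add_self
  calc ‖weylSqDiff W k z - weylSqDiff W k y‖ₑ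
      = ‖(weylM W k z - weylM W k y) * (weylM W k z + weylM W k y)
        + (weylM (reflectPrimitive W) k (-y) - weylM (reflectPrimitive W) k (-z))
          * (weylM (reflectPrimitive W) k (-y) + weylM (reflectPrimitive W) k (-z))‖ₑ := by
        rw [weylSqDiff, weylSqDiff]; congr 1; ring
    _ ≤ _ := enorm_add_le _ _
    _ ≤ ENNReal.ofReal √(z - y) * incrementBound ‖k‖ W y z
          * (2 * (ENNReal.ofReal ‖k‖ * pairBound ‖k‖ W y z))
        + ENNReal.ofReal √(z - y) * incrementBound ‖k‖ (reflectPrimitive W) (-z) (-y)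
          * (2 * (ENNReal.ofReal ‖k‖ * pairBound ‖k‖ W y z)) := by
        rw [enorm_mul, enorm_mul]
        exact add_le_add (mul_le_mul' h1 h3) (mul_le_mul' h2 h4)
    _ = 2 * (ENNReal.ofReal ‖k‖ * (ENNReal.ofReal √(z - y) *
        ((incrementBound ‖k‖ W y z + incrementBound ‖k‖ (reflectPrimitive W) (-z) (-y))
          * pairBound ‖k‖ W y z))) := by ring
    _ ≤ _ := by
        rw [sq]
        refine mul_le_mul_right (mul_le_mul_right (mul_le_mul_right (mul_le_mul_left ?_ _) _) _) _
        exact le_self_add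

end

end

section
open scoped NNReal

/-! ### Moments of the pathwise bounds -/

/-- The bound on the moments of `incrementBound`. -/
def incrementMoment (C : ℝ → ℝ≥0) (p : ℝ) : ℝ≥0∞ :=
  2 ^ (p - 1) * (2 ^ (p - 1) * (2 ^ (p - 1) * (noiseMoment C p + noiseMoment C p) + C p)
    + 3 ^ p * noiseMoment C (2 * p))

/-- The bound on the moments of `twoSidedBound`. -/
def twoSidedMoment (C : ℝ → ℝ≥0) (p : ℝ) : ℝ≥0∞ :=
  2 ^ (p - 1) * (noiseMoment C p + noiseMoment C p)

/-- The bound on the moments of `pairBound`. -/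
def pairMoment (C : ℝ → ℝ≥0) (p : ℝ) : ℝ≥0∞ :=
  2 ^ (p - 1) * (2 ^ (p - 1) * (incrementMoment C p + incrementMoment C p)
    + 2 ^ (p - 1) * (twoSidedMoment C p + twoSidedMoment C p))

theorem rpow_lt_top_of_one_le {a : ℝ≥0∞} (ha : a ≠ ⊤) {p : ℝ} (hp : 0 ≤ p) : a ^ p < ∞ :=
  (ENNReal.rpow_ne_top_of_nonneg hp ha).lt_top

theorem twoSidedMoment_lt_top (C : ℝ → ℝ≥0) {p : ℝ} (hp : 1 ≤ p) : twoSidedMoment C p < ∞ := by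
  have h1 := noiseMoment_lt_top C hp
  exact ENNReal.mul_lt_top (rpow_lt_top_of_one_le (by simp) (by linarith))
    (ENNReal.add_lt_top.2 ⟨h1, h1⟩)

theorem incrementMoment_lt_top (C : ℝ → ℝ≥0) {p : ℝ} (hp : 1 ≤ p) : incrementMoment C p < ∞ := by
  have h1 := noiseMoment_lt_top C hp
  have h2 : (2 : ℝ≥0∞) ^ (p - 1) < ∞ := rpow_lt_top_of_one_le (by simp) (by linarith)
  exact ENNReal.mul_lt_top h2 (ENNReal.add_lt_top.2 ⟨ENNReal.mul_lt_top h2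
    (ENNReal.add_lt_top.2 ⟨ENNReal.mul_lt_top h2 (ENNReal.add_lt_top.2 ⟨h1, h1⟩), by simp⟩),
    ENNReal.mul_lt_top (rpow_lt_top_of_one_le (by simp) (by linarith))
      (noiseMoment_lt_top C (by linarith))⟩)

theorem pairMoment_lt_top (C : ℝ → ℝ≥0) {p : ℝ} (hp : 1 ≤ p) : pairMoment C p < ∞ := by
  have h1 := twoSidedMoment_lt_top C hp
  have h3 := incrementMoment_lt_top C hp
  have h2 : (2 : ℝ≥0∞) ^ (p - 1) < ∞ := rpow_lt_top_of_one_le (by simp) (by linarith)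
  exact ENNReal.mul_lt_top h2 (ENNReal.add_lt_top.2
    ⟨ENNReal.mul_lt_top h2 (ENNReal.add_lt_top.2 ⟨h3, h3⟩),
      ENNReal.mul_lt_top h2 (ENNReal.add_lt_top.2 ⟨h1, h1⟩)⟩)

section
variable {Ω : Type*} [MeasurableSpace Ω] {P : Measure Ω} {W : Ω → ℝ → ℝ} {C : ℝ → ℝ≥0}

theorem RegularProcess.measurable_noiseBound_apply (h : RegularProcess P W C) (κ x : ℝ) :
    Measurable fun ω => noiseBound κ (W ω) x := by
  have h1 := (h.measurable_noiseBound κ).fun_comp (measurable_prodMk_right (y := x))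
  exact h1

theorem RegularProcess.lintegral_holder_rpow_le (h : RegularProcess P W C) {y z : ℝ} (hyz : y < z)
    (hz : z ≤ y + 2) {p : ℝ} (hp : 0 ≤ p) :
    ∫⁻ ω, ENNReal.ofReal (|W ω z - W ω y| / √(z - y)) ^ p ∂P ≤ C p := by
  refine le_trans (lintegral_mono fun ω => ?_) (h.exp_moment p y z hp hyz hz)
  set N := |W ω z - W ω y| / √(z - y) with hN
  have hN0 : 0 ≤ N := by positivity
  change ENNReal.ofReal N ^ p ≤ ENNReal.ofReal (Real.exp (p * N))
  rw [ENNReal.ofReal_rpow_of_nonneg hN0 hp, mul_comm, Real.exp_mul]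
  refine ENNReal.ofReal_le_ofReal (Real.rpow_le_rpow hN0 ?_ hp)
  linarith [Real.add_one_le_exp N]

/-- Jensen for the normalized Lebesgue measure on (y, z] makes the bound independent of the length
of the interval, however short. -/
theorem RegularProcess.lintegral_average_rpow_le [IsProbabilityMeasure P]
    (h : RegularProcess P W C) {κ : ℝ} (hκ : 0 ≤ κ) {y z : ℝ} (hyz : y < z) {p : ℝ} (hp : 1 ≤ p) :
    ∫⁻ ω, (ENNReal.ofReal (1 / (z - y)) * ∫⁻ x in Ioc y z, noiseBound κ (W ω) x ^ 2) ^ p ∂P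
      ≤ noiseMoment C (2 * p) := by
  have hd : 0 < z - y := by linarith
  have hm := h.measurable_noiseBound κ
  have hc1 : ENNReal.ofReal (1 / (z - y)) * ENNReal.ofReal (z - y) = 1 := by
    rw [← ENNReal.ofReal_mul (by positivity), one_div_mul_cancel hd.ne', ENNReal.ofReal_one]
  have hct : ENNReal.ofReal (1 / (z - y)) ≠ ⊤ := ENNReal.ofReal_ne_top
  set c := ENNReal.ofReal (1 / (z - y))
  calc ∫⁻ ω, (c * ∫⁻ x in Ioc y z, noiseBound κ (W ω) x ^ 2) ^ p ∂P
      ≤ ∫⁻ ω, (∫⁻ x in Ioc y z, noiseBound κ (W ω) x ^ (2 * p) * c) ∂P := by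
        refine lintegral_mono fun ω => ?_
        have h1 := hm.fun_comp (measurable_prodMk_left (x := ω))
        have h2 := rpow_lintegral_mul_le (μ := volume.restrict (Ioc y z)) (h1.pow_const 2)
          (measurable_const (a := c)) hp
        simp only [lintegral_const, Measure.restrict_apply_univ, Real.volume_Ioc, hc1,
          ENNReal.one_rpow, one_mul] at h2
        rw [← lintegral_const_mul' _ _ hct]
        simp_rw [mul_comm c]
        refine h2.trans (le_of_eq (lintegral_congr fun x => ?_))
        rw [← ENNReal.rpow_natCast, ← ENNReal.rpow_mul]
        norm_num
    _ = ∫⁻ x in Ioc y z, (∫⁻ ω, noiseBound κ (W ω) x ^ (2 * p) ∂P) * c := by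
        rw [lintegral_lintegral_swap ((hm.pow_const _).mul_const c).aemeasurable]
        refine lintegral_congr fun x => ?_
        rw [lintegral_mul_const' _ _ hct]
    _ ≤ ∫⁻ x in Ioc y z, noiseMoment C (2 * p) * c :=
        lintegral_mono fun x => mul_le_mul_left
          (h.lintegral_noiseBound_rpow_le hκ x (by linarith)) _
    _ = noiseMoment C (2 * p) := by
        rw [lintegral_const, Measure.restrict_apply_univ, Real.volume_Ioc, mul_assoc, hc1, mul_one]

theorem RegularProcess.lintegral_incrementBound_rpow_le [IsProbabilityMeasure P]
    (h : RegularProcess P W C) {κ : ℝ} (hκ : 0 ≤ κ) {y z : ℝ} (hyz : y < z) (hz : z ≤ y + 2)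
    {p : ℝ} (hp : 1 ≤ p) :
    ∫⁻ ω, incrementBound κ (W ω) y z ^ p ∂P ≤ incrementMoment C p := by
  have m1 := h.measurable_noiseBound_apply κ
  have m2 : Measurable fun ω => ENNReal.ofReal (|W ω z - W ω y| / √(z - y)) :=
    (((h.measurable z).sub (h.measurable y)).abs.div_const _).ennreal_ofReal
  refine lintegral_add_rpow_le (((m1 z).add (m1 y)).add m2).aemeasurable hp ?_ ?_
  · refine lintegral_add_rpow_le ((m1 z).add (m1 y)).aemeasurable hp ?_ ?_
    · exact lintegral_add_rpow_le (m1 z).aemeasurable hp (h.lintegral_noiseBound_rpow_le hκ z hp)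
        (h.lintegral_noiseBound_rpow_le hκ y hp)
    · exact h.lintegral_holder_rpow_le hyz hz (by linarith)
  · simp_rw [ENNReal.mul_rpow_of_nonneg 3 _ (zero_le_one.trans hp)]
    rw [lintegral_const_mul' _ _ (ENNReal.rpow_ne_top_of_nonneg (by linarith) (by simp))]
    exact mul_le_mul_right (h.lintegral_average_rpow_le hκ hyz hp) _

theorem RegularProcess.lintegral_twoSidedBound_rpow_le [IsProbabilityMeasure P]
    (h : RegularProcess P W C) {κ : ℝ} (hκ : 0 ≤ κ) (x : ℝ) {p : ℝ} (hp : 1 ≤ p) :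
    ∫⁻ ω, twoSidedBound κ (W ω) x ^ p ∂P ≤ twoSidedMoment C p :=
  lintegral_add_rpow_le (h.measurable_noiseBound_apply κ x).aemeasurable hp
    (h.lintegral_noiseBound_rpow_le hκ x hp) (h.reflect.lintegral_noiseBound_rpow_le hκ (-x) hp)

theorem RegularProcess.measurable_twoSidedBound (h : RegularProcess P W C) (κ x : ℝ) :
    Measurable fun ω => twoSidedBound κ (W ω) x :=
  (h.measurable_noiseBound_apply κ x).add (h.reflect.measurable_noiseBound_apply κ (-x))

theorem RegularProcess.measurable_incrementBound (h : RegularProcess P W C) (κ y z : ℝ) :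
    Measurable fun ω => incrementBound κ (W ω) y z := by
  have m1 := h.measurable_noiseBound_apply κ
  have m2 : Measurable fun ω => ENNReal.ofReal (|W ω z - W ω y| / √(z - y)) :=
    (((h.measurable z).sub (h.measurable y)).abs.div_const _).ennreal_ofReal
  have m3 : Measurable fun ω => ∫⁻ x in Ioc y z, noiseBound κ (W ω) x ^ 2 :=
    ((h.measurable_noiseBound κ).pow_const 2).lintegral_prod_right'
  exact (((m1 z).add (m1 y)).add m2).add ((m3.const_mul _).const_mul _)

theorem RegularProcess.lintegral_pairBound_rpow_le [IsProbabilityMeasure P]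
    (h : RegularProcess P W C) {κ : ℝ} (hκ : 0 ≤ κ) {y z : ℝ} (hyz : y < z) (hz : z ≤ y + 2)
    {p : ℝ} (hp : 1 ≤ p) :
    ∫⁻ ω, pairBound κ (W ω) y z ^ p ∂P ≤ pairMoment C p := by
  have m1 := h.measurable_incrementBound κ y z
  have m2 := h.reflect.measurable_incrementBound κ (-z) (-y)
  refine lintegral_add_rpow_le (m1.add m2).aemeasurable hp ?_ ?_
  · exact lintegral_add_rpow_le m1.aemeasurable hp
      (h.lintegral_incrementBound_rpow_le hκ hyz hz hp)
      (h.reflect.lintegral_incrementBound_rpow_le hκ (neg_lt_neg hyz) (by linarith) hp)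
  · exact lintegral_add_rpow_le (h.measurable_twoSidedBound κ y).aemeasurable hp
      (h.lintegral_twoSidedBound_rpow_le hκ y hp) (h.lintegral_twoSidedBound_rpow_le hκ z hp)

end

/-! ### The polynomial weight -/

/-- The weight `⟨x⟩^{-β}`. -/
def bracketWeight (β x : ℝ) : ℝ := (1 + x ^ 2) ^ (-β / 2)

/-- The derivative of `⟨x⟩^{-β}`. -/
def bracketWeightDeriv (β x : ℝ) : ℝ := -β * x * (1 + x ^ 2) ^ (-β / 2 - 1)

theorem japaneseBracket_rpow_neg (β x : ℝ) : japaneseBracket x ^ (-β) = bracketWeight β x := by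
  rw [japaneseBracket, bracketWeight, Real.sqrt_eq_rpow, ← Real.rpow_mul (by positivity)]
  congr 1; ring

theorem bracketWeight_pos (β x : ℝ) : 0 < bracketWeight β x := by
  unfold bracketWeight; positivity

theorem continuous_bracketWeight (β : ℝ) : Continuous (bracketWeight β) := by
  unfold bracketWeight
  exact (by fun_prop : Continuous fun x : ℝ => 1 + x ^ 2).rpow_const
    fun x => Or.inl (by positivity)

theorem continuous_bracketWeightDeriv (β : ℝ) : Continuous (bracketWeightDeriv β) := by
  unfold bracketWeightDeriv
  exact (continuous_const.mul continuous_id).mul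
    ((by fun_prop : Continuous fun x : ℝ => 1 + x ^ 2).rpow_const fun x => Or.inl (by positivity))

theorem hasDerivAt_one_add_sq_rpow (a x : ℝ) :
    HasDerivAt (fun x : ℝ => (1 + x ^ 2) ^ a) (2 * a * x * (1 + x ^ 2) ^ (a - 1)) x := by
  have h1 : HasDerivAt (fun x : ℝ => 1 + x ^ 2) (2 * x) x := by
    simpa using (hasDerivAt_pow 2 x).const_add 1
  refine (h1.rpow_const (p := a) (Or.inl (by positivity))).congr_deriv ?_
  ring

theorem hasDerivAt_bracketWeight (β x : ℝ) :
    HasDerivAt (bracketWeight β) (bracketWeightDeriv β x) x := by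
  refine (hasDerivAt_one_add_sq_rpow (-β / 2) x).congr_deriv ?_
  rw [bracketWeightDeriv]; ring

theorem one_add_sq_rpow_sub_one_mul_le (a x : ℝ) :
    |x| * (1 + x ^ 2) ^ (a - 1) ≤ (1 + x ^ 2) ^ a := by
  have h0 : (0 : ℝ) < 1 + x ^ 2 := by positivity
  rw [Real.rpow_sub_one h0.ne', ← mul_div_assoc, div_le_iff₀ h0, mul_comm]
  refine mul_le_mul_of_nonneg_left ?_ (by positivity)
  nlinarith [sq_nonneg (|x| - 1), sq_abs x, abs_nonneg x]

theorem abs_bracketWeightDeriv_le {β : ℝ} (hβ : 0 ≤ β) (x : ℝ) :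
    |bracketWeightDeriv β x| ≤ β * bracketWeight β x := by
  rw [bracketWeightDeriv, abs_mul, abs_mul, abs_neg, abs_of_nonneg hβ,
    abs_of_pos (Real.rpow_pos_of_pos (by positivity) _), mul_assoc]
  exact mul_le_mul_of_nonneg_left (one_add_sq_rpow_sub_one_mul_le _ x) hβ

theorem exists_hasDerivAt_bracketWeightDeriv {β : ℝ} (hβ : 0 ≤ β) (x : ℝ) :
    ∃ v, HasDerivAt (bracketWeightDeriv β) v x ∧ |v| ≤ β * (β + 3) * bracketWeight β x := by
  have h0 : (0 : ℝ) < 1 + x ^ 2 := by positivity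
  have h1 := ((hasDerivAt_id x).const_mul (-β)).mul (hasDerivAt_one_add_sq_rpow (-β / 2 - 1) x)
  refine ⟨_, h1, ?_⟩
  have e1 : (1 + x ^ 2) ^ (-β / 2 - 1) = bracketWeight β x / (1 + x ^ 2) := by
    rw [bracketWeight, Real.rpow_sub_one h0.ne']
  have e2 : (1 + x ^ 2) ^ (-β / 2 - 1 - 1) = bracketWeight β x / (1 + x ^ 2) / (1 + x ^ 2) := by
    rw [Real.rpow_sub_one h0.ne', e1]
  simp only [id_eq, mul_one]
  rw [e1, e2]
  have hw := bracketWeight_pos β x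
  set w := bracketWeight β x
  have e3 : -β * (w / (1 + x ^ 2)) + -β * x * (2 * (-β / 2 - 1) * x * (w / (1 + x ^ 2) / (1 + x ^ 2)))
      = β * w * ((β + 2) * (x ^ 2 / (1 + x ^ 2)) - 1) * (1 / (1 + x ^ 2)) := by
    field_simp
    ring
  have hq0 : 0 ≤ x ^ 2 / (1 + x ^ 2) := by positivity
  have hq1 : x ^ 2 / (1 + x ^ 2) ≤ 1 := by rw [div_le_one h0]; linarith
  have hr1 : 1 / (1 + x ^ 2) ≤ 1 := by rw [div_le_one h0]; nlinarith
  rw [e3, abs_mul, abs_mul, abs_of_nonneg (by positivity : 0 ≤ β * w),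
    abs_of_pos (by positivity : 0 < 1 / (1 + x ^ 2))]
  have hm : |(β + 2) * (x ^ 2 / (1 + x ^ 2)) - 1| ≤ β + 3 := by
    rw [abs_le]; constructor <;> nlinarith
  calc β * w * |(β + 2) * (x ^ 2 / (1 + x ^ 2)) - 1| * (1 / (1 + x ^ 2))
      ≤ β * w * (β + 3) * 1 := by gcongr
    _ = _ := by ring

theorem bracketWeight_le {β : ℝ} (hβ : 0 ≤ β) {x y : ℝ} (h : |y - x| ≤ 1) :
    bracketWeight β y ≤ 2 ^ β * bracketWeight β x := by
  have h0 : (0 : ℝ) < 1 + x ^ 2 := by positivity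
  have h1 : (0 : ℝ) < 1 + y ^ 2 := by positivity
  have hxy : (1 + x ^ 2) / 4 ≤ 1 + y ^ 2 := by
    have := abs_le.1 h
    nlinarith [sq_nonneg (y + (y - x))]
  have := Real.rpow_le_rpow_of_nonpos (by positivity) hxy (by linarith : -β / 2 ≤ 0)
  rw [Real.div_rpow h0.le (by norm_num)] at this
  refine this.trans (le_of_eq ?_)
  rw [bracketWeight, show (4 : ℝ) = 2 ^ (2 : ℝ) by norm_num, ← Real.rpow_mul (by norm_num),
    div_eq_mul_inv, ← Real.rpow_neg (by norm_num), mul_comm]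
  congr 2
  ring

theorem abs_sub_le_of_bracketWeight {f f' : ℝ → ℝ} {β c : ℝ} (hβ : 0 ≤ β) (hc : 0 ≤ c)
    (hf : ∀ x, HasDerivAt f (f' x) x) (hf' : ∀ x, |f' x| ≤ c * bracketWeight β x) {x t : ℝ}
    (ht0 : 0 < t) (ht1 : t ≤ 1) :
    |f (x + t) - f (x - t)| ≤ 2 * c * 2 ^ β * (bracketWeight β x * √(2 * t)) := by
  have h1 : ∀ y ∈ Icc (x - t) (x + t), ‖f' y‖ ≤ c * (2 ^ β * bracketWeight β x) := by
    intro y hy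
    refine (hf' y).trans (mul_le_mul_of_nonneg_left (bracketWeight_le hβ ?_) hc)
    rw [abs_le]; constructor <;> linarith [hy.1, hy.2]
  have h2 := (convex_Icc (x - t) (x + t)).norm_image_sub_le_of_norm_hasDerivWithin_le
    (fun y _ => (hf y).hasDerivWithinAt) h1 (x := x - t) (y := x + t)
    ⟨le_rfl, by linarith⟩ ⟨by linarith, le_rfl⟩
  rw [Real.norm_eq_abs, Real.norm_eq_abs, show x + t - (x - t) = 2 * t by ring,
    abs_of_pos (by linarith : 0 < 2 * t)] at h2
  have h3 : 2 * t ≤ 2 * √(2 * t) := by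
    have h4 := Real.mul_self_sqrt (by linarith : 0 ≤ 2 * t)
    have h5 : √(2 * t) ≤ 2 := by
      rw [Real.sqrt_le_left (by norm_num)]; linarith
    nlinarith [Real.sqrt_nonneg (2 * t)]
  have hw := bracketWeight_pos β x
  calc _ ≤ c * (2 ^ β * bracketWeight β x) * (2 * t) := h2
    _ ≤ c * (2 ^ β * bracketWeight β x) * (2 * √(2 * t)) := by gcongr
    _ = _ := by ring

/-! ### Increments of the derivative of the weighted reciprocal. -/

/-- The derivative of `⟨x⟩^{-β} weylSum`. -/
def weightedWeylDeriv (β : ℝ) (W : ℝ → ℝ) (k : ℂ) (x : ℝ) : ℂ :=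
  bracketWeightDeriv β x * weylSum W k x + bracketWeight β x * weylSqDiff W k x

/-- The constant in `enorm_weightedWeylDeriv_sub_le`. -/
def weightConst (β : ℝ) : ℝ := 2 ^ β * (1 + β) + 2 * (β * (β + 3)) * 2 ^ β + 2 * β * 2 ^ β

section
variable {W : ℝ → ℝ} {k : ℂ}

theorem hasDerivAt_weighted_weylSum (β : ℝ) (hW : Continuous W) (hk : SectorialParameter k)
    (ht : TameNoise ‖k‖ W) (ht' : TameNoise ‖k‖ (reflectPrimitive W)) (x : ℝ) :
    HasDerivAt (fun x => (bracketWeight β x : ℂ) * weylSum W k x) (weightedWeylDeriv β W k x) x :=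
  (hasDerivAt_bracketWeight β x).ofReal_comp.mul (hasDerivAt_weylSum hW hk ht ht' x)

theorem enorm_ofReal_mul_le {a b : ℝ} (h : |a| ≤ b) (z : ℂ) :
    ‖(a : ℂ) * z‖ₑ ≤ ENNReal.ofReal b * ‖z‖ₑ := by
  rw [enorm_mul, ← ofReal_norm, Complex.norm_real, Real.norm_eq_abs]
  exact mul_le_mul_left (ENNReal.ofReal_le_ofReal h) _

theorem enorm_weightedWeylDeriv_le {β : ℝ} (hβ : 0 ≤ β) (hW : Continuous W)
    (hk : SectorialParameter k) (ht : TameNoise ‖k‖ W) (ht' : TameNoise ‖k‖ (reflectPrimitive W))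
    (x : ℝ) : ‖weightedWeylDeriv β W k x‖ₑ ≤ ENNReal.ofReal (bracketWeight β x)
      * (ENNReal.ofReal (2 * (β + 1) * ‖k‖) * twoSidedBound ‖k‖ W x ^ 2) := by
  have hT := one_le_twoSidedBound ‖k‖ W x
  have hw := (bracketWeight_pos β x).le
  have h1 := enorm_ofReal_mul_le (abs_bracketWeightDeriv_le hβ x) (weylSum W k x)
  have h2 := enorm_ofReal_mul_le (abs_of_pos (bracketWeight_pos β x)).le (weylSqDiff W k x)
  have h3 := enorm_weylSum_le hW hk ht ht' x
  have h4 := enorm_weylSqDiff_le hW hk ht ht' x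
  set T := twoSidedBound ‖k‖ W x
  have hT2 : T ≤ T ^ 2 := by rw [sq]; exact le_mul_of_one_le_left' hT
  calc ‖weightedWeylDeriv β W k x‖ₑ ≤ _ := enorm_add_le _ _
    _ ≤ ENNReal.ofReal (β * bracketWeight β x) * (2 * (ENNReal.ofReal ‖k‖ * T ^ 2))
        + ENNReal.ofReal (bracketWeight β x) * (2 * (ENNReal.ofReal ‖k‖ * T ^ 2)) := by
        refine add_le_add (h1.trans (mul_le_mul_right (h3.trans ?_) _))
          (h2.trans (mul_le_mul_right h4 _))
        gcongr
    _ = _ := by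
        rw [ENNReal.ofReal_mul hβ, ENNReal.ofReal_mul (by positivity : 0 ≤ 2 * (β + 1)),
          ENNReal.ofReal_mul (by norm_num : (0 : ℝ) ≤ 2), ENNReal.ofReal_add hβ zero_le_one,
          ENNReal.ofReal_ofNat, ENNReal.ofReal_one]
        ring

/-- The product rule for differences gives four terms; the smooth weight contributes an increment of
order t ≤ √t times itself, and weights at points within distance 1 of x are comparable to the weight
at x. The constant is 7 = 1 + 2 + 2 + 2. -/
theorem enorm_weightedWeylDeriv_sub_le {β : ℝ} (hβ : 0 ≤ β) (hW : Continuous W)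
    (hk : SectorialParameter k) (ht : TameNoise ‖k‖ W) (ht' : TameNoise ‖k‖ (reflectPrimitive W))
    {x t : ℝ} (ht0 : 0 < t) (ht1 : t ≤ 1) :
    ‖weightedWeylDeriv β W k (x + t) - weightedWeylDeriv β W k (x - t)‖ₑ
      ≤ ENNReal.ofReal (weightConst β * (bracketWeight β x * √(2 * t)))
        * (7 * (ENNReal.ofReal ‖k‖ * pairBound ‖k‖ W (x - t) (x + t) ^ 2)) := by
  have hyz : x - t < x + t := by linarith
  have hd : x + t - (x - t) = 2 * t := by ring
  have a1 := enorm_weylSum_sub_le hW hk ht ht' hyz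
  have a2 := enorm_weylSqDiff_sub_le hW hk ht ht' hyz
  have a3 := enorm_weylSum_le hW hk ht ht' (x - t)
  have a4 := enorm_weylSqDiff_le hW hk ht ht' (x - t)
  rw [hd] at a1 a2
  have hTD : twoSidedBound ‖k‖ W (x - t) ≤ pairBound ‖k‖ W (x - t) (x + t) :=
    le_self_add.trans le_add_self
  have hD := (one_le_twoSidedBound ‖k‖ W (x - t)).trans hTD
  set D := pairBound ‖k‖ W (x - t) (x + t)
  set T := twoSidedBound ‖k‖ W (x - t)
  have hD2 : D ≤ D ^ 2 := by rw [sq]; exact le_mul_of_one_le_left' hD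
  have hw := bracketWeight_pos β x
  set s := √(2 * t)
  have hs : 0 ≤ s := Real.sqrt_nonneg _
  set A := weightConst β with hA
  have hp : (0 : ℝ) < 2 ^ β := by positivity
  have hxt : |x + t - x| ≤ 1 := by rw [add_sub_cancel_left, abs_of_pos ht0]; exact ht1
  have b0 := bracketWeight_le hβ hxt
  have c1 : 2 ^ β * (1 + β) ≤ A := by
    rw [hA, weightConst]
    have : 0 ≤ 2 * (β * (β + 3)) * 2 ^ β := by positivity
    have : 0 ≤ 2 * β * 2 ^ β := by positivity
    linarith
  have b1 : |bracketWeight β (x + t)| ≤ A * bracketWeight β x := by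
    rw [abs_of_pos (bracketWeight_pos _ _)]
    refine b0.trans (mul_le_mul_of_nonneg_right (le_trans ?_ c1) hw.le)
    nlinarith
  have b2 : |bracketWeightDeriv β (x + t)| ≤ A * bracketWeight β x := by
    refine (abs_bracketWeightDeriv_le hβ _).trans ?_
    calc β * bracketWeight β (x + t) ≤ β * (2 ^ β * bracketWeight β x) := by gcongr
      _ = (2 ^ β * β) * bracketWeight β x := by ring
      _ ≤ _ := mul_le_mul_of_nonneg_right (le_trans (by nlinarith) c1) hw.le
  have b3 : |bracketWeight β (x + t) - bracketWeight β (x - t)| ≤ A * (bracketWeight β x * s) := by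
    refine (abs_sub_le_of_bracketWeight hβ hβ (hasDerivAt_bracketWeight β)
      (abs_bracketWeightDeriv_le hβ) ht0 ht1).trans (mul_le_mul_of_nonneg_right ?_ (by positivity))
    rw [hA, weightConst]
    have : 0 ≤ 2 * (β * (β + 3)) * 2 ^ β := by positivity
    have : 0 ≤ 2 ^ β * (1 + β) := by positivity
    linarith
  have b4 : |bracketWeightDeriv β (x + t) - bracketWeightDeriv β (x - t)|
      ≤ A * (bracketWeight β x * s) := by
    choose f'' hf'' hb using exists_hasDerivAt_bracketWeightDeriv hβ
    refine (abs_sub_le_of_bracketWeight hβ (by positivity) hf''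
      hb ht0 ht1).trans (mul_le_mul_of_nonneg_right ?_ (by positivity))
    rw [hA, weightConst]
    have : 0 ≤ 2 * β * 2 ^ β := by positivity
    have : 0 ≤ 2 ^ β * (1 + β) := by positivity
    linarith
  have hA0 : 0 ≤ A := le_trans (by positivity) c1
  have hκ : 1 ≤ ENNReal.ofReal ‖k‖ := by
    rw [← ENNReal.ofReal_one]; exact ENNReal.ofReal_le_ofReal hk.one_le
  have e : weightedWeylDeriv β W k (x + t) - weightedWeylDeriv β W k (x - t)
      = ((bracketWeightDeriv β (x + t) : ℝ) : ℂ) * (weylSum W k (x + t) - weylSum W k (x - t))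
        + ((bracketWeightDeriv β (x + t) - bracketWeightDeriv β (x - t) : ℝ) : ℂ)
          * weylSum W k (x - t)
        + ((bracketWeight β (x + t) : ℝ) : ℂ) * (weylSqDiff W k (x + t) - weylSqDiff W k (x - t))
        + ((bracketWeight β (x + t) - bracketWeight β (x - t) : ℝ) : ℂ)
          * weylSqDiff W k (x - t) := by
    simp only [weightedWeylDeriv]; push_cast; ring
  have es : ENNReal.ofReal (A * (bracketWeight β x * s))
      = ENNReal.ofReal (A * bracketWeight β x) * ENNReal.ofReal s := by
    rw [← ENNReal.ofReal_mul (by positivity)]; congr 1; ring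
  rw [e]
  calc _ ≤ _ := enorm_add_le _ _
    _ ≤ _ := add_le_add_left ((enorm_add_le _ _).trans (add_le_add_left (enorm_add_le _ _) _)) _
    _ ≤ ENNReal.ofReal (A * bracketWeight β x) * (ENNReal.ofReal s * (ENNReal.ofReal ‖k‖ * D ^ 2))
        + ENNReal.ofReal (A * (bracketWeight β x * s)) * (2 * (ENNReal.ofReal ‖k‖ * D ^ 2))
        + ENNReal.ofReal (A * bracketWeight β x)
          * (2 * (ENNReal.ofReal ‖k‖ * (ENNReal.ofReal s * D ^ 2)))
        + ENNReal.ofReal (A * (bracketWeight β x * s)) * (2 * (ENNReal.ofReal ‖k‖ * D ^ 2)) := by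
        refine add_le_add (add_le_add (add_le_add ?_ ?_) ?_) ?_
        · refine (enorm_ofReal_mul_le b2 _).trans (mul_le_mul_right (a1.trans ?_) _)
          exact mul_le_mul_right (hD2.trans (le_mul_of_one_le_left' hκ)) _
        · refine (enorm_ofReal_mul_le b4 _).trans (mul_le_mul_right (a3.trans ?_) _)
          exact mul_le_mul_right (mul_le_mul_right (hTD.trans hD2) _) _
        · exact (enorm_ofReal_mul_le b1 _).trans (mul_le_mul_right a2 _)
        · refine (enorm_ofReal_mul_le b3 _).trans (mul_le_mul_right (a4.trans ?_) _)
          gcongr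
    _ = _ := by rw [es]; ring

end

end

section
/-! ### Sobolev norms through increments of the derivative -/

theorem integral_smul_fourier_eq {f g : ℝ → ℂ} (hf : Integrable f) (hg : Integrable g) :
    ∫ x, 𝓕 f x • g x = ∫ x, f x • 𝓕 g x := by
  simpa using! VectorFourier.integral_fourierIntegral_smul_eq_flip (L := innerₗ ℝ)
      (μ := volume) (ν := volume) Real.continuous_fourierChar continuous_inner hf hg

theorem continuous_fourier {f : ℝ → ℂ} (hf : Integrable f) : Continuous (𝓕 f) :=
  VectorFourier.fourierIntegral_continuous Real.continuous_fourierChar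
    (by exact continuous_inner) hf

/-- On `L¹ ∩ L²` the Plancherel transform is given by the Fourier integral. -/
theorem fourier_toLp_ae_eq {f : ℝ → ℂ} (h1 : Integrable f) (h2 : MemLp f 2 volume) :
    ((𝓕 (h2.toLp f) : Lp (α := ℝ) ℂ 2 volume) : ℝ → ℂ) =ᵐ[volume] 𝓕 f := by
  refine ae_eq_of_integral_contDiff_smul_eq
    ((Lp.memLp _).locallyIntegrable (by norm_num)) (continuous_fourier h1).locallyIntegrable
    fun g hg hgs => ?_
  have hG1 : HasCompactSupport fun x => (g x : ℂ) := hgs.comp_left Complex.ofReal_zero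
  have hG2 : ContDiff ℝ (⊤ : ℕ∞) fun x => (g x : ℂ) := Complex.ofRealCLM.contDiff.comp hg
  set G : 𝓢(ℝ, ℂ) := hG1.toSchwartzMap hG2 with hG
  have hGg (x : ℝ) : G x = (g x : ℂ) := rfl
  -- Both transforms satisfy the same duality relation against test functions: one as a tempered
  -- distribution, the other by Fubini.
  have e1 := congrArg (fun T : 𝓢'(ℝ, ℂ) => T G) (Lp.fourier_toTemperedDistribution_eq (h2.toLp f))
  simp only [TemperedDistribution.fourier_apply, Lp.toTemperedDistribution_apply] at e1
  calc ∫ x, g x • (𝓕 (h2.toLp f) : Lp (α := ℝ) ℂ 2 volume) x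
      = ∫ x, G x • (𝓕 (h2.toLp f) : Lp (α := ℝ) ℂ 2 volume) x := by
        refine integral_congr_ae (Eventually.of_forall fun x => ?_)
        simp [hGg]
    _ = ∫ x, (𝓕 G) x • (h2.toLp f) x := e1.symm
    _ = ∫ x, 𝓕 (G : ℝ → ℂ) x • f x := by
        refine integral_congr_ae ?_
        filter_upwards [h2.coeFn_toLp] with x hx
        rw [hx, SchwartzMap.fourier_coe]
    _ = ∫ x, G x • 𝓕 f x := integral_smul_fourier_eq G.integrable h1
    _ = _ := by
        refine integral_congr_ae (Eventually.of_forall fun x => ?_)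
        simp [hGg]

theorem lintegral_enorm_sq_eq_eLpNorm (f : ℝ → ℂ) :
    ∫⁻ x, ‖f x‖ₑ ^ 2 = eLpNorm f 2 volume ^ 2 := by
  rw [eLpNorm_eq_lintegral_rpow_enorm_toReal (by norm_num) (by norm_num), ← ENNReal.rpow_natCast,
    ← ENNReal.rpow_mul]
  simp

theorem lintegral_enorm_fourier_sq {f : ℝ → ℂ} (h1 : Integrable f) (h2 : MemLp f 2 volume) :
    ∫⁻ η, ‖𝓕 f η‖ₑ ^ 2 = ∫⁻ x, ‖f x‖ₑ ^ 2 := by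
  have h3 := fourier_toLp_ae_eq h1 h2
  have h4 : eLpNorm (𝓕 f) 2 volume = eLpNorm f 2 volume := by
    rw [← eLpNorm_congr_ae h3, ← eLpNorm_congr_ae h2.coeFn_toLp, ← Lp.enorm_def, ← Lp.enorm_def,
      ← ofReal_norm, ← ofReal_norm, Lp.norm_fourier_eq]
  rw [lintegral_enorm_sq_eq_eLpNorm, lintegral_enorm_sq_eq_eLpNorm, h4]

theorem sobolevNorm_eq {f : ℝ → ℂ} (h1 : Integrable f) (h2 : MemLp f 2 volume) (s : ℝ) :
    sobolevNorm s f = (∫⁻ η : ℝ, ENNReal.ofReal ((4 + (2 * Real.pi * η) ^ 2) ^ s)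
      * ‖𝓕 f η‖ₑ ^ 2) ^ (1 / 2 : ℝ) := by
  rw [sobolevNorm, dif_pos h2]
  congr 1
  refine lintegral_congr_ae ?_
  filter_upwards [fourier_toLp_ae_eq h1 h2] with η hη
  rw [hη]

theorem sobolevNorm_mono {s s' : ℝ} (h : s ≤ s') (f : ℝ → ℂ) :
    sobolevNorm s f ≤ sobolevNorm s' f := by
  unfold sobolevNorm
  split_ifs with hf
  · gcongr with η
    nlinarith [sq_nonneg (2 * Real.pi * η)]
  · exact le_rfl

theorem fourier_comp_add_right (f : ℝ → ℂ) (t η : ℝ) :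
    𝓕 (fun x => f (x + t)) η = Complex.exp ((2 * Real.pi * η * t : ℝ) * Complex.I) * 𝓕 f η := by
  rw [Real.fourier_real_eq_integral_exp_smul, Real.fourier_real_eq_integral_exp_smul,
    ← integral_add_right_eq_self (μ := volume) (fun v => Complex.exp (↑(-2 * Real.pi * v * η)
      * Complex.I) • f v) t, ← integral_const_mul]
  refine integral_congr_ae (Eventually.of_forall fun x => ?_)
  simp only [smul_eq_mul]
  rw [← mul_assoc, ← Complex.exp_add]
  congr 2
  push_cast
  ring

/-- The centred difference of F' acts on the Fourier side as multiplication by -2ξ sin(ξt), with ξ =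
2πη. -/
theorem fourier_increment_deriv {F F' : ℝ → ℂ} (hd : ∀ x, HasDerivAt F (F' x) x)
    (hF : Integrable F) (hF' : Integrable F') (t η : ℝ) :
    ‖𝓕 (fun x => F' (x + t) - F' (x - t)) η‖ₑ ^ 2
      = ENNReal.ofReal (4 * Real.sin (2 * Real.pi * η * t) ^ 2 * (2 * Real.pi * η) ^ 2)
        * ‖𝓕 F η‖ₑ ^ 2 := by
  have e : F' = deriv F := funext fun x => (hd x).deriv.symm
  have h1 : 𝓕 F' η = (2 * Real.pi * Complex.I * η) * 𝓕 F η := by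
    have := congrFun (Real.fourier_deriv hF (fun x => (hd x).differentiableAt) (e ▸ hF')) η
    rw [e, this, smul_eq_mul]
  have h2 : 𝓕 (fun x => F' (x + t) - F' (x - t)) η
      = 𝓕 (fun x => F' (x + t)) η - 𝓕 (fun x => F' (x + -t)) η := by
    simp only [Real.fourier_real_eq, ← sub_eq_add_neg]
    rw [← integral_sub]
    · simp only [smul_sub]
    · exact (Real.fourierIntegral_convergent_iff (V := ℝ) η).2 (hF'.comp_add_right t) |>.congr
        (Eventually.of_forall fun x => by simp [mul_comm])
    · exact (Real.fourierIntegral_convergent_iff (V := ℝ) η).2 (hF'.comp_sub_right t) |>.congr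
        (Eventually.of_forall fun x => by simp [mul_comm])
  have h3 : 𝓕 (fun x => F' (x + t) - F' (x - t)) η
      = 2 * Real.sin (2 * Real.pi * η * t) * Complex.I * (2 * Real.pi * η) * Complex.I * 𝓕 F η := by
    rw [h2, fourier_comp_add_right, fourier_comp_add_right, h1, Complex.ofReal_sin]
    have hs := Complex.two_sin ((2 * Real.pi * η * t : ℝ) : ℂ)
    have e2 : ((2 * Real.pi * η * -t : ℝ) : ℂ) = -((2 * Real.pi * η * t : ℝ) : ℂ) := by
      push_cast; ring
    rw [e2, hs]
    linear_combination (Complex.exp (((2 * Real.pi * η * t : ℝ) : ℂ) * Complex.I)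
      - Complex.exp (-((2 * Real.pi * η * t : ℝ) : ℂ) * Complex.I))
      * 2 * Real.pi * η * 𝓕 F η * Complex.I * Complex.I_sq
  rw [h3, ← ofReal_norm, ← ENNReal.ofReal_pow (norm_nonneg _), norm_mul, mul_pow,
    ENNReal.ofReal_mul (by positivity), ENNReal.ofReal_pow (norm_nonneg (𝓕 F η)), ofReal_norm]
  congr 2
  simp only [norm_mul, Complex.norm_I, Complex.norm_real, mul_one, Complex.norm_ofNat,
    Real.norm_eq_abs, mul_pow, sq_abs]
  ring

/-- Keep only 1/(2|ξ|) < t < 1/|ξ|, where the sine is at least 1/4 and t^{1-2s} at least |ξ|^{2s-1}.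
The interval has length 1/(2|ξ|), which accounts for the 8. -/
theorem le_lintegral_sin_sq {s : ℝ} (hs1 : 1 ≤ s) {ξ : ℝ} (hξ : 1 ≤ |ξ|) :
    ENNReal.ofReal (|ξ| ^ (2 * s) / 8) ≤ ∫⁻ t in Ioo (0 : ℝ) 1,
      ENNReal.ofReal (t ^ (1 - 2 * s)) * ENNReal.ofReal (4 * Real.sin (ξ * t) ^ 2 * ξ ^ 2) := by
  have hξ0 : 0 < |ξ| := by linarith
  have hsub : Ioo (1 / (2 * |ξ|)) (1 / |ξ|) ⊆ Ioo (0 : ℝ) 1 := by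
    refine Ioo_subset_Ioo (by positivity) ?_
    rw [div_le_one hξ0]; exact hξ
  refine le_trans ?_ (lintegral_mono_set hsub)
  have hpt : ∀ t ∈ Ioo (1 / (2 * |ξ|)) (1 / |ξ|), ENNReal.ofReal (|ξ| ^ (2 * s - 1) * (ξ ^ 2 / 4))
      ≤ ENNReal.ofReal (t ^ (1 - 2 * s)) * ENNReal.ofReal (4 * Real.sin (ξ * t) ^ 2 * ξ ^ 2) := by
    intro t ht
    have ht0 : 0 < t := lt_trans (by positivity) ht.1
    have ht1 : |ξ| * t ≤ 1 := by
      have := ht.2.le; rw [le_div_iff₀ hξ0] at this; linarith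
    have ht2 : 1 / 2 ≤ |ξ| * t := by
      have := ht.1.le
      rw [div_le_iff₀ (by positivity)] at this; linarith
    rw [← ENNReal.ofReal_mul (by positivity)]
    refine ENNReal.ofReal_le_ofReal ?_
    have h1 : |ξ| ^ (2 * s - 1) ≤ t ^ (1 - 2 * s) := by
      have hle : t ≤ |ξ|⁻¹ := by rw [← one_div]; exact ht.2.le
      have := Real.rpow_le_rpow_of_nonpos ht0 hle (by linarith : 1 - 2 * s ≤ 0)
      rw [Real.inv_rpow hξ0.le, ← Real.rpow_neg hξ0.le, neg_sub] at this
      exact this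
    have h2 : 1 / 4 ≤ Real.sin (|ξ| * t) := by
      have hpi := Real.pi_gt_three
      have hpi4 := Real.pi_le_four
      have h3 := Real.mul_le_sin (x := |ξ| * t) (by positivity) (by linarith)
      have h4 : 1 / 2 ≤ 2 / Real.pi := by
        rw [div_le_div_iff₀ (by norm_num) Real.pi_pos]; linarith
      nlinarith
    have h3 : Real.sin (ξ * t) ^ 2 = Real.sin (|ξ| * t) ^ 2 := by
      rcases abs_cases ξ with ⟨h, -⟩ | ⟨h, -⟩ <;> rw [h]
      rw [neg_mul, Real.sin_neg, neg_sq]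
    rw [h3]
    have h4 : (1 : ℝ) / 16 ≤ Real.sin (|ξ| * t) ^ 2 := by nlinarith
    have h5 : ξ ^ 2 / 4 ≤ 4 * Real.sin (|ξ| * t) ^ 2 * ξ ^ 2 := by nlinarith [sq_nonneg ξ]
    exact mul_le_mul h1 h5 (by positivity) (by positivity)
  refine le_trans ?_ (setLIntegral_mono' measurableSet_Ioo hpt)
  rw [setLIntegral_const, Real.volume_Ioo, ← ENNReal.ofReal_mul (by positivity)]
  refine ENNReal.ofReal_le_ofReal (le_of_eq ?_)
  rw [Real.rpow_sub_one hξ0.ne', ← sq_abs ξ]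
  field_simp
  norm_num

/-- Low frequencies are paid for by the L² norm, high ones by the increments; 200 = 8 · 25, where 25
bounds 5^s. -/
theorem sobolevWeight_le {s : ℝ} (hs1 : 1 ≤ s) (hs2 : s ≤ 2) (ξ : ℝ) :
    ENNReal.ofReal ((4 + ξ ^ 2) ^ s) ≤ 200 * (1 + ∫⁻ t in Ioo (0 : ℝ) 1,
      ENNReal.ofReal (t ^ (1 - 2 * s)) * ENNReal.ofReal (4 * Real.sin (ξ * t) ^ 2 * ξ ^ 2)) := by
  have h5 : (5 : ℝ) ^ s ≤ 25 := by
    calc (5 : ℝ) ^ s ≤ 5 ^ (2 : ℝ) := Real.rpow_le_rpow_of_exponent_le (by norm_num) hs2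
      _ = 25 := by norm_num
  rcases le_or_gt |ξ| 1 with h | h
  · refine le_trans ?_ (mul_le_mul_right le_self_add 200)
    rw [mul_one, show (200 : ℝ≥0∞) = ENNReal.ofReal 200 by norm_num]
    refine ENNReal.ofReal_le_ofReal ?_
    have : ξ ^ 2 ≤ 1 := by rw [← sq_abs]; exact pow_le_one₀ (abs_nonneg _) h
    calc (4 + ξ ^ 2) ^ s ≤ 5 ^ s := Real.rpow_le_rpow (by positivity) (by linarith) (by linarith)
      _ ≤ 200 := by linarith
  · refine le_trans ?_ (mul_le_mul_right (le_add_left (le_lintegral_sin_sq hs1 h.le)) 200)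
    rw [show (200 : ℝ≥0∞) = ENNReal.ofReal 200 by norm_num, ← ENNReal.ofReal_mul (by norm_num)]
    refine ENNReal.ofReal_le_ofReal ?_
    have h1 : 1 ≤ ξ ^ 2 := by rw [← sq_abs]; exact one_le_pow₀ h.le
    calc (4 + ξ ^ 2) ^ s ≤ (5 * ξ ^ 2) ^ s :=
          Real.rpow_le_rpow (by positivity) (by linarith) (by linarith)
      _ = 5 ^ s * |ξ| ^ (2 * s) := by
          rw [Real.mul_rpow (by norm_num) (by positivity), ← sq_abs, ← Real.rpow_natCast,
            ← Real.rpow_mul (abs_nonneg _)]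
          norm_num
      _ ≤ 25 * |ξ| ^ (2 * s) := by gcongr
      _ = _ := by ring

theorem sobolevNorm_sq_le {s : ℝ} (hs1 : 1 ≤ s) (hs2 : s ≤ 2) {F F' : ℝ → ℂ}
    (hd : ∀ x, HasDerivAt F (F' x) x) (hF1 : Integrable F) (hF2 : MemLp F 2 volume)
    (hF1' : Integrable F') (hF2' : MemLp F' 2 volume) :
    sobolevNorm s F ^ 2 ≤ 200 * ((∫⁻ x, ‖F x‖ₑ ^ 2) + ∫⁻ t in Ioo (0 : ℝ) 1,
      ENNReal.ofReal (t ^ (1 - 2 * s)) * ∫⁻ x, ‖F' (x + t) - F' (x - t)‖ₑ ^ 2) := by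
  have hpl (t : ℝ) : ∫⁻ x, ‖F' (x + t) - F' (x - t)‖ₑ ^ 2
      = ∫⁻ η, ENNReal.ofReal (4 * Real.sin (2 * Real.pi * η * t) ^ 2 * (2 * Real.pi * η) ^ 2)
        * ‖𝓕 F η‖ₑ ^ 2 := by
    have i1 : Integrable fun x => F' (x + t) - F' (x - t) :=
      (hF1'.comp_add_right t).sub (hF1'.comp_sub_right t)
    have i2 : MemLp (fun x => F' (x + t) - F' (x - t)) 2 volume :=
      (hF2'.comp_measurePreserving (measurePreserving_add_right volume t)).sub
        (hF2'.comp_measurePreserving (measurePreserving_sub_right volume t))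
    rw [← lintegral_enorm_fourier_sq i1 i2]
    exact lintegral_congr fun η => fourier_increment_deriv hd hF1 hF1' t η
  have hcF : Measurable fun η => ‖𝓕 F η‖ₑ ^ 2 := ((continuous_fourier hF1).measurable.enorm).pow_const 2
  have hm : Measurable fun p : ℝ × ℝ => ENNReal.ofReal (p.1 ^ (1 - 2 * s)) * (ENNReal.ofReal
      (4 * Real.sin (2 * Real.pi * p.2 * p.1) ^ 2 * (2 * Real.pi * p.2) ^ 2) * ‖𝓕 F p.2‖ₑ ^ 2) := by
    refine (measurable_fst.pow_const _).ennreal_ofReal.mul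
      (Measurable.mul ?_ (hcF.comp measurable_snd))
    exact (by fun_prop : Continuous fun p : ℝ × ℝ => 4 * Real.sin (2 * Real.pi * p.2 * p.1) ^ 2
      * (2 * Real.pi * p.2) ^ 2).measurable.ennreal_ofReal
  have hswap : ∫⁻ t in Ioo (0 : ℝ) 1,
      ENNReal.ofReal (t ^ (1 - 2 * s)) * ∫⁻ x, ‖F' (x + t) - F' (x - t)‖ₑ ^ 2
      = ∫⁻ η, (∫⁻ t in Ioo (0 : ℝ) 1, ENNReal.ofReal (t ^ (1 - 2 * s)) * ENNReal.ofReal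
      (4 * Real.sin (2 * Real.pi * η * t) ^ 2 * (2 * Real.pi * η) ^ 2)) * ‖𝓕 F η‖ₑ ^ 2 := by
    calc _ = ∫⁻ t in Ioo (0 : ℝ) 1, ∫⁻ η, ENNReal.ofReal (t ^ (1 - 2 * s)) * (ENNReal.ofReal
          (4 * Real.sin (2 * Real.pi * η * t) ^ 2 * (2 * Real.pi * η) ^ 2) * ‖𝓕 F η‖ₑ ^ 2) := by
          refine lintegral_congr fun t => ?_
          rw [hpl, lintegral_const_mul' _ _ ENNReal.ofReal_ne_top]
      _ = ∫⁻ η, ∫⁻ t in Ioo (0 : ℝ) 1, ENNReal.ofReal (t ^ (1 - 2 * s)) * (ENNReal.ofReal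
          (4 * Real.sin (2 * Real.pi * η * t) ^ 2 * (2 * Real.pi * η) ^ 2) * ‖𝓕 F η‖ₑ ^ 2) :=
          lintegral_lintegral_swap hm.aemeasurable
      _ = _ := by
          refine lintegral_congr fun η => ?_
          rw [← lintegral_mul_const' _ _ (by simp)]
          simp_rw [mul_assoc]
  rw [sobolevNorm_eq hF1 hF2, ← ENNReal.rpow_natCast, ← ENNReal.rpow_mul]
  norm_num only
  rw [ENNReal.rpow_one, hswap, ← lintegral_enorm_fourier_sq hF1 hF2, ← lintegral_add_left hcF,
    ← lintegral_const_mul' _ _ (by simp)]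
  refine lintegral_mono fun η => ?_
  refine (mul_le_mul_left (sobolevWeight_le hs1 hs2 (2 * Real.pi * η)) _).trans (le_of_eq ?_)
  ring

end

section
open scoped NNReal

/-! ### Moments of the weighted norms -/

theorem lintegral_bracketWeight_rpow_lt_top {β p : ℝ} (hβp : 1 < β * p) :
    ∫⁻ x, ENNReal.ofReal (bracketWeight β x) ^ p < ∞ := by
  have h1 : Integrable (fun x : ℝ => ((1 : ℝ) + ‖x‖ ^ 2) ^ (-(β * p) / 2)) :=
    integrable_rpow_neg_one_add_norm_sq (by simpa using hβp)
  refine lt_of_eq_of_lt (lintegral_congr fun x => ?_) h1.lintegral_lt_top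
  rw [ENNReal.ofReal_rpow_of_pos (bracketWeight_pos β x), bracketWeight,
    ← Real.rpow_mul (by positivity), Real.norm_eq_abs, sq_abs]
  congr 2
  ring

theorem measurable_ofReal_bracketWeight (β : ℝ) :
    Measurable fun x => ENNReal.ofReal (bracketWeight β x) :=
  (continuous_bracketWeight β).measurable.ennreal_ofReal

section
variable {Ω : Type*} [MeasurableSpace Ω] {P : Measure Ω} {W : Ω → ℝ → ℝ} {C : ℝ → ℝ≥0}

theorem lintegral_lintegral_rpow_le [SFinite P] {Φ : Ω → ℝ → ℂ}
    (hΦ : Measurable (Function.uncurry Φ)) {β p : ℝ} {K : ℝ≥0∞}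
    (h : ∀ x, ∫⁻ ω, ‖Φ ω x‖ₑ ^ p ∂P ≤ ENNReal.ofReal (bracketWeight β x) ^ p * K) :
    ∫⁻ ω, (∫⁻ x, ‖Φ ω x‖ₑ ^ p) ∂P
      ≤ (∫⁻ x, ENNReal.ofReal (bracketWeight β x) ^ p) * K := by
  rw [lintegral_lintegral_swap (hΦ.enorm.pow_const p).aemeasurable,
    ← lintegral_mul_const _ ((measurable_ofReal_bracketWeight β).pow_const p)]
  exact lintegral_mono h

theorem ae_memLp [SFinite P] {Φ : Ω → ℝ → ℂ} (hΦ : Measurable (Function.uncurry Φ)) {β p : ℝ}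
    {K : ℝ≥0∞} (hp : 0 < p) (hβp : 1 < β * p) (hK : K < ∞)
    (h : ∀ x, ∫⁻ ω, ‖Φ ω x‖ₑ ^ p ∂P ≤ ENNReal.ofReal (bracketWeight β x) ^ p * K) :
    ∀ᵐ ω ∂P, MemLp (Φ ω) (ENNReal.ofReal p) volume := by
  have h1 : ∀ᵐ ω ∂P, ∫⁻ x, ‖Φ ω x‖ₑ ^ p < ∞ := by
    have hm : Measurable fun q : Ω × ℝ => ‖Φ q.1 q.2‖ₑ ^ p := hΦ.enorm.pow_const p
    refine ae_lt_top hm.lintegral_prod_right' ?_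
    exact ((lintegral_lintegral_rpow_le hΦ h).trans_lt
      (ENNReal.mul_lt_top (lintegral_bracketWeight_rpow_lt_top hβp) hK)).ne
  filter_upwards [h1] with ω hω
  have hmω := hΦ.fun_comp (measurable_prodMk_left (x := ω))
  refine ⟨hmω.aestronglyMeasurable, ?_⟩
  rw [eLpNorm_eq_lintegral_rpow_enorm_toReal (by simpa using hp) ENNReal.ofReal_ne_top,
    ENNReal.toReal_ofReal hp.le]
  exact ENNReal.rpow_lt_top_of_nonneg (by positivity) hω.ne

theorem ae_integrable_and_memLp [SFinite P] {Φ : Ω → ℝ → ℂ}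
    (hΦ : Measurable (Function.uncurry Φ)) {β : ℝ} {K : ℝ → ℝ≥0∞} (hβ : 1 < β)
    (hK : ∀ p, 1 ≤ p → K p < ∞)
    (h : ∀ p, 1 ≤ p → ∀ x, ∫⁻ ω, ‖Φ ω x‖ₑ ^ p ∂P
      ≤ ENNReal.ofReal (bracketWeight β x) ^ p * K p) :
    ∀ᵐ ω ∂P, Integrable (Φ ω) ∧ MemLp (Φ ω) 2 volume := by
  have h1 := ae_memLp hΦ one_pos (by linarith) (hK 1 le_rfl) (h 1 le_rfl)
  have h2 := ae_memLp hΦ two_pos (by linarith) (hK 2 one_le_two) (h 2 one_le_two)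
  filter_upwards [h1, h2] with ω h1 h2
  rw [ENNReal.ofReal_one] at h1
  rw [ENNReal.ofReal_ofNat] at h2
  exact ⟨memLp_one_iff_integrable.1 h1, h2⟩

theorem RegularProcess.exists_measurable_weylSum [IsProbabilityMeasure P]
    (h : RegularProcess P W C) {k : ℂ} (hk : SectorialParameter k) :
    ∃ H S : Ω → ℝ → ℂ, Measurable (Function.uncurry H) ∧ Measurable (Function.uncurry S) ∧
      ∀ᵐ ω ∂P, weylSum (W ω) k = H ω ∧ weylSqDiff (W ω) k = S ω := by
  obtain ⟨G, hG, hGW⟩ := h.exists_measurable_weylM hk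
  obtain ⟨G', hG', hGW'⟩ := h.reflect.exists_measurable_weylM hk
  have hG'n := hG'.fun_comp (measurable_fst.prodMk measurable_snd.neg :
    Measurable fun p : Ω × ℝ => (p.1, -p.2))
  refine ⟨fun ω x => G ω x + G' ω (-x), fun ω x => G ω x ^ 2 - G' ω (-x) ^ 2,
    hG.add hG'n, ?_, ?_⟩
  · have h1 : Measurable fun p : Ω × ℝ => Function.uncurry G p ^ 2 := hG.pow_const 2
    have h2 : Measurable fun p : Ω × ℝ => Function.uncurry G' (p.1, -p.2) ^ 2 := hG'n.pow_const 2
    exact h1.sub h2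
  filter_upwards [hGW, hGW'] with ω h1 h2
  refine ⟨funext fun x => ?_, funext fun x => ?_⟩
  · simp only [weylSum, h1, h2]
  · simp only [weylSqDiff, h1, h2]

theorem RegularProcess.ae_tameNoise_both [IsProbabilityMeasure P] (h : RegularProcess P W C)
    (κ : ℝ) (hκ : 0 ≤ κ) :
    ∀ᵐ ω ∂P, TameNoise κ (W ω) ∧ TameNoise κ (reflectPrimitive (W ω)) := by
  filter_upwards [h.ae_tameNoise hκ, h.reflect.ae_tameNoise hκ] with ω h1 h2
  exact ⟨h1, h2⟩

/-- The function `⟨x⟩^{-β} / g(x)`. -/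
def weightedWeylSum (β : ℝ) (W : ℝ → ℝ) (k : ℂ) (x : ℝ) : ℂ :=
  (bracketWeight β x : ℂ) * weylSum W k x

theorem enorm_weightedWeylSum {β : ℝ} {W : ℝ → ℝ} {k : ℂ} (x : ℝ) :
    ‖weightedWeylSum β W k x‖ₑ = ENNReal.ofReal (bracketWeight β x) * ‖weylSum W k x‖ₑ := by
  rw [weightedWeylSum, enorm_mul]
  congr 1
  rw [← ofReal_norm, Complex.norm_real, Real.norm_of_nonneg (bracketWeight_pos β x).le]

theorem lintegral_const_mul_rpow_le {α : Type*} [MeasurableSpace α] {μ : Measure α}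
    {f : α → ℝ≥0∞} {c K : ℝ≥0∞} {p : ℝ} (hc : c ≠ ∞) (hp : 0 ≤ p)
    (h : ∫⁻ x, f x ^ p ∂μ ≤ K) : ∫⁻ x, (c * f x) ^ p ∂μ ≤ c ^ p * K := by
  simp_rw [ENNReal.mul_rpow_of_nonneg _ _ hp]
  rw [lintegral_const_mul' _ _ (ENNReal.rpow_ne_top_of_nonneg hp hc)]
  exact mul_le_mul_right h _

theorem RegularProcess.lintegral_weylSum_rpow_le [IsProbabilityMeasure P]
    (h : RegularProcess P W C) {k : ℂ} (hk : SectorialParameter k) (x : ℝ) {p : ℝ} (hp : 1 ≤ p) :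
    ∫⁻ ω, ‖weylSum (W ω) k x‖ₑ ^ p ∂P
      ≤ (2 * ENNReal.ofReal ‖k‖) ^ p * twoSidedMoment C p := by
  refine le_trans (lintegral_mono_ae ?_) (lintegral_const_mul_rpow_le (by finiteness) (by linarith)
    (h.lintegral_twoSidedBound_rpow_le (norm_nonneg k) x hp))
  filter_upwards [h.ae_tameNoise_both ‖k‖ (norm_nonneg k)] with ω hω
  refine ENNReal.rpow_le_rpow ?_ (by linarith)
  rw [mul_assoc]
  exact enorm_weylSum_le (h.continuous ω) hk hω.1 hω.2 x

theorem RegularProcess.lintegral_weightedWeylSum_rpow_le [IsProbabilityMeasure P]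
    (h : RegularProcess P W C) {k : ℂ} (hk : SectorialParameter k) (β x : ℝ) {p : ℝ}
    (hp : 1 ≤ p) :
    ∫⁻ ω, ‖weightedWeylSum β (W ω) k x‖ₑ ^ p ∂P ≤ ENNReal.ofReal (bracketWeight β x) ^ p
      * ((2 * ENNReal.ofReal ‖k‖) ^ p * twoSidedMoment C p) := by
  simp_rw [enorm_weightedWeylSum]
  exact lintegral_const_mul_rpow_le (by finiteness) (by linarith)
    (h.lintegral_weylSum_rpow_le hk x hp)

theorem RegularProcess.lintegral_weightedWeylDeriv_rpow_le [IsProbabilityMeasure P]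
    (h : RegularProcess P W C) {k : ℂ} (hk : SectorialParameter k) {β : ℝ} (hβ : 0 ≤ β) (x : ℝ)
    {p : ℝ} (hp : 1 ≤ p) :
    ∫⁻ ω, ‖weightedWeylDeriv β (W ω) k x‖ₑ ^ p ∂P ≤ ENNReal.ofReal (bracketWeight β x) ^ p
      * (ENNReal.ofReal (2 * (β + 1) * ‖k‖) ^ p * twoSidedMoment C (2 * p)) := by
  have h1 : ∫⁻ ω, (twoSidedBound ‖k‖ (W ω) x ^ 2) ^ p ∂P ≤ twoSidedMoment C (2 * p) := by
    refine le_trans (le_of_eq (lintegral_congr fun ω => ?_))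
      (h.lintegral_twoSidedBound_rpow_le (norm_nonneg k) x (by linarith : 1 ≤ 2 * p))
    rw [← ENNReal.rpow_natCast, ← ENNReal.rpow_mul]
    norm_num
  have h2 := lintegral_const_mul_rpow_le (c := ENNReal.ofReal (bracketWeight β x))
    ENNReal.ofReal_ne_top (by linarith) (lintegral_const_mul_rpow_le
      (c := ENNReal.ofReal (2 * (β + 1) * ‖k‖)) ENNReal.ofReal_ne_top (by linarith) h1)
  refine le_trans (lintegral_mono_ae ?_) h2
  filter_upwards [h.ae_tameNoise_both ‖k‖ (norm_nonneg k)] with ω hω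
  exact ENNReal.rpow_le_rpow
    (enorm_weightedWeylDeriv_le hβ (h.continuous ω) hk hω.1 hω.2 x) (by linarith)

theorem RegularProcess.lintegral_eLpNorm_le [IsProbabilityMeasure P]
    (h : RegularProcess P W C) {k : ℂ} (hk : SectorialParameter k) (β : ℝ) {p : ℝ}
    (hp : 1 ≤ p) :
    AEMeasurable (fun ω => eLpNorm (weightedWeylSum β (W ω) k) (ENNReal.ofReal p) volume) P ∧
      ∫⁻ ω, eLpNorm (weightedWeylSum β (W ω) k) (ENNReal.ofReal p) volume ^ p ∂P
        ≤ (∫⁻ x, ENNReal.ofReal (bracketWeight β x) ^ p)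
          * ((2 * ENNReal.ofReal ‖k‖) ^ p * twoSidedMoment C p) := by
  obtain ⟨H, S, hH, -, hHS⟩ := h.exists_measurable_weylSum hk
  have hp0 : 0 < p := by linarith
  have e (f : ℝ → ℂ) : eLpNorm f (ENNReal.ofReal p) volume = (∫⁻ x, ‖f x‖ₑ ^ p) ^ (1 / p) := by
    rw [eLpNorm_eq_lintegral_rpow_enorm_toReal (by simpa using hp0) ENNReal.ofReal_ne_top,
      ENNReal.toReal_ofReal hp0.le]
  set Φ : Ω → ℝ → ℂ := fun ω x => (bracketWeight β x : ℂ) * H ω x with hΦ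
  have hΦm : Measurable (Function.uncurry Φ) :=
    ((Complex.measurable_ofReal.comp (continuous_bracketWeight β).measurable).comp
      measurable_snd).mul hH
  have hae : ∀ᵐ ω ∂P, weightedWeylSum β (W ω) k = Φ ω := by
    filter_upwards [hHS] with ω hω
    ext x
    rw [weightedWeylSum, hω.1]
  have hm : Measurable fun q : Ω × ℝ => ‖Φ q.1 q.2‖ₑ ^ p := hΦm.enorm.pow_const p
  constructor
  · refine ⟨fun ω => (∫⁻ x, ‖Φ ω x‖ₑ ^ p) ^ (1 / p), hm.lintegral_prod_right'.pow_const _, ?_⟩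
    filter_upwards [hae] with ω hω
    rw [e, hω]
  · refine le_trans (le_of_eq (lintegral_congr_ae ?_)) (lintegral_lintegral_rpow_le hΦm
      fun x => le_trans (le_of_eq (lintegral_congr_ae ?_))
        (h.lintegral_weightedWeylSum_rpow_le hk β x hp))
    · filter_upwards [hae] with ω hω
      rw [e, hω, ← ENNReal.rpow_mul, one_div_mul_cancel hp0.ne', ENNReal.rpow_one]
    · filter_upwards [hae] with ω hω
      rw [hω]

end

end

section
open scoped NNReal

/-! ### Moments of the Sobolev norm -/

section
variable {Ω : Type*} [MeasurableSpace Ω] {P : Measure Ω} {W : Ω → ℝ → ℝ} {C : ℝ → ℝ≥0}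

/-- A substitute for Minkowski's inequality: write Ψ = (Ψ/g) g, apply Jensen for the measure g dμ,
then Fubini. The size of Ψ in the variable a is thereby put into g. -/
theorem lintegral_lintegral_rpow_le_of_weight [SFinite P] {α : Type*} [MeasurableSpace α]
    {μ : Measure α} [SFinite μ] {Ψ : Ω × α → ℝ≥0∞} (hΨ : Measurable Ψ) {g : α → ℝ≥0∞}
    (hg : Measurable g) {r : ℝ} (hr : 1 ≤ r) {K : ℝ≥0∞}
    (h : ∀ᵐ a ∂μ, g a ≠ 0 ∧ g a ≠ ∞ ∧ ∫⁻ ω, Ψ (ω, a) ^ r ∂P ≤ g a ^ r * K) :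
    ∫⁻ ω, (∫⁻ a, Ψ (ω, a) ∂μ) ^ r ∂P ≤ (∫⁻ a, g a ∂μ) ^ (r - 1) * ((∫⁻ a, g a ∂μ) * K) := by
  have hr0 : 0 ≤ r := by linarith
  by_cases hI : ∫⁻ a, g a ∂μ = ∞
  -- For infinite total weight the right side is infinite unless K = 0, in which case Ψ vanishes
  -- almost everywhere.
  · by_cases hK : K = 0
    · have h0 : ∀ᵐ a ∂μ, ∫⁻ ω, Ψ (ω, a) ^ r ∂P = 0 := by
        filter_upwards [h] with a ha
        simpa [hK] using ha.2.2
      have h1 : ∫⁻ ω, (∫⁻ a, Ψ (ω, a) ^ r ∂μ) ∂P = 0 := by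
        rw [lintegral_lintegral_swap (hΨ.pow_const r).aemeasurable, lintegral_congr_ae h0]
        simp
      have hm : Measurable fun ω => ∫⁻ a, Ψ (ω, a) ^ r ∂μ :=
        (hΨ.pow_const r).lintegral_prod_right'
      rw [lintegral_eq_zero_iff hm] at h1
      have h2 : ∀ᵐ ω ∂P, (∫⁻ a, Ψ (ω, a) ∂μ) ^ r = 0 := by
        filter_upwards [h1] with ω hω
        have hmω := (hΨ.pow_const r).fun_comp (measurable_prodMk_left (x := ω))
        have h3 := (lintegral_eq_zero_iff hmω).1 hω
        have h4 : ∫⁻ a, Ψ (ω, a) ∂μ = 0 := by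
          refine (lintegral_congr_ae (g := fun _ => 0) ?_).trans (by simp)
          filter_upwards [h3] with a ha
          simp only [Pi.zero_apply, ENNReal.rpow_eq_zero_iff] at ha
          rcases ha with ha | ha
          · exact ha.1
          · linarith [ha.2]
        rw [h4, ENNReal.zero_rpow_of_pos (by linarith)]
      rw [lintegral_congr_ae h2]
      simp
    · rw [hI, ENNReal.top_mul hK]
      refine le_top.trans (le_of_eq (ENNReal.mul_top ?_).symm)
      simp only [ne_eq, ENNReal.rpow_eq_zero_iff]
      rintro (h | h)
      · exact absurd h.1 (by simp)
      · linarith [h.2]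
  have hm1 (ω : Ω) : Measurable fun a => Ψ (ω, a) := hΨ.fun_comp (measurable_prodMk_left (x := ω))
  have hm2 : Measurable fun q : Ω × α => (Ψ q / g q.2) ^ r * g q.2 :=
    ((hΨ.div (hg.comp measurable_snd)).pow_const r).mul (hg.comp measurable_snd)
  calc ∫⁻ ω, (∫⁻ a, Ψ (ω, a) ∂μ) ^ r ∂P
      = ∫⁻ ω, (∫⁻ a, Ψ (ω, a) / g a * g a ∂μ) ^ r ∂P := by
        refine lintegral_congr fun ω => ?_
        congr 1
        refine lintegral_congr_ae ?_
        filter_upwards [h] with a ha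
        exact (ENNReal.div_mul_cancel ha.1 ha.2.1).symm
    _ ≤ ∫⁻ ω, ((∫⁻ a, g a ∂μ) ^ (r - 1) * ∫⁻ a, (Ψ (ω, a) / g a) ^ r * g a ∂μ) ∂P :=
        lintegral_mono fun ω => rpow_lintegral_mul_le ((hm1 ω).div hg) hg hr
    _ = (∫⁻ a, g a ∂μ) ^ (r - 1) * ∫⁻ a, (∫⁻ ω, (Ψ (ω, a) / g a) ^ r * g a ∂P) ∂μ := by
        rw [lintegral_const_mul' _ _ (ENNReal.rpow_ne_top_of_nonneg (by linarith) hI),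
          lintegral_lintegral_swap hm2.aemeasurable]
    _ ≤ (∫⁻ a, g a ∂μ) ^ (r - 1) * ∫⁻ a, g a * K ∂μ := by
        refine mul_le_mul_right (lintegral_mono_ae ?_) _
        filter_upwards [h] with a ha
        rw [lintegral_mul_const' _ _ ha.2.1, mul_comm]
        refine mul_le_mul_right ?_ _
        simp_rw [div_eq_mul_inv, ENNReal.mul_rpow_of_nonneg _ _ hr0]
        rw [lintegral_mul_const' _ _ (ENNReal.rpow_ne_top_of_nonneg hr0
          (ENNReal.inv_ne_top.2 ha.1)), ENNReal.inv_rpow, ← div_eq_mul_inv]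
        exact ENNReal.div_le_of_le_mul' ha.2.2
    _ = _ := by rw [lintegral_mul_const _ hg]

/-- The measure on the increments which gives the fractional part of the Sobolev norm. -/
def gagliardoMeasure (s : ℝ) : Measure (ℝ × ℝ) :=
  ((volume.restrict (Ioo (0 : ℝ) 1)).withDensity fun t => ENNReal.ofReal (t ^ (1 - 2 * s))).prod
    volume

instance (s : ℝ) : SFinite (gagliardoMeasure s) := by
  unfold gagliardoMeasure; infer_instance

theorem measurable_gagliardoDensity (s : ℝ) :
    Measurable fun t : ℝ => ENNReal.ofReal (t ^ (1 - 2 * s)) :=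
  (measurable_id.pow_const _).ennreal_ofReal

theorem lintegral_gagliardoMeasure {f : ℝ × ℝ → ℝ≥0∞} (hf : Measurable f) (s : ℝ) :
    ∫⁻ a, f a ∂(gagliardoMeasure s) = ∫⁻ t in Ioo (0 : ℝ) 1,
      ENNReal.ofReal (t ^ (1 - 2 * s)) * ∫⁻ x, f (t, x) := by
  rw [gagliardoMeasure, lintegral_prod _ hf.aemeasurable,
    lintegral_withDensity_eq_lintegral_mul _ (measurable_gagliardoDensity s)
      hf.lintegral_prod_right']
  rfl

theorem ae_gagliardoMeasure (s : ℝ) : ∀ᵐ a ∂(gagliardoMeasure s), a.1 ∈ Ioo (0 : ℝ) 1 := by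
  refine Measure.quasiMeasurePreserving_fst.ae ?_
  exact (withDensity_absolutelyContinuous _ _).ae_le (ae_restrict_mem measurableSet_Ioo)

/-- The weight of the increments of the derivative. -/
def incrementWeight (β : ℝ) (a : ℝ × ℝ) : ℝ≥0∞ :=
  ENNReal.ofReal (bracketWeight β a.2 * √(2 * a.1)) ^ 2

theorem measurable_incrementWeight (β : ℝ) : Measurable (incrementWeight β) := by
  unfold incrementWeight
  refine Measurable.pow_const (Measurable.ennreal_ofReal ?_) 2
  exact ((continuous_bracketWeight β).measurable.comp measurable_snd).mul
    (measurable_fst.const_mul 2).sqrt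

/-- The Hölder exponent 1/2 supplies a factor 2t against the density t^{1-2s}. Integrability of
t^{2-2s} at 0 is the condition s < 3/2. -/
theorem lintegral_incrementWeight_lt_top {β s : ℝ} (hβ : 1 < β) (hs : s < 3 / 2) :
    ∫⁻ a, incrementWeight β a ∂(gagliardoMeasure s) < ∞ := by
  have hI : ∫⁻ x, ENNReal.ofReal (bracketWeight β x) ^ (2 : ℝ) < ∞ :=
    lintegral_bracketWeight_rpow_lt_top (by linarith)
  rw [lintegral_gagliardoMeasure (measurable_incrementWeight β)]
  have h1 (t : ℝ) (ht : t ∈ Ioo (0 : ℝ) 1) :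
      ENNReal.ofReal (t ^ (1 - 2 * s)) * ∫⁻ x, incrementWeight β (t, x)
      = ENNReal.ofReal (2 * t ^ (2 - 2 * s))
        * ∫⁻ x, ENNReal.ofReal (bracketWeight β x) ^ (2 : ℝ) := by
    have ht0 := ht.1
    have e (x : ℝ) : incrementWeight β (t, x)
        = ENNReal.ofReal (2 * t) * ENNReal.ofReal (bracketWeight β x) ^ (2 : ℝ) := by
      rw [incrementWeight, ENNReal.ofReal_mul (bracketWeight_pos β x).le, mul_pow,
        ← ENNReal.ofReal_pow (Real.sqrt_nonneg _), Real.sq_sqrt (by positivity), mul_comm,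
        ENNReal.rpow_ofNat]
    simp_rw [e]
    rw [lintegral_const_mul' _ _ ENNReal.ofReal_ne_top, ← mul_assoc,
      ← ENNReal.ofReal_mul (by positivity)]
    congr 2
    rw [show 2 - 2 * s = (1 - 2 * s) + 1 by ring, Real.rpow_add_one ht0.ne']
    ring
  rw [setLIntegral_congr_fun measurableSet_Ioo h1, lintegral_mul_const']
  · refine ENNReal.mul_lt_top ?_ hI
    have h2 : IntervalIntegrable (fun t : ℝ => t ^ (2 - 2 * s)) volume 0 1 :=
      intervalIntegral.intervalIntegrable_rpow' (by linarith)
    have h3 : IntegrableOn (fun t : ℝ => 2 * t ^ (2 - 2 * s)) (Ioo 0 1) :=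
      (((intervalIntegrable_iff_integrableOn_Ioo_of_le zero_le_one).1 h2).const_mul 2)
    exact h3.lintegral_lt_top
  · exact hI.ne

/-- The Plancherel transform is only an element of L², with no joint measurability in ω. For
integrable samples it is represented by the Fourier integral, which is jointly measurable. -/
theorem aemeasurable_sobolevNorm {F Φ : Ω → ℝ → ℂ} (hΦ : Measurable (Function.uncurry Φ))
    (h : ∀ᵐ ω ∂P, F ω = Φ ω ∧ Integrable (Φ ω) ∧ MemLp (Φ ω) 2 volume) (s : ℝ) :
    AEMeasurable (fun ω => sobolevNorm s (F ω)) P := by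
  have h1 : Measurable fun q : (Ω × ℝ) × ℝ =>
      Complex.exp (↑(-2 * Real.pi * q.2 * q.1.2) * Complex.I) • Φ q.1.1 q.2 := by
    have a1 : Measurable fun q : (Ω × ℝ) × ℝ =>
        Complex.exp (↑(-2 * Real.pi * q.2 * q.1.2) * Complex.I) :=
      ((Complex.measurable_ofReal.comp
        ((measurable_snd.const_mul (-2 * Real.pi)).mul measurable_fst.snd)).mul_const _).cexp
    have a2 := hΦ.fun_comp (measurable_fst.fst.prodMk measurable_snd :
        Measurable fun q : (Ω × ℝ) × ℝ => (q.1.1, q.2))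
    exact a1.smul a2
  have h2 : Measurable fun q : Ω × ℝ => 𝓕 (Φ q.1) q.2 := by
    simp_rw [Real.fourier_real_eq_integral_exp_smul]
    exact (h1.stronglyMeasurable.integral_prod_right').measurable
  have h3 : Measurable fun q : Ω × ℝ => ENNReal.ofReal ((4 + (2 * Real.pi * q.2) ^ 2) ^ s)
      * ‖𝓕 (Φ q.1) q.2‖ₑ ^ 2 := by
    refine Measurable.mul (Measurable.ennreal_ofReal ?_) (h2.enorm.pow_const 2)
    exact (((measurable_snd.const_mul _).pow_const 2).const_add _).pow_const s
  refine ⟨fun ω => (∫⁻ η : ℝ, ENNReal.ofReal ((4 + (2 * Real.pi * η) ^ 2) ^ s)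
      * ‖𝓕 (Φ ω) η‖ₑ ^ 2) ^ (1 / 2 : ℝ), h3.lintegral_prod_right'.pow_const _, ?_⟩
  filter_upwards [h] with ω hω
  rw [hω.1, sobolevNorm_eq hω.2.1 hω.2.2]

/-- Measurable versions of `⟨x⟩^{-β} / g` and of its derivative. -/
theorem RegularProcess.exists_measurable_weighted [IsProbabilityMeasure P]
    (h : RegularProcess P W C) {k : ℂ} (hk : SectorialParameter k) {β : ℝ} (hβ : 1 < β) :
    ∃ Φ Φ' : Ω → ℝ → ℂ, Measurable (Function.uncurry Φ) ∧ Measurable (Function.uncurry Φ') ∧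
      ∀ᵐ ω ∂P, (weightedWeylSum β (W ω) k = Φ ω ∧ Integrable (Φ ω) ∧ MemLp (Φ ω) 2 volume) ∧
        weightedWeylDeriv β (W ω) k = Φ' ω ∧ Integrable (Φ' ω) ∧ MemLp (Φ' ω) 2 volume := by
  obtain ⟨H, S, hH, hS, hHS⟩ := h.exists_measurable_weylSum hk
  have hw : Measurable fun q : Ω × ℝ => (bracketWeight β q.2 : ℂ) :=
    (Complex.measurable_ofReal.comp (continuous_bracketWeight β).measurable).comp measurable_snd
  have hw' : Measurable fun q : Ω × ℝ => (bracketWeightDeriv β q.2 : ℂ) :=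
    (Complex.measurable_ofReal.comp (continuous_bracketWeightDeriv β).measurable).comp measurable_snd
  set Φ : Ω → ℝ → ℂ := fun ω x => (bracketWeight β x : ℂ) * H ω x with hΦ
  set Φ' : Ω → ℝ → ℂ := fun ω x =>
    (bracketWeightDeriv β x : ℂ) * H ω x + (bracketWeight β x : ℂ) * S ω x with hΦ'
  have m : Measurable (Function.uncurry Φ) := hw.mul hH
  have m' : Measurable (Function.uncurry Φ') := (hw'.mul hH).add (hw.mul hS)
  have e : ∀ᵐ ω ∂P, weightedWeylSum β (W ω) k = Φ ω := by
    filter_upwards [hHS] with ω hω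
    ext x
    rw [weightedWeylSum, hω.1]
  have e' : ∀ᵐ ω ∂P, weightedWeylDeriv β (W ω) k = Φ' ω := by
    filter_upwards [hHS] with ω hω
    ext x
    rw [weightedWeylDeriv, hω.1, hω.2]
  have i := ae_integrable_and_memLp (P := P) m hβ
    (K := fun p => (2 * ENNReal.ofReal ‖k‖) ^ p * twoSidedMoment C p)
    (fun p hp => ENNReal.mul_lt_top (rpow_lt_top_of_one_le (by finiteness) (by linarith))
      (twoSidedMoment_lt_top C hp))
    (fun p hp x => by
      refine le_trans (le_of_eq (lintegral_congr_ae ?_))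
        (h.lintegral_weightedWeylSum_rpow_le hk β x hp)
      filter_upwards [e] with ω hω
      rw [hω])
  have i' := ae_integrable_and_memLp (P := P) m' hβ
    (K := fun p => ENNReal.ofReal (2 * (β + 1) * ‖k‖) ^ p * twoSidedMoment C (2 * p))
    (fun p hp => ENNReal.mul_lt_top (rpow_lt_top_of_one_le (by finiteness) (by linarith))
      (twoSidedMoment_lt_top C (by linarith)))
    (fun p hp x => by
      refine le_trans (le_of_eq (lintegral_congr_ae ?_))
        (h.lintegral_weightedWeylDeriv_rpow_le hk (by linarith) x hp)
      filter_upwards [e'] with ω hω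
      rw [hω])
  refine ⟨Φ, Φ', m, m', ?_⟩
  filter_upwards [e, e', i, i'] with ω h1 h2 h3 h4
  exact ⟨⟨h1, h3⟩, h2, h4⟩

theorem RegularProcess.aemeasurable_sobolevNorm [IsProbabilityMeasure P]
    (h : RegularProcess P W C) {k : ℂ} (hk : SectorialParameter k) {β : ℝ} (hβ : 1 < β) (s : ℝ) :
    AEMeasurable (fun ω => sobolevNorm s (weightedWeylSum β (W ω) k)) P := by
  obtain ⟨Φ, Φ', m, -, hae⟩ := h.exists_measurable_weighted hk hβ
  exact WhiteNoiseGreen.aemeasurable_sobolevNorm m (hae.mono fun ω hω => hω.1) s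

theorem RegularProcess.lintegral_increment_rpow_le [IsProbabilityMeasure P]
    (h : RegularProcess P W C) {k : ℂ} (hk : SectorialParameter k) {β : ℝ} (hβ : 0 ≤ β) {x t : ℝ}
    (ht0 : 0 < t) (ht1 : t ≤ 1) {r : ℝ} (hr : 1 ≤ r) :
    ∫⁻ ω, (‖weightedWeylDeriv β (W ω) k (x + t) - weightedWeylDeriv β (W ω) k (x - t)‖ₑ ^ 2) ^ r ∂P
      ≤ incrementWeight β (t, x) ^ r
        * ((ENNReal.ofReal (weightConst β) * (7 * ENNReal.ofReal ‖k‖)) ^ (2 * r)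
          * pairMoment C (4 * r)) := by
  have hr0 : 0 ≤ r := by linarith
  have hA : 0 ≤ weightConst β := by unfold weightConst; positivity
  have sq_rpow (a : ℝ≥0∞) : (a ^ 2) ^ r = a ^ (2 * r) := by
    rw [← ENNReal.rpow_natCast, ← ENNReal.rpow_mul]; norm_num
  have h1 : ∫⁻ ω, (pairBound ‖k‖ (W ω) (x - t) (x + t) ^ 2) ^ (2 * r) ∂P ≤ pairMoment C (4 * r) := by
    refine le_trans (le_of_eq (lintegral_congr fun ω => ?_))
      (h.lintegral_pairBound_rpow_le (norm_nonneg k) (by linarith : x - t < x + t) (by linarith)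
        (by linarith : 1 ≤ 4 * r))
    rw [← ENNReal.rpow_natCast, ← ENNReal.rpow_mul]
    congr 1
    push_cast
    ring
  have hw : 0 ≤ bracketWeight β x * √(2 * t) :=
    mul_nonneg (bracketWeight_pos β x).le (Real.sqrt_nonneg _)
  have h2 := lintegral_const_mul_rpow_le
    (c := ENNReal.ofReal (bracketWeight β x * √(2 * t))) ENNReal.ofReal_ne_top (by linarith)
    (lintegral_const_mul_rpow_le (c := ENNReal.ofReal (weightConst β) * (7 * ENNReal.ofReal ‖k‖))
      (by finiteness) (by linarith) h1)
  rw [incrementWeight, sq_rpow]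
  refine le_trans (lintegral_mono_ae ?_) h2
  filter_upwards [h.ae_tameNoise_both ‖k‖ (norm_nonneg k)] with ω hω
  rw [sq_rpow]
  refine ENNReal.rpow_le_rpow ?_ (by linarith)
  refine (enorm_weightedWeylDeriv_sub_le hβ (h.continuous ω) hk hω.1 hω.2 ht0 ht1).trans
    (le_of_eq ?_)
  rw [ENNReal.ofReal_mul hA]
  ring

/-- The two terms of `sobolevNorm_sq_le` are integrals of squares over the line and over the space
of increments. The weighted Jensen inequality applies to both with r-th powers, so it is the moments
of order 2r of the norm that are bounded. -/
theorem RegularProcess.lintegral_sobolevNorm_rpow_le [IsProbabilityMeasure P]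
    (h : RegularProcess P W C) {k : ℂ} (hk : SectorialParameter k) {β s : ℝ} (hβ : 1 < β)
    (hs1 : 1 ≤ s) (hs2 : s < 3 / 2) {r : ℝ} (hr : 1 ≤ r) :
    ∫⁻ ω, sobolevNorm s (weightedWeylSum β (W ω) k) ^ (2 * r) ∂P ≤ 200 ^ r * (2 ^ (r - 1) *
      ((∫⁻ x, ENNReal.ofReal (bracketWeight β x) ^ 2) ^ (r - 1)
        * ((∫⁻ x, ENNReal.ofReal (bracketWeight β x) ^ 2)
          * ((2 * ENNReal.ofReal ‖k‖) ^ (2 * r) * twoSidedMoment C (2 * r)))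
      + (∫⁻ a, incrementWeight β a ∂(gagliardoMeasure s)) ^ (r - 1)
        * ((∫⁻ a, incrementWeight β a ∂(gagliardoMeasure s))
          * ((ENNReal.ofReal (weightConst β) * (7 * ENNReal.ofReal ‖k‖)) ^ (2 * r)
            * pairMoment C (4 * r))))) := by
  obtain ⟨Φ, Φ', m, m', hae⟩ := h.exists_measurable_weighted hk hβ
  have hr0 : 0 ≤ r := by linarith
  have sq_rpow (a : ℝ≥0∞) : (a ^ 2) ^ r = a ^ (2 * r) := by
    rw [← ENNReal.rpow_natCast, ← ENNReal.rpow_mul]; norm_num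
  have mA : Measurable fun q : Ω × ℝ => ‖Φ q.1 q.2‖ₑ ^ 2 := m.enorm.pow_const 2
  have mB : Measurable fun q : Ω × (ℝ × ℝ) =>
      ‖Φ' q.1 (q.2.2 + q.2.1) - Φ' q.1 (q.2.2 - q.2.1)‖ₑ ^ 2 := by
    have a1 := m'.fun_comp (measurable_fst.prodMk (measurable_snd.snd.add measurable_snd.fst) :
      Measurable fun q : Ω × (ℝ × ℝ) => (q.1, q.2.2 + q.2.1))
    have a2 := m'.fun_comp (measurable_fst.prodMk (measurable_snd.snd.sub measurable_snd.fst) :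
      Measurable fun q : Ω × (ℝ × ℝ) => (q.1, q.2.2 - q.2.1))
    exact (a1.sub a2).enorm.pow_const 2
  have hA : ∫⁻ ω, (∫⁻ x, ‖Φ ω x‖ₑ ^ 2) ^ r ∂P ≤ _ :=
    lintegral_lintegral_rpow_le_of_weight (P := P) (μ := volume) mA
      ((measurable_ofReal_bracketWeight β).pow_const 2) hr
      (K := (2 * ENNReal.ofReal ‖k‖) ^ (2 * r) * twoSidedMoment C (2 * r))
      (Eventually.of_forall fun x => by
        refine ⟨by simpa using bracketWeight_pos β x, by finiteness, ?_⟩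
        rw [sq_rpow]
        refine le_trans (le_of_eq (lintegral_congr_ae ?_))
          (h.lintegral_weightedWeylSum_rpow_le hk β x (by linarith : 1 ≤ 2 * r))
        filter_upwards [hae] with ω hω
        rw [sq_rpow, hω.1.1])
  have hB : ∫⁻ ω, (∫⁻ a, ‖Φ' ω (a.2 + a.1) - Φ' ω (a.2 - a.1)‖ₑ ^ 2 ∂(gagliardoMeasure s)) ^ r ∂P
      ≤ _ :=
    lintegral_lintegral_rpow_le_of_weight (P := P) (μ := gagliardoMeasure s) mB
      (measurable_incrementWeight β) hr
      (K := (ENNReal.ofReal (weightConst β) * (7 * ENNReal.ofReal ‖k‖)) ^ (2 * r)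
            * pairMoment C (4 * r))
      (by
        filter_upwards [ae_gagliardoMeasure s] with a ha
        have hw := bracketWeight_pos β a.2
        have hs : 0 < √(2 * a.1) := Real.sqrt_pos.2 (by linarith [ha.1])
        refine ⟨?_, ?_, ?_⟩
        · simpa [incrementWeight] using mul_pos hw hs
        · unfold incrementWeight; finiteness
        · refine le_trans (le_of_eq (lintegral_congr_ae ?_))
            (h.lintegral_increment_rpow_le hk (by linarith) ha.1 ha.2.le hr)
          filter_upwards [hae] with ω hω
          rw [hω.2.1])
  have hsum := lintegral_add_rpow_le (mA.lintegral_prod_right').aemeasurable hr hA hB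
  refine le_trans (lintegral_mono_ae ?_) (lintegral_const_mul_rpow_le (c := 200) (by simp) hr0 hsum)
  filter_upwards [hae, h.ae_tameNoise_both ‖k‖ (norm_nonneg k)] with ω hω ht
  rw [← sq_rpow]
  refine ENNReal.rpow_le_rpow ?_ hr0
  have hmω : Measurable fun a : ℝ × ℝ => ‖Φ' ω (a.2 + a.1) - Φ' ω (a.2 - a.1)‖ₑ ^ 2 := by
    have := mB.fun_comp (measurable_prodMk_left (x := ω))
    exact this
  have hd (x : ℝ) : HasDerivAt (Φ ω) (Φ' ω x) x := by
    have h0 := hasDerivAt_weighted_weylSum β (h.continuous ω) hk ht.1 ht.2 x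
    have e : (fun x => (bracketWeight β x : ℂ) * weylSum (W ω) k x) = Φ ω := hω.1.1
    rwa [e, hω.2.1] at h0
  have h1 := sobolevNorm_sq_le hs1 (by linarith) hd hω.1.2.1 hω.1.2.2 hω.2.2.1 hω.2.2.2
  rw [hω.1.1, lintegral_gagliardoMeasure hmω]
  exact h1

end

end

section
open Set Filter Topology ProbabilityTheory
open scoped NNReal

/-! ### Gaussian moments of white noise -/

section
variable {Ω : Type*} [MeasurableSpace Ω] {P : Measure Ω} {q : Ω → RealTempered}

/-- Testing the characteristic functional on multiples t f gives the characteristic function of a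
single pairing. -/
theorem IsWhiteNoise.map_eq [IsProbabilityMeasure P] (hq : IsWhiteNoise P q) (f : 𝓢(ℝ, ℝ)) :
    P.map (fun ω => q ω f) = gaussianReal 0 (∫ x, f x ^ 2).toNNReal := by
  have hm := hq.measurable_apply f
  have : IsProbabilityMeasure (P.map fun ω => q ω f) :=
    Measure.isProbabilityMeasure_map hm.aemeasurable
  refine Measure.ext_of_charFun (funext fun t => ?_)
  rw [charFun_gaussianReal, charFun_apply_real, integral_map hm.aemeasurable
    (by fun_prop)]
  have h := hq.charFun (t • f)
  simp only [map_smul, smul_eq_mul, smul_apply, mul_pow, integral_const_mul] at h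
  have e : (fun ω => Complex.exp (t * (q ω f : ℝ) * Complex.I))
      = fun ω => Complex.exp (Complex.I * ((t * q ω f : ℝ) : ℂ)) := by
    ext ω; congr 1; push_cast; ring
  rw [e, h, Real.coe_toNNReal _ (integral_nonneg fun x => sq_nonneg (f x))]
  congr 1
  push_cast
  ring

theorem integral_sq_le_of_eLpNorm_le {f : ℝ → ℝ} (hf : Continuous f) {σ : ℝ} (hσ : 0 ≤ σ)
    (h : eLpNorm f 2 volume ≤ ENNReal.ofReal σ) : ∫ x, f x ^ 2 ≤ σ ^ 2 := by
  rw [integral_eq_lintegral_of_nonneg_ae (Eventually.of_forall fun x => sq_nonneg (f x))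
    (hf.pow 2).aestronglyMeasurable]
  refine ENNReal.toReal_le_of_le_ofReal (by positivity) ?_
  rw [ENNReal.ofReal_pow hσ]
  refine le_trans (le_of_eq ?_) (pow_le_pow_left' h 2)
  rw [eLpNorm_eq_lintegral_rpow_enorm_toReal (by norm_num) (by norm_num), ← ENNReal.rpow_natCast,
    ← ENNReal.rpow_mul]
  simp only [ENNReal.toReal_ofNat, ENNReal.rpow_ofNat, Nat.cast_ofNat, one_div,
    inv_mul_cancel_of_invertible, ENNReal.rpow_one]
  refine lintegral_congr fun x => ?_
  rw [← ofReal_norm, ← ENNReal.ofReal_pow (norm_nonneg _), Real.norm_eq_abs, sq_abs]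

/-- e^{|x|} ≤ e^x + e^{-x} and the Gaussian moment generating function. Only an upper bound σ for
the L² norm is used, so approximate test functions are allowed. -/
theorem IsWhiteNoise.lintegral_exp_abs_le [IsProbabilityMeasure P] (hq : IsWhiteNoise P q)
    {f : 𝓢(ℝ, ℝ)} {σ : ℝ} (hσ : 0 < σ) (h : eLpNorm f 2 volume ≤ ENNReal.ofReal σ) (a : ℝ) :
    ∫⁻ ω, ENNReal.ofReal (Real.exp (a * (|q ω f| / σ))) ∂P
      ≤ ENNReal.ofReal (2 * Real.exp (a ^ 2 / 2)) := by
  have hm := hq.measurable_apply f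
  have hmap := hq.map_eq f
  have hv := integral_sq_le_of_eLpNorm_le f.continuous hσ.le h
  have hv0 : 0 ≤ ∫ x, f x ^ 2 := integral_nonneg fun x => sq_nonneg (f x)
  set v : ℝ≥0 := (∫ x, f x ^ 2).toNNReal with hvdef
  have hvv : (v : ℝ) ≤ σ ^ 2 := by rw [hvdef, Real.coe_toNNReal _ hv0]; exact hv
  have key (b : ℝ) (hb : b ^ 2 * σ ^ 2 = a ^ 2) :
      ∫⁻ ω, ENNReal.ofReal (Real.exp (b * q ω f)) ∂P ≤ ENNReal.ofReal (Real.exp (a ^ 2 / 2)) := by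
    have hint : Integrable (fun ω => Real.exp (b * q ω f)) P := by
      have h1 : Integrable (fun x => Real.exp (b * x)) (P.map fun ω => q ω f) := by
        rw [hmap]; exact integrable_exp_mul_gaussianReal b
      exact h1.comp_measurable hm
    rw [← ofReal_integral_eq_lintegral_ofReal hint (Eventually.of_forall fun ω =>
      (Real.exp_pos _).le)]
    refine ENNReal.ofReal_le_ofReal ?_
    have h2 := mgf_gaussianReal hmap b
    rw [mgf] at h2
    rw [h2]
    refine Real.exp_le_exp.2 ?_
    rw [← hb]
    nlinarith [sq_nonneg b]
  calc ∫⁻ ω, ENNReal.ofReal (Real.exp (a * (|q ω f| / σ))) ∂P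
      ≤ ∫⁻ ω, (ENNReal.ofReal (Real.exp (a / σ * q ω f))
        + ENNReal.ofReal (Real.exp (-(a / σ) * q ω f))) ∂P := by
        refine lintegral_mono fun ω => ?_
        rcases abs_cases (q ω f) with ⟨h, -⟩ | ⟨h, -⟩
        · refine le_trans (le_of_eq ?_) le_self_add
          rw [h]; congr 2; ring
        · refine le_trans (le_of_eq ?_) le_add_self
          rw [h]; congr 2; ring
    _ = ∫⁻ ω, ENNReal.ofReal (Real.exp (a / σ * q ω f)) ∂P
        + ∫⁻ ω, ENNReal.ofReal (Real.exp (-(a / σ) * q ω f)) ∂P :=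
        lintegral_add_left ((hm.const_mul _).exp.ennreal_ofReal) _
    _ ≤ ENNReal.ofReal (Real.exp (a ^ 2 / 2)) + ENNReal.ofReal (Real.exp (a ^ 2 / 2)) := by
        refine add_le_add (key _ ?_) (key _ ?_) <;> field_simp
    _ = _ := by rw [← ENNReal.ofReal_add (Real.exp_pos _).le (Real.exp_pos _).le, two_mul]

theorem IsWhiteNoise.lintegral_abs_pow_le [IsProbabilityMeasure P] (hq : IsWhiteNoise P q)
    {f : 𝓢(ℝ, ℝ)} {σ : ℝ} (hσ : 0 < σ) (h : eLpNorm f 2 volume ≤ ENNReal.ofReal σ) (n : ℕ) :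
    ∫⁻ ω, ENNReal.ofReal (|q ω f| ^ n) ∂P
      ≤ ENNReal.ofReal (n.factorial * σ ^ n * (2 * Real.exp (1 / 2))) := by
  have h1 := hq.lintegral_exp_abs_le hσ h 1
  simp only [one_mul, one_pow] at h1
  rw [ENNReal.ofReal_mul (by positivity)]
  refine le_trans ?_ (mul_le_mul_right h1 _)
  rw [← lintegral_const_mul' _ _ ENNReal.ofReal_ne_top]
  refine lintegral_mono fun ω => ?_
  rw [← ENNReal.ofReal_mul (by positivity)]
  refine ENNReal.ofReal_le_ofReal ?_
  have h2 := Real.pow_div_factorial_le_exp (x := |q ω f| / σ) (by positivity) n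
  rw [div_le_iff₀ (by positivity), div_pow, div_le_iff₀ (by positivity)] at h2
  linarith

end

/-! ### Dyadic approximation of the Brownian path -/

/-- The function `1_{(0,t]}` (`-1_{(t,0]}` for negative `t`), whose pairing with white noise is the
Brownian path at time `t`. -/
def signedIndicator (t : ℝ) : ℝ → ℝ := (Iic t).indicator 1 - (Iic 0).indicator 1

theorem signedIndicator_sub {s t : ℝ} (h : s ≤ t) :
    signedIndicator t - signedIndicator s = (Ioc s t).indicator 1 := by
  ext x
  simp only [signedIndicator, Pi.sub_apply, indicator_apply, mem_Iic, mem_Ioc, Pi.one_apply]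
  split_ifs <;> first | (norm_num; done) | (exfalso; grind)

theorem eLpNorm_indicator_Ioc {s t : ℝ} (h : s ≤ t) :
    eLpNorm ((Ioc s t).indicator (1 : ℝ → ℝ)) 2 volume = ENNReal.ofReal √(t - s) := by
  have := eLpNorm_indicator_const (μ := (volume : Measure ℝ)) (p := 2) (c := (1 : ℝ))
    (measurableSet_Ioc (a := s) (b := t)) (by norm_num) (by norm_num)
  rw [show (1 : ℝ → ℝ) = fun _ => 1 from rfl, this]
  simp only [enorm_one, Real.volume_Ioc, ENNReal.toReal_ofNat, one_mul]
  rw [ENNReal.ofReal_rpow_of_nonneg (by linarith) (by norm_num), Real.sqrt_eq_rpow]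

theorem eLpNorm_signedIndicator_sub {s t : ℝ} (h : s ≤ t) :
    eLpNorm (signedIndicator t - signedIndicator s) 2 volume = ENNReal.ofReal √(t - s) := by
  rw [signedIndicator_sub h, eLpNorm_indicator_Ioc h]

theorem measurable_signedIndicator (t : ℝ) : Measurable (signedIndicator t) :=
  (measurable_one.indicator measurableSet_Iic).sub (measurable_one.indicator measurableSet_Iic)

theorem memLp_signedIndicator (t : ℝ) : MemLp (signedIndicator t) 2 volume := by
  refine ⟨(measurable_signedIndicator t).aestronglyMeasurable, ?_⟩
  have h0 : signedIndicator 0 = 0 := by simp [signedIndicator]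
  rcases le_total 0 t with h | h
  · have := eLpNorm_signedIndicator_sub h
    rw [h0, sub_zero] at this
    rw [this]; exact ENNReal.ofReal_lt_top
  · have := eLpNorm_signedIndicator_sub h
    rw [h0, zero_sub, eLpNorm_neg] at this
    rw [this]; exact ENNReal.ofReal_lt_top

theorem exists_schwartz_approx_signedIndicator (n : ℕ) (i : ℤ) :
    ∃ f : 𝓢(ℝ, ℝ), eLpNorm ((f : ℝ → ℝ) - signedIndicator (i / 2 ^ n)) 2 volume
      ≤ ENNReal.ofReal ((1 / 2) ^ n) := by
  obtain ⟨g, hg1, hg2, hg3⟩ := (memLp_signedIndicator (i / 2 ^ n)).exist_eLpNorm_sub_le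
    (by norm_num) (by norm_num) (ε := (1 / 2) ^ n) (by positivity)
  refine ⟨hg1.toSchwartzMap hg2, ?_⟩
  rw [eLpNorm_sub_comm]
  exact hg3

/-- A Schwartz function close in `L²` to the signed indicator function of `i / 2ⁿ`. -/
def dyadicTest (n : ℕ) (i : ℤ) : 𝓢(ℝ, ℝ) := (exists_schwartz_approx_signedIndicator n i).choose

theorem eLpNorm_dyadicTest_sub (n : ℕ) (i : ℤ) :
    eLpNorm ((dyadicTest n i : ℝ → ℝ) - signedIndicator (i / 2 ^ n)) 2 volume
      ≤ ENNReal.ofReal ((1 / 2) ^ n) :=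
  (exists_schwartz_approx_signedIndicator n i).choose_spec

/-- The dyadic scale `2^{-n/2}`. -/
def dyadicScale (n : ℕ) : ℝ := √((1 / 2) ^ n)

theorem dyadicScale_pos (n : ℕ) : 0 < dyadicScale n := Real.sqrt_pos.2 (by positivity)

theorem dyadicScale_sq (n : ℕ) : dyadicScale n ^ 2 = (1 / 2) ^ n := Real.sq_sqrt (by positivity)

theorem pow_le_dyadicScale (n : ℕ) : (1 / 2 : ℝ) ^ n ≤ dyadicScale n := by
  have h1 : (1 / 2 : ℝ) ^ n ≤ 1 := pow_le_one₀ (by norm_num) (by norm_num)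
  exact Real.le_sqrt_of_sq_le (by rw [sq]; exact mul_le_of_le_one_left (by positivity) h1)

theorem dyadicScale_succ_le (n : ℕ) : dyadicScale (n + 1) ≤ dyadicScale n :=
  Real.sqrt_le_sqrt (pow_le_pow_of_le_one (by norm_num) (by norm_num) (Nat.le_succ n))

theorem tendsto_dyadicScale : Tendsto dyadicScale atTop (𝓝 0) := by
  have := (tendsto_pow_atTop_nhds_zero_of_lt_one (r := (1 / 2 : ℝ)) (by norm_num)
    (by norm_num)).sqrt
  rw [Real.sqrt_zero] at this
  exact this

theorem eLpNorm_dyadicTest_floor_sub (n : ℕ) (t : ℝ) :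
    eLpNorm ((dyadicTest n ⌊2 ^ n * t⌋ : ℝ → ℝ) - signedIndicator t) 2 volume
      ≤ ENNReal.ofReal (2 * dyadicScale n) := by
  set i := ⌊2 ^ n * t⌋ with hi
  have h2 : (0 : ℝ) < 2 ^ n := by positivity
  have hle : (i : ℝ) / 2 ^ n ≤ t := by
    rw [div_le_iff₀ h2, mul_comm]; exact Int.floor_le _
  have hlt : t - i / 2 ^ n ≤ (1 / 2) ^ n := by
    have := (Int.lt_floor_add_one (2 ^ n * t)).le
    rw [← hi] at this
    rw [one_div, inv_pow, sub_le_iff_le_add, ← one_div, ← add_div, le_div_iff₀ h2]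
    linarith
  have e : (dyadicTest n i : ℝ → ℝ) - signedIndicator t
      = ((dyadicTest n i : ℝ → ℝ) - signedIndicator (i / 2 ^ n))
        - (signedIndicator t - signedIndicator (i / 2 ^ n)) := by abel
  have m1 := (measurable_signedIndicator (i / 2 ^ n)).aestronglyMeasurable (μ := volume)
  have m2 := (measurable_signedIndicator t).aestronglyMeasurable (μ := volume)
  have m3 := (dyadicTest n i).continuous.aestronglyMeasurable (μ := volume)
  rw [e]
  refine (eLpNorm_sub_le (m3.sub m1) (m2.sub m1) (by norm_num)).trans ?_
  rw [eLpNorm_signedIndicator_sub hle, two_mul,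
    ENNReal.ofReal_add (dyadicScale_pos n).le (dyadicScale_pos n).le]
  refine add_le_add ((eLpNorm_dyadicTest_sub n i).trans
    (ENNReal.ofReal_le_ofReal (pow_le_dyadicScale n)))
    (ENNReal.ofReal_le_ofReal (Real.sqrt_le_sqrt hlt))

/-- Each test function is within 2 · 2^{-n/2} (respectively 2 · 2^{-m/2}) of its indicator, the
error being smoothing plus rounding to the grid; the indicators themselves are at distance √(t-s).
-/
theorem eLpNorm_dyadicTest_sub_dyadicTest_le (n m : ℕ) {s t : ℝ} (h : s ≤ t) :
    eLpNorm (dyadicTest n ⌊2 ^ n * t⌋ - dyadicTest m ⌊2 ^ m * s⌋ : 𝓢(ℝ, ℝ)) 2 volume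
      ≤ ENNReal.ofReal (2 * dyadicScale n + 2 * dyadicScale m + √(t - s)) := by
  set f := dyadicTest n ⌊2 ^ n * t⌋ with hf
  set g := dyadicTest m ⌊2 ^ m * s⌋ with hg
  have e : ((f - g : 𝓢(ℝ, ℝ)) : ℝ → ℝ) = (((f : ℝ → ℝ) - signedIndicator t)
      - ((g : ℝ → ℝ) - signedIndicator s)) + (signedIndicator t - signedIndicator s) := by
    ext x
    simp only [sub_apply, Pi.add_apply, Pi.sub_apply]
    ring
  have m1 := (measurable_signedIndicator s).aestronglyMeasurable (μ := volume)
  have m2 := (measurable_signedIndicator t).aestronglyMeasurable (μ := volume)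
  have m3 := f.continuous.aestronglyMeasurable (μ := volume)
  have m4 := g.continuous.aestronglyMeasurable (μ := volume)
  have p1 := dyadicScale_pos n
  have p2 := dyadicScale_pos m
  rw [e, ENNReal.ofReal_add (by positivity) (Real.sqrt_nonneg _),
    ENNReal.ofReal_add (by positivity) (by positivity)]
  refine (eLpNorm_add_le ((m3.sub m2).sub (m4.sub m1)) (m2.sub m1) (by norm_num)).trans ?_
  refine add_le_add ((eLpNorm_sub_le (m3.sub m2) (m4.sub m1) (by norm_num)).trans
    (add_le_add (eLpNorm_dyadicTest_floor_sub n t) (eLpNorm_dyadicTest_floor_sub m s)))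
    (eLpNorm_signedIndicator_sub h).le

/-- The dyadic approximation of a primitive of `T`. -/
def dyadicPath (T : RealTempered) (n : ℕ) (t : ℝ) : ℝ := T (dyadicTest n ⌊2 ^ n * t⌋)

/-- Geometric convergence in n gives a locally uniform limit. The approximations are step functions,
so continuity of the limit comes from the separate bound on their oscillation over the mesh size. -/
theorem exists_continuous_limit {w : ℕ → ℝ → ℝ}
    (h : ∀ N : ℕ, ∃ C θ : ℝ, 0 ≤ θ ∧ θ < 1 ∧ ∀ n : ℕ, ∀ t ∈ Icc (-N : ℝ) N,
      |w n t - w (n + 1) t| ≤ C * θ ^ n ∧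
        ∀ s ∈ Icc (-N : ℝ) N, |s - t| ≤ (1 / 2) ^ n → |w n s - w n t| ≤ C * θ ^ n) :
    ∃ W : ℝ → ℝ, Continuous W ∧
      ∀ N : ℕ, TendstoUniformlyOn w W atTop (Icc (-N : ℝ) N) := by
  have hmem (t : ℝ) : ∃ N : ℕ, t ∈ Icc (-N : ℝ) N := by
    obtain ⟨N, hN⟩ := exists_nat_ge |t|
    exact ⟨N, abs_le.1 hN⟩
  have hlim (t : ℝ) : ∃ x, Tendsto (fun n => w n t) atTop (𝓝 x) := by
    obtain ⟨N, hN⟩ := hmem t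
    obtain ⟨C, θ, -, hθ, h⟩ := h N
    exact cauchySeq_tendsto_of_complete (cauchySeq_of_le_geometric θ C hθ fun n => (h n t hN).1)
  choose W hW using hlim
  have hu (N : ℕ) : TendstoUniformlyOn w W atTop (Icc (-N : ℝ) N) := by
    obtain ⟨C, θ, hθ0, hθ, h⟩ := h N
    rw [Metric.tendstoUniformlyOn_iff]
    intro ε hε
    have h1 : Tendsto (fun n : ℕ => C * θ ^ n / (1 - θ)) atTop (𝓝 0) := by
      simpa using ((tendsto_pow_atTop_nhds_zero_of_lt_one hθ0 hθ).const_mul C).div_const (1 - θ)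
    filter_upwards [h1.eventually (gt_mem_nhds hε)] with n hn t ht
    rw [dist_comm]
    exact (dist_le_of_le_geometric_of_tendsto θ C hθ (fun n => (h n t ht).1) (hW t) n).trans_lt hn
  refine ⟨W, continuous_iff_continuousAt.2 fun t => ?_, hu⟩
  obtain ⟨N, hN⟩ := exists_nat_gt |t|
  obtain ⟨C, θ, hθ0, hθ, hC⟩ := h N
  rw [Metric.continuousAt_iff]
  intro ε hε
  have h1 : Tendsto (fun n : ℕ => C * θ ^ n) atTop (𝓝 0) := by
    simpa using (tendsto_pow_atTop_nhds_zero_of_lt_one hθ0 hθ).const_mul C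
  obtain ⟨n, hn1, hn2⟩ := ((h1.eventually (gt_mem_nhds (by linarith : 0 < ε / 3))).and
    ((Metric.tendstoUniformlyOn_iff.1 (hu N)) (ε / 3) (by linarith))).exists
  have hpos : (0 : ℝ) < (1 / 2) ^ n := by positivity
  refine ⟨min ((1 / 2) ^ n) (N - |t|), lt_min hpos (by linarith), fun {s} hs => ?_⟩
  rw [lt_min_iff, Real.dist_eq] at hs
  have htN : t ∈ Icc (-N : ℝ) N := abs_le.1 hN.le
  have hsN : s ∈ Icc (-N : ℝ) N := by
    refine abs_le.1 ?_
    have := abs_add_le (s - t) t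
    rw [sub_add_cancel] at this
    linarith [hs.2]
  have a1 := hn2 t htN
  have a2 := hn2 s hsN
  have a3 := (hC n t htN).2 s hsN hs.1.le
  rw [Real.dist_eq] at a1 a2 ⊢
  have e : W s - W t = (W s - w n s) + (w n s - w n t) - (W t - w n t) := by ring
  rw [e]
  have b1 := abs_sub (W s - w n s + (w n s - w n t)) (W t - w n t)
  have b2 := abs_add_le (W s - w n s) (w n s - w n t)
  linarith

/-- Summing (4/3)^n X_n in expectation gives a geometric series of ratio 2/3. This plays the role of
Markov's inequality with Borel–Cantelli. -/
theorem ae_le_geometric {Ω : Type*} [MeasurableSpace Ω] {P : Measure Ω} {X : ℕ → Ω → ℝ≥0∞}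
    (hX : ∀ n, Measurable (X n)) {K : ℝ≥0∞} (hK : K ≠ ∞)
    (h : ∀ n, ∫⁻ ω, X n ω ∂P ≤ K * ENNReal.ofReal ((1 / 2) ^ n)) :
    ∀ᵐ ω ∂P, ∃ C : ℝ, 0 ≤ C ∧ ∀ n, X n ω ≤ ENNReal.ofReal (C * (3 / 4) ^ n) := by
  have hS : ∀ᵐ ω ∂P, ∑' n, ENNReal.ofReal ((4 / 3) ^ n) * X n ω < ∞ := by
    refine ae_lt_top (Measurable.tsum fun n => (hX n).const_mul _) ?_
    rw [lintegral_tsum fun n => ((hX n).const_mul _).aemeasurable]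
    refine ne_of_lt ?_
    calc ∑' n, ∫⁻ ω, ENNReal.ofReal ((4 / 3) ^ n) * X n ω ∂P
        ≤ ∑' n : ℕ, K * ENNReal.ofReal ((2 / 3) ^ n) := by
          refine ENNReal.tsum_le_tsum fun n => ?_
          rw [lintegral_const_mul' _ _ ENNReal.ofReal_ne_top]
          refine (mul_le_mul_right (h n) _).trans (le_of_eq ?_)
          rw [mul_left_comm, ← ENNReal.ofReal_mul (by positivity), ← mul_pow]
          norm_num
      _ < ∞ := by
          rw [ENNReal.tsum_mul_left, ← ENNReal.ofReal_tsum_of_nonneg (fun n => by positivity)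
            (summable_geometric_of_lt_one (by norm_num) (by norm_num))]
          exact ENNReal.mul_lt_top hK.lt_top ENNReal.ofReal_lt_top
  filter_upwards [hS] with ω hω
  refine ⟨(∑' n, ENNReal.ofReal ((4 / 3) ^ n) * X n ω).toReal, ENNReal.toReal_nonneg, fun n => ?_⟩
  rw [ENNReal.ofReal_mul ENNReal.toReal_nonneg, ENNReal.ofReal_toReal hω.ne]
  have h1 : ENNReal.ofReal ((4 / 3) ^ n) * X n ω
      ≤ ∑' n, ENNReal.ofReal ((4 / 3) ^ n) * X n ω := ENNReal.le_tsum n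
  calc X n ω = ENNReal.ofReal ((4 / 3) ^ n) * X n ω * ENNReal.ofReal ((3 / 4) ^ n) := by
        rw [mul_right_comm, ← ENNReal.ofReal_mul (by positivity), ← mul_pow]
        norm_num
    _ ≤ _ := by gcongr

end

section
open Set Filter Topology ProbabilityTheory
open scoped NNReal

/-! ### The Brownian path -/

section
variable {Ω : Type*} [MeasurableSpace Ω] {P : Measure Ω} {q : Ω → RealTempered}

/-- The difference between consecutive dyadic approximations on a cell. -/
def dyadicRefinement (n : ℕ) (j : ℤ) : 𝓢(ℝ, ℝ) :=
  dyadicTest (n + 1) j - dyadicTest n ⌊(j : ℝ) / 2⌋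

/-- The jump of a dyadic approximation. -/
def dyadicJump (n : ℕ) (j : ℤ) : 𝓢(ℝ, ℝ) := dyadicTest n (j + 1) - dyadicTest n j

theorem eLpNorm_dyadicRefinement_le (n : ℕ) (j : ℤ) :
    eLpNorm (dyadicRefinement n j) 2 volume ≤ ENNReal.ofReal (5 * dyadicScale n) := by
  have h := eLpNorm_dyadicTest_sub_dyadicTest_le (n + 1) n (le_refl ((j : ℝ) / 2 ^ (n + 1)))
  have e1 : (2 : ℝ) ^ (n + 1) * (j / 2 ^ (n + 1)) = j := by field_simp
  have e2 : (2 : ℝ) ^ n * (j / 2 ^ (n + 1)) = j / 2 := by rw [pow_succ]; field_simp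
  rw [e1, e2, Int.floor_intCast] at h
  refine h.trans (ENNReal.ofReal_le_ofReal ?_)
  have := dyadicScale_succ_le n
  have := dyadicScale_pos n
  simp only [sub_self, Real.sqrt_zero]
  linarith

theorem eLpNorm_dyadicJump_le (n : ℕ) (j : ℤ) :
    eLpNorm (dyadicJump n j) 2 volume ≤ ENNReal.ofReal (5 * dyadicScale n) := by
  have hle : (j : ℝ) / 2 ^ n ≤ ((j + 1 : ℤ) : ℝ) / 2 ^ n := by
    push_cast; gcongr; linarith
  have h := eLpNorm_dyadicTest_sub_dyadicTest_le n n hle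
  have e1 : (2 : ℝ) ^ n * (j / 2 ^ n) = j := by field_simp
  have e2 : (2 : ℝ) ^ n * (((j + 1 : ℤ) : ℝ) / 2 ^ n) = ((j + 1 : ℤ) : ℝ) := by field_simp
  rw [e1, e2, Int.floor_intCast, Int.floor_intCast] at h
  refine h.trans (ENNReal.ofReal_le_ofReal (le_of_eq ?_))
  have e3 : ((j + 1 : ℤ) : ℝ) / 2 ^ n - j / 2 ^ n = (1 / 2) ^ n := by
    push_cast
    rw [one_div, inv_pow]
    field_simp
    ring
  rw [e3]
  change 2 * dyadicScale n + 2 * dyadicScale n + dyadicScale n = _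
  ring

/-- The fourth powers of the fluctuations at level `n` over `[-N, N]`. -/
def dyadicFluctuation (N n : ℕ) (T : RealTempered) : ℝ≥0∞ :=
  ∑ j ∈ Finset.Icc (-((N + 1) * 2 ^ (n + 1)) : ℤ) ((N + 1) * 2 ^ (n + 1)),
    (ENNReal.ofReal (|T (dyadicRefinement n j)| ^ 4) + ENNReal.ofReal (|T (dyadicJump n j)| ^ 4))

theorem IsWhiteNoise.measurable_dyadicFluctuation (hq : IsWhiteNoise P q) (N n : ℕ) :
    Measurable fun ω => dyadicFluctuation N n (q ω) := by
  unfold dyadicFluctuation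
  refine Finset.measurable_sum _ fun j _ => ?_
  exact (((hq.measurable_apply _).abs.pow_const 4).ennreal_ofReal).add
    (((hq.measurable_apply _).abs.pow_const 4).ennreal_ofReal)

/-- About 2^n cells, each with fourth moment of order 4^{-n}, leave 2^{-n}. Second moments, of order
2^{-n} per cell, would not decay after summation. -/
theorem IsWhiteNoise.lintegral_dyadicFluctuation_le [IsProbabilityMeasure P]
    (hq : IsWhiteNoise P q) (N n : ℕ) :
    ∫⁻ ω, dyadicFluctuation N n (q ω) ∂P
      ≤ ENNReal.ofReal ((4 * N + 5) * (2 * (24 * 5 ^ 4 * (2 * Real.exp (1 / 2)))))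
        * ENNReal.ofReal ((1 / 2) ^ n) := by
  set M := 24 * 5 ^ 4 * (2 * Real.exp (1 / 2)) with hM
  have hd := dyadicScale_pos n
  have h4 : dyadicScale n ^ 4 = (1 / 2) ^ n * (1 / 2) ^ n := by
    rw [show dyadicScale n ^ 4 = (dyadicScale n ^ 2) ^ 2 by ring, dyadicScale_sq]; ring
  have hb (f : 𝓢(ℝ, ℝ)) (hf : eLpNorm f 2 volume ≤ ENNReal.ofReal (5 * dyadicScale n)) :
      ∫⁻ ω, ENNReal.ofReal (|q ω f| ^ 4) ∂P ≤ ENNReal.ofReal (M * ((1 / 2) ^ n * (1 / 2) ^ n)) := by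
    refine (hq.lintegral_abs_pow_le (by positivity) hf 4).trans (ENNReal.ofReal_le_ofReal ?_)
    rw [mul_pow, h4, hM, show Nat.factorial 4 = 24 from rfl]
    push_cast
    linarith
  have hm (f : 𝓢(ℝ, ℝ)) : Measurable fun ω => ENNReal.ofReal (|q ω f| ^ 4) :=
    ((hq.measurable_apply f).abs.pow_const 4).ennreal_ofReal
  have hm2 (j : ℤ) : Measurable fun ω => ENNReal.ofReal (|q ω (dyadicRefinement n j)| ^ 4)
      + ENNReal.ofReal (|q ω (dyadicJump n j)| ^ 4) := (hm _).add (hm _)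
  unfold dyadicFluctuation
  rw [lintegral_finsetSum _ fun j _ => hm2 j]
  have hterm (j : ℤ) : ∫⁻ ω, (ENNReal.ofReal (|q ω (dyadicRefinement n j)| ^ 4)
      + ENNReal.ofReal (|q ω (dyadicJump n j)| ^ 4)) ∂P
      ≤ ENNReal.ofReal (2 * M * ((1 / 2) ^ n * (1 / 2) ^ n)) := by
    rw [lintegral_add_left (hm _)]
    refine (add_le_add (hb _ (eLpNorm_dyadicRefinement_le n j))
      (hb _ (eLpNorm_dyadicJump_le n j))).trans (le_of_eq ?_)
    rw [← ENNReal.ofReal_add (by positivity) (by positivity)]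
    congr 1; ring
  refine (Finset.sum_le_card_nsmul _ _ _ fun j _ => hterm j).trans ?_
  rw [nsmul_eq_mul, ← ENNReal.ofReal_natCast, ← ENNReal.ofReal_mul (by positivity),
    ← ENNReal.ofReal_mul (by positivity), Int.card_Icc]
  refine ENNReal.ofReal_le_ofReal ?_
  have hcard : (((((N + 1) * 2 ^ (n + 1) : ℤ) + 1 - (-((N + 1) * 2 ^ (n + 1)) : ℤ)).toNat : ℕ) : ℝ)
      ≤ (4 * N + 5) * 2 ^ n := by
    have h0 : (0 : ℤ) ≤ ((N + 1) * 2 ^ (n + 1) : ℤ) + 1 - (-((N + 1) * 2 ^ (n + 1)) : ℤ) := by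
      have : (0 : ℤ) ≤ (N + 1) * 2 ^ (n + 1) := by positivity
      linarith
    rw [← Int.cast_natCast, Int.toNat_of_nonneg h0]
    push_cast
    have h1 : (1 : ℝ) ≤ 2 ^ n := one_le_pow₀ (by norm_num)
    rw [pow_succ]
    nlinarith
  have hM0 : 0 ≤ M := by positivity
  calc _ ≤ (4 * N + 5) * 2 ^ n * (2 * M * ((1 / 2) ^ n * (1 / 2) ^ n)) := by gcongr
    _ = (4 * N + 5) * (2 * M) * (1 / 2) ^ n * (2 ^ n * (1 / 2) ^ n) := by ring
    _ = _ := by rw [← mul_pow]; norm_num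

theorem abs_pow_four_le_of_dyadicFluctuation {N n : ℕ} {T : RealTempered} {C : ℝ} (hC : 0 ≤ C)
    (h : dyadicFluctuation N n T ≤ ENNReal.ofReal (C * (3 / 4) ^ n)) {j : ℤ}
    (hj : |(j : ℝ)| ≤ (N + 1) * 2 ^ (n + 1)) :
    |T (dyadicRefinement n j)| ≤ C ^ (1 / 4 : ℝ) * ((3 / 4) ^ (1 / 4 : ℝ)) ^ n ∧
      |T (dyadicJump n j)| ≤ C ^ (1 / 4 : ℝ) * ((3 / 4) ^ (1 / 4 : ℝ)) ^ n := by
  have hmem : j ∈ Finset.Icc (-((N + 1) * 2 ^ (n + 1)) : ℤ) ((N + 1) * 2 ^ (n + 1)) := by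
    rw [Finset.mem_Icc]
    have := abs_le.1 hj
    constructor
    · have := this.1; exact_mod_cast this
    · have := this.2; exact_mod_cast this
  have h1 := (Finset.single_le_sum (f := fun j => ENNReal.ofReal (|T (dyadicRefinement n j)| ^ 4)
    + ENNReal.ofReal (|T (dyadicJump n j)| ^ 4)) (fun _ _ => zero_le) hmem).trans h
  have key (x : ℝ) (hx : ENNReal.ofReal (|x| ^ 4) ≤ ENNReal.ofReal (C * (3 / 4) ^ n)) :
      |x| ≤ C ^ (1 / 4 : ℝ) * ((3 / 4) ^ (1 / 4 : ℝ)) ^ n := by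
    rw [ENNReal.ofReal_le_ofReal_iff (by positivity)] at hx
    have h2 := Real.rpow_le_rpow (by positivity) hx (by norm_num : (0 : ℝ) ≤ 1 / 4)
    rw [← Real.rpow_natCast, ← Real.rpow_mul (abs_nonneg _), Real.mul_rpow hC (by positivity)] at h2
    norm_num at h2
    refine h2.trans (le_of_eq ?_)
    rw [← Real.rpow_natCast ((3 / 4 : ℝ) ^ (1 / 4 : ℝ)), ← Real.rpow_mul (by norm_num),
      mul_comm (1 / 4 : ℝ), Real.rpow_mul (by norm_num), Real.rpow_natCast]
  exact ⟨key _ (le_self_add.trans h1), key _ (le_add_self.trans h1)⟩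

/-- The level-n cell of a point is the parent of its level-(n+1) cell, so consecutive approximations
differ by the refinement attached to the finer cell. -/
theorem floor_floor_div_two (x : ℝ) : ⌊((⌊2 * x⌋ : ℤ) : ℝ) / 2⌋ = ⌊x⌋ := by
  rw [Int.floor_eq_iff]
  have h1 := Int.floor_le (2 * x)
  have h2 := Int.floor_le x
  have h3 := Int.lt_floor_add_one x
  constructor
  · have : 2 * ⌊x⌋ ≤ ⌊2 * x⌋ := Int.le_floor.2 (by push_cast; linarith)
    have : ((2 * ⌊x⌋ : ℤ) : ℝ) ≤ ⌊2 * x⌋ := by exact_mod_cast this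
    push_cast at this
    linarith
  · linarith

theorem abs_floor_two_pow_mul_le {N n : ℕ} {t : ℝ} (ht : t ∈ Icc (-N : ℝ) N) :
    |((⌊2 ^ n * t⌋ : ℤ) : ℝ)| ≤ (N + 1) * 2 ^ n := by
  have h1 := Int.floor_le (2 ^ n * t)
  have h2 := Int.lt_floor_add_one (2 ^ n * t)
  have h3 : (1 : ℝ) ≤ 2 ^ n := one_le_pow₀ (by norm_num)
  rw [abs_le]
  constructor <;> nlinarith [ht.1, ht.2]

theorem abs_dyadicPath_sub_le {N : ℕ} {T : RealTempered} {C : ℝ} (hC : 0 ≤ C)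
    (h : ∀ n, dyadicFluctuation N n T ≤ ENNReal.ofReal (C * (3 / 4) ^ n)) (n : ℕ) {t : ℝ}
    (ht : t ∈ Icc (-N : ℝ) N) :
    |dyadicPath T n t - dyadicPath T (n + 1) t|
        ≤ C ^ (1 / 4 : ℝ) * ((3 / 4) ^ (1 / 4 : ℝ)) ^ n ∧
      ∀ s ∈ Icc (-N : ℝ) N, |s - t| ≤ (1 / 2) ^ n →
        |dyadicPath T n s - dyadicPath T n t| ≤ C ^ (1 / 4 : ℝ) * ((3 / 4) ^ (1 / 4 : ℝ)) ^ n := by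
  have hmono : ((N : ℝ) + 1) * 2 ^ n ≤ (N + 1) * 2 ^ (n + 1) := by
    have : (2 : ℝ) ^ n ≤ 2 ^ (n + 1) := pow_le_pow_right₀ (by norm_num) (Nat.le_succ n)
    gcongr
  constructor
  · have h1 := (abs_pow_four_le_of_dyadicFluctuation hC (h n)
      (abs_floor_two_pow_mul_le (n := n + 1) ht)).1
    have e : (2 : ℝ) ^ (n + 1) * t = 2 * (2 ^ n * t) := by ring
    rw [dyadicRefinement, e, floor_floor_div_two, ← e, map_sub, abs_sub_comm] at h1
    exact h1
  · have key : ∀ s ∈ Icc (-N : ℝ) N, ∀ t ∈ Icc (-N : ℝ) N, s ≤ t → t - s ≤ (1 / 2) ^ n →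
        |dyadicPath T n t - dyadicPath T n s|
          ≤ C ^ (1 / 4 : ℝ) * ((3 / 4) ^ (1 / 4 : ℝ)) ^ n := by
      intro s hs t ht hst hd
      have h2 : (0 : ℝ) < 2 ^ n := by positivity
      have hd' : 2 ^ n * t ≤ 2 ^ n * s + 1 := by
        have := mul_le_mul_of_nonneg_left hd h2.le
        rw [← mul_pow] at this
        norm_num at this
        linarith
      have a1 : ⌊2 ^ n * s⌋ ≤ ⌊2 ^ n * t⌋ := Int.floor_mono (by gcongr)
      have a2 : ⌊2 ^ n * t⌋ ≤ ⌊2 ^ n * s⌋ + 1 := by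
        rw [← Int.floor_add_one]; exact Int.floor_mono hd'
      rcases (by omega : ⌊2 ^ n * t⌋ = ⌊2 ^ n * s⌋ ∨ ⌊2 ^ n * t⌋ = ⌊2 ^ n * s⌋ + 1) with e | e
      · rw [dyadicPath, dyadicPath, e, sub_self, abs_zero]; positivity
      · have h1 := (abs_pow_four_le_of_dyadicFluctuation hC (h n)
          ((abs_floor_two_pow_mul_le (n := n) hs).trans hmono)).2
        rw [dyadicJump, map_sub] at h1
        rw [dyadicPath, dyadicPath, e]
        exact h1
    intro s hs hd
    rcases le_total s t with hst | hst
    · rw [abs_sub_comm]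
      refine key s hs t ht hst ?_
      rwa [abs_sub_comm, abs_of_nonneg (by linarith)] at hd
    · refine key t ht s hs hst ?_
      rwa [abs_of_nonneg (by linarith)] at hd

/-- The dyadic approximations converge locally uniformly to `W`. -/
def IsDyadicLimit (T : RealTempered) (W : ℝ → ℝ) : Prop :=
  Continuous W ∧ ∀ N : ℕ, TendstoUniformlyOn (dyadicPath T) W atTop (Icc (-N : ℝ) N)

theorem IsDyadicLimit.tendsto {T : RealTempered} {W : ℝ → ℝ} (h : IsDyadicLimit T W) (t : ℝ) :
    Tendsto (fun n => dyadicPath T n t) atTop (𝓝 (W t)) := by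
  obtain ⟨N, hN⟩ := exists_nat_ge |t|
  exact (h.2 N).tendsto_at (abs_le.1 hN)

theorem IsWhiteNoise.ae_exists_isDyadicLimit [IsProbabilityMeasure P] (hq : IsWhiteNoise P q) :
    ∀ᵐ ω ∂P, ∃ W, IsDyadicLimit (q ω) W := by
  have h : ∀ᵐ ω ∂P, ∀ N : ℕ, ∃ C : ℝ, 0 ≤ C ∧
      ∀ n, dyadicFluctuation N n (q ω) ≤ ENNReal.ofReal (C * (3 / 4) ^ n) :=
    ae_all_iff.2 fun N => ae_le_geometric (fun n => hq.measurable_dyadicFluctuation N n)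
      ENNReal.ofReal_ne_top (fun n => hq.lintegral_dyadicFluctuation_le N n)
  filter_upwards [h] with ω hω
  refine exists_continuous_limit fun N => ?_
  obtain ⟨C, hC, hCn⟩ := hω N
  exact ⟨_, (3 / 4) ^ (1 / 4 : ℝ), by positivity, Real.rpow_lt_one (by norm_num) (by norm_num)
    (by norm_num), fun n t ht => abs_dyadicPath_sub_le hC hCn n ht⟩

end

end

section
open Set Filter Topology ProbabilityTheory
open scoped NNReal

/-! ### The Brownian path is a primitive of white noise -/

/-- The nodes of the dyadic partition of `[-N, N]` of mesh `2⁻ⁿ`. -/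
def dyadicNode (N n k : ℕ) : ℝ := -N + k / 2 ^ n

theorem dyadicNode_eq (N n k : ℕ) :
    dyadicNode N n k = (((k : ℤ) - N * 2 ^ n : ℤ) : ℝ) / 2 ^ n := by
  rw [dyadicNode]; push_cast; field_simp; ring

theorem dyadicNode_zero (N n : ℕ) : dyadicNode N n 0 = -N := by simp [dyadicNode]

theorem dyadicNode_last (N n : ℕ) : dyadicNode N n (2 * N * 2 ^ n) = N := by
  rw [dyadicNode]; push_cast; field_simp; ring

theorem dyadicNode_succ (N n k : ℕ) : dyadicNode N n (k + 1) = dyadicNode N n k + (1 / 2) ^ n := by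
  rw [dyadicNode, dyadicNode, one_div, inv_pow]; push_cast; field_simp; ring

theorem le_dyadicNode_iff (N n k : ℕ) (x : ℝ) :
    x ≤ dyadicNode N n k ↔ ⌈(x + N) * 2 ^ n⌉₊ ≤ k := by
  rw [Nat.ceil_le, dyadicNode, ← le_div_iff₀ (by positivity)]
  constructor <;> intro h <;> linarith

/-- Summation by parts. As φ vanishes at both ends, the part of the signed indicators independent of
the node drops out, and the sum telescopes to -φ at the first node to the right of x, which is
within one mesh of x. -/
theorem abs_sum_sub_mul_signedIndicator_add_le {N : ℕ} {M : ℝ} {φ : ℝ → ℝ}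
    (hM : ∀ x y, |φ x - φ y| ≤ M * |x - y|) (hφ : ∀ x, (N : ℝ) ≤ |x| → φ x = 0) (n : ℕ) (x : ℝ) :
    |∑ k ∈ Finset.range (2 * N * 2 ^ n), (φ (dyadicNode N n (k + 1)) - φ (dyadicNode N n k))
        * signedIndicator (dyadicNode N n k) x + φ x|
      ≤ (Icc (-N : ℝ) N).indicator (fun _ => M * (1 / 2) ^ n) x := by
  have hM0 : 0 ≤ M := by simpa using (abs_nonneg _).trans (hM 1 0)
  set m := 2 * N * 2 ^ n with hm
  set F : ℕ → ℝ := fun k => φ (dyadicNode N n k) with hF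
  set c := ⌈(x + N) * 2 ^ n⌉₊ with hc
  have hFm : F m = 0 := by
    simp only [hF, hm, dyadicNode_last]; exact hφ _ (le_abs_self _)
  have hF0 : F 0 = 0 := by
    simp only [hF, dyadicNode_zero]; exact hφ _ (by rw [abs_neg]; exact le_abs_self _)
  have hsum : ∑ k ∈ Finset.range m, (F (k + 1) - F k) * signedIndicator (dyadicNode N n k) x
      = ∑ k ∈ Finset.range m, if c ≤ k then F (k + 1) - F k else 0 := by
    have e (k : ℕ) : (F (k + 1) - F k) * signedIndicator (dyadicNode N n k) x
        = (if c ≤ k then F (k + 1) - F k else 0)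
          - (F (k + 1) - F k) * (Iic (0 : ℝ)).indicator 1 x := by
      simp only [signedIndicator, Pi.sub_apply, mul_sub, sub_left_inj]
      by_cases h : c ≤ k
      · rw [indicator_of_mem (mem_Iic.2 ((le_dyadicNode_iff N n k x).2 h)), if_pos h, Pi.one_apply, mul_one]
      · rw [indicator_of_notMem fun h' => h ((le_dyadicNode_iff N n k x).1 (mem_Iic.1 h')), if_neg h, mul_zero]
    rw [Finset.sum_congr rfl fun k _ => e k, Finset.sum_sub_distrib, ← Finset.sum_mul,
      Finset.sum_range_sub, hFm, hF0]
    simp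
  have hfil : ∑ k ∈ Finset.range m, (if c ≤ k then F (k + 1) - F k else 0)
      = if c ≤ m then -F c else 0 := by
    rw [← Finset.sum_filter]
    have : Finset.filter (fun k => c ≤ k) (Finset.range m) = Finset.Ico c m := by
      ext k; simp [and_comm]
    rw [this]
    split_ifs with h
    · rw [Finset.sum_Ico_eq_sub _ h, Finset.sum_range_sub, Finset.sum_range_sub, hFm, hF0]; ring
    · rw [Finset.Ico_eq_empty (by omega), Finset.sum_empty]
  change |∑ k ∈ Finset.range m, (F (k + 1) - F k) * signedIndicator (dyadicNode N n k) x + φ x| ≤ _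
  rw [hsum, hfil]
  by_cases hx : x ∈ Icc (-N : ℝ) N
  · rw [indicator_of_mem hx]
    have hcm : c ≤ m := by
      rw [hc, ← le_dyadicNode_iff, hm, dyadicNode_last]; exact hx.2
    rw [if_pos hcm, neg_add_eq_sub]
    refine (hM _ _).trans ?_
    have h0 : 0 ≤ (x + N) * 2 ^ n := mul_nonneg (by linarith [hx.1]) (by positivity)
    have h1 : x ≤ dyadicNode N n c := (le_dyadicNode_iff N n c x).2 le_rfl
    have h2 : dyadicNode N n c ≤ x + (1 / 2) ^ n := by
      have := (Nat.ceil_lt_add_one h0).le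
      rw [← hc] at this
      have h3 : (c : ℝ) / 2 ^ n ≤ x + N + (1 / 2) ^ n := by
        rw [div_le_iff₀ (by positivity), one_div, inv_pow]
        field_simp
        linarith
      rw [dyadicNode]; linarith
    gcongr
    rw [abs_le]; constructor <;> linarith
  · rw [indicator_of_notMem hx]
    have hx0 : φ x = 0 := hφ x (by
      by_contra h
      exact hx (abs_le.1 (not_le.1 h).le))
    rw [hx0, add_zero]
    split_ifs with h
    · rcases le_total x (-N) with h1 | h1
      · have : c = 0 := by
          rw [hc, Nat.ceil_eq_zero]
          exact mul_nonpos_of_nonpos_of_nonneg (by linarith) (by positivity)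
        rw [this, hF0]; simp
      · have h2 : x ≤ N := by
          have := (le_dyadicNode_iff N n m x).2 h
          rwa [hm, dyadicNode_last] at this
        exact absurd ⟨h1, h2⟩ hx
    · simp

/-- The Stieltjes sum of the dyadic test functions against the increments of `φ`. -/
def stieltjesTest (N n : ℕ) (φ : ℝ → ℝ) : 𝓢(ℝ, ℝ) :=
  ∑ k ∈ Finset.range (2 * N * 2 ^ n), (φ (dyadicNode N n (k + 1)) - φ (dyadicNode N n k))
    • dyadicTest n (k - N * 2 ^ n)

/-- The discretization costs M 2^{-n} on an interval of length 2N. Smoothing the indicators costs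
2N·2^n terms, each a slope increment M 2^{-n} times the approximation error 2^{-n}; this is why the
error was chosen as small as 2^{-n}. -/
theorem eLpNorm_add_stieltjesTest_le {N : ℕ} {M : ℝ} {φ : 𝓢(ℝ, ℝ)}
    (hM : ∀ x y, |φ x - φ y| ≤ M * |x - y|) (hφ : ∀ x, (N : ℝ) ≤ |x| → φ x = 0) (n : ℕ) :
    eLpNorm ((φ + stieltjesTest N n φ : 𝓢(ℝ, ℝ)) : ℝ → ℝ) 2 volume
      ≤ ENNReal.ofReal ((M * √(2 * N) + 2 * N * M) * (1 / 2) ^ n) := by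
  have hM0 : 0 ≤ M := by simpa using (abs_nonneg _).trans (hM 1 0)
  set d : ℕ → ℝ := fun k => φ (dyadicNode N n (k + 1)) - φ (dyadicNode N n k) with hd
  set t : ℕ → ℝ := dyadicNode N n
  set f : ℕ → 𝓢(ℝ, ℝ) := fun k => dyadicTest n (k - N * 2 ^ n) with hf
  set S : ℝ → ℝ := fun x => ∑ k ∈ Finset.range (2 * N * 2 ^ n), d k * signedIndicator (t k) x + φ x
    with hS
  have hft (k : ℕ) : eLpNorm ((f k : ℝ → ℝ) - signedIndicator (t k)) 2 volume
      ≤ ENNReal.ofReal ((1 / 2) ^ n) := by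
    have := eLpNorm_dyadicTest_sub n (k - N * 2 ^ n)
    rwa [← dyadicNode_eq] at this
  have hmS (k : ℕ) : AEStronglyMeasurable (d k • ((f k : ℝ → ℝ) - signedIndicator (t k))) volume :=
    ((f k).continuous.aestronglyMeasurable.sub
      (measurable_signedIndicator _).aestronglyMeasurable).const_smul _
  have e : ((φ + stieltjesTest N n φ : 𝓢(ℝ, ℝ)) : ℝ → ℝ)
      = S + ∑ k ∈ Finset.range (2 * N * 2 ^ n), d k • ((f k : ℝ → ℝ) - signedIndicator (t k)) := by
    ext x
    simp only [add_apply, stieltjesTest, sum_apply, smul_apply, hS, Pi.add_apply, Finset.sum_apply,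
      Pi.smul_apply, Pi.sub_apply, smul_eq_mul, mul_sub, Finset.sum_sub_distrib]
    ring
  have hSm : AEStronglyMeasurable S volume := by
    refine Measurable.aestronglyMeasurable ?_
    refine Measurable.add (Finset.measurable_sum _ fun k _ => ?_) φ.continuous.measurable
    exact (measurable_signedIndicator _).const_mul _
  rw [e, add_mul, ENNReal.ofReal_add (by positivity) (by positivity)]
  refine (eLpNorm_add_le hSm (Finset.aestronglyMeasurable_sum _ fun k _ => hmS k)
    (by norm_num)).trans (add_le_add ?_ ?_)
  · refine (eLpNorm_mono_real fun x => abs_sum_sub_mul_signedIndicator_add_le hM hφ n x).trans ?_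
    refine (eLpNorm_indicator_const_le _ _).trans (le_of_eq ?_)
    rw [Real.volume_Icc, ENNReal.toReal_ofNat, ENNReal.ofReal_rpow_of_nonneg (by
      have : (0 : ℝ) ≤ N := by positivity
      linarith) (by norm_num), ← Real.sqrt_eq_rpow, ← ofReal_norm, ← ENNReal.ofReal_mul
      (norm_nonneg _), Real.norm_of_nonneg (by positivity)]
    congr 1
    rw [sub_neg_eq_add, ← two_mul]; ring
  · refine (eLpNorm_sum_le (fun k _ => hmS k) (by norm_num)).trans ?_
    refine (Finset.sum_le_card_nsmul _ _ (ENNReal.ofReal (M * (1 / 2) ^ n * (1 / 2) ^ n))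
      fun k _ => ?_).trans ?_
    · refine eLpNorm_const_smul_le.trans ?_
      rw [← ofReal_norm]
      refine (mul_le_mul' (ENNReal.ofReal_le_ofReal ?_) (hft k)).trans_eq
        (ENNReal.ofReal_mul (by positivity)).symm
      refine (hM _ _).trans (le_of_eq ?_)
      rw [dyadicNode_succ, add_sub_cancel_left, abs_of_nonneg (by positivity)]
    · rw [Finset.card_range, nsmul_eq_mul, ← ENNReal.ofReal_natCast, ← ENNReal.ofReal_mul
        (by positivity)]
      refine ENNReal.ofReal_le_ofReal (le_of_eq ?_)
      push_cast
      have : (2 : ℝ) ^ n * (1 / 2) ^ n = 1 := by rw [← mul_pow]; norm_num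
      linear_combination (2 * N * M * (1 / 2) ^ n) * this

/-- On each dyadic cell the pairing is the constant value of the step-function approximation, so the
sum is the integral of that approximation against φ', and uniform convergence concludes. -/
theorem IsDyadicLimit.tendsto_stieltjesTest {T : RealTempered} {W : ℝ → ℝ} (h : IsDyadicLimit T W)
    (N : ℕ) (φ : 𝓢(ℝ, ℝ)) {M : ℝ} (hM : ∀ x, |deriv φ x| ≤ M) :
    Tendsto (fun n => T (stieltjesTest N n φ)) atTop (𝓝 (∫ x in (-N : ℝ)..N, W x * deriv φ x)) := by
  have hM0 : 0 ≤ M := (abs_nonneg _).trans (hM 0)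
  have hdc : Continuous (deriv φ) := (φ.smooth 1).continuous_deriv (by norm_num)
  rw [Metric.tendsto_atTop']
  intro ε hε
  set δ := ε / (M * (2 * N) + 1) with hδ
  have hpos : 0 < M * (2 * N) + 1 := by positivity
  have hδ0 : 0 < δ := by positivity
  obtain ⟨n₀, hn₀⟩ := eventually_atTop.1 (Metric.tendstoUniformlyOn_iff.1 (h.2 N) δ hδ0)
  refine ⟨n₀, fun n hn => ?_⟩
  have hclose := hn₀ n hn.le
  set m := 2 * N * 2 ^ n with hm
  set t : ℕ → ℝ := dyadicNode N n with ht
  have hint (a b : ℝ) : IntervalIntegrable (fun x => W x * deriv φ x) volume a b :=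
    (h.1.mul hdc).intervalIntegrable a b
  have hI : ∫ x in (-N : ℝ)..N, W x * deriv φ x
      = ∑ k ∈ Finset.range m, ∫ x in t k..t (k + 1), W x * deriv φ x := by
    rw [intervalIntegral.sum_integral_adjacent_intervals fun k _ => hint _ _]
    rw [ht, dyadicNode_zero, hm, dyadicNode_last]
  have hT : T (stieltjesTest N n φ) = ∑ k ∈ Finset.range m,
      ∫ x in t k..t (k + 1), T (dyadicTest n (k - N * 2 ^ n)) * deriv φ x := by
    rw [stieltjesTest, map_sum]
    refine Finset.sum_congr rfl fun k _ => ?_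
    rw [map_smul, intervalIntegral.integral_const_mul, intervalIntegral.integral_deriv_eq_sub
      (fun x _ => φ.differentiableAt) (hdc.intervalIntegrable _ _), smul_eq_mul, mul_comm]
  rw [dist_eq_norm, hI, hT, ← Finset.sum_sub_distrib]
  have hterm : ∀ k ∈ Finset.range m,
      ‖(∫ x in t k..t (k + 1), T (dyadicTest n (k - N * 2 ^ n)) * deriv φ x)
        - ∫ x in t k..t (k + 1), W x * deriv φ x‖ ≤ δ * M * (1 / 2) ^ n := by
    intro k hk
    have hkm : k + 1 ≤ m := Finset.mem_range.1 hk
    have hp : (0 : ℝ) < (1 / 2) ^ n := by positivity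
    have hle : t k ≤ t (k + 1) := by rw [ht, dyadicNode_succ]; linarith
    have h0 : -(N : ℝ) ≤ t k := by
      rw [ht, dyadicNode]
      have : (0 : ℝ) ≤ k / 2 ^ n := by positivity
      linarith
    have h1 : t (k + 1) ≤ N := by
      rw [← dyadicNode_last N n, ht, dyadicNode, dyadicNode]
      gcongr
    rw [← intervalIntegral.integral_sub ((hdc.intervalIntegrable _ _).const_mul _) (hint _ _)]
    refine (intervalIntegral.norm_integral_le_of_norm_le_const_ae (C := δ * M) ?_).trans
      (le_of_eq ?_)
    · have hne : ∀ᵐ x : ℝ, x ≠ t (k + 1) := by simp [ae_iff]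
      filter_upwards [hne] with x hx hx2
      rw [uIoc_of_le hle] at hx2
      have hlt : x < t (k + 1) := lt_of_le_of_ne hx2.2 hx
      have hfl : ⌊2 ^ n * x⌋ = (k : ℤ) - N * 2 ^ n := by
        have h2 : (0 : ℝ) < 2 ^ n := by positivity
        have a1 := hx2.1
        have a2 := hlt
        rw [ht, dyadicNode_eq, div_lt_iff₀ h2] at a1
        rw [ht, dyadicNode_eq, lt_div_iff₀ h2] at a2
        rw [Int.floor_eq_iff]
        push_cast at a1 a2 ⊢
        constructor <;> linarith
      have hc := hclose x ⟨h0.trans hx2.1.le, hx2.2.trans h1⟩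
      rw [dyadicPath, hfl, dist_comm, Real.dist_eq] at hc
      rw [← sub_mul, norm_mul, Real.norm_eq_abs, Real.norm_eq_abs]
      exact mul_le_mul hc.le (hM x) (abs_nonneg _) hδ0.le
    · rw [ht, dyadicNode_succ, add_sub_cancel_left, abs_of_pos hp]
  refine ((norm_sum_le _ _).trans (Finset.sum_le_card_nsmul _ _ _ hterm)).trans_lt ?_
  rw [Finset.card_range, nsmul_eq_mul, hm]
  push_cast
  have e2 : (2 : ℝ) ^ n * (1 / 2) ^ n = 1 := by rw [← mul_pow]; norm_num
  calc 2 * (N : ℝ) * 2 ^ n * (δ * M * (1 / 2) ^ n) = δ * (M * (2 * N)) := by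
        linear_combination (2 * N * (δ * M)) * e2
    _ < δ * (M * (2 * N) + 1) := by nlinarith
    _ = ε := by rw [hδ]; field_simp

theorem exists_abs_deriv_le (φ : 𝓢(ℝ, ℝ)) : ∃ M, (∀ x, |deriv φ x| ≤ M) ∧
    ∀ x y, |φ x - φ y| ≤ M * |x - y| := by
  obtain ⟨M, hM⟩ := φ.decay' 0 1
  have h (x : ℝ) : ‖deriv φ x‖ ≤ M := by
    have := hM x
    rwa [pow_zero, one_mul, norm_iteratedFDeriv_eq_norm_iteratedDeriv, iteratedDeriv_one] at this
  refine ⟨M, h, fun x y => ?_⟩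
  exact Convex.norm_image_sub_le_of_norm_deriv_le (s := univ) (fun x _ => φ.differentiableAt)
    (fun x _ => h x) convex_univ (mem_univ y) (mem_univ x)

section
variable {Ω : Type*} [MeasurableSpace Ω] {P : Measure Ω} {q : Ω → RealTempered}

/-- The test functions φ + `stieltjesTest` tend to zero in L² geometrically, hence their pairings
with q tend to zero almost surely, while their pathwise limit is the left side. The null set depends
on φ but not on W. -/
theorem IsWhiteNoise.ae_apply_eq [IsProbabilityMeasure P] (hq : IsWhiteNoise P q) {N : ℕ}
    {φ : 𝓢(ℝ, ℝ)} (hφ : ∀ x, (N : ℝ) ≤ |x| → φ x = 0) :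
    ∀ᵐ ω ∂P, ∀ W, IsDyadicLimit (q ω) W →
      q ω φ + ∫ x in (-N : ℝ)..N, W x * deriv φ x = 0 := by
  obtain ⟨M, hM, hM'⟩ := exists_abs_deriv_le φ
  have hM0 : 0 ≤ M := (abs_nonneg _).trans (hM 0)
  set K := M * √(2 * N) + 2 * N * M with hK
  have hK0 : 0 ≤ K := by positivity
  have hX : ∀ n, ∫⁻ ω, ENNReal.ofReal |q ω (φ + stieltjesTest N n φ)| ∂P
      ≤ ENNReal.ofReal ((K + 1) * (2 * Real.exp (1 / 2))) * ENNReal.ofReal ((1 / 2) ^ n) := by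
    intro n
    have h1 := eLpNorm_add_stieltjesTest_le hM' hφ n
    have h2 := hq.lintegral_abs_pow_le (f := φ + stieltjesTest N n φ)
      (σ := (K + 1) * (1 / 2) ^ n) (by positivity)
      (h1.trans (ENNReal.ofReal_le_ofReal (by rw [← hK]; gcongr; linarith))) 1
    simp only [pow_one, Nat.factorial_one, Nat.cast_one, one_mul] at h2
    refine h2.trans (le_of_eq ?_)
    rw [← ENNReal.ofReal_mul (by positivity)]
    congr 1; ring
  filter_upwards [ae_le_geometric (fun n => (hq.measurable_apply _).abs.ennreal_ofReal)
    ENNReal.ofReal_ne_top hX] with ω ⟨C, hC0, hC⟩ W hW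
  have hlim := (hW.tendsto_stieltjesTest N φ hM).const_add (q ω φ)
  refine tendsto_nhds_unique hlim ?_
  rw [tendsto_zero_iff_abs_tendsto_zero]
  have hg : Tendsto (fun n : ℕ => C * (3 / 4 : ℝ) ^ n) atTop (𝓝 0) := by
    simpa using (tendsto_pow_atTop_nhds_zero_of_lt_one (r := (3 / 4 : ℝ)) (by norm_num)
      (by norm_num)).const_mul C
  refine squeeze_zero (fun n => abs_nonneg _) (fun n => ?_) hg
  have := hC n
  rw [ENNReal.ofReal_le_ofReal_iff (by positivity), map_add] at this
  exact this

end

/-- The Schwartz functions vanishing outside `(-N, N)`. -/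
def supportedTest (N : ℕ) : Set 𝓢(ℝ, ℝ) := {φ | ∀ x, (N : ℝ) ≤ |x| → φ x = 0}

/-- The sequence of derivatives of a Schwartz function. -/
def derivSequence (φ : 𝓢(ℝ, ℝ)) (m : ℕ) : C(ℝ, ℝ) :=
  ⟨iteratedDeriv m φ, (φ.smooth m).continuous_iteratedDeriv m le_rfl⟩

theorem iteratedDeriv_eq_zero_of_mem_supportedTest {N : ℕ} {φ : 𝓢(ℝ, ℝ)} (h : φ ∈ supportedTest N)
    (m : ℕ) {x : ℝ} (hx : (N : ℝ) < |x|) : iteratedDeriv m φ x = 0 := by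
  have h1 : (φ : ℝ → ℝ) =ᶠ[𝓝 x] fun _ => 0 := by
    filter_upwards [continuous_abs.continuousAt.eventually (lt_mem_nhds hx)] with y hy
    exact h y hy.le
  rw [h1.iteratedDeriv_eq]
  simp

/-- On a fixed compact support the polynomial factors in the Schwartz seminorms are bounded, so
uniform convergence of each derivative suffices. -/
theorem tendsto_of_tendsto_derivSequence {N : ℕ} {ι : Type*} {l : Filter ι} {u : ι → 𝓢(ℝ, ℝ)}
    {φ : 𝓢(ℝ, ℝ)} (hu : ∀ i, u i ∈ supportedTest N) (hφ : φ ∈ supportedTest N)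
    (h : Tendsto (fun i => derivSequence (u i)) l (𝓝 (derivSequence φ))) :
    Tendsto u l (𝓝 φ) := by
  rw [(schwartz_withSeminorms ℝ ℝ ℝ).tendsto_nhds]
  rintro ⟨k, m⟩ ε hε
  have h1 := ContinuousMap.tendsto_iff_forall_isCompact_tendstoUniformlyOn.1
    (tendsto_pi_nhds.1 h m) (Icc (-N : ℝ) N) isCompact_Icc
  have hε2 : 0 < ε / 2 / ((N : ℝ) ^ k + 1) := by positivity
  filter_upwards [Metric.tendstoUniformlyOn_iff.1 h1 _ hε2] with i hi
  refine lt_of_le_of_lt ?_ (half_lt_self hε)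
  refine SchwartzMap.seminorm_le_bound' ℝ k m _ (by positivity) fun x => ?_
  have e : iteratedDeriv m (u i - φ : 𝓢(ℝ, ℝ)) x = iteratedDeriv m (u i) x - iteratedDeriv m φ x :=
    iteratedDeriv_sub ((u i).smooth m).contDiffAt (φ.smooth m).contDiffAt
  rw [e]
  rcases le_or_gt |x| N with hx | hx
  · have h2 := (hi x (abs_le.1 hx)).le
    rw [dist_comm, dist_eq_norm] at h2
    have h3 : ‖iteratedDeriv m (u i) x - iteratedDeriv m φ x‖ ≤ ε / 2 / ((N : ℝ) ^ k + 1) := h2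
    calc |x| ^ k * ‖iteratedDeriv m (u i) x - iteratedDeriv m φ x‖
        ≤ ((N : ℝ) ^ k + 1) * (ε / 2 / ((N : ℝ) ^ k + 1)) := by
          refine mul_le_mul ?_ h3 (norm_nonneg _) (by positivity)
          have := pow_le_pow_left₀ (abs_nonneg x) hx k
          linarith
      _ = ε / 2 := by field_simp
  · rw [iteratedDeriv_eq_zero_of_mem_supportedTest (hu i) m hx,
      iteratedDeriv_eq_zero_of_mem_supportedTest hφ m hx]
    simp only [sub_self, norm_zero, mul_zero]
    positivity

/-- The test functions with a given support embed in a countable product of the second countable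
spaces C(ℝ, ℝ) through their derivatives, so they have a countable dense subset in a topology for
which both T and the integral of Wφ' are continuous. One null set then serves all test functions. -/
theorem exists_countable_supportedTest (N : ℕ) : ∃ D : Set 𝓢(ℝ, ℝ), D.Countable ∧
    D ⊆ supportedTest N ∧ ∀ (T : RealTempered) (W : ℝ → ℝ), Continuous W →
      (∀ φ ∈ D, T φ + ∫ x in (-N : ℝ)..N, W x * deriv φ x = 0) →
      ∀ φ ∈ supportedTest N, T φ + ∫ x in (-N : ℝ)..N, W x * deriv φ x = 0 := by
  let e : supportedTest N → ℕ → C(ℝ, ℝ) := fun φ => derivSequence φ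
  let τ : TopologicalSpace (supportedTest N) := TopologicalSpace.induced e inferInstance
  have : SecondCountableTopology (supportedTest N) :=
    TopologicalSpace.secondCountableTopology_induced _ _ e
  have he : Continuous e := continuous_induced_dom
  have hval : Continuous (Subtype.val : supportedTest N → 𝓢(ℝ, ℝ)) :=
    continuous_iff_continuousAt.2 fun φ => tendsto_of_tendsto_derivSequence (fun ψ => ψ.2) φ.2
      he.continuousAt
  obtain ⟨D, hD, hDd⟩ := TopologicalSpace.exists_countable_dense (supportedTest N)
  refine ⟨Subtype.val '' D, hD.image _, by rintro _ ⟨φ, -, rfl⟩; exact φ.2,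
    fun T W hW h φ hφ => ?_⟩
  have hder (φ : supportedTest N) (x : ℝ) : deriv φ.1 x = e φ 1 x := by
    change _ = iteratedDeriv 1 φ.1 x
    rw [iteratedDeriv_one]
  have hcont : Continuous fun φ : supportedTest N =>
      T φ.1 + ∫ x in (-N : ℝ)..N, W x * deriv φ.1 x := by
    refine (T.continuous.comp hval).add ?_
    simp only [hder]
    refine intervalIntegral.continuous_parametric_intervalIntegral_of_continuous' ?_ _ _
    have h1 : Continuous fun p : supportedTest N × ℝ => e p.1 1 p.2 :=
      (((continuous_apply 1).comp he).comp continuous_fst).eval continuous_snd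
    exact (hW.comp continuous_snd).mul h1
  exact congrFun (hcont.ext_on hDd continuous_const fun ψ hψ => h _ ⟨ψ, hψ, rfl⟩) ⟨φ, hφ⟩

section
variable {Ω : Type*} [MeasurableSpace Ω] {P : Measure Ω} {q : Ω → RealTempered}

theorem IsWhiteNoise.ae_isPrimitive [IsProbabilityMeasure P] (hq : IsWhiteNoise P q) :
    ∀ᵐ ω ∂P, ∀ W, IsDyadicLimit (q ω) W → IsPrimitive (q ω) W := by
  choose D hDc hDs hD using exists_countable_supportedTest
  have h : ∀ᵐ ω ∂P, ∀ N : ℕ, ∀ φ ∈ D N, ∀ W, IsDyadicLimit (q ω) W →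
      q ω φ + ∫ x in (-N : ℝ)..N, W x * deriv φ x = 0 :=
    ae_all_iff.2 fun N => (ae_ball_iff (hDc N)).2 fun φ hφ => hq.ae_apply_eq (hDs N hφ)
  filter_upwards [h] with ω hω W hW
  refine ⟨hW.1, fun φ hφ => ?_⟩
  obtain ⟨R, hR, hRφ⟩ := exists_pos_forall_lt_abs_eq_zero hφ
  obtain ⟨N, hN⟩ := exists_nat_gt R
  have hmem : φ ∈ supportedTest N := fun x hx => hRφ x (hN.le.trans hx)
  have h1 := hD N (q ω) W hW.1 (fun φ hφ => hω N φ hφ W hW) φ hmem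
  have h2 : ∫ x, W x * deriv φ x = ∫ x in (-N : ℝ)..N, W x * deriv φ x := by
    refine integral_eq_intervalIntegral_of_eq_zero_off (by positivity) fun x hx => ?_
    rw [deriv_eq_zero_of_eq_zero_off hmem x hx, mul_zero]
  rw [h2]; linarith

end

end

section
open Set Filter Topology ProbabilityTheory
open scoped NNReal

/-! ### Regular processes with white noise derivative -/

section
variable {Ω : Type*} [MeasurableSpace Ω] {P : Measure Ω} {q : Ω → RealTempered}

/-- A bound for the exponential moments of normalized Brownian increments. -/
def brownianMoment (a : ℝ) : ℝ≥0 := (2 * Real.exp (2 * a ^ 2)).toNNReal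

-- The limit path is set to zero off a measurable set of full measure, so that continuity and
-- measurability hold everywhere. Exponential moments pass to the limit by Fatou.
open scoped Classical in
theorem IsWhiteNoise.exists_regularProcess [IsProbabilityMeasure P] (hq : IsWhiteNoise P q) :
    ∃ W : Ω → ℝ → ℝ, RegularProcess P W brownianMoment ∧ ∀ᵐ ω ∂P, IsPrimitive (q ω) (W ω) := by
  obtain ⟨A, hA, hAm, hlim⟩ := hq.ae_exists_isDyadicLimit.exists_measurable_mem
  choose! W₀ hW₀ using hlim
  set W : Ω → ℝ → ℝ := fun ω => if ω ∈ A then W₀ ω else 0 with hW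
  have hWA {ω : Ω} (h : ω ∈ A) : IsDyadicLimit (q ω) (W ω) := by
    simp only [hW, if_pos h]; exact hW₀ ω h
  have hmeas (t : ℝ) : Measurable fun ω => W ω t := by
    refine measurable_of_tendsto_metrizable
      (f := fun n => A.indicator fun ω => dyadicPath (q ω) n t)
      (fun n => (hq.measurable_apply _).indicator hAm) (tendsto_pi_nhds.2 fun ω => ?_)
    by_cases h : ω ∈ A
    · simp only [indicator_of_mem h]; exact (hWA h).tendsto t
    · simp [indicator_of_notMem h, hW, if_neg h]
  refine ⟨W, ⟨fun ω => ?_, hmeas, fun a s t ha hst _ => ?_⟩, ?_⟩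
  · by_cases h : ω ∈ A
    · exact (hWA h).1
    · simp only [hW, if_neg h]; exact continuous_zero
  · set X : ℕ → Ω → ℝ≥0∞ := fun n ω =>
      ENNReal.ofReal (Real.exp (a * (|dyadicPath (q ω) n t - dyadicPath (q ω) n s| / √(t - s))))
      with hX
    have hXm (n : ℕ) : Measurable (X n) :=
      ((((((hq.measurable_apply _).sub (hq.measurable_apply _)).abs).div_const _).const_mul
        _).exp).ennreal_ofReal
    have h1 : ∀ᵐ ω ∂P, ENNReal.ofReal (Real.exp (a * (|W ω t - W ω s| / √(t - s))))
        = liminf (fun n => X n ω) atTop := by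
      filter_upwards [hA] with ω hω
      have h2 := (hWA hω).tendsto t
      have h3 := (hWA hω).tendsto s
      exact (ENNReal.tendsto_ofReal ((Real.continuous_exp.tendsto _).comp
        (((h2.sub h3).abs.div_const _).const_mul a))).liminf_eq.symm
    rw [lintegral_congr_ae h1]
    refine (lintegral_liminf_le hXm).trans ?_
    refine (liminf_le_limsup (by isBoundedDefault) (by isBoundedDefault)).trans
      (limsup_le_of_le (by isBoundedDefault) ?_)
    have hts : 0 < √(t - s) := Real.sqrt_pos.2 (by linarith)
    filter_upwards [tendsto_dyadicScale.eventually (gt_mem_nhds (by positivity : 0 < √(t - s) / 4))]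
      with n hn
    -- For large n the approximation error is below √(t-s), so the L² norm is at most 2√(t-s).
    -- Doubling a compensates for this σ and yields e^{(2a)²/2} = e^{2a²}.
    have h4 := hq.lintegral_exp_abs_le (σ := 2 * √(t - s)) (by positivity)
      ((eLpNorm_dyadicTest_sub_dyadicTest_le n n hst.le).trans
        (ENNReal.ofReal_le_ofReal (by linarith))) (2 * a)
    refine (le_of_eq (lintegral_congr fun ω => ?_)).trans (h4.trans (le_of_eq ?_))
    · simp only [hX, dyadicPath, map_sub]
      congr 2
      field_simp
    · rw [brownianMoment, ENNReal.ofReal]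
      congr 4
      ring
  · filter_upwards [hA, hq.ae_isPrimitive] with ω hω h
    exact h _ (hWA hω)

end

/-- Du Bois-Reymond for the difference; it ties the arbitrarily chosen primitive of the statement to
the measurable process constructed above. -/
theorem IsPrimitive.exists_eq_add_const {T : RealTempered} {W₁ W₂ : ℝ → ℝ}
    (h₁ : IsPrimitive T W₁) (h₂ : IsPrimitive T W₂) : ∃ c, ∀ x, W₁ x = W₂ x + c := by
  have hc : Continuous fun x => W₁ x - W₂ x := h₁.1.sub h₂.1
  have hcC : Continuous fun x => ((W₁ x - W₂ x : ℝ) : ℂ) := Complex.continuous_ofReal.comp hc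
  obtain ⟨c, hconst⟩ := exists_ae_eq_const_of_integral_mul_deriv_eq_zero
    hcC.locallyIntegrable fun φ hφ hs => by
      have e1 := h₁.2 (hs.toSchwartzMap hφ) hs
      have e2 := h₂.2 (hs.toSchwartzMap hφ) hs
      change _ = -∫ x, W₁ x * deriv φ x at e1
      change _ = -∫ x, W₂ x * deriv φ x at e2
      have hd : Continuous (deriv φ) := hφ.continuous_deriv (by norm_num)
      have i1 : Integrable fun x => W₁ x * deriv φ x :=
        (h₁.1.mul hd).integrable_of_hasCompactSupport hs.deriv.mul_left
      have i2 : Integrable fun x => W₂ x * deriv φ x :=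
        (h₂.1.mul hd).integrable_of_hasCompactSupport hs.deriv.mul_left
      have e3 : ∫ x, (W₁ x - W₂ x) * deriv φ x = 0 := by
        simp only [sub_mul]
        rw [integral_sub i1 i2]
        linarith
      have e4 : ∫ x, ((W₁ x - W₂ x : ℝ) : ℂ) * ((deriv φ x : ℝ) : ℂ)
          = ((∫ x, (W₁ x - W₂ x) * deriv φ x : ℝ) : ℂ) := by
        rw [← integral_complex_ofReal]
        push_cast
        rfl
      rw [e4, e3, Complex.ofReal_zero]
  have h := (Continuous.ae_eq_iff_eq volume hcC continuous_const).1 hconst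
  refine ⟨c.re, fun x => ?_⟩
  have := congrArg Complex.re (congrFun h x)
  rw [Complex.ofReal_re] at this
  linarith

theorem isPrimitive_primitive {T : RealTempered} (h : ∃ W, IsPrimitive T W) :
    IsPrimitive T (primitive T) := by
  rw [primitive, dif_pos h]; exact h.choose_spec

/-! ### Periodization -/

theorem periodizedPrimitive_add_const (L : ℝ) (W : ℝ → ℝ) (c x : ℝ) :
    periodizedPrimitive L (fun x => W x + c) x = periodizedPrimitive L W x + c := by
  simp only [periodizedPrimitive]; ring

theorem continuous_periodizedPrimitive {L : ℝ} (hL : 0 < L) {W : ℝ → ℝ} (hW : Continuous W) :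
    Continuous (periodizedPrimitive L W) := by
  set h : ℝ → ℝ := fun u => W (-L + 2 * L * u) - u * (W L - W (-L)) with hh
  have hc : Continuous h := by fun_prop
  -- Removing the linear drift makes the values of h at 0 and 1 agree, so its composition with the
  -- fractional part is continuous.
  have h1 : Continuous fun y : ℝ => h (Int.fract y) :=
    ContinuousOn.comp_fract'' hc.continuousOn (by simp only [hh]; ring_nf)
  have e : periodizedPrimitive L W
      = fun x => h (Int.fract ((x + L) / (2 * L))) + (x + L) / (2 * L) * (W L - W (-L)) := by
    ext x
    simp only [periodizedPrimitive, hh, Int.fract]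
    have : -L + 2 * L * ((x + L) / (2 * L) - (⌊(x + L) / (2 * L)⌋ : ℤ))
        = x - 2 * (⌊(x + L) / (2 * L)⌋ : ℤ) * L := by field_simp; ring
    rw [this]; ring
  rw [e]
  exact (h1.comp (by fun_prop)).add (by fun_prop)

/-- An interval no longer than a period meets at most two cells. The inequalities in the second
alternative are strict because both pieces are later normalized by the square roots of their
lengths; an endpoint on the cell boundary is put into the first alternative. -/
theorem periodizedPrimitive_sub_cases {L s t : ℝ} (hL : 0 < L) (hst : s < t) (ht : t ≤ s + 2 * L) :
    (∃ s' t', t' - s' = t - s ∧ ∀ W : ℝ → ℝ,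
        periodizedPrimitive L W t - periodizedPrimitive L W s = W t' - W s') ∨
      ∃ s' t', s' < L ∧ -L < t' ∧ (L - s') + (t' - -L) = t - s ∧ ∀ W : ℝ → ℝ,
        periodizedPrimitive L W t - periodizedPrimitive L W s
          = (W L - W s') + (W t' - W (-L)) := by
  set m := ⌊(t + L) / (2 * L)⌋ with hm
  set j := ⌊(s + L) / (2 * L)⌋ with hj
  have hjm : j ≤ m := Int.floor_mono (by gcongr)
  have hmj : m ≤ j + 1 := by
    rw [hm, hj, ← Int.floor_add_one]
    refine Int.floor_mono ?_
    rw [div_add_one (by positivity)]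
    exact div_le_div_of_nonneg_right (by linarith) (by positivity)
  have h1 := Int.floor_le ((t + L) / (2 * L))
  have h2 := Int.lt_floor_add_one ((s + L) / (2 * L))
  rw [← hm, le_div_iff₀ (by positivity)] at h1
  rw [← hj, div_lt_iff₀ (by positivity)] at h2
  simp only [periodizedPrimitive, ← hm, ← hj]
  rcases (by omega : m = j ∨ m = j + 1) with e | e
  · refine Or.inl ⟨s - 2 * j * L, t - 2 * m * L, by rw [e]; ring, fun W => by rw [e]; ring⟩
  · have e' : (m : ℝ) = j + 1 := by rw [e]; push_cast; ring
    rw [e'] at h1 ⊢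
    rcases eq_or_lt_of_le (by linarith : -L ≤ t - 2 * (j + 1) * L) with h0 | h0
    · refine Or.inl ⟨s - 2 * j * L, L, by linarith, fun W => ?_⟩
      rw [← h0]; ring
    · exact Or.inr ⟨s - 2 * j * L, t - 2 * (j + 1) * L, by linarith, h0, by ring, fun W => by ring⟩

/-- When an increment crosses a cell boundary, its normalized size is at most x + y for the two
pieces, and e^{a(x+y)} ≤ e^{2ax} + e^{2ay}. No independence of the pieces is used, and since L ≥ 1 a
distance of at most 2 crosses at most one boundary, so the constants are free of L. -/
theorem RegularProcess.periodized {Ω : Type*} [MeasurableSpace Ω] {P : Measure Ω} {W : Ω → ℝ → ℝ}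
    {C : ℝ → ℝ≥0} (h : RegularProcess P W C) {L : ℝ} (hL : 1 ≤ L) :
    RegularProcess P (fun ω => periodizedPrimitive L (W ω)) fun a => C a + 2 * C (2 * a) := by
  have hL0 : 0 < L := by linarith
  refine ⟨fun ω => continuous_periodizedPrimitive hL0 (h.continuous ω), fun t => ?_,
    fun a s t ha hst ht => ?_⟩
  · exact (h.measurable _).add (((h.measurable _).sub (h.measurable _)).const_mul _)
  have hcoe : ((C a + 2 * C (2 * a) : ℝ≥0) : ℝ≥0∞) = C a + (C (2 * a) + C (2 * a)) := by
    push_cast; ring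
  rw [hcoe]
  rcases periodizedPrimitive_sub_cases hL0 hst (by linarith) with
    ⟨s', t', e, hV⟩ | ⟨s', t', hs', ht', e, hV⟩
  · simp only [hV, ← e]
    exact (h.exp_moment a s' t' ha (by linarith) (by linarith)).trans le_self_add
  · have hA := h.exp_moment (2 * a) s' L (by linarith) hs' (by linarith)
    have hB := h.exp_moment (2 * a) (-L) t' (by linarith) ht' (by linarith)
    refine le_trans ?_ ((add_le_add hA hB).trans le_add_self)
    have hm (u v r : ℝ) : Measurable fun ω =>
        ENNReal.ofReal (Real.exp (2 * a * (|W ω u - W ω v| / √r))) :=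
      ((((((h.measurable u).sub (h.measurable v)).abs).div_const _).const_mul _).exp).ennreal_ofReal
    rw [← lintegral_add_left (hm _ _ _)]
    refine lintegral_mono fun ω => ?_
    rw [hV, ← ENNReal.ofReal_add (Real.exp_pos _).le (Real.exp_pos _).le]
    refine ENNReal.ofReal_le_ofReal ?_
    set x := |W ω L - W ω s'| / √(L - s') with hx
    set y := |W ω t' - W ω (-L)| / √(t' - -L) with hy
    have p1 : 0 < √(L - s') := Real.sqrt_pos.2 (by linarith)
    have p2 : 0 < √(t' - -L) := Real.sqrt_pos.2 (by linarith)
    have hxy : |W ω L - W ω s' + (W ω t' - W ω (-L))| / √(t - s) ≤ x + y := by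
      have hd : |W ω L - W ω s' + (W ω t' - W ω (-L))| / √(t - s)
          ≤ |W ω L - W ω s'| / √(t - s) + |W ω t' - W ω (-L)| / √(t - s) := by
        rw [← add_div]
        exact div_le_div_of_nonneg_right (abs_add_le _ _) (Real.sqrt_nonneg _)
      refine hd.trans (add_le_add ?_ ?_)
      · exact div_le_div_of_nonneg_left (abs_nonneg _) p1 (Real.sqrt_le_sqrt (by linarith))
      · exact div_le_div_of_nonneg_left (abs_nonneg _) p2 (Real.sqrt_le_sqrt (by linarith))
    have hmax : a * (|W ω L - W ω s' + (W ω t' - W ω (-L))| / √(t - s))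
        ≤ max (2 * a * x) (2 * a * y) := by
      refine (mul_le_mul_of_nonneg_left hxy ha).trans ?_
      rw [le_max_iff]
      rcases le_total x y with hle | hle
      · right; nlinarith
      · left; nlinarith
    refine (Real.exp_le_exp.2 hmax).trans ?_
    have q1 := Real.exp_pos (2 * a * x)
    have q2 := Real.exp_pos (2 * a * y)
    rcases max_choice (2 * a * x) (2 * a * y) with hch | hch <;> rw [hch] <;> linarith

theorem IsWhiteNoise.exists_regularProcess_potentialPrimitive {Ω : Type*} [MeasurableSpace Ω]
    {P : Measure Ω} [IsProbabilityMeasure P] {q : Ω → RealTempered} (hq : IsWhiteNoise P q)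
    {L₀ : ℕ∞} (hL : IsDyadicVolume L₀) :
    ∃ V : Ω → ℝ → ℝ,
      RegularProcess P V (fun a => brownianMoment a + 2 * brownianMoment (2 * a)) ∧
      ∀ᵐ ω ∂P, (∃ W, IsPrimitive (q ω) W) ∧
        ∃ c, potentialPrimitive (q ω) L₀ = fun x => V ω x + c := by
  obtain ⟨W, hW, hWq⟩ := hq.exists_regularProcess
  rcases hL with rfl | ⟨n, -, rfl⟩
  · refine ⟨W, ⟨hW.continuous, hW.measurable, fun a s t ha hst ht =>
      (hW.exp_moment a s t ha hst ht).trans ?_⟩, ?_⟩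
    · exact_mod_cast le_self_add
    · filter_upwards [hWq] with ω hω
      obtain ⟨c, hc⟩ := (isPrimitive_primitive ⟨_, hω⟩).exists_eq_add_const hω
      exact ⟨⟨_, hω⟩, c, funext hc⟩
  · refine ⟨_, hW.periodized (L := ((2 ^ n : ℕ) : ℝ)) ?_, ?_⟩
    · exact_mod_cast Nat.one_le_two_pow
    · filter_upwards [hWq] with ω hω
      obtain ⟨c, hc⟩ := (isPrimitive_primitive ⟨_, hω⟩).exists_eq_add_const hω
      refine ⟨⟨_, hω⟩, c, funext fun x => ?_⟩
      rw [← periodizedPrimitive_add_const, ← funext hc]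
      rfl

end

section
open Set Filter Topology ProbabilityTheory
open scoped NNReal

/-! ### The Green's function of white noise -/

theorem IsWhiteNoise.exists_weightedReciprocal_eq {Ω : Type*} [MeasurableSpace Ω]
    {P : Measure Ω} [IsProbabilityMeasure P] {q : Ω → RealTempered} (hq : IsWhiteNoise P q)
    {L₀ : ℕ∞} (hL : IsDyadicVolume L₀) {k : ℂ} (hk : SectorialParameter k) :
    ∃ V : Ω → ℝ → ℝ,
      RegularProcess P V (fun a => brownianMoment a + 2 * brownianMoment (2 * a)) ∧
      ∀ᵐ ω ∂P, ((∃ W, IsPrimitive (q ω) W) ∧ HasDiagGreen (potentialPrimitive (q ω) L₀) k) ∧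
        ∀ β, weightedReciprocal β (diagGreen (potentialPrimitive (q ω) L₀) k)
          = weightedWeylSum β (V ω) k := by
  obtain ⟨V, hV, hVq⟩ := hq.exists_regularProcess_potentialPrimitive hL
  refine ⟨V, hV, ?_⟩
  filter_upwards [hVq, hV.ae_tameNoise_both ‖k‖ (norm_nonneg k)] with ω ⟨hp, c, hc⟩ ⟨ht, ht'⟩
  obtain ⟨hG, hg⟩ := hasDiagGreen_and_eq (hV.continuous ω) hk ht ht'
  rw [hc, hasDiagGreen_add_const (hV.continuous ω), diagGreen_add_const (hV.continuous ω)]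
  refine ⟨⟨hp, hG⟩, fun β => funext fun x => ?_⟩
  rw [weightedReciprocal, hg, japaneseBracket_rpow_neg, weightedWeylSum, one_div, div_inv_eq_mul]

/-- The bound on the moments of the Sobolev norm of the weighted reciprocal. -/
def sobolevMoment (C : ℝ → ℝ≥0) (β s r : ℝ) : ℝ≥0∞ :=
  200 ^ r * (2 ^ (r - 1) *
    ((∫⁻ x, ENNReal.ofReal (bracketWeight β x) ^ 2) ^ (r - 1)
      * ((∫⁻ x, ENNReal.ofReal (bracketWeight β x) ^ 2)
        * (2 ^ (2 * r) * twoSidedMoment C (2 * r)))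
    + (∫⁻ a, incrementWeight β a ∂(gagliardoMeasure s)) ^ (r - 1)
      * ((∫⁻ a, incrementWeight β a ∂(gagliardoMeasure s))
        * ((ENNReal.ofReal (weightConst β) * 7) ^ (2 * r) * pairMoment C (4 * r)))))

theorem sobolevMoment_lt_top (C : ℝ → ℝ≥0) {β s r : ℝ} (hβ : 1 < β) (hs : s < 3 / 2)
    (hr : 1 ≤ r) : sobolevMoment C β s r < ∞ := by
  have hI : ∫⁻ x, ENNReal.ofReal (bracketWeight β x) ^ 2 < ∞ := by
    have := lintegral_bracketWeight_rpow_lt_top (β := β) (p := 2) (by linarith)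
    simpa only [ENNReal.rpow_ofNat] using this
  have hJ := lintegral_incrementWeight_lt_top hβ hs
  have hT := twoSidedMoment_lt_top C (p := 2 * r) (by linarith)
  have hM := pairMoment_lt_top C (p := 4 * r) (by linarith)
  have hr1 : 0 ≤ r - 1 := by linarith
  have hr2 : 0 ≤ 2 * r := by linarith
  have hpow {a : ℝ≥0∞} (ha : a < ∞) {p : ℝ} (hp : 0 ≤ p) : a ^ p < ∞ :=
    rpow_lt_top_of_one_le ha.ne hp
  have hw : ENNReal.ofReal (weightConst β) * 7 < ∞ :=
    ENNReal.mul_lt_top ENNReal.ofReal_lt_top (by simp)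
  exact ENNReal.mul_lt_top (hpow (by simp) (by linarith)) (ENNReal.mul_lt_top
    (hpow (by simp) hr1) (ENNReal.add_lt_top.2
      ⟨ENNReal.mul_lt_top (hpow hI hr1) (ENNReal.mul_lt_top hI (ENNReal.mul_lt_top
        (hpow (by simp) hr2) hT)),
      ENNReal.mul_lt_top (hpow hJ hr1) (ENNReal.mul_lt_top hJ (ENNReal.mul_lt_top
        (hpow hw hr2) hM))⟩))

/-- Moments of order p follow from those of order 2p by Cauchy–Schwarz, and smaller s are dominated
by max(s, 1) because 4 + ξ² ≥ 1. -/
theorem RegularProcess.lintegral_sobolevNorm_le {Ω : Type*} [MeasurableSpace Ω]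
    {P : Measure Ω} [IsProbabilityMeasure P] {W : Ω → ℝ → ℝ} {C : ℝ → ℝ≥0}
    (h : RegularProcess P W C) {k : ℂ} (hk : SectorialParameter k) {β s : ℝ} (hβ : 1 < β)
    (hs : s < 3 / 2) {p : ℝ} (hp : 1 ≤ p) :
    ∫⁻ ω, sobolevNorm s (weightedWeylSum β (W ω) k) ^ p ∂P
      ≤ sobolevMoment C β (max s 1) p ^ (1 / 2 : ℝ) * ENNReal.ofReal ‖k‖ ^ p := by
  have hp0 : 0 ≤ p := by linarith
  have h1 : ∫⁻ ω, sobolevNorm (max s 1) (weightedWeylSum β (W ω) k) ^ (2 * p) ∂P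
      ≤ sobolevMoment C β (max s 1) p * ENNReal.ofReal ‖k‖ ^ (2 * p) := by
    refine (h.lintegral_sobolevNorm_rpow_le hk hβ (le_max_right _ _)
      (max_lt hs (by norm_num)) hp).trans (le_of_eq ?_)
    rw [sobolevMoment, ← mul_assoc (ENNReal.ofReal (weightConst β)),
      ENNReal.mul_rpow_of_nonneg _ _ (by linarith : 0 ≤ 2 * p),
      ENNReal.mul_rpow_of_nonneg (ENNReal.ofReal (weightConst β) * 7) _
        (by linarith : 0 ≤ 2 * p)]
    ring
  have h2 := rpow_lintegral_le (((h.aemeasurable_sobolevNorm hk hβ (max s 1)).pow_const p))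
    (p := 2) (by norm_num)
  simp only [measure_univ, ENNReal.one_rpow, one_mul, ← ENNReal.rpow_mul] at h2
  rw [mul_comm p 2] at h2
  have h3 := ENNReal.rpow_le_rpow (h2.trans h1) (by norm_num : (0 : ℝ) ≤ 1 / 2)
  rw [← ENNReal.rpow_mul, ENNReal.mul_rpow_of_nonneg _ _ (by norm_num), ← ENNReal.rpow_mul,
    show (2 : ℝ) * (1 / 2) = 1 by norm_num, ENNReal.rpow_one,
    show 2 * p * (1 / 2) = p by ring] at h3
  refine (lintegral_mono fun ω => ?_).trans h3
  exact ENNReal.rpow_le_rpow (sobolevNorm_mono (le_max_left _ _) _) hp0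

theorem mul_rpow_ofReal_le {A : ℝ≥0∞} (hA : A < ∞) {x p : ℝ} (hx : 0 ≤ x) (hp : 0 ≤ p) :
    A * ENNReal.ofReal x ^ p ≤ ENNReal.ofReal ((A.toReal + 1) * x ^ p) := by
  rw [ENNReal.ofReal_mul (by positivity), ENNReal.ofReal_rpow_of_nonneg hx hp]
  gcongr
  rw [ENNReal.ofReal_add ENNReal.toReal_nonneg zero_le_one, ENNReal.ofReal_toReal hA.ne]
  exact le_self_add

end

end WhiteNoiseGreen

end

/-! ### The main theorem. -/

open WhiteNoiseGreen
theorem proposition4p5 :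
    ∃ C : ℝ, 1 ≤ C ∧
      -- the objects in the two bounds are almost surely well defined
      (∀ (Ω : Type u) [MeasurableSpace Ω] (P : Measure Ω) [IsProbabilityMeasure P]
        (q : Ω → RealTempered), IsWhiteNoise P q →
        ∀ L₀ : ℕ∞, IsDyadicVolume L₀ →
        ∀ k : ℂ, StrictlyAdmissible C k →
        ∀ᵐ ω ∂P, (∃ W, IsPrimitive (q ω) W) ∧
          HasDiagGreen (potentialPrimitive (q ω) L₀) k) ∧
      -- the bound in `L^p`
      (∀ p β : ℝ, 1 ≤ p → 1 / p < β → ∃ K : ℝ, 0 < K ∧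
        ∀ (Ω : Type u) [MeasurableSpace Ω] (P : Measure Ω) [IsProbabilityMeasure P]
          (q : Ω → RealTempered), IsWhiteNoise P q →
        ∀ L₀ : ℕ∞, IsDyadicVolume L₀ →
        ∀ k : ℂ, StrictlyAdmissible C k →
          AEMeasurable (fun ω => eLpNorm (weightedReciprocal β
            (diagGreen (potentialPrimitive (q ω) L₀) k))
            (ENNReal.ofReal p) volume) P ∧
          ∫⁻ ω, eLpNorm (weightedReciprocal β
            (diagGreen (potentialPrimitive (q ω) L₀) k))
            (ENNReal.ofReal p) volume ^ p ∂P ≤ ENNReal.ofReal (K * ‖k‖ ^ p)) ∧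
      -- the bound in `H^s`
      (∀ p β s : ℝ, 1 ≤ p → 5 < β → 0 ≤ s → s < 3 / 2 → ∃ K : ℝ, 0 < K ∧
        ∀ (Ω : Type u) [MeasurableSpace Ω] (P : Measure Ω) [IsProbabilityMeasure P]
          (q : Ω → RealTempered), IsWhiteNoise P q →
        ∀ L₀ : ℕ∞, IsDyadicVolume L₀ →
        ∀ k : ℂ, StrictlyAdmissible C k →
          AEMeasurable (fun ω => sobolevNorm s
            (weightedReciprocal β
              (diagGreen (potentialPrimitive (q ω) L₀) k))) P ∧
          ∫⁻ ω, sobolevNorm s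
            (weightedReciprocal β
              (diagGreen (potentialPrimitive (q ω) L₀) k)) ^ p ∂P
            ≤ ENNReal.ofReal (K * ‖k‖ ^ p)) := by
  -- The threshold serves only to guarantee κ ≥ 1; no smallness of the noise relative to k is
  -- required, because the pointwise bound holds for noise of any size.
  refine ⟨1, le_rfl, ?_, ?_, ?_⟩
  · intro Ω _ P _ q hq L₀ hL k hk
    obtain ⟨V, -, h⟩ := hq.exists_weightedReciprocal_eq hL hk.sectorialParameter
    exact h.mono fun ω hω => hω.1
  · intro p β hp hβ
    have hp0 : 0 < p := by linarith
    rw [div_lt_iff₀ hp0] at hβ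
    -- The moment function of the periodized noise also dominates that of the full line, so a single
    -- K serves every volume.
    set C : ℝ → NNReal := fun a => brownianMoment a + 2 * brownianMoment (2 * a) with hC
    set A : ℝ≥0∞ := (∫⁻ x, ENNReal.ofReal (bracketWeight β x) ^ p)
      * (2 ^ p * twoSidedMoment C p) with hA
    have hA0 : A < ∞ := ENNReal.mul_lt_top (lintegral_bracketWeight_rpow_lt_top hβ)
      (ENNReal.mul_lt_top (rpow_lt_top_of_one_le (by simp) hp0.le) (twoSidedMoment_lt_top C hp))
    refine ⟨A.toReal + 1, by positivity, fun Ω _ P _ q hq L₀ hL k hk => ?_⟩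
    obtain ⟨V, hV, h⟩ := hq.exists_weightedReciprocal_eq hL hk.sectorialParameter
    obtain ⟨h1, h2⟩ := hV.lintegral_eLpNorm_le hk.sectorialParameter β hp
    refine ⟨h1.congr (h.mono fun ω hω => by simp only [hω.2 β]), ?_⟩
    rw [lintegral_congr_ae (h.mono fun ω hω => by rw [hω.2 β])]
    refine h2.trans (le_trans (le_of_eq ?_) (mul_rpow_ofReal_le hA0 (norm_nonneg k) hp0.le))
    rw [ENNReal.mul_rpow_of_nonneg _ _ hp0.le, hA]
    ring
  · intro p β s hp hβ _ hs
    have hβ1 : 1 < β := by linarith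
    set C : ℝ → NNReal := fun a => brownianMoment a + 2 * brownianMoment (2 * a) with hC
    have hA0 : sobolevMoment C β (max s 1) p ^ (1 / 2 : ℝ) < ∞ :=
      rpow_lt_top_of_one_le
        (sobolevMoment_lt_top C hβ1 (max_lt hs (by norm_num)) hp).ne (by norm_num)
    refine ⟨(sobolevMoment C β (max s 1) p ^ (1 / 2 : ℝ)).toReal + 1, by positivity,
      fun Ω _ P _ q hq L₀ hL k hk => ?_⟩
    obtain ⟨V, hV, h⟩ := hq.exists_weightedReciprocal_eq hL hk.sectorialParameter
    refine ⟨(hV.aemeasurable_sobolevNorm hk.sectorialParameter hβ1 s).congr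
      (h.mono fun ω hω => by simp only [hω.2 β]), ?_⟩
    rw [lintegral_congr_ae (h.mono fun ω hω => by rw [hω.2 β])]
    exact (hV.lintegral_sobolevNorm_le hk.sectorialParameter hβ1 hs hp).trans
      (mul_rpow_ofReal_le hA0 (norm_nonneg k) (by linarith))
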